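/- Let $k$ be a field. A DG coalgebra is a coalgebra in the monoidal category of differential $\mathbb Z$-graded $k$-vector spaces (differential of degree $+1$); it is positively graded if it vanishes in negative degrees. For DG coalgebras $C,D$ a DG comodule over $C\otimes D^{op}$ is the same as a DG $C$-$D$-bicomodule. $\mathrm{Chain}^+(C\otimes D^{op})$ denotes those that are bounded below, $C^e=C\otimes C^{op}$, and $\mathcal D(C\otimes D^{op})$ is the localization, at the quasi-isomorphisms, of the homotopy category of DG $C$-$D$-bicomodules. For a DG $C$-$D$-bicomodule $M$ let $C(M)=\bigoplus_{r\ge 1}C^{\otimes r}\otimes M$ be the standard resolution with respect to the left coaction, where $c_1\otimes\dots\otimes c_r\otimes m$ has degree $\sum|c_i|+|m|+r-1$ and the differential is $(-1)^{r-1}d+b'$, $b'=\sum_{i=0}^{r}(-1)^i\Delta_i$ ($\Delta_i$ comultiplies the $(i+1)$-st factor; the last one is the coaction on $M$). For a $C$-$D$-bicomodule $P$ and a $D$-$E$-bicomodule $N$ put $P\Box_D^RN=P\Box_D D(N)$. For a DG $C$-bicomodule $M$ and $n\in\mathbb Z$ put $$\mathrm{Hoch}^n(M,C)=H^n\bigl(C(C)\Box_{C^e}M\bigr),\qquad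 H^n(M,C)=\mathrm{Hom}_{\mathcal D(C^e)}(M,C[n]).$$ Let $\mathrm{Hoch}^*(C)$ be the cohomology of the Hochschild complex $\bigoplus_{n\ge 0}C^{\otimes n+1}$, where $c_0\otimes\dots\otimes c_n$ has degree $\sum|c_i|+n$ and the differential is $(-1)^nd+b$, $b=b'+(-1)^{n+1}\Delta_{n+1}$, with $\Delta_{n+1}(c_0\otimes\dots\otimes c_n)=\sum\pm c_0''\otimes c_1\otimes\dots\otimes c_n\otimes c_0'$ (Koszul sign). Let $H^*(C)=H^*(C,C)=\bigoplus_n\mathrm{Hom}_{\mathcal D(C^e)}(C,C[n])$, a graded $k$-algebra under composition. **Theorem.** Let $C$ and $D$ be positively graded DG coalgebras over $k$, and let $P\in\mathrm{Chain}^+(C\otimes D^{op})$ and $Q\in\mathrm{Chain}^+(D\otimes C^{op})$ be such that $P\Box_D^RQ\cong C$ in $\mathcal D(C^e)$ and $Q\Box_C^RP\cong D$ in $\mathcal D(D^e)$. Then for every $M\in\mathrm{Chain}^+(C^e)$ and every $n\in\mathbb Z$ there are isomorphisms of $k$-vector spaces $$\mathrm{Hoch}^n(M,C)\cong\mathrm{Hoch}^n\bigl((Q\Box_C^RM)\Box_C^RP,\,D\bigr),\qquad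 H^n(M,C)\cong H^n\bigl((Q\Box_C^RM)\Box_C^RP,\,D\bigr).$$ In particular $\mathrm{Hoch}^n(C)\cong\mathrm{Hoch}^n(D)$ for all $n$, and $H^*(C)\cong H^*(D)$ as graded (unital) $k$-algebras. -/

import Mathlib

open CategoryTheory TensorProduct DirectSum

universe v u

namespace DGC

variable {k : Type v} [Field k]

/-- The sign `(-1)^n`, as an element of the ground field. -/
def sgn (k : Type v) [Field k] (n : ℤ) : k := ((n.negOnePow : ℤ) : k)

lemma sgn_add (m n : ℤ) : sgn k (m + n) = sgn k m * sgn k n := by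
  simp [sgn, Int.negOnePow_add]

@[simp] lemma sgn_zero : sgn k 0 = 1 := by simp [sgn]

@[simp] lemma sgn_one : sgn k 1 = -1 := by simp [sgn]

@[simp] lemma sgn_neg (n : ℤ) : sgn k (-n) = sgn k n := by simp [sgn]

@[simp] lemma sgn_mul_self (n : ℤ) : sgn k n * sgn k n = 1 := by
  rw [← sgn_add, sgn, Int.negOnePow_even _ ⟨n, rfl⟩]; simp

lemma sgn_sub (m n : ℤ) : sgn k (m - n) = sgn k m * sgn k n := by
  rw [sub_eq_add_neg, sgn_add, sgn_neg]

/-- A grading by submodules is internal as soon as the pieces span and there are linear maps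
`q n` that are injective on the piece of degree `n` and vanish on the other pieces. -/
lemma isInternal_of {V : Type u} [AddCommGroup V] [Module k V] (gr : ℤ → Submodule k V)
    (htop : ⨆ n, gr n = ⊤) (q : ℤ → V →ₗ[k] V)
    (hq : ∀ n, ∀ x ∈ gr n, q n x = x) (hq' : ∀ m n, m ≠ n → ∀ x ∈ gr m, q n x = 0) :
    DirectSum.IsInternal gr := by
  rw [DirectSum.isInternal_submodule_iff_iSupIndep_and_iSup_eq_top]
  refine ⟨fun n => ?_, htop⟩
  rw [Submodule.disjoint_def]
  intro x hx hx'
  have h : (⨆ j, ⨆ (_ : j ≠ n), gr j) ≤ LinearMap.ker (q n) :=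
    iSup_le fun j => iSup_le fun hj y hy => hq' j n hj y hy
  rw [← hq n x hx]
  exact h hx'

/-- A differential graded vector space: a `ℤ`-graded vector space `⨁ n, gr n` together with a
differential of degree `+1`. -/
structure DGVect (k : Type v) [Field k] where
  carrier : Type u
  [addCommGroup : AddCommGroup carrier]
  [module : Module k carrier]
  gr : ℤ → Submodule k carrier
  internal : DirectSum.IsInternal gr
  d : carrier →ₗ[k] carrier
  d_mem : ∀ n, ∀ x ∈ gr n, d x ∈ gr (n + 1)
  d_d : d ∘ₗ d = 0

attribute [instance] DGVect.addCommGroup DGVect.module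

namespace DGVect

instance : CoeSort (DGVect.{v, u} k) (Type u) := ⟨carrier⟩

variable (V W U : DGVect.{v, u} k)

variable {V} in
lemma mem_cast {m n : ℤ} {x : V} (h : x ∈ V.gr m) (e : m = n) : x ∈ V.gr n := e ▸ h

lemma d_d_apply (x : V) : V.d (V.d x) = 0 := LinearMap.congr_fun V.d_d x

lemma iSup_gr : ⨆ n, V.gr n = ⊤ := V.internal.submodule_iSup_eq_top

variable {V} in
lemma induction {p : V → Prop} (x : V) (hom : ∀ n, ∀ x ∈ V.gr n, p x) (zero : p 0)
    (add : ∀ x y, p x → p y → p (x + y)) : p x :=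
  Submodule.iSup_induction V.gr (motive := p) (by rw [V.iSup_gr]; trivial) hom zero add

variable {V} in
lemma hom_ext {X : Type*} [AddCommGroup X] [Module k X] {f g : V →ₗ[k] X}
    (h : ∀ n, ∀ x ∈ V.gr n, f x = g x) : f = g := by
  refine LinearMap.ext fun x => ?_
  exact induction (p := fun x => f x = g x) x h (by simp) (fun x y hx hy => by simp [hx, hy])

lemma coe_bijective : Function.Bijective (DirectSum.coeLinearMap V.gr) := V.internal

/-- The linear map with prescribed restrictions to the homogeneous components. -/
noncomputable def glue {X : Type*} [AddCommGroup X] [Module k X] (φ : ∀ n, V.gr n →ₗ[k] X) :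
    V →ₗ[k] X :=
  DirectSum.toModule k ℤ X φ ∘ₗ
    (LinearEquiv.ofBijective (DirectSum.coeLinearMap V.gr) V.coe_bijective).symm.toLinearMap

variable {V} in
lemma glue_of_mem {X : Type*} [AddCommGroup X] [Module k X] (φ : ∀ n, V.gr n →ₗ[k] X)
    {n : ℤ} {x : V} (h : x ∈ V.gr n) : V.glue φ x = φ n ⟨x, h⟩ := by
  have : (LinearEquiv.ofBijective (DirectSum.coeLinearMap V.gr) V.coe_bijective).symm x =
      DirectSum.lof k ℤ (fun n => V.gr n) n ⟨x, h⟩ := by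
    rw [LinearEquiv.symm_apply_eq]
    simp [DirectSum.coeLinearMap_lof]
  simp only [glue, LinearMap.comp_apply, LinearEquiv.coe_coe, this]
  simp

/-- The projection to the component of degree `n`. -/
noncomputable def proj (n : ℤ) : V →ₗ[k] V :=
  V.glue fun m => if m = n then (V.gr m).subtype else 0

variable {V} in
lemma proj_same {n : ℤ} {x : V} (h : x ∈ V.gr n) : V.proj n x = x := by
  simp [proj, glue_of_mem _ h]

variable {V} in
lemma proj_ne {m n : ℤ} (hmn : m ≠ n) {x : V} (h : x ∈ V.gr m) : V.proj n x = 0 := by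
  simp [proj, glue_of_mem _ h, hmn]

lemma proj_mem (n : ℤ) (x : V) : V.proj n x ∈ V.gr n := by
  refine induction (p := fun x => V.proj n x ∈ V.gr n) x (fun m x hx => ?_) (by simp) (fun x y hx hy => by
    rw [map_add]; exact add_mem hx hy)
  by_cases h : m = n
  · subst h; rwa [proj_same hx]
  · simp [proj_ne h hx]

variable {V} in
lemma exists_sum_proj (x : V) : ∃ s : Finset ℤ, x = ∑ n ∈ s, V.proj n x := by
  suffices h : ∃ s : Finset ℤ, ∀ t, s ⊆ t → x = ∑ n ∈ t, V.proj n x from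
    h.imp fun s hs => hs s subset_rfl
  refine induction (p := fun x => ∃ s : Finset ℤ, ∀ t, s ⊆ t → x = ∑ n ∈ t, V.proj n x) x
    (fun m x hx => ⟨{m}, fun t ht => ?_⟩) ⟨∅, fun t _ => by simp⟩ ?_
  · rw [Finset.sum_eq_single m (fun n _ hn => proj_ne hn.symm hx) (fun h => by simp at ht; tauto),
      proj_same hx]
  · rintro x y ⟨s, hs⟩ ⟨s', hs'⟩
    refine ⟨s ∪ s', fun t ht => ?_⟩
    simp only [map_add, Finset.sum_add_distrib]
    rw [← hs t (Finset.union_subset_left ht), ← hs' t (Finset.union_subset_right ht)]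

variable {V} in
lemma eq_zero_of_proj {x : V} (h : ∀ n, V.proj n x = 0) : x = 0 := by
  obtain ⟨s, hs⟩ := exists_sum_proj x
  rw [hs]; simp [h]

/-- The operator `x ↦ (-1)^(a |x|) x`. -/
noncomputable def sg (a : ℤ) : V →ₗ[k] V := V.glue fun n => sgn k (a * n) • (V.gr n).subtype

variable {V} in
lemma sg_of_mem (a : ℤ) {n : ℤ} {x : V} (h : x ∈ V.gr n) : V.sg a x = sgn k (a * n) • x := by
  simp [sg, glue_of_mem _ h]

@[simp] lemma sg_zero : V.sg 0 = LinearMap.id := hom_ext fun n x hx => by simp [sg_of_mem 0 hx]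

/-- Linear maps of degree `a`. -/
def IsDeg {V W : DGVect.{v, u} k} (a : ℤ) (f : V →ₗ[k] W) : Prop :=
  ∀ n, ∀ x ∈ V.gr n, f x ∈ W.gr (n + a)

/-- Morphisms of differential graded vector spaces, as a property of linear maps. -/
structure IsMor {V W : DGVect.{v, u} k} (f : V →ₗ[k] W) : Prop where
  deg : ∀ n, ∀ x ∈ V.gr n, f x ∈ W.gr n
  comm : f ∘ₗ V.d = W.d ∘ₗ f

/-- The homogeneous components of the tensor product. -/
abbrev tensorGr (n : ℤ) : Submodule k (V ⊗[k] W) :=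
  Submodule.span k {x | ∃ p q : ℤ, p + q = n ∧ ∃ v ∈ V.gr p, ∃ w ∈ W.gr q, v ⊗ₜ[k] w = x}

variable {V W} in
lemma tmul_mem {p q n : ℤ} {v : V} {w : W} (hv : v ∈ V.gr p) (hw : w ∈ W.gr q) (h : p + q = n) :
    v ⊗ₜ[k] w ∈ tensorGr V W n :=
  Submodule.subset_span ⟨p, q, h, v, hv, w, hw, rfl⟩

variable {V W} in
lemma tensor_induction {p : V ⊗[k] W → Prop} (x : V ⊗[k] W)
    (hom : ∀ m n, ∀ v ∈ V.gr m, ∀ w ∈ W.gr n, p (v ⊗ₜ w)) (zero : p 0)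
    (add : ∀ x y, p x → p y → p (x + y)) : p x := by
  induction x with
  | zero => exact zero
  | add x y hx hy => exact add _ _ hx hy
  | tmul v w =>
    refine induction (p := fun v => p (v ⊗ₜ w)) v (fun m v hv => ?_) (by simpa) (fun v v' h h' => by
      rw [add_tmul]; exact add _ _ h h')
    refine induction (p := fun w => p (v ⊗ₜ w)) w (fun n w hw => ?_) (by simpa) (fun w w' h h' => by
      rw [tmul_add]; exact add _ _ h h')
    exact hom m n v hv w hw

variable {V W} in
lemma tensor_hom_ext {X : Type*} [AddCommGroup X] [Module k X] {f g : V ⊗[k] W →ₗ[k] X}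
    (h : ∀ m n, ∀ v ∈ V.gr m, ∀ w ∈ W.gr n, f (v ⊗ₜ w) = g (v ⊗ₜ w)) : f = g := by
  refine LinearMap.ext fun x => ?_
  refine tensor_induction (p := fun x => f x = g x) x h (by simp)
    (fun x y hx hy => by simp [hx, hy])

lemma tensor_internal : DirectSum.IsInternal (tensorGr V W) := by
  refine isInternal_of _ ?_ (fun n => TensorProduct.lift (V.glue fun p =>
      LinearMap.lcomp k _ (W.proj (n - p)) ∘ₗ TensorProduct.mk k V W ∘ₗ (V.gr p).subtype)) ?_ ?_
  · rw [eq_top_iff]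
    rintro x -
    refine tensor_induction (p := fun x => x ∈ ⨆ n, tensorGr V W n) x (fun m n v hv w hw => ?_)
      (zero_mem _) (fun x y hx hy => add_mem hx hy)
    exact Submodule.mem_iSup_of_mem (m + n) (tmul_mem hv hw rfl)
  · intro n x hx
    induction hx using Submodule.span_induction with
    | mem x hx =>
      obtain ⟨p, q, h, v, hv, w, hw, rfl⟩ := hx
      have : q = n - p := by omega
      subst this
      simp [glue_of_mem _ hv, proj_same hw]
    | zero => simp
    | add x y _ _ hx hy => rw [map_add, hx, hy]
    | smul a x _ hx => rw [map_smul, hx]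
  · intro m n hmn x hx
    induction hx using Submodule.span_induction with
    | mem x hx =>
      obtain ⟨p, q, h, v, hv, w, hw, rfl⟩ := hx
      have : q ≠ n - p := by omega
      simp [glue_of_mem _ hv, proj_ne this hw]
    | zero => simp
    | add x y _ _ hx hy => rw [map_add, hx, hy, add_zero]
    | smul a x _ hx => rw [map_smul, hx, smul_zero]

end DGVect
namespace DGVect

variable {V V' W W' U : DGVect.{v, u} k}

lemma sg_mem (a : ℤ) {n : ℤ} {x : V} (h : x ∈ V.gr n) : V.sg a x ∈ V.gr n := by
  rw [sg_of_mem a h]; exact Submodule.smul_mem _ _ h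

lemma sg_add (a b : ℤ) : V.sg (a + b) = V.sg a ∘ₗ V.sg b := hom_ext fun n x hx => by
  simp [sg_of_mem _ hx, add_mul, sgn_add, smul_smul, mul_comm (sgn k (a * n))]

lemma IsDeg.comp_sg {b : ℤ} {f : V →ₗ[k] W} (hf : IsDeg b f) (a : ℤ) :
    f ∘ₗ V.sg a = sgn k (a * b) • (W.sg a ∘ₗ f) := hom_ext fun n x hx => by
  simp only [LinearMap.comp_apply, LinearMap.smul_apply, sg_of_mem _ hx, map_smul,
    sg_of_mem _ (hf n x hx), mul_add, sgn_add, smul_smul]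
  rw [mul_left_comm, sgn_mul_self, mul_one]

lemma isDeg_d : IsDeg 1 V.d := V.d_mem

lemma d_sg (a : ℤ) : V.d ∘ₗ V.sg a = sgn k a • (V.sg a ∘ₗ V.d) := by
  simpa using isDeg_d.comp_sg a

lemma IsMor.isDeg {f : V →ₗ[k] W} (hf : IsMor f) : IsDeg 0 f := fun n x hx => by
  simpa using hf.deg n x hx

lemma IsMor.comp_sg {f : V →ₗ[k] W} (hf : IsMor f) (a : ℤ) : f ∘ₗ V.sg a = W.sg a ∘ₗ f := by
  simpa using hf.isDeg.comp_sg a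

lemma IsMor.comm_apply {f : V →ₗ[k] W} (hf : IsMor f) (x : V) : f (V.d x) = W.d (f x) :=
  LinearMap.congr_fun hf.comm x

lemma IsMor.id : IsMor (LinearMap.id : V →ₗ[k] V) := ⟨fun _ _ h => h, rfl⟩

lemma IsMor.comp {f : V →ₗ[k] W} {g : W →ₗ[k] U} (hg : IsMor g) (hf : IsMor f) :
    IsMor (g ∘ₗ f) :=
  ⟨fun n x hx => hg.deg n _ (hf.deg n x hx), by
    rw [LinearMap.comp_assoc, hf.comm, ← LinearMap.comp_assoc, hg.comm, LinearMap.comp_assoc]⟩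

lemma IsMor.zero : IsMor (0 : V →ₗ[k] W) := ⟨fun n x _ => zero_mem _, by simp⟩

lemma IsMor.add {f g : V →ₗ[k] W} (hf : IsMor f) (hg : IsMor g) : IsMor (f + g) :=
  ⟨fun n x hx => add_mem (hf.deg n x hx) (hg.deg n x hx), by
    rw [LinearMap.add_comp, LinearMap.comp_add, hf.comm, hg.comm]⟩

lemma IsMor.smul {f : V →ₗ[k] W} (hf : IsMor f) (a : k) : IsMor (a • f) :=
  ⟨fun n x hx => Submodule.smul_mem _ _ (hf.deg n x hx), by
    rw [LinearMap.smul_comp, LinearMap.comp_smul, hf.comm]⟩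

lemma IsMor.neg {f : V →ₗ[k] W} (hf : IsMor f) : IsMor (-f) := by
  simpa using hf.smul (-1)

lemma IsMor.sub {f g : V →ₗ[k] W} (hf : IsMor f) (hg : IsMor g) : IsMor (f - g) := by
  simpa [sub_eq_add_neg] using hf.add hg.neg

lemma tensor_mem {X : Type*} [AddCommGroup X] [Module k X] {f : V ⊗[k] W →ₗ[k] X} {n : ℤ}
    {S : Submodule k X}
    (h : ∀ p q, p + q = n → ∀ v ∈ V.gr p, ∀ w ∈ W.gr q, f (v ⊗ₜ w) ∈ S) :
    ∀ x ∈ tensorGr V W n, f x ∈ S := by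
  have : tensorGr V W n ≤ S.comap f := by
    rw [Submodule.span_le]
    rintro _ ⟨p, q, e, v, hv, w, hw, rfl⟩
    exact h p q e v hv w hw
  exact this

variable (V W) in
/-- The tensor product of differential graded vector spaces, with
`d (v ⊗ w) = d v ⊗ w + (-1)^|v| v ⊗ d w`. -/
noncomputable abbrev tensor : DGVect.{v, u} k where
  carrier := V ⊗[k] W
  gr := tensorGr V W
  internal := tensor_internal V W
  d := TensorProduct.map V.d LinearMap.id + TensorProduct.map (V.sg 1) W.d
  d_mem n := tensor_mem fun p q e v hv w hw => by
    simp only [LinearMap.add_apply, map_tmul, LinearMap.id_apply]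
    exact add_mem (tmul_mem (V.d_mem _ _ hv) hw (by omega))
      (tmul_mem (sg_mem 1 hv) (W.d_mem _ _ hw) (by omega))
  d_d := by
    refine tensor_hom_ext fun m n v hv w hw => ?_
    simp [sg_of_mem _ hv, sg_of_mem _ (V.d_mem _ _ hv), d_d_apply, ← smul_tmul', sgn_add, neg_tmul]

lemma tensor_d_tmul {p : ℤ} {v : V} (hv : v ∈ V.gr p) (w : W) :
    (V.tensor W).d (v ⊗ₜ w) = V.d v ⊗ₜ w + sgn k p • v ⊗ₜ W.d w := by
  simp [sg_of_mem _ hv, ← smul_tmul']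

lemma IsDeg.map {a b c : ℤ} {f : V →ₗ[k] V'} {g : W →ₗ[k] W'} (hf : IsDeg a f) (hg : IsDeg b g)
    (h : a + b = c) : IsDeg (V := V.tensor W) (W := V'.tensor W') c (TensorProduct.map f g) :=
  fun n => tensor_mem fun p q e v hv w hw => by
    rw [map_tmul]
    exact tmul_mem (hf _ _ hv) (hg _ _ hw) (by omega)

lemma IsMor.map {f : V →ₗ[k] V'} {g : W →ₗ[k] W'} (hf : IsMor f) (hg : IsMor g) :
    IsMor (V := V.tensor W) (W := V'.tensor W') (TensorProduct.map f g) where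
  deg n := by simpa using hf.isDeg.map hg.isDeg (add_zero 0) n
  comm := by
    simp only [LinearMap.comp_add, LinearMap.add_comp, ← TensorProduct.map_comp, hf.comm,
      hg.comm, hf.comp_sg, LinearMap.comp_id, LinearMap.id_comp]

lemma tensor_hom_ext₃ {X : Type*} [AddCommGroup X] [Module k X]
    {f g : (V ⊗[k] W) ⊗[k] U →ₗ[k] X}
    (h : ∀ l m n, ∀ v ∈ V.gr l, ∀ w ∈ W.gr m, ∀ u ∈ U.gr n,
      f ((v ⊗ₜ w) ⊗ₜ u) = g ((v ⊗ₜ w) ⊗ₜ u)) : f = g := by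
  refine tensor_hom_ext (V := V.tensor W) fun _ n x _ u hu => ?_
  refine tensor_induction (p := fun x : V ⊗[k] W => f (x ⊗ₜ u) = g (x ⊗ₜ u)) x
    (fun l m v hv w hw => h l m n v hv w hw u hu) (by simp) (fun x y hx hy => ?_)
  rw [add_tmul, map_add, map_add, hx, hy]

variable (V W U) in
lemma isMor_assoc : IsMor (V := (V.tensor W).tensor U) (W := V.tensor (W.tensor U))
    (TensorProduct.assoc k V W U).toLinearMap where
  deg n := tensor_mem fun p q e x hx u hu =>
    tensor_mem (f := (TensorProduct.assoc k V W U).toLinearMap ∘ₗ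
        (TensorProduct.mk k (V ⊗[k] W) U).flip u)
      (fun p' q' e' v hv w hw => by
        simpa using tmul_mem hv (tmul_mem (V := W) (W := U) hw hu rfl) (by omega)) x hx
  comm := by
    refine tensor_hom_ext₃ fun p q r v hv w hw u hu => ?_
    have h := tmul_mem (V := V) (W := W) hv hw rfl
    have h1 : (V.tensor W).sg 1 (v ⊗ₜ[k] w) = sgn k (1 * (p + q)) • v ⊗ₜ[k] w :=
      sg_of_mem (V := V.tensor W) 1 h
    simp only [LinearMap.comp_apply, LinearMap.add_apply,
      map_tmul, LinearMap.id_apply, h1, sg_of_mem _ hv, sg_of_mem _ hw, add_tmul, map_add,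
      LinearEquiv.coe_coe, assoc_tmul, ← smul_tmul', map_smul, tmul_smul, tmul_add,
      smul_smul, mul_add, sgn_add, add_assoc]
    rw [mul_comm (sgn k (1 * q))]

variable (V W U) in
lemma isMor_assoc_symm : IsMor (V := V.tensor (W.tensor U)) (W := (V.tensor W).tensor U)
    (TensorProduct.assoc k V W U).symm.toLinearMap where
  deg n := tensor_mem fun p q e v hv x hx =>
    tensor_mem (f := (TensorProduct.assoc k V W U).symm.toLinearMap ∘ₗ
        (TensorProduct.mk k V (W ⊗[k] U)) v)
      (fun p' q' e' w hw u hu => by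
        simpa using tmul_mem (V := V.tensor W) (tmul_mem (V := V) (W := W) hv hw rfl) hu (by omega)) x hx
  comm := by
    have := (isMor_assoc V W U).comm
    rw [LinearEquiv.toLinearMap_symm_comp_eq, ← LinearMap.comp_assoc, LinearEquiv.eq_comp_toLinearMap_symm, this]

variable (V W) in
/-- The symmetry `v ⊗ w ↦ (-1)^(|v| |w|) w ⊗ v` of the tensor product. -/
noncomputable def swap : V ⊗[k] W →ₗ[k] W ⊗[k] V :=
  TensorProduct.lift (V.glue fun p =>
    LinearMap.lcomp k _ (W.sg p) ∘ₗ (TensorProduct.mk k W V).flip ∘ₗ (V.gr p).subtype)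

lemma swap_tmul {p q : ℤ} {v : V} {w : W} (hv : v ∈ V.gr p) (hw : w ∈ W.gr q) :
    swap V W (v ⊗ₜ w) = sgn k (p * q) • w ⊗ₜ v := by
  simp [swap, glue_of_mem _ hv, sg_of_mem _ hw]

variable (V W) in
lemma isMor_swap : IsMor (V := V.tensor W) (W := W.tensor V) (swap V W) where
  deg n := tensor_mem fun p q e v hv w hw => by
    rw [swap_tmul hv hw]
    exact Submodule.smul_mem _ _ (tmul_mem hw hv (by omega))
  comm := tensor_hom_ext fun p q v hv w hw => by
    simp only [LinearMap.comp_apply, LinearMap.add_apply, map_tmul, LinearMap.id_apply,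
      sg_of_mem _ hv, ← smul_tmul', map_add, map_smul, swap_tmul hv hw,
      swap_tmul (V.d_mem _ _ hv) hw, swap_tmul hv (W.d_mem _ _ hw), sg_of_mem _ hw,
      smul_add, smul_smul, ← sgn_add]
    rw [add_comm]
    rw [show 1 * p + p * (q + 1) = p * q + p + p by ring, sgn_add _ p, sgn_add _ p, mul_assoc,
      sgn_mul_self, mul_one, show p * q + 1 * q = (p + 1) * q by ring]

lemma swap_naturality {f : V →ₗ[k] V'} {g : W →ₗ[k] W'} (hf : IsMor f) (hg : IsMor g) :
    swap V' W' ∘ₗ TensorProduct.map f g = TensorProduct.map g f ∘ₗ swap V W :=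
  tensor_hom_ext fun p q v hv w hw => by
    simp [swap_tmul hv hw, swap_tmul (hf.deg _ _ hv) (hg.deg _ _ hw)]

end DGVect

namespace DGVect

variable {V W : DGVect.{v, u} k}

lemma IsMor.comp_proj {f : V →ₗ[k] W} (hf : IsMor f) (n : ℤ) (x : V) :
    f (V.proj n x) = W.proj n (f x) := by
  refine LinearMap.congr_fun (f := f ∘ₗ V.proj n) (g := W.proj n ∘ₗ f) (hom_ext fun m x hx => ?_) x
  by_cases h : m = n
  · subst h; simp [proj_same hx, proj_same (hf.deg _ _ hx)]
  · simp [proj_ne h hx, proj_ne h (hf.deg _ _ hx)]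

/-- An injective morphism of graded vector spaces reflects degrees. -/
lemma IsMor.mem_of_injective {f : V →ₗ[k] W} (hf : IsMor f) (hi : Function.Injective f) {n : ℤ}
    {x : V} (h : f x ∈ W.gr n) : x ∈ V.gr n := by
  have : V.proj n x = x := hi (by rw [hf.comp_proj, proj_same h])
  rw [← this]
  exact V.proj_mem n x

variable (V) in
/-- The shift `V[a]`, with `V[a]_n = V_(n+a)` and differential `(-1)^a d`. -/
abbrev shift (a : ℤ) : DGVect.{v, u} k where
  carrier := V
  gr n := V.gr (n + a)
  internal := by
    refine isInternal_of _ ?_ (fun n => V.proj (n + a)) (fun n x hx => proj_same hx)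
      (fun m n hmn x hx => proj_ne (by omega) hx)
    rw [← V.iSup_gr]
    exact (Equiv.addRight a).iSup_congr fun _ => rfl
  d := sgn k a • V.d
  d_mem n x hx := Submodule.smul_mem _ _ (mem_cast (V.d_mem _ _ hx) (by omega))
  d_d := by rw [LinearMap.smul_comp, LinearMap.comp_smul, V.d_d, smul_zero, smul_zero]

/-- For `θ : V → W` of degree one that anticommutes with the differentials, the extension
`W ⊕ V` with the differential `(w, v) ↦ (d w + θ v, d v)`. -/
abbrev ext (θ : V →ₗ[k] W) (hθ : IsDeg 1 θ) (hd : W.d ∘ₗ θ + θ ∘ₗ V.d = 0) : DGVect.{v, u} k where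
  carrier := W × V
  gr n := (W.gr n).prod (V.gr n)
  internal := by
    refine isInternal_of _ ?_ (fun n => LinearMap.prodMap (W.proj n) (V.proj n)) ?_ ?_
    · rw [eq_top_iff]
      rintro ⟨w, v⟩ -
      have h1 : (w, (0 : V)) ∈ ⨆ n, (W.gr n).prod (V.gr n) :=
        induction (p := fun w => (w, (0 : V)) ∈ ⨆ n, (W.gr n).prod (V.gr n)) w
          (fun n x hx => Submodule.mem_iSup_of_mem n ⟨hx, zero_mem _⟩) (zero_mem _)
          (fun x y hx hy => by simpa using add_mem hx hy)
      have h2 : ((0 : W), v) ∈ ⨆ n, (W.gr n).prod (V.gr n) :=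
        induction (p := fun v => ((0 : W), v) ∈ ⨆ n, (W.gr n).prod (V.gr n)) v
          (fun n x hx => Submodule.mem_iSup_of_mem n ⟨zero_mem _, hx⟩) (zero_mem _)
          (fun x y hx hy => by simpa using add_mem hx hy)
      simpa using add_mem h1 h2
    · rintro n ⟨w, v⟩ ⟨hw, hv⟩
      exact Prod.ext (proj_same hw) (proj_same hv)
    · rintro m n hmn ⟨w, v⟩ ⟨hw, hv⟩
      exact Prod.ext (proj_ne hmn hw) (proj_ne hmn hv)
  d := LinearMap.prod (W.d ∘ₗ LinearMap.fst k W V + θ ∘ₗ LinearMap.snd k W V)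
    (V.d ∘ₗ LinearMap.snd k W V)
  d_mem n x hx := ⟨add_mem (W.d_mem _ _ hx.1) (hθ _ _ hx.2), V.d_mem _ _ hx.2⟩
  d_d := by
    refine LinearMap.ext fun x => Prod.ext ?_ ?_
    · have := LinearMap.congr_fun hd x.2
      simpa [d_d_apply, add_assoc] using this
    · simp [d_d_apply]

/-- The elements of degree `n` in a direct sum. -/
abbrev seqGr (V : ℕ → DGVect.{v, u} k) (n : ℤ) : Submodule k (⨁ r, V r) :=
  ⨆ r, ((V r).gr n).map (DirectSum.lof k ℕ (fun r => V r) r)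

lemma lof_mem (V : ℕ → DGVect.{v, u} k) (r : ℕ) {n : ℤ} {x : V r} (h : x ∈ (V r).gr n) :
    DirectSum.lof k ℕ (fun r => V r) r x ∈ seqGr V n :=
  Submodule.mem_iSup_of_mem r ⟨x, h, rfl⟩

lemma seq_mem {V : ℕ → DGVect.{v, u} k} {X : Type*} [AddCommGroup X] [Module k X]
    {f : (⨁ r, V r) →ₗ[k] X} {n : ℤ} {S : Submodule k X}
    (h : ∀ r, ∀ x ∈ (V r).gr n, f (DirectSum.lof k ℕ (fun r => V r) r x) ∈ S) :
    ∀ x ∈ seqGr V n, f x ∈ S := by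
  have : seqGr V n ≤ S.comap f := by
    refine iSup_le fun r => ?_
    rintro _ ⟨x, hx, rfl⟩
    exact h r x hx
  exact this

/-- For a sequence of maps `θ r : V r → V (r + 1)` of degree one that anticommute with the
differentials and have zero composites, the sum `⨁ r, V r` with the differential `d + θ`. -/
noncomputable abbrev seqSum (V : ℕ → DGVect.{v, u} k) (θ : ∀ r, V r →ₗ[k] V (r + 1))
    (hθ : ∀ r, IsDeg 1 (θ r)) (hd : ∀ r, (V (r + 1)).d ∘ₗ θ r + θ r ∘ₗ (V r).d = 0)
    (hθθ : ∀ r, θ (r + 1) ∘ₗ θ r = 0) : DGVect.{v, u} k where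
  carrier := ⨁ r, V r
  gr n := seqGr V n
  internal := by
    refine isInternal_of _ ?_ (fun n => DirectSum.toModule k ℕ _ fun r =>
      DirectSum.lof k ℕ (fun r => V r) r ∘ₗ (V r).proj n) (fun n => ?_) (fun m n hmn => ?_)
    · rw [eq_top_iff]
      rintro x -
      induction x using DirectSum.induction_on with
      | zero => exact zero_mem _
      | add x y hx hy => exact add_mem hx hy
      | of r x =>
        exact induction (p := fun x => DirectSum.of (fun r => V r) r x ∈ _) x
          (fun n x hx => Submodule.mem_iSup_of_mem n (lof_mem V r hx)) (by simp)
          (fun x y hx hy => by rw [map_add]; exact add_mem hx hy)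
    · refine fun x hx => sub_eq_zero.mp (seq_mem (f := _ - LinearMap.id) (S := ⊥)
        (fun r x hx => ?_) x hx)
      simp [proj_same hx]
    · refine seq_mem (S := ⊥) fun r x hx => ?_
      simp [proj_ne hmn hx]
  d := DirectSum.toModule k ℕ _ fun r => DirectSum.lof k ℕ (fun r => V r) r ∘ₗ (V r).d +
    DirectSum.lof k ℕ (fun r => V r) (r + 1) ∘ₗ θ r
  d_mem n := seq_mem fun r x hx => by
    rw [DirectSum.toModule_lof]
    exact add_mem (lof_mem V r ((V r).d_mem _ _ hx)) (lof_mem V (r + 1) (hθ r _ _ hx))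
  d_d := by
    refine DirectSum.linearMap_ext _ fun r => LinearMap.ext fun x => ?_
    have h := LinearMap.congr_fun (hd r) x
    have h' := LinearMap.congr_fun (hθθ r) x
    simp only [LinearMap.add_apply, LinearMap.comp_apply, LinearMap.zero_apply] at h h'
    rw [LinearMap.comp_apply, LinearMap.comp_apply, DirectSum.toModule_lof, LinearMap.add_apply,
      map_add, LinearMap.comp_apply, LinearMap.comp_apply, DirectSum.toModule_lof,
      DirectSum.toModule_lof]
    simp only [LinearMap.add_apply, LinearMap.comp_apply, d_d_apply, h', map_zero, zero_add,
      add_zero, LinearMap.zero_apply]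
    rw [← map_add, add_comm (θ r _), h, map_zero]

/-- The kernel of a morphism of differential graded vector spaces. -/
abbrev ker (f : V →ₗ[k] W) (hf : IsMor f) : DGVect.{v, u} k where
  carrier := LinearMap.ker f
  gr n := (V.gr n).comap (LinearMap.ker f).subtype
  internal := by
    have hp : ∀ n, ∀ x ∈ LinearMap.ker f, V.proj n x ∈ LinearMap.ker f := fun n x hx => by
      rw [LinearMap.mem_ker] at hx ⊢
      rw [hf.comp_proj, hx, map_zero]
    refine isInternal_of _ ?_ (fun n => (V.proj n).restrict (hp n)) ?_ ?_
    · rw [eq_top_iff]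
      rintro x -
      obtain ⟨s, hs⟩ := exists_sum_proj x.1
      have : x = ∑ n ∈ s, ⟨V.proj n x, hp n x x.2⟩ := by
        ext; rw [AddSubmonoidClass.coe_finsetSum]; exact hs
      rw [this]
      exact sum_mem fun n _ => Submodule.mem_iSup_of_mem n (V.proj_mem n x)
    · exact fun n x hx => Subtype.ext (proj_same hx)
    · exact fun m n hmn x hx => Subtype.ext (proj_ne hmn hx)
  d := V.d.restrict fun x hx => by
    rw [LinearMap.mem_ker] at hx ⊢
    rw [hf.comm_apply, hx, map_zero]
  d_mem n x hx := V.d_mem n x hx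
  d_d := LinearMap.ext fun x => Subtype.ext (V.d_d_apply x)

variable (V) in
/-- The cocycles of degree `n`. -/
def Z (n : ℤ) : Submodule k V := V.gr n ⊓ LinearMap.ker V.d

variable (V) in
/-- The coboundaries of degree `n`, inside the cocycles. -/
def B (n : ℤ) : Submodule k (V.Z n) := ((V.gr (n - 1)).map V.d).comap (V.Z n).subtype

variable (V) in
/-- The cohomology of a differential graded vector space in degree `n`. -/
abbrev H (n : ℤ) : Type u := V.Z n ⧸ V.B n

/-- The map induced in cohomology by a morphism. -/
def Hmap {f : V →ₗ[k] W} (hf : IsMor f) (n : ℤ) : V.H n →ₗ[k] W.H n :=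
  Submodule.mapQ _ _ (f.restrict (p := V.Z n) (q := W.Z n) fun x hx => ⟨hf.deg _ _ hx.1, by
    change W.d (f x) = 0
    rw [← hf.comm_apply, LinearMap.mem_ker.mp hx.2, map_zero]⟩) (by
    rintro x ⟨y, hy, hyx⟩
    exact ⟨f y, hf.deg _ _ hy, by rw [← hf.comm_apply, hyx]; rfl⟩)

end DGVect

lemma DGVect.sg_tensor {V W : DGVect.{v, u} k} (a : ℤ) :
    (V.tensor W).sg a = TensorProduct.map (V.sg a) (W.sg a) :=
  DGVect.tensor_hom_ext fun p q v hv w hw => by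
    rw [DGVect.sg_of_mem (V := V.tensor W) a (DGVect.tmul_mem hv hw rfl), map_tmul,
      DGVect.sg_of_mem a hv, DGVect.sg_of_mem a hw, mul_add, sgn_add]
    simp [smul_smul, ← smul_tmul', mul_comm]

/-- A differential graded coalgebra: a coalgebra in the monoidal category of differential graded
vector spaces. -/
structure DGCoalg (k : Type v) [Field k] extends DGVect.{v, u} k where
  [coalgebra : Coalgebra k carrier]
  isMor_comul : DGVect.IsMor (V := toDGVect) (W := toDGVect.tensor toDGVect)
    (Coalgebra.comul : carrier →ₗ[k] carrier ⊗[k] carrier)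
  counit_gr : ∀ n, n ≠ 0 → ∀ x ∈ gr n, (Coalgebra.counit : carrier →ₗ[k] k) x = 0
  counit_d : (Coalgebra.counit : carrier →ₗ[k] k) ∘ₗ d = 0

attribute [instance] DGCoalg.coalgebra

instance : CoeSort (DGCoalg.{v, u} k) (Type u) := ⟨fun C => C.carrier⟩

/-- The comultiplication. -/
abbrev DGCoalg.Δ (C : DGCoalg.{v, u} k) : C →ₗ[k] C ⊗[k] C := Coalgebra.comul

/-- The counit. -/
abbrev DGCoalg.ε (C : DGCoalg.{v, u} k) : C →ₗ[k] k := Coalgebra.counit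

lemma DGCoalg.counit_sg (C : DGCoalg.{v, u} k) (a : ℤ) : C.ε ∘ₗ C.sg a = C.ε :=
  DGVect.hom_ext fun n x hx => by
    by_cases h : n = 0
    · subst h; simp [DGVect.sg_of_mem a hx]
    · simp [DGVect.sg_of_mem a hx, C.counit_gr n h x hx]

/-- Positively graded coalgebras: no nonzero components in negative degrees. -/
def DGCoalg.IsPos (C : DGCoalg.{v, u} k) : Prop := ∀ n < 0, C.gr n = ⊥

/-- A differential graded `C`-`D`-bicomodule, that is, a differential graded comodule over
`C ⊗ D^op`, given by commuting coactions of `C` on the left and of `D` on the right. -/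
structure Bicomod (C D : DGCoalg.{v, u} k) extends DGVect.{v, u} k where
  lact : carrier →ₗ[k] C ⊗[k] carrier
  ract : carrier →ₗ[k] carrier ⊗[k] D
  isMor_lact : DGVect.IsMor (V := toDGVect) (W := C.toDGVect.tensor toDGVect) lact
  isMor_ract : DGVect.IsMor (V := toDGVect) (W := toDGVect.tensor D.toDGVect) ract
  lact_coassoc : (TensorProduct.assoc k C C carrier).toLinearMap ∘ₗ
    TensorProduct.map C.Δ LinearMap.id ∘ₗ lact = TensorProduct.map LinearMap.id lact ∘ₗ lact
  lact_counit : (TensorProduct.lid k carrier).toLinearMap ∘ₗ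
    TensorProduct.map C.ε LinearMap.id ∘ₗ lact = LinearMap.id
  ract_coassoc : (TensorProduct.assoc k carrier D D).toLinearMap ∘ₗ
    TensorProduct.map ract LinearMap.id ∘ₗ ract = TensorProduct.map LinearMap.id D.Δ ∘ₗ ract
  ract_counit : (TensorProduct.rid k carrier).toLinearMap ∘ₗ
    TensorProduct.map LinearMap.id D.ε ∘ₗ ract = LinearMap.id
  lact_ract : (TensorProduct.assoc k C carrier D).toLinearMap ∘ₗ
    TensorProduct.map lact LinearMap.id ∘ₗ ract = TensorProduct.map LinearMap.id ract ∘ₗ lact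

namespace Bicomod

variable {C D E F : DGCoalg.{v, u} k}

instance : CoeSort (Bicomod C D) (Type u) := ⟨fun M => M.carrier⟩

/-- Left bounded bicomodules. -/
def IsBddBelow (M : Bicomod C D) : Prop := ∃ a : ℤ, ∀ n < a, M.gr n = ⊥

/-- Graded bicolinear maps of degree `a`. The sign is the one of the Koszul rule for
moving a map of degree `a` past an element of `C`. -/
structure IsColin {M N : Bicomod C D} (a : ℤ) (f : M →ₗ[k] N) : Prop where
  deg : DGVect.IsDeg (V := M.toDGVect) (W := N.toDGVect) a f
  left : N.lact ∘ₗ f = TensorProduct.map (C.sg a) f ∘ₗ M.lact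
  right : N.ract ∘ₗ f = TensorProduct.map f LinearMap.id ∘ₗ M.ract

/-- Morphisms of differential graded bicomodules. -/
@[ext]
structure Hom (M N : Bicomod C D) where
  lin : M →ₗ[k] N
  isMor : DGVect.IsMor (V := M.toDGVect) (W := N.toDGVect) lin
  left : N.lact ∘ₗ lin = TensorProduct.map LinearMap.id lin ∘ₗ M.lact
  right : N.ract ∘ₗ lin = TensorProduct.map lin LinearMap.id ∘ₗ M.ract

/-- The category of differential graded `C`-`D`-bicomodules. -/
instance : Category (Bicomod C D) where
  Hom := Hom
  id M := ⟨LinearMap.id, .id, by simp, by simp⟩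
  comp f g := ⟨g.lin ∘ₗ f.lin, g.isMor.comp f.isMor, by
    rw [← LinearMap.comp_assoc, g.left, LinearMap.comp_assoc, f.left, ← LinearMap.comp_assoc,
      ← TensorProduct.map_comp, LinearMap.id_comp], by
    rw [← LinearMap.comp_assoc, g.right, LinearMap.comp_assoc, f.right, ← LinearMap.comp_assoc,
      ← TensorProduct.map_comp, LinearMap.id_comp]⟩

@[ext]
lemma hom_ext {M N : Bicomod C D} {f g : M ⟶ N} (h : f.lin = g.lin) : f = g := Hom.ext h

@[simp] lemma id_lin (M : Bicomod C D) : Hom.lin (𝟙 M) = LinearMap.id := rfl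

@[simp] lemma comp_lin {M N L : Bicomod C D} (f : M ⟶ N) (g : N ⟶ L) :
    (f ≫ g).lin = g.lin ∘ₗ f.lin := rfl

section Linear

variable {M N : Bicomod C D}

instance : Zero (M ⟶ N) := ⟨⟨0, .zero, by simp, by simp⟩⟩

instance : Add (M ⟶ N) := ⟨fun f g => ⟨f.lin + g.lin, f.isMor.add g.isMor, by
  rw [LinearMap.comp_add, f.left, g.left, TensorProduct.map_add_right, LinearMap.add_comp], by
  rw [LinearMap.comp_add, f.right, g.right, TensorProduct.map_add_left, LinearMap.add_comp]⟩⟩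

instance : SMul k (M ⟶ N) := ⟨fun a f => ⟨a • f.lin, f.isMor.smul a, by
  rw [LinearMap.comp_smul, f.left, TensorProduct.map_smul_right, LinearMap.smul_comp], by
  rw [LinearMap.comp_smul, f.right, TensorProduct.map_smul_left, LinearMap.smul_comp]⟩⟩

instance : Neg (M ⟶ N) := ⟨fun f => (-1 : k) • f⟩

@[simp] lemma zero_lin : Hom.lin (0 : M ⟶ N) = 0 := rfl
@[simp] lemma add_lin (f g : M ⟶ N) : (f + g).lin = f.lin + g.lin := rfl
@[simp] lemma smul_lin (a : k) (f : M ⟶ N) : (a • f).lin = a • f.lin := rfl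
@[simp] lemma neg_lin (f : M ⟶ N) : (-f).lin = -f.lin :=
  (neg_one_smul k f.lin : (-1 : k) • f.lin = _)

instance : AddCommGroup (M ⟶ N) where
  add_assoc _ _ _ := hom_ext (add_assoc _ _ _)
  zero_add _ := hom_ext (zero_add _)
  add_zero _ := hom_ext (add_zero _)
  add_comm _ _ := hom_ext (add_comm _ _)
  neg_add_cancel _ := hom_ext (by simp)
  nsmul := nsmulRec
  zsmul := zsmulRec

@[simp] lemma sub_lin (f g : M ⟶ N) : (f - g).lin = f.lin - g.lin := by
  rw [sub_eq_add_neg, add_lin, neg_lin, sub_eq_add_neg]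

instance : Module k (M ⟶ N) where
  one_smul _ := hom_ext (one_smul _ _)
  mul_smul _ _ _ := hom_ext (mul_smul _ _ _)
  smul_zero _ := hom_ext (smul_zero _)
  smul_add _ _ _ := hom_ext (smul_add _ _ _)
  add_smul _ _ _ := hom_ext (add_smul _ _ _)
  zero_smul _ := hom_ext (zero_smul _ _)

end Linear

instance : Preadditive (Bicomod C D) where
  add_comp _ _ _ _ _ _ := hom_ext (LinearMap.comp_add _ _ _)
  comp_add _ _ _ _ _ _ := hom_ext (LinearMap.add_comp _ _ _)

instance : Linear k (Bicomod C D) where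
  smul_comp _ _ _ _ _ _ := hom_ext (LinearMap.comp_smul _ _ _)
  comp_smul _ _ _ _ _ _ := hom_ext (LinearMap.smul_comp _ _ _)

/-- The coalgebra `C` as a bicomodule over itself. -/
abbrev regular (C : DGCoalg.{v, u} k) : Bicomod C C where
  toDGVect := C.toDGVect
  lact := C.Δ
  ract := C.Δ
  isMor_lact := C.isMor_comul
  isMor_ract := C.isMor_comul
  lact_coassoc := Coalgebra.coassoc
  lact_counit := by
    have : TensorProduct.map C.ε LinearMap.id ∘ₗ C.Δ = TensorProduct.mk k k C 1 :=
      Coalgebra.rTensor_counit_comp_comul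
    rw [this]; ext x; simp
  ract_coassoc := Coalgebra.coassoc
  ract_counit := by
    have : TensorProduct.map LinearMap.id C.ε ∘ₗ C.Δ = (TensorProduct.mk k C k).flip 1 :=
      Coalgebra.lTensor_counit_comp_comul
    rw [this]; ext x; simp
  lact_ract := Coalgebra.coassoc

lemma assoc_nat {A A' B B' X X' : Type u} [AddCommGroup A] [Module k A] [AddCommGroup A']
    [Module k A'] [AddCommGroup B] [Module k B] [AddCommGroup B'] [Module k B'] [AddCommGroup X]
    [Module k X] [AddCommGroup X'] [Module k X'] (f : A →ₗ[k] A') (g : B →ₗ[k] B')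
    (h : X →ₗ[k] X') : (TensorProduct.assoc k A' B' X').toLinearMap ∘ₗ
      TensorProduct.map (TensorProduct.map f g) h =
      TensorProduct.map f (TensorProduct.map g h) ∘ₗ (TensorProduct.assoc k A B X).toLinearMap :=
  TensorProduct.ext_threefold fun _ _ _ => rfl

/-- A bicomodule structure may be checked on a jointly epimorphic family of maps `i j` that
generate in each degree. The maps `τ j` measure how far the `i j` are from commuting with the
differentials. -/
abbrev ofEpi (X : DGVect.{v, u} k) {ι : Type} (M : ι → Bicomod C D) (i τ : ∀ j, M j →ₗ[k] X)
    (hi : ∀ (Y : Type u) [AddCommGroup Y] [Module k Y] (f g : X →ₗ[k] Y),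
      (∀ j, f ∘ₗ i j = g ∘ₗ i j) → f = g)
    (hgr : ∀ n, X.gr n = ⨆ j, ((M j).gr n).map (i j))
    (hd : ∀ j, X.d ∘ₗ i j = i j ∘ₗ (M j).d + τ j)
    (lact : X →ₗ[k] C ⊗[k] X) (ract : X →ₗ[k] X ⊗[k] D)
    (hl : ∀ j, lact ∘ₗ i j = TensorProduct.map LinearMap.id (i j) ∘ₗ (M j).lact)
    (hr : ∀ j, ract ∘ₗ i j = TensorProduct.map (i j) LinearMap.id ∘ₗ (M j).ract)
    (hτl : ∀ j, lact ∘ₗ τ j = TensorProduct.map (C.sg 1) (τ j) ∘ₗ (M j).lact)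
    (hτr : ∀ j, ract ∘ₗ τ j = TensorProduct.map (τ j) LinearMap.id ∘ₗ (M j).ract) :
    Bicomod C D where
  toDGVect := X
  lact := lact
  ract := ract
  isMor_lact := by
    have hi0 : ∀ j, DGVect.IsDeg (V := (M j).toDGVect) (W := X) 0 (i j) := fun j n x hx => by
      rw [hgr, add_zero]; exact Submodule.mem_iSup_of_mem j ⟨x, hx, rfl⟩
    refine ⟨fun n => ?_, hi _ _ _ fun j => ?_⟩
    · suffices h : X.gr n ≤ ((C.toDGVect.tensor X).gr n).comap lact from h
      rw [hgr]
      refine iSup_le fun j => ?_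
      rintro _ ⟨x, hx, rfl⟩
      have h1 := LinearMap.congr_fun (hl j) x
      have h2 := (DGVect.IsMor.id (V := C.toDGVect)).isDeg.map (hi0 j) (add_zero 0) n _
        ((M j).isMor_lact.deg n x hx)
      rw [add_zero] at h2
      rw [Submodule.mem_comap]
      exact h1 ▸ h2
    · have h := (M j).isMor_lact.comm
      rw [LinearMap.comp_assoc, hd, LinearMap.comp_add, hτl, ← LinearMap.comp_assoc, hl,
        LinearMap.comp_assoc, h, LinearMap.comp_assoc, hl]
      simp only [LinearMap.add_comp, LinearMap.comp_add, ← LinearMap.comp_assoc,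
        ← TensorProduct.map_comp, hd, TensorProduct.map_add_right, LinearMap.id_comp,
        LinearMap.comp_id, add_assoc]
  isMor_ract := by
    have hi0 : ∀ j, DGVect.IsDeg (V := (M j).toDGVect) (W := X) 0 (i j) := fun j n x hx => by
      rw [hgr, add_zero]; exact Submodule.mem_iSup_of_mem j ⟨x, hx, rfl⟩
    refine ⟨fun n => ?_, hi _ _ _ fun j => ?_⟩
    · suffices h : X.gr n ≤ ((X.tensor D.toDGVect).gr n).comap ract from h
      rw [hgr]
      refine iSup_le fun j => ?_
      rintro _ ⟨x, hx, rfl⟩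
      have h1 := LinearMap.congr_fun (hr j) x
      have h2 := (hi0 j).map (DGVect.IsMor.id (V := D.toDGVect)).isDeg (add_zero 0) n _
        ((M j).isMor_ract.deg n x hx)
      rw [add_zero] at h2
      rw [Submodule.mem_comap]
      exact h1 ▸ h2
    · have h := (M j).isMor_ract.comm
      have h' : i j ∘ₗ (M j).sg 1 = X.sg 1 ∘ₗ i j := by simpa using (hi0 j).comp_sg 1
      rw [LinearMap.comp_assoc, hd, LinearMap.comp_add, hτr, ← LinearMap.comp_assoc, hr,
        LinearMap.comp_assoc, h, LinearMap.comp_assoc, hr]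
      simp only [LinearMap.add_comp, LinearMap.comp_add, ← LinearMap.comp_assoc,
        ← TensorProduct.map_comp, hd, TensorProduct.map_add_left, LinearMap.id_comp,
        LinearMap.comp_id, h']
      abel
  lact_coassoc := hi _ _ _ fun j => by
    have h : TensorProduct.map C.Δ LinearMap.id ∘ₗ TensorProduct.map LinearMap.id (i j) =
        TensorProduct.map (TensorProduct.map LinearMap.id LinearMap.id) (i j) ∘ₗ
          TensorProduct.map C.Δ LinearMap.id := by
      simp [← TensorProduct.map_comp]
    calc _ = (TensorProduct.assoc k C C X).toLinearMap ∘ₗ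
          (TensorProduct.map C.Δ LinearMap.id ∘ₗ TensorProduct.map LinearMap.id (i j)) ∘ₗ
            (M j).lact := by simp only [LinearMap.comp_assoc, hl]
      _ = TensorProduct.map LinearMap.id (TensorProduct.map LinearMap.id (i j)) ∘ₗ
          TensorProduct.map LinearMap.id (M j).lact ∘ₗ (M j).lact := by
        rw [h, ← (M j).lact_coassoc]
        simp only [← LinearMap.comp_assoc, assoc_nat]
      _ = _ := by
        rw [LinearMap.comp_assoc, hl]
        simp only [← LinearMap.comp_assoc, ← TensorProduct.map_comp, hl]
  lact_counit := hi _ _ _ fun j => by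
    have h : (TensorProduct.lid k X).toLinearMap ∘ₗ TensorProduct.map LinearMap.id (i j) =
        i j ∘ₗ (TensorProduct.lid k (M j)).toLinearMap := by ext; simp
    calc _ = (TensorProduct.lid k X).toLinearMap ∘ₗ TensorProduct.map LinearMap.id (i j) ∘ₗ
          TensorProduct.map C.ε LinearMap.id ∘ₗ (M j).lact := by
          simp only [LinearMap.comp_assoc, hl]
          simp only [← LinearMap.comp_assoc (M j).lact, ← TensorProduct.map_comp,
            LinearMap.id_comp, LinearMap.comp_id]
      _ = _ := by
        rw [← LinearMap.comp_assoc, h, LinearMap.comp_assoc, (M j).lact_counit]; rfl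
  ract_coassoc := hi _ _ _ fun j => by
    have h : TensorProduct.map LinearMap.id D.Δ ∘ₗ TensorProduct.map (i j) LinearMap.id =
        TensorProduct.map (i j) (TensorProduct.map LinearMap.id LinearMap.id) ∘ₗ
          TensorProduct.map LinearMap.id D.Δ := by
      simp [← TensorProduct.map_comp]
    symm
    calc _ = (TensorProduct.map LinearMap.id D.Δ ∘ₗ TensorProduct.map (i j) LinearMap.id) ∘ₗ
            (M j).ract := by simp only [LinearMap.comp_assoc, hr]
      _ = (TensorProduct.assoc k X D D).toLinearMap ∘ₗ
          TensorProduct.map (TensorProduct.map (i j) LinearMap.id) LinearMap.id ∘ₗ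
          TensorProduct.map (M j).ract LinearMap.id ∘ₗ (M j).ract := by
        rw [h, LinearMap.comp_assoc, ← (M j).ract_coassoc]
        simp only [← LinearMap.comp_assoc, assoc_nat]
      _ = _ := by
        rw [LinearMap.comp_assoc, LinearMap.comp_assoc, hr]
        simp only [← LinearMap.comp_assoc (M j).ract, ← TensorProduct.map_comp, hr,
          LinearMap.id_comp]
  ract_counit := hi _ _ _ fun j => by
    have h : (TensorProduct.rid k X).toLinearMap ∘ₗ TensorProduct.map (i j) LinearMap.id =
        i j ∘ₗ (TensorProduct.rid k (M j)).toLinearMap := by ext; simp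
    calc _ = (TensorProduct.rid k X).toLinearMap ∘ₗ TensorProduct.map (i j) LinearMap.id ∘ₗ
          TensorProduct.map LinearMap.id D.ε ∘ₗ (M j).ract := by
          simp only [LinearMap.comp_assoc, hr]
          simp only [← LinearMap.comp_assoc (M j).ract, ← TensorProduct.map_comp,
            LinearMap.id_comp, LinearMap.comp_id]
      _ = _ := by
        rw [← LinearMap.comp_assoc, h, LinearMap.comp_assoc, (M j).ract_counit]; rfl
  lact_ract := hi _ _ _ fun j => by
    calc _ = (TensorProduct.assoc k C X D).toLinearMap ∘ₗ
          TensorProduct.map (TensorProduct.map LinearMap.id (i j)) LinearMap.id ∘ₗ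
          TensorProduct.map (M j).lact LinearMap.id ∘ₗ (M j).ract := by
          simp only [LinearMap.comp_assoc, hr]
          simp only [← LinearMap.comp_assoc (M j).ract, ← TensorProduct.map_comp, hl,
            LinearMap.id_comp]
      _ = TensorProduct.map LinearMap.id (TensorProduct.map (i j) LinearMap.id) ∘ₗ
          TensorProduct.map LinearMap.id (M j).ract ∘ₗ (M j).lact := by
        rw [← (M j).lact_ract]
        simp only [← LinearMap.comp_assoc, assoc_nat]
      _ = _ := by
        rw [LinearMap.comp_assoc, hl]
        simp only [← LinearMap.comp_assoc, ← TensorProduct.map_comp, hr, LinearMap.id_comp]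

end Bicomod

namespace Bicomod

variable {C D E F : DGCoalg.{v, u} k}

lemma comul_sg (C : DGCoalg.{v, u} k) (a : ℤ) :
    C.Δ ∘ₗ C.sg a = TensorProduct.map (C.sg a) (C.sg a) ∘ₗ C.Δ := by
  rw [C.isMor_comul.comp_sg a, DGVect.sg_tensor]

lemma tensorGr_shift (V W : DGVect.{v, u} k) (a n : ℤ) :
    DGVect.tensorGr V W (n + a) ≤ DGVect.tensorGr V (W.shift a) n := by
  rw [Submodule.span_le]
  rintro _ ⟨p, q, h, v, hv, w, hw, rfl⟩
  exact DGVect.tmul_mem (W := W.shift a) (q := q - a) hv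
    (DGVect.mem_cast (V := W) hw (by omega)) (by omega)

lemma tensorGr_shift' (V W : DGVect.{v, u} k) (a n : ℤ) :
    DGVect.tensorGr V W (n + a) ≤ DGVect.tensorGr (V.shift a) W n := by
  rw [Submodule.span_le]
  rintro _ ⟨p, q, h, v, hv, w, hw, rfl⟩
  exact DGVect.tmul_mem (V := V.shift a) (p := p - a)
    (DGVect.mem_cast (V := V) hv (by omega)) hw (by omega)

lemma sg_shift (V : DGVect.{v, u} k) (a b : ℤ) : (V.shift a).sg b = sgn k (b * a) • V.sg b :=
  DGVect.hom_ext (V := V.shift a) fun n x hx => by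
    rw [DGVect.sg_of_mem (V := V.shift a) b hx, LinearMap.smul_apply, DGVect.sg_of_mem (V := V) b hx,
      smul_smul, mul_add, sgn_add, mul_left_comm, sgn_mul_self, mul_one]

/-- The shift `M[a]`, with `M[a]_n = M_(n+a)`, differential `(-1)^a d` and the left coaction
`m ↦ (-1)^(a |c|) c ⊗ m'`. -/
noncomputable abbrev shift (M : Bicomod C D) (a : ℤ) : Bicomod C D where
  toDGVect := M.toDGVect.shift a
  lact := TensorProduct.map (C.sg a) LinearMap.id ∘ₗ M.lact
  ract := M.ract
  isMor_lact := by
    refine ⟨fun n x hx => tensorGr_shift _ _ _ _ ?_, ?_⟩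
    · refine DGVect.tensor_mem (f := TensorProduct.map (C.sg a) LinearMap.id)
        (fun p q h c hc m hm => ?_) _ (M.isMor_lact.deg _ x hx)
      exact DGVect.tmul_mem (DGVect.sg_mem a hc) hm h
    · rw [LinearMap.comp_smul, LinearMap.comp_assoc, M.isMor_lact.comm]
      simp only [LinearMap.comp_add, LinearMap.add_comp, ← LinearMap.comp_assoc,
        ← TensorProduct.map_comp, LinearMap.id_comp, LinearMap.comp_id, DGVect.d_sg,
        TensorProduct.map_smul_left, TensorProduct.map_smul_right, LinearMap.smul_comp, smul_add,
        ← DGVect.sg_add, add_comm a]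
  isMor_ract := by
    refine ⟨fun n x hx => tensorGr_shift' _ _ _ _ (M.isMor_ract.deg _ x hx), ?_⟩
    rw [LinearMap.comp_smul, M.isMor_ract.comm]
    change _ = (TensorProduct.map _ _ + TensorProduct.map ((M.toDGVect.shift a).sg 1) _) ∘ₗ _
    rw [sg_shift]
    simp only [TensorProduct.map_smul_left, LinearMap.smul_comp, LinearMap.add_comp, smul_add,
      one_mul]
  lact_coassoc := by
    have h : TensorProduct.map (C.Δ ∘ₗ C.sg a) (LinearMap.id : M →ₗ[k] M) =
        TensorProduct.map (TensorProduct.map (C.sg a) (C.sg a)) LinearMap.id ∘ₗ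
          TensorProduct.map C.Δ LinearMap.id := by
      rw [← TensorProduct.map_comp, comul_sg, LinearMap.id_comp]
    rw [← LinearMap.comp_assoc M.lact, ← TensorProduct.map_comp, LinearMap.id_comp, h,
      LinearMap.comp_assoc, ← LinearMap.comp_assoc, assoc_nat, LinearMap.comp_assoc,
      M.lact_coassoc]
    simp only [← LinearMap.comp_assoc, ← TensorProduct.map_comp, LinearMap.id_comp,
      LinearMap.comp_id]
  lact_counit := by
    have h := M.lact_counit
    rw [← LinearMap.comp_assoc M.lact, ← TensorProduct.map_comp, C.counit_sg]
    exact h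
  ract_coassoc := M.ract_coassoc
  ract_counit := M.ract_counit
  lact_ract := by
    have h' : TensorProduct.map (TensorProduct.map (C.sg a) LinearMap.id ∘ₗ M.lact)
        (LinearMap.id : D →ₗ[k] D) =
        TensorProduct.map (TensorProduct.map (C.sg a) LinearMap.id) LinearMap.id ∘ₗ
          TensorProduct.map M.lact LinearMap.id := by
      rw [← TensorProduct.map_comp, LinearMap.id_comp]
    rw [h', LinearMap.comp_assoc, ← LinearMap.comp_assoc, assoc_nat, LinearMap.comp_assoc,
      M.lact_ract, TensorProduct.map_id]
    simp only [← LinearMap.comp_assoc, ← TensorProduct.map_comp, LinearMap.id_comp,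
      LinearMap.comp_id]

end Bicomod

namespace Bicomod

variable {C D E F : DGCoalg.{v, u} k}

/-- For a bicolinear map `θ : M → N` of degree one that anticommutes with the differentials, the
bicomodule `N ⊕ M` with the differential `(n, m) ↦ (d n + θ m, d m)`. -/
noncomputable abbrev ext {M N : Bicomod C D} (θ : M →ₗ[k] N) (hθ : IsColin 1 θ)
    (hd : N.d ∘ₗ θ + θ ∘ₗ M.d = 0) : Bicomod C D :=
  ofEpi (DGVect.ext (V := M.toDGVect) (W := N.toDGVect) θ hθ.deg hd)
    (fun b : Bool => Bool.rec N M b)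
    (fun b => Bool.rec (LinearMap.inl k N M) (LinearMap.inr k N M) b)
    (fun b => Bool.rec 0 (LinearMap.inl k N M ∘ₗ θ) b)
    (fun _ _ _ f g h => LinearMap.prod_ext (h false) (h true))
    (fun n => by
      apply le_antisymm
      · rintro ⟨x, y⟩ ⟨hx, hy⟩
        have h1 : (x, (0 : M)) ∈ _ := Submodule.mem_iSup_of_mem (p := fun b : Bool =>
          ((Bool.rec N M b : Bicomod C D).gr n).map (Bool.rec (LinearMap.inl k N M)
            (LinearMap.inr k N M) b : (Bool.rec N M b : Bicomod C D) →ₗ[k] N × M))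
            false ⟨x, hx, rfl⟩
        have h2 : ((0 : N), y) ∈ _ := Submodule.mem_iSup_of_mem (p := fun b : Bool =>
          ((Bool.rec N M b : Bicomod C D).gr n).map (Bool.rec (LinearMap.inl k N M)
            (LinearMap.inr k N M) b : (Bool.rec N M b : Bicomod C D) →ₗ[k] N × M))
            true ⟨y, hy, rfl⟩
        simpa using add_mem h1 h2
      · refine iSup_le fun b => ?_
        rcases b with - | -
        · rintro _ ⟨x, hx, rfl⟩; exact ⟨hx, zero_mem _⟩
        · rintro _ ⟨x, hx, rfl⟩; exact ⟨zero_mem _, hx⟩)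
    (fun b => by
      rcases b with - | -
      · refine LinearMap.ext fun x => Prod.ext ?_ ?_ <;> simp
      · refine LinearMap.ext fun x => Prod.ext ?_ ?_ <;> simp)
    (LinearMap.coprod (TensorProduct.map LinearMap.id (LinearMap.inl k N M) ∘ₗ N.lact)
      (TensorProduct.map LinearMap.id (LinearMap.inr k N M) ∘ₗ M.lact))
    (LinearMap.coprod (TensorProduct.map (LinearMap.inl k N M) LinearMap.id ∘ₗ N.ract)
      (TensorProduct.map (LinearMap.inr k N M) LinearMap.id ∘ₗ M.ract))
    (fun b => by
      rcases b with - | -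
      · exact LinearMap.coprod_inl _ _
      · exact LinearMap.coprod_inr _ _)
    (fun b => by
      rcases b with - | -
      · exact LinearMap.coprod_inl _ _
      · exact LinearMap.coprod_inr _ _)
    (fun b => by
      rcases b with - | -
      · simp
      · simp only
        rw [← LinearMap.comp_assoc, LinearMap.coprod_inl, LinearMap.comp_assoc, hθ.left,
          ← LinearMap.comp_assoc, ← TensorProduct.map_comp, LinearMap.id_comp])
    (fun b => by
      rcases b with - | -
      · simp
      · simp only
        rw [← LinearMap.comp_assoc, LinearMap.coprod_inl, LinearMap.comp_assoc, hθ.right,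
          ← LinearMap.comp_assoc, ← TensorProduct.map_comp, LinearMap.id_comp])

/-- For a sequence of bicolinear maps `θ r : M r → M (r + 1)` of degree one that anticommute with
the differentials and have zero composites, the bicomodule `⨁ r, M r` with the differential
`d + θ`. -/
noncomputable abbrev seqSum (M : ℕ → Bicomod C D) (θ : ∀ r, M r →ₗ[k] M (r + 1))
    (hθ : ∀ r, IsColin 1 (θ r)) (hd : ∀ r, (M (r + 1)).d ∘ₗ θ r + θ r ∘ₗ (M r).d = 0)
    (hθθ : ∀ r, θ (r + 1) ∘ₗ θ r = 0) : Bicomod C D :=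
  ofEpi (DGVect.seqSum (fun r => (M r).toDGVect) θ (fun r => (hθ r).deg) hd hθθ) M
    (fun r => DirectSum.lof k ℕ (fun r => M r) r)
    (fun r => DirectSum.lof k ℕ (fun r => M r) (r + 1) ∘ₗ θ r)
    (fun _ _ _ f g h => DirectSum.linearMap_ext _ h)
    (fun n => rfl)
    (fun r => LinearMap.ext fun x => by
      rw [LinearMap.comp_apply]
      exact DirectSum.toModule_lof (M := fun r => (M r).carrier) k r x)
    (DirectSum.toModule k ℕ _ fun r =>
      TensorProduct.map LinearMap.id (DirectSum.lof k ℕ (fun r => M r) r) ∘ₗ (M r).lact)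
    (DirectSum.toModule k ℕ _ fun r =>
      TensorProduct.map (DirectSum.lof k ℕ (fun r => M r) r) LinearMap.id ∘ₗ (M r).ract)
    (fun r => LinearMap.ext fun x => DirectSum.toModule_lof _ _ _)
    (fun r => LinearMap.ext fun x => DirectSum.toModule_lof _ _ _)
    (fun r => LinearMap.ext fun x => by
      have := LinearMap.congr_fun (hθ r).left x
      simp only [LinearMap.comp_apply] at this
      rw [LinearMap.comp_apply, LinearMap.comp_apply, DirectSum.toModule_lof, LinearMap.comp_apply,
        this, ← LinearMap.comp_apply, ← TensorProduct.map_comp, LinearMap.id_comp,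
        LinearMap.comp_apply])
    (fun r => LinearMap.ext fun x => by
      have := LinearMap.congr_fun (hθ r).right x
      simp only [LinearMap.comp_apply] at this
      rw [LinearMap.comp_apply, LinearMap.comp_apply, DirectSum.toModule_lof, LinearMap.comp_apply,
        this, ← LinearMap.comp_apply, ← TensorProduct.map_comp, LinearMap.id_comp,
        LinearMap.comp_apply])

/-- The tensor product `P ⊗ N` over the ground field of a `C`-`D`-bicomodule and an
`E`-`F`-bicomodule, with the outer coactions of `C` and `F`. -/
noncomputable abbrev outer (P : Bicomod C D) (N : Bicomod E F) : Bicomod C F where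
  toDGVect := P.toDGVect.tensor N.toDGVect
  lact := (TensorProduct.assoc k C P N).toLinearMap ∘ₗ TensorProduct.map P.lact LinearMap.id
  ract := (TensorProduct.assoc k P N F).symm.toLinearMap ∘ₗ
    TensorProduct.map LinearMap.id N.ract
  isMor_lact := DGVect.IsMor.comp (V := P.toDGVect.tensor N.toDGVect)
    (W := (C.toDGVect.tensor P.toDGVect).tensor N.toDGVect)
    (U := C.toDGVect.tensor (P.toDGVect.tensor N.toDGVect))
    (DGVect.isMor_assoc C.toDGVect P.toDGVect N.toDGVect)
    (DGVect.IsMor.map (V := P.toDGVect) (V' := C.toDGVect.tensor P.toDGVect) (W := N.toDGVect)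
      (W' := N.toDGVect) P.isMor_lact .id)
  isMor_ract := DGVect.IsMor.comp (V := P.toDGVect.tensor N.toDGVect)
    (W := P.toDGVect.tensor (N.toDGVect.tensor F.toDGVect))
    (U := (P.toDGVect.tensor N.toDGVect).tensor F.toDGVect)
    (DGVect.isMor_assoc_symm P.toDGVect N.toDGVect F.toDGVect)
    (DGVect.IsMor.map (V := P.toDGVect) (V' := P.toDGVect) (W := N.toDGVect)
      (W' := N.toDGVect.tensor F.toDGVect) .id N.isMor_ract)
  lact_coassoc := by
    refine TensorProduct.ext' fun p n => ?_
    have h := LinearMap.congr_fun P.lact_coassoc p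
    simp only [LinearMap.comp_apply, map_tmul, LinearMap.id_apply, LinearEquiv.coe_coe] at h ⊢
    trans (TensorProduct.assoc k C C (P ⊗[k] N)) ((TensorProduct.assoc k (C ⊗[k] C) P N)
      ((TensorProduct.map C.Δ LinearMap.id (P.lact p)) ⊗ₜ n))
    · generalize P.lact p = x
      induction x with
      | zero => simp
      | add x y hx hy => simp only [add_tmul, map_add, hx, hy]
      | tmul c p => simp
    rw [(LinearEquiv.eq_symm_apply _).mpr h]
    trans (TensorProduct.map LinearMap.id (TensorProduct.assoc k C P N).toLinearMap)
      (TensorProduct.assoc k C (C ⊗[k] P) N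
        ((TensorProduct.map LinearMap.id P.lact (P.lact p)) ⊗ₜ n))
    · generalize TensorProduct.map LinearMap.id P.lact (P.lact p) = x
      refine LinearMap.congr_fun (f := (TensorProduct.assoc k C C (P ⊗[k] N)).toLinearMap ∘ₗ
        (TensorProduct.assoc k (C ⊗[k] C) P N).toLinearMap ∘ₗ
        (TensorProduct.mk k _ _).flip n ∘ₗ (TensorProduct.assoc k C C P).symm.toLinearMap)
        (g := (TensorProduct.map LinearMap.id (TensorProduct.assoc k C P N).toLinearMap) ∘ₗ
          (TensorProduct.assoc k C (C ⊗[k] P) N).toLinearMap ∘ₗ (TensorProduct.mk k _ _).flip n)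
        ?_ x
      ext; simp
    · generalize P.lact p = x
      induction x with
      | zero => simp
      | add x y hx hy => simp only [add_tmul, map_add, hx, hy]
      | tmul c p => simp
  lact_counit := by
    refine TensorProduct.ext' fun p n => ?_
    have h := LinearMap.congr_fun P.lact_counit p
    simp only [LinearMap.comp_apply, map_tmul, LinearMap.id_apply, LinearEquiv.coe_coe] at h ⊢
    conv_rhs => rw [← h]
    generalize P.lact p = x
    induction x with
    | zero => simp
    | add x y hx hy => simp only [add_tmul, map_add, hx, hy]
    | tmul c p => simp [smul_tmul']
  ract_coassoc := by
    refine TensorProduct.ext' fun p n => ?_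
    have h := LinearMap.congr_fun N.ract_coassoc n
    simp only [LinearMap.comp_apply, map_tmul, LinearMap.id_apply, LinearEquiv.coe_coe] at h ⊢
    trans (TensorProduct.assoc k P N (F ⊗[k] F)).symm
      (p ⊗ₜ (TensorProduct.map LinearMap.id F.Δ (N.ract n)))
    swap
    · generalize N.ract n = x
      induction x with
      | zero => simp
      | add x y hx hy => simp only [tmul_add, map_add, hx, hy]
      | tmul c p => simp
    rw [← h]
    trans (TensorProduct.assoc k P N (F ⊗[k] F)).symm
      (p ⊗ₜ (TensorProduct.assoc k N F F (TensorProduct.map N.ract LinearMap.id (N.ract n))))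
    swap
    · rfl
    generalize N.ract n = x
    induction x with
    | zero => simp
    | add x y hx hy => simp only [tmul_add, map_add, hx, hy]
    | tmul n f =>
      simp only [assoc_symm_tmul, map_tmul, LinearMap.comp_apply, LinearMap.id_apply,
        LinearEquiv.coe_coe]
      generalize N.ract n = x
      induction x with
      | zero => simp
      | add x y hx hy => simp only [tmul_add, add_tmul, map_add, hx, hy]
      | tmul n f => simp
  ract_counit := by
    refine TensorProduct.ext' fun p n => ?_
    have h := LinearMap.congr_fun N.ract_counit n
    simp only [LinearMap.comp_apply, map_tmul, LinearMap.id_apply, LinearEquiv.coe_coe] at h ⊢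
    conv_rhs => rw [← h]
    generalize N.ract n = x
    induction x with
    | zero => simp
    | add x y hx hy => simp only [tmul_add, map_add, hx, hy]
    | tmul c p => simp
  lact_ract := by
    refine TensorProduct.ext' fun p n => ?_
    simp only [LinearMap.comp_apply, map_tmul, LinearMap.id_apply, LinearEquiv.coe_coe]
    trans TensorProduct.map LinearMap.id (TensorProduct.assoc k P N F).symm.toLinearMap
      (TensorProduct.assoc k C P (N ⊗[k] F) (P.lact p ⊗ₜ N.ract n))
    · generalize N.ract n = x
      induction x with
      | zero => simp
      | add x y hx hy => simp only [tmul_add, map_add, hx, hy]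
      | tmul n f =>
        simp only [assoc_symm_tmul, map_tmul, LinearMap.comp_apply, LinearMap.id_apply,
          LinearEquiv.coe_coe]
        generalize P.lact p = x
        induction x with
        | zero => simp
        | add x y hx hy => simp only [add_tmul, map_add, hx, hy]
        | tmul c p => simp
    · generalize P.lact p = x
      induction x with
      | zero => simp
      | add x y hx hy => simp only [add_tmul, map_add, hx, hy]
      | tmul c p => simp

end Bicomod

namespace Bicomod

variable {C D E F : DGCoalg.{v, u} k}

section Ker

variable {M N : Bicomod C D} (f : M ⟶ N)

/-- A linear retraction onto the kernel. -/
noncomputable def kerRetr : M →ₗ[k] LinearMap.ker f.lin :=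
  (LinearMap.exists_leftInverse_of_injective (LinearMap.ker f.lin).subtype
    (Submodule.ker_subtype _)).choose

lemma kerRetr_comp : kerRetr f ∘ₗ (LinearMap.ker f.lin).subtype = LinearMap.id :=
  (LinearMap.exists_leftInverse_of_injective (LinearMap.ker f.lin).subtype
    (Submodule.ker_subtype _)).choose_spec

/-- The left coaction of the kernel, the restriction of the one of `M`. -/
noncomputable def kerLact : LinearMap.ker f.lin →ₗ[k] C ⊗[k] LinearMap.ker f.lin :=
  TensorProduct.map LinearMap.id (kerRetr f) ∘ₗ M.lact ∘ₗ (LinearMap.ker f.lin).subtype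

/-- The right coaction of the kernel, the restriction of the one of `M`. -/
noncomputable def kerRact : LinearMap.ker f.lin →ₗ[k] LinearMap.ker f.lin ⊗[k] D :=
  TensorProduct.map (kerRetr f) LinearMap.id ∘ₗ M.ract ∘ₗ (LinearMap.ker f.lin).subtype

lemma kerLact_comp : TensorProduct.map LinearMap.id (LinearMap.ker f.lin).subtype ∘ₗ kerLact f =
    M.lact ∘ₗ (LinearMap.ker f.lin).subtype := by
  refine LinearMap.ext fun x => ?_
  have h : TensorProduct.map LinearMap.id f.lin (M.lact x) = 0 := by
    have := LinearMap.congr_fun f.left x.1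
    simp only [LinearMap.comp_apply, LinearMap.mem_ker.mp x.2, map_zero] at this
    exact this.symm
  obtain ⟨z, hz⟩ := (Module.Flat.lTensor_exact C
    (LinearMap.exact_subtype_ker_map f.lin) (M.lact x)).mp h
  have hz' : TensorProduct.map LinearMap.id (LinearMap.ker f.lin).subtype z = M.lact x := hz
  simp only [kerLact, LinearMap.comp_apply, Submodule.subtype_apply]
  rw [← hz']
  simp only [← LinearMap.comp_apply, ← TensorProduct.map_comp, kerRetr_comp, LinearMap.comp_id]

lemma kerRact_comp : TensorProduct.map (LinearMap.ker f.lin).subtype LinearMap.id ∘ₗ kerRact f =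
    M.ract ∘ₗ (LinearMap.ker f.lin).subtype := by
  refine LinearMap.ext fun x => ?_
  have h : TensorProduct.map f.lin LinearMap.id (M.ract x) = 0 := by
    have := LinearMap.congr_fun f.right x.1
    simp only [LinearMap.comp_apply, LinearMap.mem_ker.mp x.2, map_zero] at this
    exact this.symm
  obtain ⟨z, hz⟩ := (Module.Flat.rTensor_exact D
    (LinearMap.exact_subtype_ker_map f.lin) (M.ract x)).mp h
  have hz' : TensorProduct.map (LinearMap.ker f.lin).subtype LinearMap.id z = M.ract x := hz
  simp only [kerRact, LinearMap.comp_apply, Submodule.subtype_apply]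
  rw [← hz']
  simp only [← LinearMap.comp_apply, ← TensorProduct.map_comp, kerRetr_comp, LinearMap.comp_id]

lemma comp_cancel {A B X : Type u} [AddCommGroup A] [Module k A] [AddCommGroup B] [Module k B]
    [AddCommGroup X] [Module k X] {J : A →ₗ[k] B} {r : B →ₗ[k] A} (h : r ∘ₗ J = LinearMap.id)
    {f g : X →ₗ[k] A} (e : J ∘ₗ f = J ∘ₗ g) : f = g := by
  rw [← LinearMap.id_comp f, ← LinearMap.id_comp g, ← h, LinearMap.comp_assoc, e,
    LinearMap.comp_assoc]

/-- A bicomodule structure may be checked after a split monomorphism `i : X → M`. -/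
abbrev ofMono (X : DGVect.{v, u} k) (M : Bicomod C D) (i : X →ₗ[k] M)
    (hi : DGVect.IsMor (V := X) (W := M.toDGVect) i) (r : M →ₗ[k] X)
    (hr : r ∘ₗ i = LinearMap.id) (lact : X →ₗ[k] C ⊗[k] X) (ract : X →ₗ[k] X ⊗[k] D)
    (hlact : TensorProduct.map LinearMap.id i ∘ₗ lact = M.lact ∘ₗ i)
    (hract : TensorProduct.map i LinearMap.id ∘ₗ ract = M.ract ∘ₗ i) : Bicomod C D where
  toDGVect := X
  lact := lact
  ract := ract
  isMor_lact := by
    have hJ := DGVect.IsMor.map (V := C.toDGVect) (V' := C.toDGVect) (W := X) (W' := M.toDGVect)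
      .id hi
    have hc : TensorProduct.map LinearMap.id r ∘ₗ TensorProduct.map LinearMap.id i =
        (LinearMap.id : C ⊗[k] X →ₗ[k] _) := by
      rw [← TensorProduct.map_comp, hr, LinearMap.id_comp, TensorProduct.map_id]
    refine ⟨fun n x hx => hJ.mem_of_injective
      (Function.LeftInverse.injective (LinearMap.congr_fun hc)) ?_, comp_cancel hc ?_⟩
    · have h := LinearMap.congr_fun hlact x
      rw [LinearMap.comp_apply, LinearMap.comp_apply] at h
      rw [h]
      exact M.isMor_lact.deg n _ (hi.deg n x hx)
    · have h1 := hJ.comm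
      rw [← LinearMap.comp_assoc, hlact, LinearMap.comp_assoc, hi.comm, ← LinearMap.comp_assoc,
        M.isMor_lact.comm, LinearMap.comp_assoc, ← hlact, ← LinearMap.comp_assoc, ← h1,
        LinearMap.comp_assoc]
  isMor_ract := by
    have hJ := DGVect.IsMor.map (V := X) (V' := M.toDGVect) (W := D.toDGVect) (W' := D.toDGVect)
      hi .id
    have hc : TensorProduct.map r LinearMap.id ∘ₗ TensorProduct.map i LinearMap.id =
        (LinearMap.id : X ⊗[k] D →ₗ[k] _) := by
      rw [← TensorProduct.map_comp, hr, LinearMap.id_comp, TensorProduct.map_id]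
    refine ⟨fun n x hx => hJ.mem_of_injective
      (Function.LeftInverse.injective (LinearMap.congr_fun hc)) ?_, comp_cancel hc ?_⟩
    · have h := LinearMap.congr_fun hract x
      rw [LinearMap.comp_apply, LinearMap.comp_apply] at h
      rw [h]
      exact M.isMor_ract.deg n _ (hi.deg n x hx)
    · have h1 := hJ.comm
      rw [← LinearMap.comp_assoc, hract, LinearMap.comp_assoc, hi.comm, ← LinearMap.comp_assoc,
        M.isMor_ract.comm, LinearMap.comp_assoc, ← hract, ← LinearMap.comp_assoc, ← h1,
        LinearMap.comp_assoc]
  lact_coassoc := by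
    refine comp_cancel (J := TensorProduct.map LinearMap.id (TensorProduct.map LinearMap.id i))
      (r := TensorProduct.map LinearMap.id (TensorProduct.map LinearMap.id r))
      (by simp only [← TensorProduct.map_comp, hr, LinearMap.id_comp, TensorProduct.map_id]) ?_
    have h : TensorProduct.map (TensorProduct.map LinearMap.id LinearMap.id) i ∘ₗ
        TensorProduct.map C.Δ LinearMap.id =
        TensorProduct.map C.Δ LinearMap.id ∘ₗ TensorProduct.map LinearMap.id i := by
      simp [← TensorProduct.map_comp]
    rw [← LinearMap.comp_assoc, ← assoc_nat, LinearMap.comp_assoc, ← LinearMap.comp_assoc lact, h,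
      LinearMap.comp_assoc, hlact, ← LinearMap.comp_assoc i, ← LinearMap.comp_assoc i,
      M.lact_coassoc, LinearMap.comp_assoc, ← hlact, ← LinearMap.comp_assoc,
      ← TensorProduct.map_comp, ← hlact, ← LinearMap.comp_assoc lact, ← TensorProduct.map_comp]
  lact_counit := by
    refine comp_cancel hr ?_
    have h : i ∘ₗ (TensorProduct.lid k X).toLinearMap =
        (TensorProduct.lid k M).toLinearMap ∘ₗ TensorProduct.map LinearMap.id i := by ext; simp
    have h' : TensorProduct.map LinearMap.id i ∘ₗ TensorProduct.map C.ε LinearMap.id =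
        TensorProduct.map C.ε LinearMap.id ∘ₗ TensorProduct.map LinearMap.id i := by
      simp [← TensorProduct.map_comp]
    rw [← LinearMap.comp_assoc, h, LinearMap.comp_assoc, ← LinearMap.comp_assoc lact, h',
      LinearMap.comp_assoc, hlact, ← LinearMap.comp_assoc i, ← LinearMap.comp_assoc i,
      M.lact_counit, LinearMap.id_comp, LinearMap.comp_id]
  ract_coassoc := by
    refine comp_cancel (J := TensorProduct.map i (TensorProduct.map LinearMap.id LinearMap.id))
      (r := TensorProduct.map r (TensorProduct.map LinearMap.id LinearMap.id))
      (by simp only [← TensorProduct.map_comp, hr, LinearMap.id_comp, TensorProduct.map_id]) ?_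
    have h : TensorProduct.map (TensorProduct.map i LinearMap.id) LinearMap.id ∘ₗ
        TensorProduct.map ract LinearMap.id =
        TensorProduct.map M.ract (LinearMap.id : D →ₗ[k] D) ∘ₗ
          TensorProduct.map i LinearMap.id := by
      simp only [← TensorProduct.map_comp, hract, LinearMap.id_comp]
    have h' : TensorProduct.map i (TensorProduct.map LinearMap.id LinearMap.id) ∘ₗ
        TensorProduct.map LinearMap.id D.Δ =
        TensorProduct.map LinearMap.id D.Δ ∘ₗ TensorProduct.map i LinearMap.id := by
      simp [← TensorProduct.map_comp]
    rw [← LinearMap.comp_assoc, ← assoc_nat, LinearMap.comp_assoc, ← LinearMap.comp_assoc ract, h,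
      LinearMap.comp_assoc, hract, ← LinearMap.comp_assoc i, ← LinearMap.comp_assoc i,
      M.ract_coassoc, LinearMap.comp_assoc, ← hract, ← LinearMap.comp_assoc, ← h',
      LinearMap.comp_assoc]
  ract_counit := by
    refine comp_cancel hr ?_
    have h : i ∘ₗ (TensorProduct.rid k X).toLinearMap =
        (TensorProduct.rid k M).toLinearMap ∘ₗ TensorProduct.map i LinearMap.id := by ext; simp
    have h' : TensorProduct.map i LinearMap.id ∘ₗ TensorProduct.map LinearMap.id D.ε =
        TensorProduct.map LinearMap.id D.ε ∘ₗ TensorProduct.map i LinearMap.id := by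
      simp [← TensorProduct.map_comp]
    rw [← LinearMap.comp_assoc, h, LinearMap.comp_assoc, ← LinearMap.comp_assoc ract, h',
      LinearMap.comp_assoc, hract, ← LinearMap.comp_assoc i, ← LinearMap.comp_assoc i,
      M.ract_counit, LinearMap.id_comp, LinearMap.comp_id]
  lact_ract := by
    refine comp_cancel (J := TensorProduct.map LinearMap.id (TensorProduct.map i LinearMap.id))
      (r := TensorProduct.map LinearMap.id (TensorProduct.map r LinearMap.id))
      (by simp only [← TensorProduct.map_comp, hr, LinearMap.id_comp, TensorProduct.map_id]) ?_
    have h : TensorProduct.map (TensorProduct.map LinearMap.id i) LinearMap.id ∘ₗ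
        TensorProduct.map lact LinearMap.id =
        TensorProduct.map M.lact (LinearMap.id : D →ₗ[k] D) ∘ₗ
          TensorProduct.map i LinearMap.id := by
      simp only [← TensorProduct.map_comp, hlact, LinearMap.id_comp]
    rw [← LinearMap.comp_assoc, ← assoc_nat, LinearMap.comp_assoc, ← LinearMap.comp_assoc ract, h,
      LinearMap.comp_assoc, hract, ← LinearMap.comp_assoc i, ← LinearMap.comp_assoc i,
      M.lact_ract, LinearMap.comp_assoc, ← hlact]
    simp only [← LinearMap.comp_assoc, ← TensorProduct.map_comp, hract, LinearMap.id_comp]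

/-- The kernel of a morphism of differential graded bicomodules. -/
noncomputable abbrev ker : Bicomod C D :=
  ofMono (DGVect.ker (V := M.toDGVect) (W := N.toDGVect) f.lin f.isMor) M
    (LinearMap.ker f.lin).subtype ⟨fun _ _ hx => hx, rfl⟩ (kerRetr f) (kerRetr_comp f)
    (kerLact f) (kerRact f) (kerLact_comp f) (kerRact_comp f)

end Ker

/-- The coaction of `D`, as a morphism of bicomodules from `N` to the cofree bicomodule `D ⊗ N`. -/
noncomputable abbrev coact (N : Bicomod D E) : N ⟶ outer (regular D) N where
  lin := N.lact
  isMor := N.isMor_lact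
  left := by rw [LinearMap.comp_assoc]; exact N.lact_coassoc
  right := by
    rw [LinearMap.comp_assoc, LinearEquiv.toLinearMap_symm_comp_eq]
    exact N.lact_ract.symm

/-- Functoriality of the tensor product in the second variable. -/
noncomputable abbrev outerMap (P : Bicomod C D) {N N' : Bicomod E F} (f : N ⟶ N') :
    outer P N ⟶ outer P N' where
  lin := TensorProduct.map LinearMap.id f.lin
  isMor := .map (V := P.toDGVect) (V' := P.toDGVect) (W := N.toDGVect) (W' := N'.toDGVect)
    .id f.isMor
  left := by
    refine TensorProduct.ext' fun p n => ?_
    simp only [LinearMap.comp_apply, map_tmul, LinearMap.id_apply, LinearEquiv.coe_coe]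
    generalize P.lact p = x
    induction x with
    | zero => simp
    | add x y hx hy => simp only [add_tmul, map_add, hx, hy]
    | tmul c p => simp
  right := by
    refine TensorProduct.ext' fun p n => ?_
    have h := LinearMap.congr_fun f.right n
    simp only [LinearMap.comp_apply, map_tmul, LinearMap.id_apply, LinearEquiv.coe_coe] at h ⊢
    rw [h]
    generalize N.ract n = x
    induction x with
    | zero => simp
    | add x y hx hy => simp only [tmul_add, map_add, hx, hy]
    | tmul c p => simp

/-- The map `p ⊗ n ↦ ρ(p) ⊗ n` given by the right coaction of `D` on `P`. -/
noncomputable abbrev coactRight (P : Bicomod C D) (N : Bicomod D E) :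
    outer P N ⟶ outer P (outer (regular D) N) where
  lin := (TensorProduct.assoc k P D N).toLinearMap ∘ₗ TensorProduct.map P.ract LinearMap.id
  isMor := DGVect.IsMor.comp (V := P.toDGVect.tensor N.toDGVect)
    (W := (P.toDGVect.tensor D.toDGVect).tensor N.toDGVect)
    (U := P.toDGVect.tensor (D.toDGVect.tensor N.toDGVect))
    (DGVect.isMor_assoc P.toDGVect D.toDGVect N.toDGVect)
    (DGVect.IsMor.map (V := P.toDGVect) (V' := P.toDGVect.tensor D.toDGVect) (W := N.toDGVect)
      (W' := N.toDGVect) P.isMor_ract .id)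
  left := by
    refine TensorProduct.ext' fun p n => ?_
    have h := LinearMap.congr_fun P.lact_ract p
    simp only [LinearMap.comp_apply, map_tmul, LinearMap.id_apply, LinearEquiv.coe_coe] at h ⊢
    trans (TensorProduct.map LinearMap.id (TensorProduct.assoc k P D N).toLinearMap)
      (TensorProduct.assoc k C (P ⊗[k] D) N
        ((TensorProduct.map LinearMap.id P.ract (P.lact p)) ⊗ₜ n))
    · rw [← h]
      generalize P.ract p = x
      induction x with
      | zero => simp
      | add x y hx hy => simp only [add_tmul, map_add, hx, hy]
      | tmul p d =>
        simp only [assoc_tmul, map_tmul, LinearMap.id_apply]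
        generalize P.lact p = x
        induction x with
        | zero => simp
        | add x y hx hy => simp only [add_tmul, map_add, hx, hy]
        | tmul c p => simp
    · generalize P.lact p = x
      induction x with
      | zero => simp
      | add x y hx hy => simp only [add_tmul, map_add, hx, hy]
      | tmul c p => simp
  right := by
    refine TensorProduct.ext' fun p n => ?_
    simp only [LinearMap.comp_apply, map_tmul, LinearMap.id_apply, LinearEquiv.coe_coe]
    trans (TensorProduct.assoc k P (D ⊗[k] N) E).symm (TensorProduct.map LinearMap.id
      (TensorProduct.assoc k D N E).symm.toLinearMap
      (TensorProduct.assoc k P D (N ⊗[k] E) (P.ract p ⊗ₜ N.ract n)))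
    · generalize P.ract p = x
      induction x with
      | zero => simp
      | add x y hx hy => simp only [add_tmul, map_add, hx, hy]
      | tmul c p => simp
    · generalize N.ract n = x
      induction x with
      | zero => simp
      | add x y hx hy => simp only [tmul_add, map_add, hx, hy]
      | tmul n e =>
        simp only [assoc_symm_tmul, map_tmul, LinearMap.comp_apply, LinearMap.id_apply,
          LinearEquiv.coe_coe]
        generalize P.ract p = x
        induction x with
        | zero => simp
        | add x y hx hy => simp only [add_tmul, map_add, hx, hy]
        | tmul p d => simp

/-- The cotensor product `P □_D N`, the kernel of the difference of the two maps
`P ⊗ N → P ⊗ D ⊗ N` given by the coactions of `D`. -/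
noncomputable abbrev cotensor (P : Bicomod C D) (N : Bicomod D E) : Bicomod C E :=
  ker (coactRight P N - outerMap P (coact N))

section Resolution

variable (M : Bicomod C D)

/-- The bicomodule `C^(⊗ r) ⊗ M`. -/
noncomputable def bar : ℕ → Bicomod C D
  | 0 => M
  | r + 1 => outer (regular C) (bar r)

/-- The map `b' : C^(⊗ r) ⊗ M → C^(⊗ (r+1)) ⊗ M`, the alternating sum
`∑ i ≤ r, (-1)^i Δ_i` of the maps that apply the comultiplication to the `i`-th factor, or the
coaction to the factor `M`. It is computed from
`b'(c ⊗ t) = Δ(c) ⊗ t - c ⊗ b'(t)`. -/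
noncomputable def barD : ∀ r, bar M r ⟶ bar M (r + 1)
  | 0 => coact M
  | r + 1 => coact (outer (regular C) (bar M r)) -
      outerMap (regular C) (N' := outer (regular C) (bar M r)) (barD r)

lemma coact_naturality {N N' : Bicomod C D} (f : N ⟶ N') :
    f ≫ coact N' = coact N ≫ outerMap (regular C) f := hom_ext f.left

lemma outerMap_comp {P : Bicomod C D} {N N' N'' : Bicomod E F} (f : N ⟶ N') (g : N' ⟶ N'') :
    outerMap P (f ≫ g) = outerMap P f ≫ outerMap P g := hom_ext (by
  simp [← TensorProduct.map_comp])

lemma outerMap_sub {P : Bicomod C D} {N N' : Bicomod E F} (f g : N ⟶ N') :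
    outerMap P (f - g) = outerMap P f - outerMap P g := hom_ext (by
  simp only [sub_lin]; exact TensorProduct.ext' fun x y => by simp [tmul_sub])

lemma outerMap_zero {P : Bicomod C D} {N N' : Bicomod E F} :
    outerMap P (0 : N ⟶ N') = 0 := hom_ext (by simp)

lemma barD_comp (r : ℕ) : barD M r ≫ barD M (r + 1) = 0 := by
  induction r with
  | zero =>
    change coact M ≫ (coact (outer (regular C) M) - outerMap (regular C) (coact M)) = 0
    rw [Preadditive.comp_sub, coact_naturality, sub_self]
  | succ r ih =>
    have h : barD M (r + 1) ≫ barD M (r + 2) = coact (bar M (r + 1)) ≫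
        outerMap (regular C) (barD M (r + 1)) -
        barD M (r + 1) ≫ outerMap (regular C) (barD M (r + 1)) := by
      rw [← coact_naturality]
      exact Preadditive.comp_sub _ _ _
    have h' : barD M (r + 1) ≫ outerMap (regular C) (barD M (r + 1)) =
        coact (outer (regular C) (bar M r)) ≫ outerMap (regular C) (barD M (r + 1)) -
        outerMap (regular C) (barD M r) ≫ outerMap (regular C) (barD M (r + 1)) :=
      Preadditive.sub_comp _ _ _
    rw [h, h', ← outerMap_comp, ih, outerMap_zero, sub_zero]
    exact sub_self _

end Resolution

end Bicomod

namespace DGVect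

lemma sg_neg (V : DGVect.{v, u} k) (a : ℤ) : V.sg (-a) = V.sg a := hom_ext fun n x hx => by
  rw [sg_of_mem _ hx, sg_of_mem _ hx, neg_mul, sgn_neg]

lemma isDeg_tot {V W : DGVect.{v, u} k} {f : V →ₗ[k] W} (hf : IsMor f) (r : ℕ) :
    IsDeg (V := V.shift (-(r : ℤ))) (W := W.shift (-((r + 1 : ℕ) : ℤ))) 1 f := fun _ x hx =>
  mem_cast (V := W) (hf.deg _ x hx) (by push_cast; ring)

lemma anticomm_tot {V W : DGVect.{v, u} k} {f : V →ₗ[k] W} (hf : IsMor f) (r : ℕ) :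
    (W.shift (-((r + 1 : ℕ) : ℤ))).d ∘ₗ f + f ∘ₗ (V.shift (-(r : ℤ))).d = 0 := by
  change (sgn k _ • W.d) ∘ₗ f + f ∘ₗ (sgn k _ • V.d) = 0
  rw [LinearMap.smul_comp, LinearMap.comp_smul, hf.comm, ← add_smul]
  simp [sgn_add]

/-- The total complex of a complex `V 0 → V 1 → ⋯` of differential graded vector spaces: an
element of degree `p` of `V r` has total degree `p + r`, and the differential is
`(-1)^r d + δ` on `V r`. -/
noncomputable abbrev tot (V : ℕ → DGVect.{v, u} k) (δ : ∀ r, V r →ₗ[k] V (r + 1))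
    (hδ : ∀ r, IsMor (δ r)) (h : ∀ r, δ (r + 1) ∘ₗ δ r = 0) : DGVect.{v, u} k :=
  seqSum (fun r => (V r).shift (-(r : ℤ))) δ (fun r => isDeg_tot (hδ r) r)
    (fun r => anticomm_tot (hδ r) r) h

end DGVect

namespace Bicomod

variable {C D E F : DGCoalg.{v, u} k}

/-- The total complex of a complex `M 0 → M 1 → ⋯` of differential graded bicomodules: an
element of degree `p` of `M r` has total degree `p + r`, and the differential is
`(-1)^r d + δ` on `M r`. -/
noncomputable abbrev tot (M : ℕ → Bicomod C D) (δ : ∀ r, M r ⟶ M (r + 1))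
    (h : ∀ r, δ r ≫ δ (r + 1) = 0) : Bicomod C D :=
  seqSum (fun r => (M r).shift (-(r : ℤ))) (fun r => (δ r).lin)
    (fun r => {
      deg := DGVect.isDeg_tot (δ r).isMor r
      left := by
        change (TensorProduct.map (C.sg _) LinearMap.id ∘ₗ (M (r + 1)).lact) ∘ₗ (δ r).lin =
          TensorProduct.map (C.sg 1) (δ r).lin ∘ₗ
            TensorProduct.map (C.sg (-(r : ℤ))) LinearMap.id ∘ₗ (M r).lact
        rw [LinearMap.comp_assoc, (δ r).left]
        simp only [← LinearMap.comp_assoc, ← TensorProduct.map_comp, LinearMap.id_comp,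
          LinearMap.comp_id, DGVect.sg_neg, ← DGVect.sg_add]
        rw [add_comm (1 : ℤ)]; rfl
      right := (δ r).right })
    (fun r => DGVect.anticomm_tot (δ r).isMor r)
    (fun r => congrArg Hom.lin (h r))

/-- The standard resolution `C(M) = ⨁ r ≥ 1, C^(⊗ r) ⊗ M` of a bicomodule with respect to its
left coaction; the total degree of `c_1 ⊗ ⋯ ⊗ c_r ⊗ m` is `∑ |c_i| + |m| + r - 1`. -/
noncomputable def res (M : Bicomod C D) : Bicomod C D :=
  tot (fun r => bar M (r + 1)) (fun r => barD M (r + 1)) (fun r => barD_comp M (r + 1))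

/-- The derived cotensor product `P □_D^R N = P □_D D(N)`, computed with the standard resolution
of `N`. -/
noncomputable def dcotensor (P : Bicomod C D) (N : Bicomod D E) : Bicomod C E :=
  cotensor P (res N)

section Env

/-- The right coaction of `C^e = C ⊗ C^op` on a `C`-bicomodule,
`x ↦ ± x₀ ⊗ (x₁ ⊗ x₋₁)`. -/
noncomputable def renv (X : Bicomod C C) : X →ₗ[k] X ⊗[k] (C ⊗[k] C) :=
  (TensorProduct.assoc k X C C).toLinearMap ∘ₗ
    DGVect.swap C.toDGVect (X.toDGVect.tensor C.toDGVect) ∘ₗ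
    TensorProduct.map LinearMap.id X.ract ∘ₗ X.lact

/-- The left coaction of `C^e = C ⊗ C^op` on a `C`-bicomodule,
`m ↦ ± (m₋₁ ⊗ m₁) ⊗ m₀`. -/
noncomputable def lenv (M : Bicomod C C) : M →ₗ[k] (C ⊗[k] C) ⊗[k] M :=
  (TensorProduct.assoc k C C M).symm.toLinearMap ∘ₗ
    TensorProduct.map LinearMap.id (DGVect.swap M.toDGVect C.toDGVect) ∘ₗ
    TensorProduct.map LinearMap.id M.ract ∘ₗ M.lact

lemma isMor_renv (X : Bicomod C C) : DGVect.IsMor (V := X.toDGVect)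
    (W := X.toDGVect.tensor (C.toDGVect.tensor C.toDGVect)) (renv X) :=
  DGVect.IsMor.comp (V := X.toDGVect)
    (W := (X.toDGVect.tensor C.toDGVect).tensor C.toDGVect)
    (U := X.toDGVect.tensor (C.toDGVect.tensor C.toDGVect))
    (DGVect.isMor_assoc X.toDGVect C.toDGVect C.toDGVect)
    (DGVect.IsMor.comp (V := X.toDGVect)
      (W := C.toDGVect.tensor (X.toDGVect.tensor C.toDGVect))
      (U := (X.toDGVect.tensor C.toDGVect).tensor C.toDGVect)
      (DGVect.isMor_swap _ _)
      (DGVect.IsMor.comp (V := X.toDGVect) (W := C.toDGVect.tensor X.toDGVect)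
        (U := C.toDGVect.tensor (X.toDGVect.tensor C.toDGVect))
        (DGVect.IsMor.map (V := C.toDGVect) (V' := C.toDGVect) (W := X.toDGVect)
          (W' := X.toDGVect.tensor C.toDGVect) .id X.isMor_ract) X.isMor_lact))

lemma isMor_lenv (M : Bicomod C C) : DGVect.IsMor (V := M.toDGVect)
    (W := (C.toDGVect.tensor C.toDGVect).tensor M.toDGVect) (lenv M) :=
  DGVect.IsMor.comp (V := M.toDGVect)
    (W := C.toDGVect.tensor (C.toDGVect.tensor M.toDGVect))
    (U := (C.toDGVect.tensor C.toDGVect).tensor M.toDGVect)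
    (DGVect.isMor_assoc_symm C.toDGVect C.toDGVect M.toDGVect)
    (DGVect.IsMor.comp (V := M.toDGVect)
      (W := C.toDGVect.tensor (M.toDGVect.tensor C.toDGVect))
      (U := C.toDGVect.tensor (C.toDGVect.tensor M.toDGVect))
      (DGVect.IsMor.map (V := C.toDGVect) (V' := C.toDGVect)
        (W := M.toDGVect.tensor C.toDGVect) (W' := C.toDGVect.tensor M.toDGVect) .id
        (DGVect.isMor_swap _ _))
      (DGVect.IsMor.comp (V := M.toDGVect) (W := C.toDGVect.tensor M.toDGVect)
        (U := C.toDGVect.tensor (M.toDGVect.tensor C.toDGVect))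
        (DGVect.IsMor.map (V := C.toDGVect) (V' := C.toDGVect) (W := M.toDGVect)
          (W' := M.toDGVect.tensor C.toDGVect) .id M.isMor_ract) M.isMor_lact))

/-- The cotensor product `X □_(C^e) M` of two `C`-bicomodules, the kernel of the difference of the
two maps `X ⊗ M → X ⊗ C^e ⊗ M` given by the coactions of `C^e`. -/
noncomputable def cotensorEnv (X M : Bicomod C C) : DGVect.{v, u} k :=
  DGVect.ker (V := X.toDGVect.tensor M.toDGVect)
    (W := X.toDGVect.tensor ((C.toDGVect.tensor C.toDGVect).tensor M.toDGVect))
    ((TensorProduct.assoc k X (C ⊗[k] C) M).toLinearMap ∘ₗ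
      TensorProduct.map (renv X) LinearMap.id - TensorProduct.map LinearMap.id (lenv M))
    (DGVect.IsMor.sub
      (DGVect.IsMor.comp (V := X.toDGVect.tensor M.toDGVect)
        (W := (X.toDGVect.tensor (C.toDGVect.tensor C.toDGVect)).tensor M.toDGVect)
        (U := X.toDGVect.tensor ((C.toDGVect.tensor C.toDGVect).tensor M.toDGVect))
        (DGVect.isMor_assoc X.toDGVect (C.toDGVect.tensor C.toDGVect) M.toDGVect)
        (DGVect.IsMor.map (V := X.toDGVect)
          (V' := X.toDGVect.tensor (C.toDGVect.tensor C.toDGVect)) (W := M.toDGVect)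
          (W' := M.toDGVect) (isMor_renv X) .id))
      (DGVect.IsMor.map (V := X.toDGVect) (V' := X.toDGVect) (W := M.toDGVect)
        (W' := (C.toDGVect.tensor C.toDGVect).tensor M.toDGVect) .id (isMor_lenv M)))

/-- `Hoch^n(M, C) = H^n(C(C) □_(C^e) M)`. -/
abbrev Hoch (M : Bicomod C C) (n : ℤ) : Type u := (cotensorEnv (res (regular C)) M).H n

end Env

section HochComplex

variable (C)

/-- The isomorphism `C^(⊗ (n+1)) ⊗ C → C^(⊗ (n+2))`. -/
noncomputable def append : ∀ n, bar (regular C) n ⊗[k] C →ₗ[k] C ⊗[k] bar (regular C) n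
  | 0 => LinearMap.id
  | n + 1 => TensorProduct.map LinearMap.id (append n) ∘ₗ
      (TensorProduct.assoc k C (bar (regular C) n) C).toLinearMap

/-- The last coface `Δ_(n+1) : C^(⊗ (n+1)) → C^(⊗ (n+2))`, which sends `c_0 ⊗ ⋯ ⊗ c_n` to
`± c_0'' ⊗ c_1 ⊗ ⋯ ⊗ c_n ⊗ c_0'`, with the Koszul sign. -/
noncomputable def lastCoface (n : ℕ) : bar (regular C) n →ₗ[k] bar (regular C) (n + 1) :=
  append C n ∘ₗ DGVect.swap C.toDGVect (bar (regular C) n).toDGVect ∘ₗ (bar (regular C) n).lact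

/-- The Hochschild differential `b = b' + (-1)^(n+1) Δ_(n+1)` on `C^(⊗ (n+1))`. -/
noncomputable def hochD (n : ℕ) : bar (regular C) n →ₗ[k] bar (regular C) (n + 1) :=
  (barD (regular C) n).lin + sgn k (n + 1) • lastCoface C n

lemma isMor_append (n : ℕ) :
    DGVect.IsMor (V := (bar (regular C) n).toDGVect.tensor C.toDGVect)
      (W := (bar (regular C) (n + 1)).toDGVect) (append C n) := by
  induction n with
  | zero => exact DGVect.IsMor.id (V := C.toDGVect.tensor C.toDGVect)
  | succ n ih =>
    exact DGVect.IsMor.comp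
      (V := (C.toDGVect.tensor (bar (regular C) n).toDGVect).tensor C.toDGVect)
      (W := C.toDGVect.tensor ((bar (regular C) n).toDGVect.tensor C.toDGVect))
      (U := C.toDGVect.tensor (bar (regular C) (n + 1)).toDGVect)
      (DGVect.IsMor.map (V := C.toDGVect) (V' := C.toDGVect)
        (W := (bar (regular C) n).toDGVect.tensor C.toDGVect)
        (W' := (bar (regular C) (n + 1)).toDGVect) .id ih)
      (DGVect.isMor_assoc C.toDGVect (bar (regular C) n).toDGVect C.toDGVect)

lemma isMor_lastCoface (n : ℕ) : DGVect.IsMor (V := (bar (regular C) n).toDGVect)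
    (W := (bar (regular C) (n + 1)).toDGVect) (lastCoface C n) :=
  DGVect.IsMor.comp (V := (bar (regular C) n).toDGVect)
    (W := (bar (regular C) n).toDGVect.tensor C.toDGVect)
    (U := (bar (regular C) (n + 1)).toDGVect) (isMor_append C n)
    (DGVect.IsMor.comp (V := (bar (regular C) n).toDGVect)
      (W := C.toDGVect.tensor (bar (regular C) n).toDGVect)
      (U := (bar (regular C) n).toDGVect.tensor C.toDGVect)
      (DGVect.isMor_swap _ _) (bar (regular C) n).isMor_lact)

lemma isMor_hochD (n : ℕ) : DGVect.IsMor (V := (bar (regular C) n).toDGVect)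
    (W := (bar (regular C) (n + 1)).toDGVect) (hochD C n) :=
  (barD (regular C) n).isMor.add ((isMor_lastCoface C n).smul _)

section Aux

variable {C}
variable {T T' : Type u} [AddCommGroup T] [Module k T] [AddCommGroup T'] [Module k T']

/-- One step in the recursion for `append`. -/
noncomputable def appendStep (A : T ⊗[k] C →ₗ[k] T') : (C ⊗[k] T) ⊗[k] C →ₗ[k] C ⊗[k] T' :=
  TensorProduct.map LinearMap.id A ∘ₗ (TensorProduct.assoc k C T C).toLinearMap

/-- One step in the recursion for `b'`. -/
noncomputable def barStep (β : T →ₗ[k] C ⊗[k] T) : C ⊗[k] T →ₗ[k] C ⊗[k] (C ⊗[k] T) :=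
  (TensorProduct.assoc k C C T).toLinearMap ∘ₗ TensorProduct.map C.Δ LinearMap.id -
    TensorProduct.map LinearMap.id β

/-- The map `t ⊗ c ↦ t ⊗ Δ(c)`. -/
noncomputable def splitLast (A : T ⊗[k] C →ₗ[k] C ⊗[k] T) :
    T ⊗[k] C →ₗ[k] C ⊗[k] (C ⊗[k] T) :=
  appendStep A ∘ₗ TensorProduct.map A LinearMap.id ∘ₗ
    (TensorProduct.assoc k T C C).symm.toLinearMap ∘ₗ TensorProduct.map LinearMap.id C.Δ

lemma splitLast_step (A : T ⊗[k] C →ₗ[k] C ⊗[k] T) :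
    splitLast (appendStep A) = TensorProduct.map LinearMap.id (splitLast A) ∘ₗ
      (TensorProduct.assoc k C T C).toLinearMap := by
  refine TensorProduct.ext_threefold fun c t c' => ?_
  simp only [splitLast, LinearMap.comp_apply, map_tmul, LinearMap.id_apply, LinearEquiv.coe_coe,
    assoc_tmul]
  generalize C.Δ c' = x
  induction x with
  | zero => simp only [tmul_zero, map_zero]
  | add x y hx hy => simp only [tmul_add, map_add, hx, hy]
  | tmul a b => simp [appendStep]

lemma barStep_append {s : k} {A : T ⊗[k] C →ₗ[k] C ⊗[k] T} {β : T →ₗ[k] C ⊗[k] T}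
    (h : barStep β ∘ₗ A = appendStep A ∘ₗ TensorProduct.map β LinearMap.id + s • splitLast A) :
    barStep (barStep β) ∘ₗ appendStep A =
      appendStep (appendStep A) ∘ₗ TensorProduct.map (barStep β) LinearMap.id +
        (-s) • splitLast (appendStep A) := by
  rw [splitLast_step]
  refine TensorProduct.ext_threefold fun c t c' => ?_
  have h1 := LinearMap.congr_fun h (t ⊗ₜ c')
  have h2 : barStep (barStep β) (c ⊗ₜ A (t ⊗ₜ c')) =
      TensorProduct.assoc k C C (C ⊗[k] T) (C.Δ c ⊗ₜ A (t ⊗ₜ c')) -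
        c ⊗ₜ barStep β (A (t ⊗ₜ c')) := rfl
  have h3 : barStep β (c ⊗ₜ t) = TensorProduct.assoc k C C T (C.Δ c ⊗ₜ t) - c ⊗ₜ β t := rfl
  have h4 : appendStep (appendStep A) ((TensorProduct.assoc k C C T (C.Δ c ⊗ₜ t)) ⊗ₜ c') =
      TensorProduct.assoc k C C (C ⊗[k] T) (C.Δ c ⊗ₜ A (t ⊗ₜ c')) := by
    generalize C.Δ c = x
    induction x with
    | zero => simp only [zero_tmul, map_zero]
    | add x y hx hy => simp only [add_tmul, map_add, hx, hy]
    | tmul a b => simp [appendStep]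
  have h5 : appendStep (appendStep A) ((c ⊗ₜ β t) ⊗ₜ c') = c ⊗ₜ appendStep A (β t ⊗ₜ c') := rfl
  simp only [LinearMap.comp_apply, LinearMap.add_apply, LinearMap.smul_apply, map_tmul,
    LinearMap.id_apply, LinearEquiv.coe_coe, assoc_tmul] at h1 ⊢
  rw [show appendStep A ((c ⊗ₜ t) ⊗ₜ c') = c ⊗ₜ A (t ⊗ₜ c') from rfl, h2, h1, h3, sub_tmul,
    map_sub, h4, h5, tmul_add, tmul_smul, neg_smul]
  abel

lemma barStep_append_zero : barStep C.Δ ∘ₗ (LinearMap.id : C ⊗[k] C →ₗ[k] C ⊗[k] C) =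
    appendStep LinearMap.id ∘ₗ TensorProduct.map C.Δ LinearMap.id +
      (-1 : k) • splitLast LinearMap.id := by
  refine TensorProduct.ext' fun c c' => ?_
  have h : splitLast LinearMap.id (c ⊗ₜ[k] c') = c ⊗ₜ C.Δ c' := by
    simp only [splitLast, LinearMap.comp_apply, map_tmul, LinearMap.id_apply, LinearEquiv.coe_coe]
    generalize C.Δ c' = x
    induction x with
    | zero => simp only [tmul_zero, map_zero]
    | add x y hx hy => simp only [tmul_add, map_add, hx, hy]
    | tmul a b => simp [appendStep]
  simp only [LinearMap.comp_apply, LinearMap.add_apply, LinearMap.smul_apply, map_tmul,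
    LinearMap.id_apply, h, barStep, LinearMap.neg_apply, LinearEquiv.coe_coe, neg_smul, one_smul,
    appendStep, TensorProduct.map_id, sub_eq_add_neg]

/-- Moving the first two factors of a tensor product to its end one after the other. -/
lemma swap_swap (V T : DGVect.{v, u} k) :
    DGVect.swap V (T.tensor V) ∘ₗ (TensorProduct.assoc k V T V).toLinearMap ∘ₗ
      DGVect.swap V (V.tensor T) ∘ₗ (TensorProduct.assoc k V V T).toLinearMap =
    (TensorProduct.assoc k T V V).symm.toLinearMap ∘ₗ DGVect.swap (V.tensor V) T :=
  DGVect.tensor_hom_ext₃ fun l m n v hv w hw t ht => by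
    have h1 := DGVect.swap_tmul (V := V) (W := V.tensor T) hv
      (DGVect.tmul_mem (V := V) (W := T) hw ht rfl)
    have h2 := DGVect.swap_tmul (V := V) (W := T.tensor V) hw
      (DGVect.tmul_mem (V := T) (W := V) ht hv rfl)
    have h3 := DGVect.swap_tmul (V := V.tensor V) (W := T)
      (DGVect.tmul_mem (V := V) (W := V) hv hw rfl) ht
    simp only [LinearMap.comp_apply, LinearEquiv.coe_coe, assoc_tmul, h1, h3, map_smul, h2,
      smul_smul, assoc_symm_tmul]
    congr 1
    rw [← sgn_add, show l * (m + n) + m * (n + l) = (l + m) * n + (l * m + l * m) by ring,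
      sgn_add _ (l * m + l * m), sgn_add (l * m), sgn_mul_self, mul_one]

lemma smul_aux {X : Type u} [AddCommGroup X] [Module k X] (s : k) (x y : X) :
    0 + (-s) • x + (s • x + (1 : k) • y + (-1 : k) • y) = 0 := by
  simp [neg_smul]

lemma hoch_comp_aux {T : DGVect.{v, u} k} {lam β : T →ₗ[k] C ⊗[k] T} {A : T ⊗[k] C →ₗ[k] C ⊗[k] T}
    (hlam : DGVect.IsMor (V := T) (W := C.toDGVect.tensor T) lam)
    (hβ : DGVect.IsMor (V := T) (W := C.toDGVect.tensor T) β)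
    (hA : DGVect.IsMor (V := T.tensor C.toDGVect) (W := C.toDGVect.tensor T) A)
    (hco : (TensorProduct.assoc k C C T).toLinearMap ∘ₗ
      TensorProduct.map C.Δ LinearMap.id ∘ₗ lam = TensorProduct.map LinearMap.id lam ∘ₗ lam)
    (hββ : barStep β ∘ₗ β = 0)
    (hβl : ((TensorProduct.assoc k C C T).toLinearMap ∘ₗ TensorProduct.map C.Δ LinearMap.id) ∘ₗ β =
      TensorProduct.map LinearMap.id β ∘ₗ lam)
    (hAl : ((TensorProduct.assoc k C C T).toLinearMap ∘ₗ TensorProduct.map C.Δ LinearMap.id) ∘ₗ A =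
      TensorProduct.map LinearMap.id A ∘ₗ (TensorProduct.assoc k C T C).toLinearMap ∘ₗ
        TensorProduct.map lam LinearMap.id)
    (s : k) (hs : s * s = 1)
    (h : barStep β ∘ₗ A = appendStep A ∘ₗ TensorProduct.map β LinearMap.id + s • splitLast A) :
    (barStep β + (-s) • (appendStep A ∘ₗ DGVect.swap C.toDGVect (C.toDGVect.tensor T) ∘ₗ
        ((TensorProduct.assoc k C C T).toLinearMap ∘ₗ TensorProduct.map C.Δ LinearMap.id))) ∘ₗ
      (β + s • (A ∘ₗ DGVect.swap C.toDGVect T ∘ₗ lam)) = 0 := by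
  have e1 : barStep β ∘ₗ (A ∘ₗ DGVect.swap C.toDGVect T ∘ₗ lam) =
      appendStep A ∘ₗ TensorProduct.map β LinearMap.id ∘ₗ DGVect.swap C.toDGVect T ∘ₗ lam +
        s • (splitLast A ∘ₗ DGVect.swap C.toDGVect T ∘ₗ lam) := by
    rw [← LinearMap.comp_assoc, h, LinearMap.add_comp, LinearMap.smul_comp, LinearMap.comp_assoc]
  have e2 : (appendStep A ∘ₗ DGVect.swap C.toDGVect (C.toDGVect.tensor T) ∘ₗ
      ((TensorProduct.assoc k C C T).toLinearMap ∘ₗ TensorProduct.map C.Δ LinearMap.id)) ∘ₗ β =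
      appendStep A ∘ₗ TensorProduct.map β LinearMap.id ∘ₗ DGVect.swap C.toDGVect T ∘ₗ lam := by
    rw [LinearMap.comp_assoc, LinearMap.comp_assoc, hβl]
    have := DGVect.swap_naturality (DGVect.IsMor.id (V := C.toDGVect)) hβ
    rw [← LinearMap.comp_assoc lam, this]
    rfl
  have e3 : (appendStep A ∘ₗ DGVect.swap C.toDGVect (C.toDGVect.tensor T) ∘ₗ
      ((TensorProduct.assoc k C C T).toLinearMap ∘ₗ TensorProduct.map C.Δ LinearMap.id)) ∘ₗ
      (A ∘ₗ DGVect.swap C.toDGVect T ∘ₗ lam) = splitLast A ∘ₗ DGVect.swap C.toDGVect T ∘ₗ lam := by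
    have n1 := DGVect.swap_naturality (DGVect.IsMor.id (V := C.toDGVect)) hA
    have n2 := DGVect.swap_naturality (DGVect.IsMor.id (V := C.toDGVect)) hlam
    have n3 := DGVect.swap_naturality C.isMor_comul (DGVect.IsMor.id (V := T))
    have n4 := swap_swap C.toDGVect T
    calc _ = appendStep A ∘ₗ DGVect.swap C.toDGVect (C.toDGVect.tensor T) ∘ₗ
          (((TensorProduct.assoc k C C T).toLinearMap ∘ₗ
            TensorProduct.map C.Δ LinearMap.id) ∘ₗ A) ∘ₗ DGVect.swap C.toDGVect T ∘ₗ lam := rfl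
      _ = appendStep A ∘ₗ (DGVect.swap C.toDGVect (C.toDGVect.tensor T) ∘ₗ
          TensorProduct.map LinearMap.id A) ∘ₗ (TensorProduct.assoc k C T C).toLinearMap ∘ₗ
          (TensorProduct.map lam LinearMap.id ∘ₗ DGVect.swap C.toDGVect T) ∘ₗ lam := by
            rw [hAl]; rfl
      _ = (appendStep A ∘ₗ TensorProduct.map A LinearMap.id) ∘ₗ
          (DGVect.swap C.toDGVect (T.tensor C.toDGVect) ∘ₗ
          (TensorProduct.assoc k C T C).toLinearMap ∘ₗ
          DGVect.swap C.toDGVect (C.toDGVect.tensor T)) ∘ₗ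
          (TensorProduct.map LinearMap.id lam ∘ₗ lam) := by rw [n1, ← n2]; rfl
      _ = (appendStep A ∘ₗ TensorProduct.map A LinearMap.id) ∘ₗ
          (DGVect.swap C.toDGVect (T.tensor C.toDGVect) ∘ₗ
          (TensorProduct.assoc k C T C).toLinearMap ∘ₗ
          DGVect.swap C.toDGVect (C.toDGVect.tensor T) ∘ₗ
          (TensorProduct.assoc k C C T).toLinearMap) ∘ₗ
          TensorProduct.map C.Δ LinearMap.id ∘ₗ lam := by rw [← hco]; rfl
      _ = (appendStep A ∘ₗ TensorProduct.map A LinearMap.id) ∘ₗ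
          (TensorProduct.assoc k T C C).symm.toLinearMap ∘ₗ
          (DGVect.swap (C.toDGVect.tensor C.toDGVect) T ∘ₗ
          TensorProduct.map C.Δ LinearMap.id) ∘ₗ lam := by rw [n4]; rfl
      _ = _ := by rw [n3]; rfl
  rw [LinearMap.comp_add, LinearMap.add_comp, LinearMap.add_comp, LinearMap.comp_smul,
    LinearMap.smul_comp, LinearMap.smul_comp, LinearMap.comp_smul, hββ, e1, e2, e3, smul_add,
    smul_smul, smul_smul, neg_mul, hs]
  exact smul_aux s _ _

end Aux

lemma barD_succ (n : ℕ) : (barD (regular C) (n + 1)).lin =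
    barStep (T := bar (regular C) n) (barD (regular C) n).lin := sub_lin _ _

lemma append_succ (n : ℕ) :
    append C (n + 1) = appendStep (T' := bar (regular C) (n + 1)) (append C n) := rfl

lemma barD_append (n : ℕ) :
    barStep (T := bar (regular C) n) (barD (regular C) n).lin ∘ₗ append C n =
      appendStep (T := bar (regular C) n) (T' := C ⊗[k] bar (regular C) n) (append C n) ∘ₗ
        TensorProduct.map (barD (regular C) n).lin LinearMap.id +
        sgn k (n + 1) • splitLast (T := bar (regular C) n) (append C n) := by
  induction n with
  | zero =>
    have := barStep_append_zero (C := C)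
    simp only [Nat.cast_zero, zero_add, sgn_one]
    exact this
  | succ n ih =>
    have := barStep_append (T := bar (regular C) n) ih
    have e : sgn k (((n + 1 : ℕ) : ℤ) + 1) = - sgn k (n + 1) := by
      rw [sgn_add]; push_cast; simp
    rw [e, barD_succ]
    exact this

lemma lact_append (n : ℕ) :
    ((TensorProduct.assoc k C C (bar (regular C) n)).toLinearMap ∘ₗ
        TensorProduct.map C.Δ LinearMap.id) ∘ₗ append C n =
      TensorProduct.map LinearMap.id (append C n) ∘ₗ
        (TensorProduct.assoc k C (bar (regular C) n) C).toLinearMap ∘ₗ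
        TensorProduct.map (bar (regular C) n).lact LinearMap.id := by
  cases n with
  | zero => exact (TensorProduct.ext' fun c c' => by
      change TensorProduct.assoc k C C C (C.Δ c ⊗ₜ c') = TensorProduct.map LinearMap.id
        LinearMap.id (TensorProduct.assoc k C C C (C.Δ c ⊗ₜ c'))
      rw [TensorProduct.map_id, LinearMap.id_apply])
  | succ n =>
    refine TensorProduct.ext_threefold (M := C) (N := bar (regular C) n) (P := C) fun c t c' => ?_
    change TensorProduct.assoc k C C (C ⊗[k] bar (regular C) n)
        (C.Δ c ⊗ₜ[k] (append C n (t ⊗ₜ[k] c') : C ⊗[k] bar (regular C) n)) =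
      TensorProduct.map LinearMap.id (appendStep (T' := C ⊗[k] bar (regular C) n) (append C n))
        (TensorProduct.assoc k C (C ⊗[k] bar (regular C) n) C
          (TensorProduct.assoc k C C (bar (regular C) n) (C.Δ c ⊗ₜ t) ⊗ₜ c'))
    generalize C.Δ c = x
    induction x with
    | zero => simp only [zero_tmul, map_zero]
    | add x y hx hy => simp only [add_tmul, map_add, hx, hy]
    | tmul a b => simp [appendStep]

lemma hochD_comp (n : ℕ) : hochD C (n + 1) ∘ₗ hochD C n = 0 := by
  have h0 : barStep (T := bar (regular C) n) (barD (regular C) n).lin ∘ₗ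
      (barD (regular C) n).lin = 0 := by
    rw [← barD_succ]; exact congrArg Hom.lin (barD_comp (regular C) n)
  have := hoch_comp_aux (T := (bar (regular C) n).toDGVect) (bar (regular C) n).isMor_lact
    (barD (regular C) n).isMor (isMor_append C n) (bar (regular C) n).lact_coassoc h0
    (barD (regular C) n).left (lact_append C n) (sgn k (n + 1)) (sgn_mul_self _) (barD_append C n)
  have e : sgn k (((n + 1 : ℕ) : ℤ) + 1) = - sgn k (n + 1) := by
    rw [sgn_add]; push_cast; simp
  rw [hochD, barD_succ, e]
  exact this

/-- The Hochschild complex of `C`: the total complex of `C → C ⊗ C → C ⊗ C ⊗ C → ⋯` with the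
differentials `b`, where `c_0 ⊗ ⋯ ⊗ c_n` has total degree `∑ |c_i| + n`. -/
noncomputable def hochComplex : DGVect.{v, u} k :=
  DGVect.tot (fun n => (bar (regular C) n).toDGVect) (hochD C) (isMor_hochD C) (hochD_comp C)

/-- `Hoch^n(C)`, the cohomology of the Hochschild complex of `C`. -/
abbrev HochC (n : ℤ) : Type u := (hochComplex C).H n

end HochComplex

end Bicomod

namespace Bicomod

variable {C D : DGCoalg.{v, u} k}

/-- A morphism of differential graded bicomodules is a quasi-isomorphism if it induces
isomorphisms in cohomology. -/
def QIso {M N : Bicomod C D} (f : M ⟶ N) : Prop :=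
  ∀ n, Function.Bijective (DGVect.Hmap (V := M.toDGVect) (W := N.toDGVect) f.isMor n)

/-- Two morphisms are homotopic if their difference is `h d + d h` for a graded bicolinear map
`h` of degree `-1`. -/
def Homotopic : HomRel (Bicomod C D) := fun M N f g =>
  ∃ h : M →ₗ[k] N, IsColin (-1) h ∧ f.lin - g.lin = h ∘ₗ M.d + N.d ∘ₗ h

section Colin

variable {M N L : Bicomod C D}

lemma isColin_zero (a : ℤ) : IsColin a (0 : M →ₗ[k] N) :=
  ⟨fun _ _ _ => zero_mem _, by simp, by simp⟩

lemma IsColin.add {a : ℤ} {f g : M →ₗ[k] N} (hf : IsColin a f) (hg : IsColin a g) :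
    IsColin a (f + g) :=
  ⟨fun n x hx => add_mem (hf.deg n x hx) (hg.deg n x hx), by
    rw [LinearMap.comp_add, hf.left, hg.left, TensorProduct.map_add_right, LinearMap.add_comp], by
    rw [LinearMap.comp_add, hf.right, hg.right, TensorProduct.map_add_left, LinearMap.add_comp]⟩

lemma IsColin.smul {a : ℤ} {f : M →ₗ[k] N} (hf : IsColin a f) (c : k) : IsColin a (c • f) :=
  ⟨fun n x hx => Submodule.smul_mem _ _ (hf.deg n x hx), by
    rw [LinearMap.comp_smul, hf.left, TensorProduct.map_smul_right, LinearMap.smul_comp], by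
    rw [LinearMap.comp_smul, hf.right, TensorProduct.map_smul_left, LinearMap.smul_comp]⟩

lemma Hom.isColin (f : M ⟶ N) : IsColin 0 f.lin :=
  ⟨f.isMor.isDeg, by rw [f.left, DGVect.sg_zero], f.right⟩

lemma IsColin.comp {a b c : ℤ} {f : M →ₗ[k] N} {g : N →ₗ[k] L} (hg : IsColin b g)
    (hf : IsColin a f) (h : a + b = c) : IsColin c (g ∘ₗ f) :=
  ⟨fun n x hx => DGVect.mem_cast (V := L.toDGVect) (hg.deg _ _ (hf.deg n x hx)) (by omega), by
    rw [← LinearMap.comp_assoc, hg.left, LinearMap.comp_assoc, hf.left, ← LinearMap.comp_assoc,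
      ← TensorProduct.map_comp, ← DGVect.sg_add, add_comm b, h], by
    rw [← LinearMap.comp_assoc, hg.right, LinearMap.comp_assoc, hf.right, ← LinearMap.comp_assoc,
      ← TensorProduct.map_comp, LinearMap.id_comp]⟩

end Colin

lemma Homotopic.add {M N : Bicomod C D} {f₁ f₂ g₁ g₂ : M ⟶ N} (hf : Homotopic f₁ f₂)
    (hg : Homotopic g₁ g₂) : Homotopic (f₁ + g₁) (f₂ + g₂) := by
  obtain ⟨h, hh, e⟩ := hf
  obtain ⟨h', hh', e'⟩ := hg
  refine ⟨h + h', hh.add hh', ?_⟩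
  rw [add_lin, add_lin, LinearMap.add_comp, LinearMap.comp_add, add_sub_add_comm, e, e']
  abel

lemma Homotopic.smul {M N : Bicomod C D} {f g : M ⟶ N} (hf : Homotopic f g) (c : k) :
    Homotopic (c • f) (c • g) := by
  obtain ⟨h, hh, e⟩ := hf
  refine ⟨c • h, hh.smul c, ?_⟩
  rw [smul_lin, smul_lin, LinearMap.smul_comp, LinearMap.comp_smul, ← smul_sub, e, smul_add]

instance : Congruence (Homotopic (C := C) (D := D)) where
  equivalence {M N} := {
    refl := fun f => ⟨0, isColin_zero _, by simp⟩
    symm := by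
      rintro f g ⟨h, hh, e⟩
      refine ⟨(-1 : k) • h, hh.smul _, ?_⟩
      rw [LinearMap.smul_comp, LinearMap.comp_smul, ← smul_add, ← e]
      simp
    trans := by
      rintro f g l ⟨h, hh, e⟩ ⟨h', hh', e'⟩
      refine ⟨h + h', hh.add hh', ?_⟩
      rw [LinearMap.add_comp, LinearMap.comp_add, ← sub_add_sub_cancel f.lin g.lin, e, e']
      abel }
  comp_left := by
    rintro X Y Z f g g' ⟨h, hh, e⟩
    refine ⟨h ∘ₗ f.lin, hh.comp f.isColin (by omega), ?_⟩
    have := f.isMor.comm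
    rw [comp_lin, comp_lin, ← LinearMap.sub_comp, e, LinearMap.add_comp, LinearMap.comp_assoc,
      ← this]
    rfl
  comp_right := by
    rintro X Y Z f f' g ⟨h, hh, e⟩
    refine ⟨g.lin ∘ₗ h, g.isColin.comp hh (by omega), ?_⟩
    have := g.isMor.comm
    rw [comp_lin, comp_lin, ← LinearMap.comp_sub, e, LinearMap.comp_add, ← LinearMap.comp_assoc,
      ← LinearMap.comp_assoc, this]
    rfl

section Shift

/-- The shift functor. -/
noncomputable abbrev shiftF (a : ℤ) : Bicomod C D ⥤ Bicomod C D where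
  obj M := M.shift a
  map {M N} f :=
    { lin := f.lin
      isMor := ⟨fun n x hx => f.isMor.deg _ x hx, by
        rw [LinearMap.comp_smul, LinearMap.smul_comp, f.isMor.comm]⟩
      left := by
        rw [LinearMap.comp_assoc, f.left]
        simp only [← LinearMap.comp_assoc, ← TensorProduct.map_comp, LinearMap.id_comp,
          LinearMap.comp_id]
      right := f.right }

lemma shift_add_lact (M : Bicomod C D) (a b : ℤ) :
    ((M.shift a).shift b).lact = (M.shift (a + b)).lact := by
  change TensorProduct.map (C.sg b) LinearMap.id ∘ₗ TensorProduct.map (C.sg a) LinearMap.id ∘ₗ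
    M.lact = TensorProduct.map (C.sg (a + b)) LinearMap.id ∘ₗ M.lact
  rw [← LinearMap.comp_assoc, ← TensorProduct.map_comp, ← DGVect.sg_add, LinearMap.id_comp,
    add_comm b]

lemma shift_add_d (M : Bicomod C D) (a b : ℤ) :
    ((M.shift a).shift b).d = (M.shift (a + b)).d := by
  change sgn k b • sgn k a • M.d = sgn k (a + b) • M.d
  rw [smul_smul, sgn_add, mul_comm]

lemma shift_zero_lact (M : Bicomod C D) : (M.shift 0).lact = M.lact := by
  change TensorProduct.map (C.sg 0) LinearMap.id ∘ₗ M.lact = M.lact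
  rw [DGVect.sg_zero, TensorProduct.map_id, LinearMap.id_comp]

lemma shift_zero_d (M : Bicomod C D) : (M.shift 0).d = M.d := by
  change sgn k 0 • M.d = M.d
  rw [sgn_zero, one_smul]

lemma shift_add_isMor (M : Bicomod C D) (a b : ℤ) :
    DGVect.IsMor (V := (M.shift (a + b)).toDGVect) (W := ((M.shift a).shift b).toDGVect)
      (LinearMap.id : M →ₗ[k] M) where
  deg n x hx := by
    change x ∈ M.gr (n + b + a)
    rw [add_assoc, add_comm b]
    exact hx
  comm := by
    rw [shift_add_d]
    rfl

lemma shift_add_isMor' (M : Bicomod C D) (a b : ℤ) :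
    DGVect.IsMor (V := ((M.shift a).shift b).toDGVect) (W := (M.shift (a + b)).toDGVect)
      (LinearMap.id : M →ₗ[k] M) where
  deg n x hx := by
    change x ∈ M.gr (n + b + a) at hx
    rw [add_assoc, add_comm b] at hx
    exact hx
  comm := by
    rw [shift_add_d]
    rfl

lemma shift_add_left (M : Bicomod C D) (a b : ℤ) :
    ((M.shift a).shift b).lact ∘ₗ (LinearMap.id : M →ₗ[k] M) =
      TensorProduct.map LinearMap.id (LinearMap.id : M →ₗ[k] M) ∘ₗ (M.shift (a + b)).lact := by
  rw [shift_add_lact, TensorProduct.map_id]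
  rfl

lemma shift_add_left' (M : Bicomod C D) (a b : ℤ) :
    (M.shift (a + b)).lact ∘ₗ (LinearMap.id : M →ₗ[k] M) =
      TensorProduct.map LinearMap.id (LinearMap.id : M →ₗ[k] M) ∘ₗ
        ((M.shift a).shift b).lact := by
  rw [shift_add_lact, TensorProduct.map_id]
  rfl

lemma comp_id_eq (M : Bicomod C D) : M.ract ∘ₗ (LinearMap.id : M →ₗ[k] M) =
      TensorProduct.map (LinearMap.id : M →ₗ[k] M) LinearMap.id ∘ₗ M.ract := by
  rw [TensorProduct.map_id]
  rfl

/-- The identification `M[a + b] ≅ M[a][b]`. -/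
noncomputable abbrev shiftAddIso (M : Bicomod C D) (a b : ℤ) :
    M.shift (a + b) ≅ (M.shift a).shift b where
  hom := ⟨(LinearMap.id : M →ₗ[k] M), shift_add_isMor M a b, shift_add_left M a b, comp_id_eq M⟩
  inv := ⟨(LinearMap.id : M →ₗ[k] M), shift_add_isMor' M a b, shift_add_left' M a b, comp_id_eq M⟩
  hom_inv_id := rfl
  inv_hom_id := rfl

/-- The identification `M[0] ≅ M`. -/
noncomputable abbrev shiftZeroIso (M : Bicomod C D) : M.shift 0 ≅ M where
  hom :=
    { lin := (LinearMap.id : M →ₗ[k] M)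
      isMor := ⟨fun n x hx => DGVect.mem_cast (V := M.toDGVect) hx (by omega),
        shift_zero_d M⟩
      left := (shift_zero_lact M).symm.trans (by rw [TensorProduct.map_id]; rfl)
      right := by rw [TensorProduct.map_id]; rfl }
  inv :=
    { lin := (LinearMap.id : M →ₗ[k] M)
      isMor := ⟨fun n x hx => DGVect.mem_cast (V := M.toDGVect) hx (by omega),
        (shift_zero_d M).symm⟩
      left := (shift_zero_lact M).trans (by rw [TensorProduct.map_id]; rfl)
      right := by rw [TensorProduct.map_id]; rfl }
  hom_inv_id := rfl
  inv_hom_id := rfl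

lemma eqToHom_shift_lin (M : Bicomod C D) {a b : ℤ} (h : a = b) (e : M.shift a = M.shift b) :
    (eqToHom e).lin = (LinearMap.id : M →ₗ[k] M) := by
  subst h; rfl

noncomputable instance : HasShift (Bicomod C D) ℤ := hasShiftMk _ _
  { F := shiftF
    zero := NatIso.ofComponents shiftZeroIso (fun _ => rfl)
    add := fun a b => NatIso.ofComponents (fun M => shiftAddIso M a b) (fun _ => rfl)
    assoc_hom_app := fun a b c M => hom_ext (by
      rw [comp_lin, comp_lin, eqToHom_shift_lin M (add_assoc a b c)]
      rfl)
    zero_add_hom_app := fun a M => hom_ext (by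
      rw [comp_lin, eqToHom_shift_lin M (zero_add a)]
      rfl)
    add_zero_hom_app := fun a M => hom_ext (by
      rw [comp_lin, eqToHom_shift_lin M (add_zero a)]
      rfl) }

lemma shift_map_eq {M N : Bicomod C D} (f : M ⟶ N) (a : ℤ) :
    f⟦a⟧' = (shiftF a).map f := rfl

instance : (Homotopic (C := C) (D := D)).IsCompatibleWithShift ℤ where
  condition := by
    rintro a M N f g ⟨h, hh, e⟩
    refine ⟨sgn k a • h, ⟨fun n x hx => Submodule.smul_mem _ _
      (DGVect.mem_cast (V := N.toDGVect) (hh.deg _ x hx) (by omega)), ?_, ?_⟩, ?_⟩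
    · change (TensorProduct.map (C.sg a) LinearMap.id ∘ₗ N.lact) ∘ₗ (sgn k a • h) =
        TensorProduct.map (C.sg (-1)) (sgn k a • h) ∘ₗ TensorProduct.map (C.sg a) LinearMap.id ∘ₗ
          M.lact
      rw [LinearMap.comp_assoc, LinearMap.comp_smul, hh.left, TensorProduct.map_smul_right,
        LinearMap.comp_smul, LinearMap.smul_comp, ← LinearMap.comp_assoc, ← LinearMap.comp_assoc,
        ← TensorProduct.map_comp, ← TensorProduct.map_comp, ← DGVect.sg_add, ← DGVect.sg_add,
        add_comm a]
      rfl
    · change N.ract ∘ₗ (sgn k a • h) = TensorProduct.map (sgn k a • h) LinearMap.id ∘ₗ M.ract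
      rw [LinearMap.comp_smul, hh.right, TensorProduct.map_smul_left, LinearMap.smul_comp]
    · change f.lin - g.lin = (sgn k a • h) ∘ₗ (sgn k a • M.d) + (sgn k a • N.d) ∘ₗ (sgn k a • h)
      simp only [LinearMap.smul_comp, LinearMap.comp_smul, smul_smul, sgn_mul_self, one_smul]
      exact e

end Shift

/-- The homotopy category of differential graded bicomodules. -/
abbrev Ho (C D : DGCoalg.{v, u} k) := Quotient (Homotopic (C := C) (D := D))

instance : Preadditive (Ho C D) := Quotient.preadditive _ fun _ _ _ _ _ _ hf hg => hf.add hg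

instance : (Quotient.functor (Homotopic (C := C) (D := D))).Additive :=
  Quotient.functor_additive _ _

instance : Linear k (Ho C D) := Quotient.linear k _ fun c _ _ _ _ hf => hf.smul c

section Acyclic

lemma qIso_iff {M N : Bicomod C D} (f : M ⟶ N) : QIso f ↔
    (∀ n, ∀ x ∈ M.gr n, M.d x = 0 → (∃ y ∈ N.gr (n - 1), N.d y = f.lin x) →
      ∃ z ∈ M.gr (n - 1), M.d z = x) ∧
    (∀ n, ∀ y ∈ N.gr n, N.d y = 0 → ∃ x ∈ M.gr n, M.d x = 0 ∧
      ∃ z ∈ N.gr (n - 1), N.d z = y - f.lin x) := by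
  rw [← forall_and]
  refine forall_congr' fun n => and_congr ?_ ?_
  · rw [← LinearMap.ker_eq_bot, LinearMap.ker_eq_bot']
    constructor
    · intro h x hx hdx ⟨y, hy, e⟩
      have := h (Submodule.Quotient.mk ⟨x, hx, hdx⟩)
        ((Submodule.Quotient.mk_eq_zero _).2 ⟨y, hy, e⟩)
      exact (Submodule.Quotient.mk_eq_zero _).1 this
    · intro h x hx
      induction x using Submodule.Quotient.induction_on with
      | _ x =>
      obtain ⟨x, hx1, hx2⟩ := x
      exact (Submodule.Quotient.mk_eq_zero _).2
        (h x hx1 hx2 ((Submodule.Quotient.mk_eq_zero _).1 hx))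
  · constructor
    · intro h y hy hdy
      obtain ⟨x, hx⟩ := h (Submodule.Quotient.mk ⟨y, hy, hdy⟩)
      induction x using Submodule.Quotient.induction_on with
      | _ x =>
      obtain ⟨x, hx1, hx2⟩ := x
      exact ⟨x, hx1, hx2, ((Submodule.Quotient.eq _).1 hx.symm)⟩
    · intro h y
      induction y using Submodule.Quotient.induction_on with
      | _ y =>
      obtain ⟨y, hy1, hy2⟩ := y
      obtain ⟨x, hx, hdx, hz⟩ := h y hy1 hy2
      exact ⟨Submodule.Quotient.mk ⟨x, hx, hdx⟩, ((Submodule.Quotient.eq _).2 hz).symm⟩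

lemma QIso.of_homotopic {M N : Bicomod C D} {f g : M ⟶ N} (h : Homotopic f g) (hg : QIso g) :
    QIso f := by
  rw [qIso_iff] at hg ⊢
  obtain ⟨h, hh, e⟩ := h
  have e' : ∀ x, M.d x = 0 → f.lin x = g.lin x + N.d (h x) := fun x hx => by
    have := LinearMap.congr_fun e x
    simp only [LinearMap.sub_apply, LinearMap.add_apply, LinearMap.comp_apply, hx, map_zero,
      zero_add] at this
    rw [← this]; abel
  refine ⟨fun n x hx hdx ⟨y, hy, ey⟩ => hg.1 n x hx hdx ⟨y - h x, sub_mem hy (hh.deg n x hx), ?_⟩,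
    fun n y hy hdy => ?_⟩
  · rw [map_sub, ey, e' x hdx]; abel
  · obtain ⟨x, hx, hdx, z, hz, ez⟩ := hg.2 n y hy hdy
    refine ⟨x, hx, hdx, z - h x, sub_mem hz (hh.deg n x hx), ?_⟩
    rw [map_sub, ez, e' x hdx]; abel

end Acyclic

end Bicomod

namespace Bicomod

variable {C D : DGCoalg.{v, u} k}

section Ext

variable {M N : Bicomod C D} (θ : M →ₗ[k] N) (hθ : IsColin 1 θ) (hd : N.d ∘ₗ θ + θ ∘ₗ M.d = 0)

lemma ext_d_apply (x : N × M) : (ext θ hθ hd).d x = (N.d x.1 + θ x.2, M.d x.2) := rfl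

/-- The inclusion of `N` in an extension. -/
noncomputable def extInl : N ⟶ ext θ hθ hd where
  lin := LinearMap.inl k N M
  isMor := ⟨fun n x hx => ⟨hx, zero_mem _⟩, LinearMap.ext fun x => by
    rw [LinearMap.comp_apply, LinearMap.comp_apply, ext_d_apply]
    simp⟩
  left := LinearMap.coprod_inl _ _
  right := LinearMap.coprod_inl _ _

lemma isColin_inr : IsColin (M := M) (N := ext θ hθ hd) 0 (LinearMap.inr k N M) where
  deg n x hx := ⟨zero_mem _, DGVect.mem_cast (V := M.toDGVect) hx (add_zero n).symm⟩
  left := by rw [DGVect.sg_zero]; exact LinearMap.coprod_inr _ _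
  right := LinearMap.coprod_inr _ _

lemma isColin_fst : IsColin (M := ext θ hθ hd) (N := N) 0 (LinearMap.fst k N M) where
  deg n x hx := DGVect.mem_cast (V := N.toDGVect) hx.1 (add_zero n).symm
  left := by
    rw [DGVect.sg_zero]
    change N.lact ∘ₗ LinearMap.fst k N M =
      TensorProduct.map LinearMap.id (LinearMap.fst k N M) ∘ₗ
        LinearMap.coprod (TensorProduct.map LinearMap.id (LinearMap.inl k N M) ∘ₗ N.lact)
          (TensorProduct.map LinearMap.id (LinearMap.inr k N M) ∘ₗ M.lact)
    refine LinearMap.prod_ext ?_ ?_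
    · rw [LinearMap.comp_assoc, LinearMap.comp_assoc, LinearMap.coprod_inl,
        ← LinearMap.comp_assoc N.lact, ← TensorProduct.map_comp, LinearMap.fst_comp_inl]
      simp
    · rw [LinearMap.comp_assoc, LinearMap.comp_assoc, LinearMap.coprod_inr,
        ← LinearMap.comp_assoc M.lact, ← TensorProduct.map_comp, LinearMap.fst_comp_inr]
      simp
  right := by
    change N.ract ∘ₗ LinearMap.fst k N M =
      TensorProduct.map (LinearMap.fst k N M) LinearMap.id ∘ₗ
        LinearMap.coprod (TensorProduct.map (LinearMap.inl k N M) LinearMap.id ∘ₗ N.ract)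
          (TensorProduct.map (LinearMap.inr k N M) LinearMap.id ∘ₗ M.ract)
    refine LinearMap.prod_ext ?_ ?_
    · rw [LinearMap.comp_assoc, LinearMap.comp_assoc, LinearMap.coprod_inl,
        ← LinearMap.comp_assoc N.ract, ← TensorProduct.map_comp, LinearMap.fst_comp_inl]
      simp
    · rw [LinearMap.comp_assoc, LinearMap.comp_assoc, LinearMap.coprod_inr,
        ← LinearMap.comp_assoc M.ract, ← TensorProduct.map_comp, LinearMap.fst_comp_inr]
      simp

lemma isColin_snd : IsColin (M := ext θ hθ hd) (N := M) 0 (LinearMap.snd k N M) where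
  deg n x hx := DGVect.mem_cast (V := M.toDGVect) hx.2 (add_zero n).symm
  left := by
    rw [DGVect.sg_zero]
    change M.lact ∘ₗ LinearMap.snd k N M =
      TensorProduct.map LinearMap.id (LinearMap.snd k N M) ∘ₗ
        LinearMap.coprod (TensorProduct.map LinearMap.id (LinearMap.inl k N M) ∘ₗ N.lact)
          (TensorProduct.map LinearMap.id (LinearMap.inr k N M) ∘ₗ M.lact)
    refine LinearMap.prod_ext ?_ ?_
    · rw [LinearMap.comp_assoc, LinearMap.comp_assoc, LinearMap.coprod_inl,
        ← LinearMap.comp_assoc N.lact, ← TensorProduct.map_comp, LinearMap.snd_comp_inl]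
      simp
    · rw [LinearMap.comp_assoc, LinearMap.comp_assoc, LinearMap.coprod_inr,
        ← LinearMap.comp_assoc M.lact, ← TensorProduct.map_comp, LinearMap.snd_comp_inr]
      simp
  right := by
    change M.ract ∘ₗ LinearMap.snd k N M =
      TensorProduct.map (LinearMap.snd k N M) LinearMap.id ∘ₗ
        LinearMap.coprod (TensorProduct.map (LinearMap.inl k N M) LinearMap.id ∘ₗ N.ract)
          (TensorProduct.map (LinearMap.inr k N M) LinearMap.id ∘ₗ M.ract)
    refine LinearMap.prod_ext ?_ ?_
    · rw [LinearMap.comp_assoc, LinearMap.comp_assoc, LinearMap.coprod_inl,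
        ← LinearMap.comp_assoc N.ract, ← TensorProduct.map_comp, LinearMap.snd_comp_inl]
      simp
    · rw [LinearMap.comp_assoc, LinearMap.comp_assoc, LinearMap.coprod_inr,
        ← LinearMap.comp_assoc M.ract, ← TensorProduct.map_comp, LinearMap.snd_comp_inr]
      simp

/-- Bicomodules with zero cohomology. -/
def Acyclic (M : Bicomod C D) : Prop :=
  ∀ n, ∀ x ∈ M.gr n, M.d x = 0 → ∃ y ∈ M.gr (n - 1), M.d y = x

lemma anticomm_apply (hd : N.d ∘ₗ θ + θ ∘ₗ M.d = 0) (x : M) : N.d (θ x) = - θ (M.d x) :=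
  eq_neg_of_add_eq_zero_left (LinearMap.congr_fun hd x)

lemma qIso_extInl (h : Acyclic M) : QIso (extInl θ hθ hd) := by
  rw [qIso_iff]
  refine ⟨fun n x hx _ ⟨y, hy, e⟩ => ?_, fun n y hy e => ?_⟩
  · rw [ext_d_apply] at e
    obtain ⟨e1, e2⟩ := Prod.ext_iff.1 e
    obtain ⟨w, hw, ew⟩ := h _ y.2 hy.2 e2
    refine ⟨y.1 - θ w, sub_mem hy.1 (DGVect.mem_cast (V := N.toDGVect) (hθ.deg _ w hw) (by omega)), ?_⟩
    rw [map_sub, anticomm_apply θ hd, ew, sub_neg_eq_add]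
    exact e1
  · rw [ext_d_apply] at e
    obtain ⟨e1, e2⟩ := Prod.ext_iff.1 e
    obtain ⟨w, hw, ew⟩ := h _ y.2 hy.2 e2
    refine ⟨y.1 - θ w, sub_mem hy.1 (DGVect.mem_cast (V := N.toDGVect) (hθ.deg _ w hw) (by omega)),
      ?_, (0, w), ⟨zero_mem _, hw⟩, ?_⟩
    · rw [map_sub, anticomm_apply θ hd, ew, sub_neg_eq_add]
      exact e1
    · rw [ext_d_apply]
      refine Prod.ext ?_ ?_
      · change N.d 0 + θ w = y.1 - (y.1 - θ w)
        rw [map_zero]; abel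
      · change M.d w = y.2 - 0
        rw [ew, sub_zero]

end Ext

section Cone

variable {A B : Bicomod C D}

lemma isColin_toShift (A : Bicomod C D) :
    IsColin (M := A) (N := A.shift 1) (-1) (LinearMap.id : A →ₗ[k] A) where
  deg n x hx := DGVect.mem_cast (V := A.toDGVect) hx (by omega)
  left := by rw [DGVect.sg_neg]; rfl
  right := comp_id_eq A

lemma sg_sg (C : DGCoalg.{v, u} k) (a : ℤ) : C.sg a ∘ₗ C.sg a = LinearMap.id := by
  have h := DGVect.sg_add (V := C.toDGVect) a (-a)
  rw [add_neg_cancel, DGVect.sg_zero, DGVect.sg_neg] at h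
  exact h.symm

lemma isColin_ofShift (A : Bicomod C D) :
    IsColin (M := A.shift 1) (N := A) 1 (LinearMap.id : A →ₗ[k] A) where
  deg n x hx := hx
  left := by
    change A.lact ∘ₗ LinearMap.id = TensorProduct.map (C.sg 1) LinearMap.id ∘ₗ
      TensorProduct.map (C.sg 1) LinearMap.id ∘ₗ A.lact
    rw [← LinearMap.comp_assoc, ← TensorProduct.map_comp, sg_sg, LinearMap.comp_id,
      LinearMap.comp_id, TensorProduct.map_id, LinearMap.id_comp]
  right := comp_id_eq A

lemma isColin_cone (s : A ⟶ B) : IsColin (M := A.shift 1) (N := B) 1 s.lin :=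
  s.isColin.comp (isColin_ofShift A) (add_zero 1)

lemma anticomm_cone (s : A ⟶ B) : B.d ∘ₗ s.lin + s.lin ∘ₗ (A.shift 1).d = 0 := by
  change _ + s.lin ∘ₗ (sgn k 1 • A.d) = 0
  rw [← s.isMor.comm, LinearMap.comp_smul, sgn_one, neg_smul, one_smul, add_neg_cancel]

/-- The mapping cone of a morphism. -/
noncomputable abbrev cone (s : A ⟶ B) : Bicomod C D :=
  ext (M := A.shift 1) (N := B) s.lin (isColin_cone s) (anticomm_cone s)

lemma cone_d_apply (s : A ⟶ B) (x : B × A) :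
    (cone s).d x = (B.d x.1 + s.lin x.2, - A.d x.2) := by
  refine Prod.ext rfl ?_
  change sgn k 1 • A.d x.2 = _
  rw [sgn_one, neg_smul, one_smul]

lemma acyclic_cone {s : A ⟶ B} (hs : QIso s) : Acyclic (cone s) := by
  rw [qIso_iff] at hs
  intro n x hx e
  rw [cone_d_apply] at e
  obtain ⟨e1, e2⟩ := Prod.ext_iff.1 e
  obtain ⟨b, a⟩ := x
  have hb : b ∈ B.gr n := hx.1
  have ha : a ∈ A.gr (n + 1) := hx.2
  have e1 : B.d b + s.lin a = 0 := e1
  have e2 : A.d a = 0 := neg_eq_zero.1 e2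
  obtain ⟨a1, ha1, ea1⟩ := hs.1 (n + 1) a ha e2
    ⟨-b, neg_mem (DGVect.mem_cast (V := B.toDGVect) hb (by omega)), by
      rw [map_neg]; exact (eq_neg_of_add_eq_zero_right e1).symm⟩
  have ha1 : a1 ∈ A.gr n := DGVect.mem_cast (V := A.toDGVect) ha1 (by omega)
  obtain ⟨a2, ha2, ea2, b1, hb1, eb1⟩ := hs.2 n (b + s.lin a1)
    (add_mem hb (s.isMor.deg _ _ ha1)) (by
      rw [map_add, ← s.isMor.comm_apply, ea1]; exact e1)
  refine ⟨(b1, a2 - a1), ⟨hb1, ?_⟩, ?_⟩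
  · exact DGVect.mem_cast (V := A.toDGVect) (sub_mem ha2 ha1) (by omega)
  · rw [cone_d_apply]
    refine Prod.ext ?_ ?_
    · change B.d b1 + s.lin (a2 - a1) = b
      rw [eb1, map_sub]; abel
    · change - A.d (a2 - a1) = a
      rw [map_sub, ea2, ea1]; abel

lemma acyclic_shift (h : Acyclic A) : Acyclic (A.shift 1) := by
  intro n x hx e
  have e : sgn k 1 • A.d x = 0 := e
  rw [sgn_one, neg_smul, one_smul, neg_eq_zero] at e
  obtain ⟨y, hy, ey⟩ := h (n + 1) x hx e
  refine ⟨-y, neg_mem (DGVect.mem_cast (V := A.toDGVect) hy (by omega)), ?_⟩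
  change sgn k 1 • A.d (-y) = x
  rw [sgn_one, neg_smul, one_smul, map_neg, neg_neg, ey]

lemma exists_leftFraction_aux {Y : Bicomod C D} {s : A ⟶ B} (hs : QIso s) (f : A ⟶ Y) :
    ∃ (Z : Bicomod C D) (i : Y ⟶ Z) (j : B ⟶ Z), QIso i ∧ Homotopic (f ≫ i) (s ≫ j) := by
  have hθ : IsColin (M := cone s) (N := Y) 1 (f.lin ∘ₗ LinearMap.snd k B A) :=
    (isColin_cone f).comp (isColin_snd (M := A.shift 1) (N := B) s.lin (isColin_cone s)
      (anticomm_cone s)) (by omega)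
  have hd : Y.d ∘ₗ (f.lin ∘ₗ LinearMap.snd k B A) +
      (f.lin ∘ₗ LinearMap.snd k B A) ∘ₗ (cone s).d = 0 := LinearMap.ext fun x => by
    change Y.d (f.lin x.2) + f.lin ((cone s).d x).2 = 0
    rw [cone_d_apply, ← f.isMor.comm_apply, ← map_add]
    change f.lin (A.d x.2 + - A.d x.2) = 0
    rw [add_neg_cancel, map_zero]
  let Z := ext (M := cone s) (N := Y) (f.lin ∘ₗ LinearMap.snd k B A) hθ hd
  have hj0 : IsColin (M := B) (N := Z) 0 (LinearMap.inr k Y (B × A) ∘ₗ LinearMap.inl k B A) :=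
    (isColin_inr (M := cone s) (N := Y) (f.lin ∘ₗ LinearMap.snd k B A) hθ hd).comp
      (extInl (M := A.shift 1) (N := B) s.lin (isColin_cone s) (anticomm_cone s)).isColin
      (add_zero 0)
  have hh : IsColin (M := A) (N := Z) (-1) (LinearMap.inr k Y (B × A) ∘ₗ LinearMap.inr k B A) :=
    (isColin_inr (M := cone s) (N := Y) (f.lin ∘ₗ LinearMap.snd k B A) hθ hd).comp
      ((isColin_inr (M := A.shift 1) (N := B) s.lin (isColin_cone s) (anticomm_cone s)).comp
        (isColin_toShift A) (add_zero _)) (add_zero _)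
  have hZ : ∀ (y : Y) (b : B) (a : A), Z.d (y, (b, a)) =
      (Y.d y + f.lin a, (B.d b + s.lin a, - A.d a)) := fun y b a => by
    change (_, (cone s).d (b, a)) = _
    rw [cone_d_apply]
    rfl
  let j : B ⟶ Z :=
    { lin := LinearMap.inr k Y (B × A) ∘ₗ LinearMap.inl k B A
      isMor := ⟨fun n x hx => DGVect.mem_cast (V := Z.toDGVect) (hj0.deg n x hx) (add_zero n),
        LinearMap.ext fun b => by
          change ((0 : Y), (B.d b, (0 : A))) = Z.d (0, (b, 0))
          rw [hZ]
          simp⟩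
      left := by have := hj0.left; rwa [DGVect.sg_zero] at this
      right := hj0.right }
  refine ⟨Z, extInl _ hθ hd, -j, qIso_extInl _ hθ hd (acyclic_cone hs), _, hh, ?_⟩
  refine LinearMap.ext fun a => ?_
  rw [comp_lin, comp_lin, neg_lin]
  change (f.lin a, (0 : B × A)) - - ((0 : Y), (s.lin a, (0 : A))) =
    ((0 : Y), ((0 : B), A.d a)) + Z.d (0, (0, a))
  rw [hZ]
  simp
  exact Prod.ext (zero_add _).symm (Prod.ext (zero_add _).symm (add_neg_cancel _).symm)

lemma ext_aux {X Y : Bicomod C D} {s : A ⟶ X} (hs : QIso s) (g : X ⟶ Y)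
    (hg : Homotopic (s ≫ g) 0) :
    ∃ (Z : Bicomod C D) (t : Y ⟶ Z), QIso t ∧ Homotopic (g ≫ t) 0 := by
  obtain ⟨h, hh, e⟩ := hg
  have e : ∀ a, g.lin (s.lin a) = h (A.d a) + Y.d (h a) := fun a => by
    have := LinearMap.congr_fun e a
    rwa [zero_lin, sub_zero] at this
  have hφ0 : IsColin (M := cone s) (N := Y) 0
      (g.lin ∘ₗ LinearMap.fst k X A + h ∘ₗ LinearMap.snd k X A) :=
    (g.isColin.comp (isColin_fst (M := A.shift 1) (N := X) s.lin (isColin_cone s)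
      (anticomm_cone s)) (add_zero 0)).add
    ((hh.comp (isColin_ofShift A) (by omega : (1 : ℤ) + -1 = 0)).comp
      (isColin_snd (M := A.shift 1) (N := X) s.lin (isColin_cone s) (anticomm_cone s))
      (add_zero 0))
  let φ : cone s ⟶ Y :=
    { lin := g.lin ∘ₗ LinearMap.fst k X A + h ∘ₗ LinearMap.snd k X A
      isMor := ⟨fun n x hx => DGVect.mem_cast (V := Y.toDGVect) (hφ0.deg n x hx) (add_zero n),
        LinearMap.ext fun x => by
          change g.lin ((cone s).d x).1 + h ((cone s).d x).2 = Y.d (g.lin x.1 + h x.2)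
          rw [cone_d_apply]
          change g.lin (X.d x.1 + s.lin x.2) + h (- A.d x.2) = _
          rw [map_add, e, map_neg, map_add, g.isMor.comm_apply]
          abel⟩
      left := by have := hφ0.left; rwa [DGVect.sg_zero] at this
      right := hφ0.right }
  have hH : IsColin (M := X) (N := cone φ) (-1)
      (LinearMap.inr k Y (X × A) ∘ₗ LinearMap.inl k X A) :=
    (isColin_inr (M := (cone s).shift 1) (N := Y) φ.lin (isColin_cone φ) (anticomm_cone φ)).comp
      ((isColin_toShift (cone s)).comp
        (extInl (M := A.shift 1) (N := X) s.lin (isColin_cone s) (anticomm_cone s)).isColin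
        (zero_add _)) (add_zero _)
  refine ⟨cone φ, extInl _ (isColin_cone φ) (anticomm_cone φ),
    qIso_extInl _ _ _ (acyclic_shift (acyclic_cone hs)), _, hH, ?_⟩
  refine LinearMap.ext fun x => ?_
  rw [comp_lin, zero_lin, sub_zero]
  change (g.lin x, (0 : X × A)) = ((0 : Y), (X.d x, (0 : A))) + (cone φ).d (0, (x, 0))
  rw [cone_d_apply, cone_d_apply]
  change _ = ((0 : Y), (X.d x, (0 : A))) +
    (Y.d 0 + (g.lin x + h 0), - (X.d x + s.lin 0, - A.d 0))
  simp
  rfl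

end Cone

end Bicomod

namespace Bicomod

variable {C D : DGCoalg.{v, u} k}

lemma QIso.bij_comp {M N L : Bicomod C D} (f : M ⟶ N) (g : N ⟶ L) (n : ℤ) :
    DGVect.Hmap (V := M.toDGVect) (W := L.toDGVect) (f ≫ g).isMor n =
      DGVect.Hmap (V := N.toDGVect) (W := L.toDGVect) g.isMor n ∘ₗ
        DGVect.Hmap (V := M.toDGVect) (W := N.toDGVect) f.isMor n :=
  LinearMap.ext fun x => Submodule.Quotient.induction_on _ x fun _ => rfl

lemma QIso.comp {M N L : Bicomod C D} {f : M ⟶ N} {g : N ⟶ L} (hf : QIso f) (hg : QIso g) :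
    QIso (f ≫ g) := fun n => by
  rw [QIso.bij_comp, LinearMap.coe_comp]
  exact (hg n).comp (hf n)

lemma QIso.id (M : Bicomod C D) : QIso (𝟙 M) := fun n => by
  have : DGVect.Hmap (V := M.toDGVect) (W := M.toDGVect) (Hom.isMor (𝟙 M)) n = LinearMap.id :=
    LinearMap.ext fun x => Submodule.Quotient.induction_on _ x fun _ => rfl
  rw [this]
  exact Function.bijective_id

variable (C D) in
/-- The quasi-isomorphisms in the homotopy category. -/
def qis : MorphismProperty (Ho C D) := fun X Y φ =>
  ∃ f : X.as ⟶ Y.as, (Quotient.functor Homotopic).map f = φ ∧ QIso f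

lemma qis_map_iff {M N : Bicomod C D} (f : M ⟶ N) :
    qis C D ((Quotient.functor Homotopic).map f) ↔ QIso f := by
  refine ⟨?_, fun h => ⟨f, rfl, h⟩⟩
  rintro ⟨g, hg, h⟩
  have : Homotopic g f := (Quotient.functor_map_eq_iff _ _ _).1 hg
  exact h.of_homotopic (Congruence.equivalence.symm this)

instance : (qis C D).IsMultiplicative where
  id_mem X := ⟨𝟙 _, CategoryTheory.Functor.map_id _ _, QIso.id _⟩
  comp_mem := by
    rintro X Y Z _ _ ⟨f, rfl, hf⟩ ⟨g, rfl, hg⟩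
    exact ⟨f ≫ g, Functor.map_comp _ _ _, hf.comp hg⟩

instance : (qis C D).RespectsIso :=
  MorphismProperty.respectsIso_of_isStableUnderComposition (by
    intro X Y φ (hφ : IsIso φ)
    obtain ⟨f, rfl⟩ := (Quotient.functor Homotopic).map_surjective (X := X.as) (Y := Y.as) φ
    obtain ⟨g, hg⟩ := (Quotient.functor Homotopic).map_surjective (X := Y.as) (Y := X.as)
      (inv ((Quotient.functor Homotopic).map f))
    have h1 : QIso (f ≫ g) := (QIso.id _).of_homotopic
      ((Quotient.functor_map_eq_iff _ _ _).1 (by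
        rw [Functor.map_comp, hg, IsIso.hom_inv_id, CategoryTheory.Functor.map_id]))
    have h2 : QIso (g ≫ f) := (QIso.id _).of_homotopic
      ((Quotient.functor_map_eq_iff _ _ _).1 (by
        rw [Functor.map_comp, hg, IsIso.inv_hom_id, CategoryTheory.Functor.map_id]))
    refine ⟨f, rfl, fun n => ?_⟩
    have h1 := h1 n
    have h2 := h2 n
    rw [QIso.bij_comp, LinearMap.coe_comp] at h1 h2
    exact ⟨h1.injective.of_comp, h2.surjective.of_comp⟩)

instance : (qis C D).HasLeftCalculusOfFractions where
  exists_leftFraction := by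
    rintro X Y ⟨s, ⟨s, rfl, hs⟩, f⟩
    obtain ⟨f, rfl⟩ := (Quotient.functor Homotopic).map_surjective f
    obtain ⟨Z, i, j, hi, h⟩ := exists_leftFraction_aux hs f
    refine ⟨⟨(Quotient.functor Homotopic).map j, (Quotient.functor Homotopic).map i,
      ⟨i, rfl, hi⟩⟩, ?_⟩
    exact ((Functor.map_comp _ _ _).symm.trans (CategoryTheory.Quotient.sound _ h)).trans (Functor.map_comp _ _ _)
  ext := by
    rintro A X Y f₁ f₂ _ ⟨s, rfl, hs⟩ e
    obtain ⟨f₁, rfl⟩ := (Quotient.functor Homotopic).map_surjective (X := X.as) (Y := Y.as) f₁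
    obtain ⟨f₂, rfl⟩ := (Quotient.functor Homotopic).map_surjective (X := X.as) (Y := Y.as) f₂
    have e' : Homotopic (s ≫ f₁) (s ≫ f₂) := (Quotient.functor_map_eq_iff _ _ _).1
      (((Functor.map_comp _ _ _).trans e).trans (Functor.map_comp _ _ _).symm)
    obtain ⟨Z, t, ht, h, hh, e⟩ := ext_aux hs (f₁ - f₂) (by
      obtain ⟨h, hh, e⟩ := e'
      refine ⟨h, hh, ?_⟩
      rw [← e, comp_lin, comp_lin, comp_lin, sub_lin, LinearMap.sub_comp, zero_lin, sub_zero])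
    refine ⟨(Quotient.functor Homotopic).obj Z, (Quotient.functor Homotopic).map t, ⟨t, rfl, ht⟩, ?_⟩
    have h : Homotopic (f₁ ≫ t) (f₂ ≫ t) := by
      refine ⟨h, hh, ?_⟩
      rw [← e, comp_lin, comp_lin, comp_lin, sub_lin, LinearMap.comp_sub, zero_lin, sub_zero]
    exact ((Functor.map_comp _ _ _).symm.trans (CategoryTheory.Quotient.sound _ h)).trans (Functor.map_comp _ _ _)

lemma QIso.shift {M N : Bicomod C D} {f : M ⟶ N} (hf : QIso f) (a : ℤ) :
    QIso ((shiftF a).map f) := by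
  rw [qIso_iff] at hf ⊢
  refine ⟨fun n x hx hdx ⟨y, hy, e⟩ => ?_, fun n y hy hdy => ?_⟩
  · obtain ⟨z, hz, ez⟩ := hf.1 (n + a) x hx (by
      have hdx : sgn k a • M.d x = 0 := hdx
      rw [← one_smul k (M.d x), ← sgn_mul_self a, mul_smul, hdx, smul_zero])
      ⟨sgn k a • y, Submodule.smul_mem _ _ (DGVect.mem_cast (V := N.toDGVect) hy (by omega)), by
        rw [map_smul]; exact e⟩
    refine ⟨sgn k a • z, Submodule.smul_mem _ _
      (DGVect.mem_cast (V := M.toDGVect) hz (by omega)), ?_⟩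
    change sgn k a • M.d (sgn k a • z) = x
    rw [map_smul, smul_smul, sgn_mul_self, one_smul, ez]
  · obtain ⟨x, hx, hdx, z, hz, ez⟩ := hf.2 (n + a) y hy (by
      have hdy : sgn k a • N.d y = 0 := hdy
      rw [← one_smul k (N.d y), ← sgn_mul_self a, mul_smul, hdy, smul_zero])
    refine ⟨x, hx, ?_, sgn k a • z, Submodule.smul_mem _ _
      (DGVect.mem_cast (V := N.toDGVect) hz (by omega)), ?_⟩
    · change sgn k a • M.d x = 0
      rw [hdx, smul_zero]
    · change sgn k a • N.d (sgn k a • z) = y - f.lin x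
      rw [map_smul, smul_smul, sgn_mul_self, one_smul, ez]

lemma qis_shift {X Y : Ho C D} {φ : X ⟶ Y} (h : qis C D φ) (a : ℤ) : qis C D (φ⟦a⟧') := by
  obtain ⟨f, rfl, hf⟩ := h
  have := ((Quotient.functor (Homotopic (C := C) (D := D))).commShiftIso a).hom.naturality f
  refine ((qis C D).arrow_mk_iso_iff (Arrow.isoMk
    (((Quotient.functor (Homotopic (C := C) (D := D))).commShiftIso a).app X.as)
    (((Quotient.functor (Homotopic (C := C) (D := D))).commShiftIso a).app Y.as)
    this.symm)).1 ?_
  exact (qis_map_iff _).2 (hf.shift a)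

instance : (qis C D).IsCompatibleWithShift ℤ where
  condition a := by
    ext X Y φ
    refine ⟨fun h => ?_, fun h => qis_shift h a⟩
    have := qis_shift (φ := φ⟦a⟧') h (-a)
    exact ((qis C D).arrow_mk_iso_iff (Arrow.isoMk
      ((shiftFunctorCompIsoId (Ho C D) a (-a) (add_neg_cancel a)).app X)
      ((shiftFunctorCompIsoId (Ho C D) a (-a) (add_neg_cancel a)).app Y)
      ((shiftFunctorCompIsoId (Ho C D) a (-a) (add_neg_cancel a)).hom.naturality φ).symm)).1 this

/-- The derived category of differential graded bicomodules, the localization of the homotopy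
category at the quasi-isomorphisms. -/
abbrev Der (C D : DGCoalg.{v, u} k) := (qis C D).Localization

/-- A bicomodule as an object of the derived category. -/
noncomputable abbrev toDer (M : Bicomod C D) : Der C D :=
  (qis C D).Q.obj ((Quotient.functor Homotopic).obj M)

/-- `H^n(M, C) = Hom(M, C[n])`, with morphisms in the derived category of `C`-bicomodules. -/
abbrev HH (M : Bicomod C C) (n : ℤ) := ShiftedHom (toDer M) (toDer (regular C)) n


end Bicomod

end DGC

/-! Write `B` for the standard resolution of a coalgebra, regarded as a bicomodule over it, and `□`
for the underived cotensor product. The resolution of any `M` is `B □ M` (`exists_isIso_res`), so a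
derived cotensor product is an ordinary one with `B` inserted: `P □^R N ≅ P □ (B □ N)`. On left
bounded bicomodules `X □ (B □ Y)` preserves quasi-isomorphisms in both variables
(`QIso.cot_res_cot`). It is a total complex with columns `X ⊗ C^(⊗ r) ⊗ Y`. Over a field
quasi-isomorphisms are homotopy equivalences and survive tensor products (`QI.lTensor`,
`QI.rTensor`), and positivity of `C` bounds all columns by the same degree, so that a comparison of
columns suffices (`QI.of_columns`). Moreover `C → B` remains a quasi-isomorphism after a cotensor
product on either side (`qIso_resAug_cot`, `qIso_cot_resAug`), since the bar sequence of `C` has one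
contraction that is right colinear and another that is left colinear.

The hypotheses on `P` and `Q` are made concrete as zigzags `P □ (B □ Q) → Z ← C` of
quasi-isomorphisms with `Z` left bounded (`Linked.of_dcotensor`). They come from the calculus of
fractions, followed by a truncation of the middle term, which is again a bicomodule because the
coalgebras are positively graded.

For Hochschild cohomology the main tool is the cocenter `tr W`, the part of a `C`-bicomodule on
which the two coactions agree up to the symmetry. It has three properties: `X □_(C^e) M` is `tr (X □
M)` (`hIso_cotensorEnv`), `tr (X □ Y)` and `tr (Y □ X)` are isomorphic (`hIso_tr_cyclic`), and `tr
(C ⊗ W)` is `W` (`bijective_rotateTr`). So `Hoch(M, C)` is the cohomology of `tr (B □ M)`, which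
depends on `M` only up to quasi-isomorphism (`QIso.hIso_tr_res`). Inserting `P □ (B □ Q)` in place
of `C` and rotating `B □ P` from the front to the end turns `tr (B □ M)` over `C` into `tr (B □ M')`
over `D` with `M'` the twist of `M` (`hIso_tr_twist`). The Hochschild complex is isomorphic to `tr
B` by the last coface (`hIso_hochComplex`), so `Hoch(C) ≅ Hoch(D)` is the case `M = C`.

For morphisms in the derived category, the functors `Q □ (B □ -)` and `- □ (B □ P)` preserve left
bounded bicomodules and quasi-isomorphisms between them, and the zigzags make them invertible up to
natural quasi-isomorphism. They are therefore equivalences of the localizations of the left bounded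
homotopy categories (`isEquivalence_twL`, `isEquivalence_twR`). By truncation these localizations
embed fully faithfully in the full derived categories (`full_locι`, `faithful_locι`). The functors
act on colinear maps of every degree (`GrFunctor`), hence respect homotopies, shifts and linear
structures. The composite sends `C` to an object isomorphic to `D`, and so identifies `Hom(M, C[n])`
with the corresponding group for `D`, compatibly with composition when `M = C`. -/

namespace DGC
variable {k : Type v} [Field k]

/-! ### Quasi-isomorphisms and homotopy equivalences of complexes over a field. -/

namespace DGVect

variable {V W U : DGVect.{v, u} k}

/-- Acyclicity of the mapping cone of `f`, spelled out on elements. -/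
def QI (f : V →ₗ[k] W) : Prop :=
  ∀ n, ∀ v ∈ V.gr (n + 1), ∀ w ∈ W.gr n, V.d v = 0 → f v = W.d w →
    ∃ v' ∈ V.gr n, V.d v' = v ∧ ∃ w' ∈ W.gr (n - 1), W.d w' = w - f v'

/-- Taking `v = 0` in `QI` gives surjectivity in cohomology, and forgetting `w'` gives injectivity.
Conversely, injectivity provides `z` with `d z = v`, and surjectivity applied to the cocycle `w - f
z` corrects `z` by a cocycle. Having one condition on a pair `(v, w)` is what makes the induction
over columns in `QI.of_columns` work. -/
lemma qi_iff {f : V →ₗ[k] W} (hf : IsMor f) : QI f ↔ ∀ n, Function.Bijective (Hmap hf n) := by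
  have key : (∀ n, Function.Bijective (Hmap hf n)) ↔
      (∀ n, ∀ x ∈ V.gr n, V.d x = 0 → (∃ y ∈ W.gr (n - 1), W.d y = f x) →
        ∃ z ∈ V.gr (n - 1), V.d z = x) ∧
      (∀ n, ∀ y ∈ W.gr n, W.d y = 0 → ∃ x ∈ V.gr n, V.d x = 0 ∧
        ∃ z ∈ W.gr (n - 1), W.d z = y - f x) := by
    rw [← forall_and]
    refine forall_congr' fun n => and_congr ?_ ?_
    · rw [← LinearMap.ker_eq_bot, LinearMap.ker_eq_bot']
      constructor
      · intro h x hx hdx ⟨y, hy, e⟩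
        have := h (Submodule.Quotient.mk ⟨x, hx, hdx⟩)
          ((Submodule.Quotient.mk_eq_zero _).2 ⟨y, hy, e⟩)
        exact (Submodule.Quotient.mk_eq_zero _).1 this
      · intro h x hx
        induction x using Submodule.Quotient.induction_on with
        | _ x =>
        obtain ⟨x, hx1, hx2⟩ := x
        exact (Submodule.Quotient.mk_eq_zero _).2
          (h x hx1 hx2 ((Submodule.Quotient.mk_eq_zero _).1 hx))
    · constructor
      · intro h y hy hdy
        obtain ⟨x, hx⟩ := h (Submodule.Quotient.mk ⟨y, hy, hdy⟩)
        induction x using Submodule.Quotient.induction_on with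
        | _ x =>
        obtain ⟨x, hx1, hx2⟩ := x
        exact ⟨x, hx1, hx2, ((Submodule.Quotient.eq _).1 hx.symm)⟩
      · intro h y
        induction y using Submodule.Quotient.induction_on with
        | _ y =>
        obtain ⟨y, hy1, hy2⟩ := y
        obtain ⟨x, hx, hdx, hz⟩ := h y hy1 hy2
        exact ⟨Submodule.Quotient.mk ⟨x, hx, hdx⟩, ((Submodule.Quotient.eq _).2 hz).symm⟩
  rw [key]
  constructor
  · refine fun h => ⟨fun n x hx hdx ⟨y, hy, e⟩ => ?_, fun n y hy hdy => ?_⟩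
    · obtain ⟨z, hz, ez, -⟩ := h (n - 1) x (mem_cast hx (by omega)) y hy hdx e.symm
      exact ⟨z, hz, ez⟩
    · obtain ⟨x, hx, ex, z, hz, ez⟩ := h n 0 (zero_mem _) y hy (map_zero _) (by rw [hdy, map_zero])
      exact ⟨x, hx, ex, z, hz, ez⟩
  · rintro ⟨h1, h2⟩ n v hv w hw hdv e
    obtain ⟨z, hz, ez⟩ := h1 (n + 1) v hv hdv ⟨w, mem_cast hw (by omega), e.symm⟩
    replace hz := mem_cast hz (show n + 1 - 1 = n by omega)
    obtain ⟨x, hx, hdx, w', hw', ew'⟩ := h2 n (w - f z) (sub_mem hw (hf.deg _ _ hz)) (by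
      rw [map_sub, ← hf.comm_apply, ez, e, sub_self])
    refine ⟨z + x, add_mem hz hx, by rw [map_add, ez, hdx, add_zero], w', hw', ?_⟩
    rw [ew', map_add, sub_sub]

lemma Hmap_comp {f : V →ₗ[k] W} {g : W →ₗ[k] U} (hf : IsMor f) (hg : IsMor g) (n : ℤ) :
    Hmap (hg.comp hf) n = Hmap hg n ∘ₗ Hmap hf n :=
  LinearMap.ext fun x => Submodule.Quotient.induction_on _ x fun _ => rfl

lemma QI.comp {f : V →ₗ[k] W} {g : W →ₗ[k] U} (hf : IsMor f) (hg : IsMor g) (h : QI f)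
    (h' : QI g) : QI (g ∘ₗ f) := by
  rw [qi_iff hf] at h
  rw [qi_iff hg] at h'
  rw [qi_iff (hg.comp hf)]
  intro n
  rw [Hmap_comp hf hg, LinearMap.coe_comp]
  exact (h' n).comp (h n)

lemma QI.of_comp_right {f : V →ₗ[k] W} {g : W →ₗ[k] U} (hf : IsMor f) (hg : IsMor g)
    (h : QI (g ∘ₗ f)) (h' : QI f) : QI g := by
  rw [qi_iff (hg.comp hf)] at h
  rw [qi_iff hf] at h'
  rw [qi_iff hg]
  intro n
  have := h n
  rw [Hmap_comp hf hg, LinearMap.coe_comp] at this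
  exact (Function.Bijective.of_comp_iff _ (h' n)).1 this

/-- Homotopy equivalences. -/
def HEq (f : V →ₗ[k] W) : Prop :=
  ∃ (g : W →ₗ[k] V) (h : V →ₗ[k] V) (h' : W →ₗ[k] W), IsMor g ∧ IsDeg (-1) h ∧ IsDeg (-1) h' ∧
    g ∘ₗ f - LinearMap.id = h ∘ₗ V.d + V.d ∘ₗ h ∧ f ∘ₗ g - LinearMap.id = h' ∘ₗ W.d + W.d ∘ₗ h'

lemma HEq.qi {f : V →ₗ[k] W} (hf : IsMor f) (h : HEq f) : QI f := by
  obtain ⟨g, h, h', hg, hh, hh', e, e'⟩ := h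
  have e : ∀ x, g (f x) - x = h (V.d x) + V.d (h x) := LinearMap.congr_fun e
  have e' : ∀ x, f (g x) - x = h' (W.d x) + W.d (h' x) := LinearMap.congr_fun e'
  intro n v hv w hw hdv e1
  have hhv : h v ∈ V.gr n := mem_cast (hh _ _ hv) (by omega)
  have hhw : h' w ∈ W.gr (n - 1) := mem_cast (hh' _ _ hw) (by omega)
  have hhfv : h' (f v) ∈ W.gr n := mem_cast (hh' _ _ (hf.deg _ _ hv)) (by omega)
  have dh : V.d (h v) = g (f v) - v := by rw [e, hdv, map_zero, zero_add]
  have dh' : W.d (h' (f v)) = f (g (f v)) - f v := by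
    rw [e', ← hf.comm_apply, hdv, map_zero, map_zero, zero_add]
  -- The naive choice `v' = g w - h v` leaves `w - f v'` equal, up to a coboundary, to the cocycle
  -- `z = f (h v) - h' (f v)`, which measures how far the two homotopies are from being compatible
  -- with `f`. Adding `g z` removes it, since `z - f (g z)` is a coboundary.
  have hz : f (h v) - h' (f v) ∈ W.gr n := sub_mem (hf.deg _ _ hhv) hhfv
  have dz : W.d (f (h v) - h' (f v)) = 0 := by
    rw [map_sub, ← hf.comm_apply, dh, dh', map_sub, sub_self]
  generalize hzz : f (h v) - h' (f v) = z at hz dz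
  have dg : V.d (g w) = g (f v) := by rw [← hg.comm_apply, ← e1]
  refine ⟨g w - h v + g z, add_mem (sub_mem (hg.deg _ _ hw) hhv) (hg.deg _ _ hz), ?_,
    - h' z - h' w, sub_mem (neg_mem (mem_cast (hh' _ _ hz) (by omega))) hhw, ?_⟩
  · rw [map_add, map_sub, dg, dh, ← hg.comm_apply, dz, map_zero]; abel
  · have e3 := e' z
    have e4 := e' w
    rw [dz, map_zero, zero_add] at e3
    rw [← e1] at e4
    rw [map_sub, map_neg, ← e3, eq_sub_of_add_eq' e4.symm, map_add, map_sub, ← hzz]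
    abel

/-- An acyclic complex over a field is contractible. -/
lemma exists_contraction (h : LinearMap.ker V.d ≤ LinearMap.range V.d) :
    ∃ s : V →ₗ[k] V, IsDeg (-1) s ∧ s ∘ₗ V.d + V.d ∘ₗ s = LinearMap.id := by
  -- The section `σ` of `d` onto its image and the retraction `π` onto the image need not be graded.
  -- The map `t` below keeps only the component of degree `n - 1` of `σ π` on elements of degree
  -- `n`, and still satisfies `d t d = d`.
  obtain ⟨σ, hσ⟩ := V.d.rangeRestrict.exists_rightInverse_of_surjective
    (LinearMap.range_eq_top.2 V.d.surjective_rangeRestrict)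
  obtain ⟨π, hπ⟩ := LinearMap.exists_leftInverse_of_injective (LinearMap.range V.d).subtype
    (Submodule.ker_subtype _)
  have h0 : ∀ x, V.d (σ (π (V.d x))) = V.d x := fun x => by
    have h1 := LinearMap.congr_fun hπ ⟨V.d x, ⟨x, rfl⟩⟩
    have h2 := congrArg Subtype.val (LinearMap.congr_fun hσ (π (V.d x)))
    refine h2.trans ?_
    exact congrArg Subtype.val h1
  let t : V →ₗ[k] V := V.glue fun n => V.proj (n - 1) ∘ₗ (σ ∘ₗ π) ∘ₗ (V.gr n).subtype
  have ht : ∀ n, ∀ x ∈ V.gr n, t x = V.proj (n - 1) (σ (π x)) := fun n x hx => glue_of_mem _ hx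
  have htd : IsDeg (-1) t := fun n x hx => by
    rw [ht n x hx]; exact V.proj_mem _ _
  have hdp : ∀ n x, V.d (V.proj n x) = V.proj (n + 1) (V.d x) := fun n x => by
    refine LinearMap.congr_fun (f := V.d ∘ₗ V.proj n) (g := V.proj (n + 1) ∘ₗ V.d)
      (hom_ext fun m x hx => ?_) x
    by_cases h : m = n
    · subst h; simp [proj_same hx, proj_same (V.d_mem _ _ hx)]
    · simp [proj_ne h hx, proj_ne (show m + 1 ≠ n + 1 by omega) (V.d_mem _ _ hx)]
  have hdtd : ∀ x, V.d (t (V.d x)) = V.d x := by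
    refine LinearMap.congr_fun (f := V.d ∘ₗ t ∘ₗ V.d) (g := V.d) (hom_ext fun n x hx => ?_)
    have hx' := V.d_mem _ _ hx
    rw [LinearMap.comp_apply, LinearMap.comp_apply, ht _ _ hx', hdp, h0]
    exact proj_same (mem_cast hx' (by omega))
  -- Since `d t d = d`, the element `x - t d x` is a cocycle, hence a coboundary, and `d t` is the
  -- identity on coboundaries. Expanding `d t (x - t d x) = x - t d x` is the contraction identity
  -- for `t - t t d`.
  refine ⟨t - t ∘ₗ t ∘ₗ V.d, fun n x hx => ?_, LinearMap.ext fun x => ?_⟩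
  · exact sub_mem (htd _ _ hx) (mem_cast (htd _ _ (htd _ _ (V.d_mem _ _ hx))) (by omega))
  · have hc : V.d (x - t (V.d x)) = 0 := by rw [map_sub, hdtd, sub_self]
    obtain ⟨y, hy⟩ := h hc
    have := hdtd y
    rw [hy, map_sub, map_sub] at this
    simp only [LinearMap.add_apply, LinearMap.comp_apply, LinearMap.sub_apply, d_d_apply, map_zero,
      sub_zero, map_sub, LinearMap.id_apply]
    rw [this]; abel

/-- `QI f` says that the cone `K` of `f` is acyclic, so `K` is contractible over a field. The matrix
entries of a contraction are the data sought: the entry `W → V` is a homotopy inverse, the entry `V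
→ V` is one homotopy, and minus the entry `W → W` is the other. -/
lemma QI.hEq {f : V →ₗ[k] W} (hf : IsMor f) (h : QI f) : HEq f := by
  have hd : W.d ∘ₗ f + f ∘ₗ (V.shift 1).d = 0 := by
    change _ + f ∘ₗ (sgn k 1 • V.d) = 0
    rw [← hf.comm, LinearMap.comp_smul, sgn_one, neg_smul, one_smul, add_neg_cancel]
  let K := DGVect.ext (V := V.shift 1) (W := W) f (fun n x hx => hf.deg _ _ hx) hd
  have hK : ∀ x : W × V, K.d x = (W.d x.1 + f x.2, - V.d x.2) := fun x => by
    refine Prod.ext rfl ?_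
    change sgn k 1 • V.d x.2 = _
    rw [sgn_one, neg_smul, one_smul]
  -- `QI` only concerns homogeneous elements; the homogeneous components of a cocycle of `K` are
  -- again cocycles.
  have hac : LinearMap.ker K.d ≤ LinearMap.range K.d := by
    intro x hx
    obtain ⟨s, hs⟩ := exists_sum_proj (V := K) x
    rw [hs]
    refine sum_mem fun n _ => ?_
    have hm := K.proj_mem n x
    have hc : K.d (K.proj n x) = 0 := by
      have hdp : K.d ∘ₗ K.proj n = K.proj (n + 1) ∘ₗ K.d := by
        refine hom_ext fun m x hx => ?_
        by_cases h : m = n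
        · subst h; simp only [LinearMap.comp_apply, proj_same hx, proj_same (K.d_mem _ _ hx)]
        · simp only [LinearMap.comp_apply, proj_ne h hx,
            proj_ne (show m + 1 ≠ n + 1 by omega) (K.d_mem _ _ hx), map_zero]
      have := LinearMap.congr_fun hdp x
      rw [LinearMap.comp_apply, LinearMap.comp_apply, LinearMap.mem_ker.1 hx, map_zero] at this
      exact this
    generalize K.proj n x = y at hm hc
    obtain ⟨w, v⟩ := y
    rw [hK] at hc
    obtain ⟨e1, e2⟩ := Prod.ext_iff.1 hc
    have e1 : W.d w + f v = 0 := e1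
    have e2 : V.d v = 0 := neg_eq_zero.1 e2
    obtain ⟨v', -, ev', w', -, ew'⟩ := h n (-v) (neg_mem hm.2) w hm.1 (by rw [map_neg, e2, neg_zero])
      (by rw [map_neg]; exact neg_eq_of_add_eq_zero_left e1)
    refine ⟨(w', v'), ?_⟩
    rw [hK]
    refine Prod.ext ?_ ?_
    · change W.d w' + f v' = w; rw [ew']; abel
    · change - V.d v' = v; rw [ev', neg_neg]
  obtain ⟨s, hs, e⟩ := exists_contraction hac
  let p1 : W →ₗ[k] W := LinearMap.fst k W V ∘ₗ s ∘ₗ LinearMap.inl k W V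
  let p2 : W →ₗ[k] V := LinearMap.snd k W V ∘ₗ s ∘ₗ LinearMap.inl k W V
  let p4 : V →ₗ[k] V := LinearMap.snd k W V ∘ₗ s ∘ₗ LinearMap.inr k W V
  have inl_mem : ∀ n, ∀ w ∈ W.gr n, ((w, 0) : W × V) ∈ K.gr n := fun n w hw => ⟨hw, zero_mem _⟩
  have inr_mem : ∀ n, ∀ v ∈ V.gr n, ((0, v) : W × V) ∈ K.gr (n - 1) := fun n v hv =>
    ⟨zero_mem _, mem_cast (V := V) hv (by omega)⟩
  have e : ∀ x, s (K.d x) + K.d (s x) = x := LinearMap.congr_fun e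
  have e1 : ∀ w, s (W.d w, 0) + K.d (s (w, 0)) = (w, 0) := fun w => by
    have := e (w, 0)
    rw [hK] at this
    simpa using this
  have e2 : ∀ v, s (f v, - V.d v) + K.d (s (0, v)) = (0, v) := fun v => by
    have := e (0, v)
    rw [hK] at this
    simpa using this
  refine ⟨p2, p4, -p1, ⟨fun n w hw => ?_, LinearMap.ext fun w => ?_⟩, fun n v hv => ?_,
    fun n w hw => ?_, LinearMap.ext fun v => ?_, LinearMap.ext fun w => ?_⟩
  · exact mem_cast (V := V) (hs _ _ (inl_mem n w hw)).2 (by omega)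
  · have := congrArg Prod.snd (e1 w)
    rw [hK] at this
    change (s (W.d w, 0)).2 = V.d (s (w, 0)).2
    exact sub_eq_zero.1 ((sub_eq_add_neg _ _).trans this)
  · exact mem_cast (V := V) (hs _ _ (inr_mem n v hv)).2 (by omega)
  · exact neg_mem (hs _ _ (inl_mem n w hw)).1
  · have := congrArg Prod.snd (e2 v)
    rw [hK] at this
    have e3 : s (f v, - V.d v) = s (f v, 0) - s (0, V.d v) := by
      rw [← map_sub]
      exact congrArg s (Prod.ext (sub_zero _).symm (zero_sub _).symm)
    rw [e3] at this
    change (s (f v, 0)).2 - v = (s (0, V.d v)).2 + V.d (s (0, v)).2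
    have h5 : (s (f v, 0)).2 - (s (0, V.d v)).2 + - V.d (s (0, v)).2 = v := this
    have key : ∀ a b c v : V, a - b + -c = v → a - v = b + c := by
      rintro a b c v rfl; abel
    exact key _ _ _ _ h5
  · have := congrArg Prod.fst (e1 w)
    rw [hK] at this
    change f (s (w, 0)).2 - w = - (s (W.d w, 0)).1 + W.d (- (s (w, 0)).1)
    have h5 : (s (W.d w, 0)).1 + (W.d (s (w, 0)).1 + f (s (w, 0)).2) = w := this
    rw [map_neg]
    nth_rw 2 [← h5]
    abel

/-- A homotopy has odd degree and is moved past `X`, so it becomes `X.sg 1 ⊗ h`. For `HEq.rTensor`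
no sign is needed. -/
lemma HEq.lTensor (X : DGVect.{v, u} k) {f : V →ₗ[k] W} (h : HEq f) :
    HEq (V := X.tensor V) (W := X.tensor W) (TensorProduct.map LinearMap.id f) := by
  obtain ⟨g, h, h', hg, hh, hh', e, e'⟩ := h
  have key : ∀ {Y : DGVect.{v, u} k} {a h : Y →ₗ[k] Y}, a - LinearMap.id = h ∘ₗ Y.d + Y.d ∘ₗ h →
      TensorProduct.map LinearMap.id a - LinearMap.id =
      TensorProduct.map (X.sg 1) h ∘ₗ (X.tensor Y).d +
        (X.tensor Y).d ∘ₗ TensorProduct.map (X.sg 1) h := fun {Y a h} e => by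
    have hs : X.sg 1 ∘ₗ X.sg 1 = LinearMap.id := by
      have := sg_add (V := X) 1 (-1)
      rw [sg_neg] at this
      rw [← this]; simp
    have e1 : TensorProduct.map LinearMap.id a - LinearMap.id =
        TensorProduct.map LinearMap.id (a - LinearMap.id : Y →ₗ[k] Y) (M := X) := by
      rw [← TensorProduct.map_id]
      refine TensorProduct.ext' fun x y => ?_
      simp [tmul_sub]
    rw [e1, e]
    simp only [LinearMap.comp_add, LinearMap.add_comp, ← TensorProduct.map_comp, hs, d_sg,
      LinearMap.comp_id, LinearMap.id_comp, sgn_one, neg_smul, one_smul,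
      TensorProduct.map_add_right]
    have e2 : TensorProduct.map (-(X.sg 1 ∘ₗ X.d)) h = - TensorProduct.map (X.sg 1 ∘ₗ X.d) h :=
      TensorProduct.ext' fun x y => by simp [neg_tmul]
    rw [e2]
    abel
  refine ⟨TensorProduct.map LinearMap.id g, TensorProduct.map (X.sg 1) h,
    TensorProduct.map (X.sg 1) h', IsMor.map .id hg, ?_, ?_, ?_, ?_⟩
  · exact IsDeg.map (a := 0) (fun n x hx => by simpa using sg_mem 1 hx) hh (by omega)
  · exact IsDeg.map (a := 0) (fun n x hx => by simpa using sg_mem 1 hx) hh' (by omega)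
  · rw [← TensorProduct.map_comp, LinearMap.id_comp]; exact key e
  · rw [← TensorProduct.map_comp, LinearMap.id_comp]; exact key e'

lemma HEq.rTensor (X : DGVect.{v, u} k) {f : V →ₗ[k] W} (h : HEq f) :
    HEq (V := V.tensor X) (W := W.tensor X) (TensorProduct.map f LinearMap.id) := by
  obtain ⟨g, h, h', hg, hh, hh', e, e'⟩ := h
  have key : ∀ {Y : DGVect.{v, u} k} {a h : Y →ₗ[k] Y}, IsDeg (-1) h →
      a - LinearMap.id = h ∘ₗ Y.d + Y.d ∘ₗ h →
      TensorProduct.map a LinearMap.id - LinearMap.id =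
      TensorProduct.map h LinearMap.id ∘ₗ (Y.tensor X).d +
        (Y.tensor X).d ∘ₗ TensorProduct.map h LinearMap.id := fun {Y a h} hh e => by
    have e1 : TensorProduct.map a LinearMap.id - LinearMap.id =
        TensorProduct.map (a - LinearMap.id : Y →ₗ[k] Y) LinearMap.id (N := X) := by
      rw [← TensorProduct.map_id]
      refine TensorProduct.ext' fun x y => ?_
      simp [sub_tmul]
    rw [e1, e]
    simp only [LinearMap.comp_add, LinearMap.add_comp, ← TensorProduct.map_comp, hh.comp_sg,
      LinearMap.comp_id, LinearMap.id_comp, TensorProduct.map_add_left]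
    have e2 : TensorProduct.map (sgn k (1 * -1) • Y.sg 1 ∘ₗ h) X.d =
        - TensorProduct.map (Y.sg 1 ∘ₗ h) X.d :=
      TensorProduct.ext' fun x y => by simp [neg_tmul]
    rw [e2]
    abel
  refine ⟨TensorProduct.map g LinearMap.id, TensorProduct.map h LinearMap.id,
    TensorProduct.map h' LinearMap.id, IsMor.map hg .id, ?_, ?_, ?_, ?_⟩
  · exact IsDeg.map (b := 0) hh (fun n x hx => by simpa using hx) (by omega)
  · exact IsDeg.map (b := 0) hh' (fun n x hx => by simpa using hx) (by omega)
  · rw [← TensorProduct.map_comp, LinearMap.id_comp]; exact key hh e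
  · rw [← TensorProduct.map_comp, LinearMap.id_comp]; exact key hh' e'

/-- This replaces the Künneth formula: over a field a quasi-isomorphism has a homotopy inverse, and
tensor products preserve homotopy equivalences. -/
lemma QI.lTensor (X : DGVect.{v, u} k) {f : V →ₗ[k] W} (hf : IsMor f) (h : QI f) :
    QI (V := X.tensor V) (W := X.tensor W) (TensorProduct.map LinearMap.id f) :=
  ((h.hEq hf).lTensor X).qi (.map .id hf)

lemma QI.rTensor (X : DGVect.{v, u} k) {f : V →ₗ[k] W} (hf : IsMor f) (h : QI f) :
    QI (V := V.tensor X) (W := W.tensor X) (TensorProduct.map f LinearMap.id) :=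
  ((h.hEq hf).rTensor X).qi (.map hf .id)

lemma QI.of_bijective {f : V →ₗ[k] W} (hf : IsMor f) (h : Function.Bijective f) : QI f := by
  intro n v hv w hw hdv e
  obtain ⟨v', rfl⟩ := h.2 w
  refine ⟨v', hf.mem_of_injective h.1 hw, h.1 ?_, 0, zero_mem _, by simp⟩
  rw [hf.comm_apply, ← e]

/-- A bijective morphism, or more generally a quasi-isomorphism, identifies the cohomology. -/
noncomputable def QI.equiv {f : V →ₗ[k] W} (hf : IsMor f) (h : QI f) (n : ℤ) : V.H n ≃ₗ[k] W.H n :=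
  LinearEquiv.ofBijective (Hmap hf n) ((qi_iff hf).1 h n)

end DGVect

end DGC

/-! ### Flatness over a field, and maps of bicomodules tested after an injection. -/

namespace DGC
variable {k : Type v} [Field k]

lemma map_id_injective {A B X : Type u} [AddCommGroup A] [Module k A] [AddCommGroup B] [Module k B]
    [AddCommGroup X] [Module k X] {f : A →ₗ[k] B} (hf : Function.Injective f) :
    Function.Injective (TensorProduct.map (LinearMap.id : X →ₗ[k] X) f) :=
  Module.Flat.lTensor_preserves_injective_linearMap f hf

lemma map_injective_id {A B X : Type u} [AddCommGroup A] [Module k A] [AddCommGroup B] [Module k B]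
    [AddCommGroup X] [Module k X] {f : A →ₗ[k] B} (hf : Function.Injective f) :
    Function.Injective (TensorProduct.map f (LinearMap.id : X →ₗ[k] X)) :=
  Module.Flat.rTensor_preserves_injective_linearMap f hf

lemma exists_map_id {A B B' X : Type u} [AddCommGroup A] [Module k A] [AddCommGroup B] [Module k B]
    [AddCommGroup B'] [Module k B'] [AddCommGroup X] [Module k X] {f : A →ₗ[k] B} {g : B →ₗ[k] B'}
    (h : Function.Exact f g) {t : X ⊗[k] B}
    (ht : TensorProduct.map (LinearMap.id : X →ₗ[k] X) g t = 0) :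
    ∃ s : X ⊗[k] A, TensorProduct.map LinearMap.id f s = t :=
  (Module.Flat.lTensor_exact X h t).1 ht

lemma exists_map_id' {A B B' X : Type u} [AddCommGroup A] [Module k A] [AddCommGroup B] [Module k B]
    [AddCommGroup B'] [Module k B'] [AddCommGroup X] [Module k X] {f : A →ₗ[k] B} {g : B →ₗ[k] B'}
    (h : Function.Exact f g) {t : B ⊗[k] X}
    (ht : TensorProduct.map g (LinearMap.id : X →ₗ[k] X) t = 0) :
    ∃ s : A ⊗[k] X, TensorProduct.map f LinearMap.id s = t :=
  (Module.Flat.rTensor_exact X h t).1 ht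

namespace Bicomod

variable {C D E F : DGCoalg.{v, u} k}

section Lift

variable {M N L : Bicomod C D}

/-- Tensoring over a field preserves injectivity, so both colinearity identities and the degree can
be tested after composing with `i`. All maps between cotensor products are obtained this way, by
restriction from tensor products. -/
lemma IsColin.of_comp {i : N ⟶ L} (hi : Function.Injective i.lin) {a : ℤ} {φ : M →ₗ[k] N}
    (h : IsColin a (i.lin ∘ₗ φ)) : IsColin a φ where
  deg n x hx := i.isMor.mem_of_injective hi (h.deg n x hx)
  left := LinearMap.ext fun x => map_id_injective hi (by
    have h1 := LinearMap.congr_fun i.left (φ x)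
    have h2 := LinearMap.congr_fun h.left x
    simp only [LinearMap.comp_apply] at h1 h2 ⊢
    rw [← h1, h2, ← LinearMap.id_comp (C.sg a), TensorProduct.map_comp, LinearMap.comp_apply]
    rfl)
  right := LinearMap.ext fun x => map_injective_id hi (by
    have h1 := LinearMap.congr_fun i.right (φ x)
    have h2 := LinearMap.congr_fun h.right x
    simp only [LinearMap.comp_apply] at h1 h2 ⊢
    rw [← h1, h2, ← LinearMap.comp_id LinearMap.id, TensorProduct.map_comp, LinearMap.comp_apply]
    rfl)

/-- A colinear map of degree zero that commutes with the differentials, as a morphism. -/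
abbrev IsColin.toHom {φ : M →ₗ[k] N} (h : IsColin 0 φ) (hd : φ ∘ₗ M.d = N.d ∘ₗ φ) : M ⟶ N where
  lin := φ
  isMor := ⟨fun n x hx => DGVect.mem_cast (V := N.toDGVect) (h.deg n x hx) (add_zero n), hd⟩
  left := by have := h.left; rwa [DGVect.sg_zero] at this
  right := h.right

/-- A linear factorization of a morphism through an injective morphism is a morphism. -/
abbrev Hom.factor {i : N ⟶ L} (hi : Function.Injective i.lin) (f : M ⟶ L) (φ : M →ₗ[k] N)
    (e : i.lin ∘ₗ φ = f.lin) : M ⟶ N :=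
  IsColin.toHom (φ := φ) (.of_comp hi (by rw [e]; exact f.isColin)) (LinearMap.ext fun x => hi (by
    have e1 := LinearMap.congr_fun e
    have h1 := i.isMor.comm_apply (φ x)
    have h2 := f.isMor.comm_apply x
    simp only [LinearMap.comp_apply] at e1 ⊢
    rw [h1, e1, e1, h2]))

lemma isIso_of_bijective {f : M ⟶ N} (h : Function.Bijective f.lin) : IsIso f := by
  let e := LinearEquiv.ofBijective f.lin h
  have he : f.lin ∘ₗ e.symm.toLinearMap = LinearMap.id :=
    LinearMap.ext fun x => e.apply_symm_apply x
  refine ⟨Hom.factor h.1 (𝟙 N) e.symm.toLinearMap he, ?_, ?_⟩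
  · exact hom_ext (LinearMap.ext fun x => e.symm_apply_apply x)
  · exact hom_ext he

lemma QIso.of_isIso (f : M ⟶ N) [IsIso f] : QIso f := by
  refine (DGVect.qi_iff f.isMor).1 (DGVect.QI.of_bijective f.isMor ⟨fun x y h => ?_, fun y => ?_⟩)
  · have e := congrArg Hom.lin (IsIso.hom_inv_id f)
    have := congrArg (inv f).lin h
    rw [← LinearMap.comp_apply, ← LinearMap.comp_apply, ← comp_lin, e] at this
    exact this
  · have e := congrArg Hom.lin (IsIso.inv_hom_id f)
    exact ⟨(inv f).lin y, LinearMap.congr_fun e y⟩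

lemma qIso_iff_qi (f : M ⟶ N) :
    QIso f ↔ DGVect.QI (V := M.toDGVect) (W := N.toDGVect) f.lin := (DGVect.qi_iff f.isMor).symm

lemma QIso.of_comp_right {f : M ⟶ N} {g : N ⟶ L} (h : QIso (f ≫ g)) (hf : QIso f) : QIso g := by
  rw [qIso_iff_qi] at h hf ⊢
  exact DGVect.QI.of_comp_right f.isMor g.isMor h hf

end Lift

/-! ### Functoriality and associativity of the tensor product over the ground field. -/

section Outer

/-- Functoriality of the tensor product over the ground field in both variables. -/
noncomputable def outerMap₂ {X X' : Bicomod C D} {Y Y' : Bicomod E F} (f : X ⟶ X') (g : Y ⟶ Y') :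
    outer X Y ⟶ outer X' Y' where
  lin := TensorProduct.map f.lin g.lin
  isMor := .map (V := X.toDGVect) (V' := X'.toDGVect) (W := Y.toDGVect) (W' := Y'.toDGVect)
    f.isMor g.isMor
  left := by
    refine TensorProduct.ext' fun p n => ?_
    have h := LinearMap.congr_fun f.left p
    simp only [LinearMap.comp_apply, map_tmul, LinearMap.id_apply, LinearEquiv.coe_coe] at h ⊢
    rw [h]
    generalize X.lact p = x
    induction x with
    | zero => simp
    | add x y hx hy => simp only [add_tmul, map_add, hx, hy]
    | tmul c p => simp
  right := by
    refine TensorProduct.ext' fun p n => ?_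
    have h := LinearMap.congr_fun g.right n
    simp only [LinearMap.comp_apply, map_tmul, LinearMap.id_apply, LinearEquiv.coe_coe] at h ⊢
    rw [h]
    generalize Y.ract n = x
    induction x with
    | zero => simp
    | add x y hx hy => simp only [tmul_add, map_add, hx, hy]
    | tmul c p => simp

@[simp] lemma outerMap₂_lin {X X' : Bicomod C D} {Y Y' : Bicomod E F} (f : X ⟶ X') (g : Y ⟶ Y') :
    (outerMap₂ f g).lin = TensorProduct.map f.lin g.lin := rfl

lemma outerMap₂_comp {X X' X'' : Bicomod C D} {Y Y' Y'' : Bicomod E F} (f : X ⟶ X') (g : Y ⟶ Y')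
    (f' : X' ⟶ X'') (g' : Y' ⟶ Y'') :
    outerMap₂ f g ≫ outerMap₂ f' g' = outerMap₂ (f ≫ f') (g ≫ g') :=
  hom_ext (TensorProduct.map_comp _ _ _ _).symm

lemma outerMap₂_id (X : Bicomod C D) (Y : Bicomod E F) : outerMap₂ (𝟙 X) (𝟙 Y) = 𝟙 (outer X Y) :=
  hom_ext TensorProduct.map_id

lemma QIso.outerMap₂_left {X X' : Bicomod C D} {f : X ⟶ X'} (hf : QIso f) (Y : Bicomod E F) :
    QIso (outerMap₂ f (𝟙 Y)) := by
  rw [qIso_iff_qi] at hf ⊢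
  exact hf.rTensor Y.toDGVect f.isMor

lemma QIso.outerMap₂_right (X : Bicomod C D) {Y Y' : Bicomod E F} {g : Y ⟶ Y'} (hg : QIso g) :
    QIso (outerMap₂ (𝟙 X) g) := by
  rw [qIso_iff_qi] at hg ⊢
  exact hg.lTensor X.toDGVect g.isMor

variable {G H : DGCoalg.{v, u} k}

/-- The associativity isomorphism for the tensor product over the ground field. -/
noncomputable def outerAssoc (X : Bicomod C D) (Y : Bicomod E F) (Z : Bicomod G H) :
    outer (outer X Y) Z ⟶ outer X (outer Y Z) where
  lin := (TensorProduct.assoc k X Y Z).toLinearMap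
  isMor := DGVect.isMor_assoc X.toDGVect Y.toDGVect Z.toDGVect
  left := by
    refine TensorProduct.ext_threefold fun x y z => ?_
    simp only [LinearMap.comp_apply, map_tmul, LinearMap.id_apply, LinearEquiv.coe_coe, assoc_tmul]
    generalize X.lact x = t
    induction t with
    | zero => simp
    | add x y hx hy => simp only [add_tmul, map_add, hx, hy]
    | tmul c p => simp
  right := by
    refine TensorProduct.ext_threefold fun x y z => ?_
    simp only [LinearMap.comp_apply, map_tmul, LinearMap.id_apply, LinearEquiv.coe_coe, assoc_tmul]
    generalize Z.ract z = t
    induction t with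
    | zero => simp
    | add x y hx hy => simp only [tmul_add, map_add, hx, hy]
    | tmul c p => simp

instance (X : Bicomod C D) (Y : Bicomod E F) (Z : Bicomod G H) : IsIso (outerAssoc X Y Z) :=
  isIso_of_bijective (TensorProduct.assoc k X Y Z).bijective

lemma outerAssoc_naturality {X X' : Bicomod C D} {Y Y' : Bicomod E F} {Z Z' : Bicomod G H}
    (f : X ⟶ X') (g : Y ⟶ Y') (h : Z ⟶ Z') :
    outerMap₂ (outerMap₂ f g) h ≫ outerAssoc X' Y' Z' =
      outerAssoc X Y Z ≫ outerMap₂ f (outerMap₂ g h) :=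
  hom_ext (assoc_nat f.lin g.lin h.lin)

end Outer

/-! ### The cotensor product as a functor. -/

section Cotensor

/-- The difference of the two maps `X ⊗ Y → X ⊗ D ⊗ Y` given by the coactions of `D`. -/
noncomputable def cmp (X : Bicomod C D) (Y : Bicomod D E) : X ⊗[k] Y →ₗ[k] X ⊗[k] (D ⊗[k] Y) :=
  (TensorProduct.assoc k X D Y).toLinearMap ∘ₗ TensorProduct.map X.ract LinearMap.id -
    TensorProduct.map LinearMap.id Y.lact

lemma cmp_tmul (X : Bicomod C D) (Y : Bicomod D E) (x : X) (y : Y) :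
    cmp X Y (x ⊗ₜ y) = TensorProduct.assoc k X D Y (X.ract x ⊗ₜ y) - x ⊗ₜ Y.lact y := rfl

lemma cotensor_lin (X : Bicomod C D) (Y : Bicomod D E) :
    (coactRight X Y - outerMap X (coact Y)).lin = cmp X Y := sub_lin _ _

variable {X X' X'' : Bicomod C D} {Y Y' Y'' : Bicomod D E}

lemma mem_cot {t : X ⊗[k] Y} :
    t ∈ LinearMap.ker (coactRight X Y - outerMap X (coact Y)).lin ↔ cmp X Y t = 0 := by
  rw [cotensor_lin, LinearMap.mem_ker]

/-- The twist `σ` is the identity for morphisms. For a graded map `g` of degree `a` it is `D.sg a`,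
with `f = X.sg a`: the Koszul sign of `g` against `X` must be accompanied by its sign against the
middle factor `D`. -/
lemma cmp_map {f : X →ₗ[k] X'} {g : Y →ₗ[k] Y'} {σ : D →ₗ[k] D}
    (hf : X'.ract ∘ₗ f = TensorProduct.map f σ ∘ₗ X.ract)
    (hg : Y'.lact ∘ₗ g = TensorProduct.map σ g ∘ₗ Y.lact) :
    cmp X' Y' ∘ₗ TensorProduct.map f g = TensorProduct.map f (TensorProduct.map σ g) ∘ₗ cmp X Y := by
  refine TensorProduct.ext' fun x y => ?_
  have h1 := LinearMap.congr_fun hf x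
  have h2 := LinearMap.congr_fun hg y
  simp only [LinearMap.comp_apply] at h1 h2
  rw [LinearMap.comp_apply, LinearMap.comp_apply, map_tmul, cmp_tmul, cmp_tmul, h1, h2, map_sub,
    map_tmul]
  congr 1
  generalize X.ract x = t
  induction t with
  | zero => simp
  | add x y hx hy => simp only [add_tmul, map_add, hx, hy]
  | tmul c p => simp

variable (X Y) in
/-- The inclusion of the cotensor product in the tensor product. -/
noncomputable def cotι : cotensor X Y ⟶ outer X Y where
  lin := (LinearMap.ker (coactRight X Y - outerMap X (coact Y)).lin).subtype
  isMor := ⟨fun _ _ h => h, rfl⟩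
  left := (kerLact_comp _).symm
  right := (kerRact_comp _).symm

variable (X Y) in
lemma cotι_injective : Function.Injective (cotι X Y).lin := Subtype.val_injective

variable (X Y) in
lemma cotι_exact : Function.Exact (cotι X Y).lin (cmp X Y) := fun t => by
  rw [← mem_cot]
  exact ⟨fun h => ⟨⟨t, h⟩, rfl⟩, by rintro ⟨s, rfl⟩; exact s.2⟩

lemma cmp_cotι (t : cotensor X Y) : cmp X Y ((cotι X Y).lin t) = 0 := mem_cot.1 t.2

/-- The map of cotensor products induced by two graded maps that are colinear over `D` up to the
same twist `σ`. -/
noncomputable def cotLin (f : X →ₗ[k] X') (g : Y →ₗ[k] Y') (σ : D →ₗ[k] D)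
    (hf : X'.ract ∘ₗ f = TensorProduct.map f σ ∘ₗ X.ract)
    (hg : Y'.lact ∘ₗ g = TensorProduct.map σ g ∘ₗ Y.lact) : cotensor X Y →ₗ[k] cotensor X' Y' :=
  LinearMap.codRestrict _ (TensorProduct.map f g ∘ₗ (cotι X Y).lin) fun t => by
    have h := LinearMap.congr_fun (cmp_map hf hg) ((cotι X Y).lin t)
    rw [LinearMap.comp_apply, LinearMap.comp_apply, cmp_cotι, map_zero] at h
    exact mem_cot.2 h

/-- A morphism to the tensor product with image in the cotensor product. -/
noncomputable def cotLift {M : Bicomod C E} (f : M ⟶ outer X Y) (h : ∀ m, cmp X Y (f.lin m) = 0) :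
    M ⟶ cotensor X Y :=
  Hom.factor (cotι_injective X Y) f (LinearMap.codRestrict _ f.lin fun m => mem_cot.2 (h m)) rfl

lemma cot_hom_ext {M : Bicomod C E} {f g : M ⟶ cotensor X Y}
    (h : f ≫ cotι X Y = g ≫ cotι X Y) : f = g :=
  hom_ext (LinearMap.ext fun x => cotι_injective X Y
    (LinearMap.congr_fun (congrArg Hom.lin h) x))

/-- Functoriality of the cotensor product. -/
noncomputable def cotMap (f : X ⟶ X') (g : Y ⟶ Y') : cotensor X Y ⟶ cotensor X' Y' :=
  cotLift (cotι X Y ≫ outerMap₂ f g) fun t => by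
    have h := LinearMap.congr_fun (cmp_map f.right g.left) ((cotι X Y).lin t)
    rw [LinearMap.comp_apply, LinearMap.comp_apply, cmp_cotι, map_zero] at h
    exact h

lemma cotMap_ι (f : X ⟶ X') (g : Y ⟶ Y') :
    cotMap f g ≫ cotι X' Y' = cotι X Y ≫ outerMap₂ f g := rfl

lemma cotMap_comp (f : X ⟶ X') (g : Y ⟶ Y') (f' : X' ⟶ X'') (g' : Y' ⟶ Y'') :
    cotMap f g ≫ cotMap f' g' = cotMap (f ≫ f') (g ≫ g') := cot_hom_ext (by
  rw [Category.assoc, cotMap_ι, ← Category.assoc, cotMap_ι, Category.assoc, outerMap₂_comp,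
    cotMap_ι])

variable (X Y) in
lemma cotMap_id : cotMap (𝟙 X) (𝟙 Y) = 𝟙 (cotensor X Y) := cot_hom_ext (by
  rw [cotMap_ι, outerMap₂_id, Category.comp_id, Category.id_comp])

instance (f : X ⟶ X') (g : Y ⟶ Y') [IsIso f] [IsIso g] : IsIso (cotMap f g) :=
  ⟨cotMap (inv f) (inv g), by simp [cotMap_comp, cotMap_id], by simp [cotMap_comp, cotMap_id]⟩

end Cotensor

/-! ### Associativity of the cotensor product. -/

section Assoc

variable {G : DGCoalg.{v, u} k}

lemma cmp_outer_left (X : Bicomod C D) (Y : Bicomod E F) (Z : Bicomod F G) :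
    (TensorProduct.assoc k X Y (F ⊗[k] Z)).toLinearMap ∘ₗ cmp (outer X Y) Z =
      TensorProduct.map LinearMap.id (cmp Y Z) ∘ₗ (TensorProduct.assoc k X Y Z).toLinearMap := by
  refine TensorProduct.ext_threefold fun x y z => ?_
  change TensorProduct.assoc k X Y (F ⊗[k] Z) (TensorProduct.assoc k (X ⊗[k] Y) F Z
      ((TensorProduct.assoc k X Y F).symm (x ⊗ₜ Y.ract y) ⊗ₜ z) - (x ⊗ₜ y) ⊗ₜ Z.lact z) =
    x ⊗ₜ (TensorProduct.assoc k Y F Z (Y.ract y ⊗ₜ z) - y ⊗ₜ Z.lact z)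
  rw [map_sub, tmul_sub, assoc_tmul]
  congr 1
  generalize Y.ract y = t
  induction t with
  | zero => simp
  | add x y hx hy => simp only [tmul_add, add_tmul, map_add, hx, hy]
  | tmul c p => simp

lemma cmp_outer_right (X : Bicomod C D) (Y : Bicomod D E) (Z : Bicomod F G) :
    cmp X (outer Y Z) ∘ₗ (TensorProduct.assoc k X Y Z).toLinearMap =
      TensorProduct.map LinearMap.id (TensorProduct.assoc k D Y Z).toLinearMap ∘ₗ
        (TensorProduct.assoc k X (D ⊗[k] Y) Z).toLinearMap ∘ₗ
          TensorProduct.map (cmp X Y) LinearMap.id := by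
  refine TensorProduct.ext_threefold fun x y z => ?_
  change TensorProduct.assoc k X D (Y ⊗[k] Z) (X.ract x ⊗ₜ (y ⊗ₜ z)) -
      x ⊗ₜ TensorProduct.assoc k D Y Z (Y.lact y ⊗ₜ z) =
    TensorProduct.map LinearMap.id (TensorProduct.assoc k D Y Z).toLinearMap
      (TensorProduct.assoc k X (D ⊗[k] Y) Z
        ((TensorProduct.assoc k X D Y (X.ract x ⊗ₜ y) - x ⊗ₜ Y.lact y) ⊗ₜ z))
  rw [sub_tmul, map_sub, map_sub, assoc_tmul, map_tmul]
  congr 1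
  generalize X.ract x = t
  induction t with
  | zero => simp
  | add x y hx hy => simp only [add_tmul, map_add, hx, hy]
  | tmul c p => simp

variable (X : Bicomod C D) (Y : Bicomod D E) (Z : Bicomod E F)

/-- The inclusion of `(X □ Y) □ Z` in the triple tensor product. -/
noncomputable def cotιL : cotensor (cotensor X Y) Z ⟶ outer (outer X Y) Z :=
  cotι (cotensor X Y) Z ≫ outerMap₂ (cotι X Y) (𝟙 Z)

/-- The inclusion of `X □ (Y □ Z)` in the triple tensor product. -/
noncomputable def cotιR : cotensor X (cotensor Y Z) ⟶ outer X (outer Y Z) :=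
  cotι X (cotensor Y Z) ≫ outerMap₂ (𝟙 X) (cotι Y Z)

lemma cotιL_injective : Function.Injective (cotιL X Y Z).lin :=
  (map_injective_id (cotι_injective X Y)).comp (cotι_injective _ _)

lemma cotιR_injective : Function.Injective (cotιR X Y Z).lin :=
  (map_id_injective (cotι_injective Y Z)).comp (cotι_injective _ _)

lemma cmp_cotιL_left (t : cotensor (cotensor X Y) Z) :
    TensorProduct.map (cmp X Y) LinearMap.id ((cotιL X Y Z).lin t) = 0 := by
  change TensorProduct.map (cmp X Y) LinearMap.id
    (TensorProduct.map (cotι X Y).lin LinearMap.id _) = 0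
  rw [← LinearMap.comp_apply, ← TensorProduct.map_comp, (cotι_exact X Y).linearMap_comp_eq_zero,
    TensorProduct.map_zero_left, LinearMap.zero_apply]

lemma cmp_map_left {X X' : Bicomod C D} {Y : Bicomod D E} (f : X ⟶ X') :
    cmp X' Y ∘ₗ TensorProduct.map f.lin LinearMap.id =
      TensorProduct.map f.lin LinearMap.id ∘ₗ cmp X Y := by
  have := cmp_map f.right (Hom.left (𝟙 Y))
  rw [id_lin, TensorProduct.map_id] at this
  exact this

lemma cmp_map_right {X : Bicomod C D} {Y Y' : Bicomod D E} (f : Y ⟶ Y') :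
    cmp X Y' ∘ₗ TensorProduct.map LinearMap.id f.lin =
      TensorProduct.map LinearMap.id (TensorProduct.map LinearMap.id f.lin) ∘ₗ cmp X Y :=
  cmp_map (Hom.right (𝟙 X)) f.left

lemma cmp_cotιL_right (t : cotensor (cotensor X Y) Z) :
    cmp (outer X Y) Z ((cotιL X Y Z).lin t) = 0 := by
  have := LinearMap.congr_fun (cmp_map_left (Y := Z) (cotι X Y)) ((cotι _ Z).lin t)
  rw [LinearMap.comp_apply, LinearMap.comp_apply, cmp_cotι, map_zero] at this
  exact this

/-- By flatness of `Z` the first condition puts `t` in `(X □ Y) ⊗ Z`; the second one then puts it in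
`(X □ Y) □ Z`, as the inclusion of `X □ Y` stays injective after tensoring. So the iterated cotensor
product is the intersection of two kernels in the triple tensor product. -/
lemma exists_cotιL {t : (X ⊗[k] Y) ⊗[k] Z} (h1 : TensorProduct.map (cmp X Y) LinearMap.id t = 0)
    (h2 : cmp (outer X Y) Z t = 0) : ∃ s, (cotιL X Y Z).lin s = t := by
  obtain ⟨s, rfl⟩ := exists_map_id' (cotι_exact X Y) h1
  have := LinearMap.congr_fun (cmp_map_left (Y := Z) (cotι X Y)) s
  rw [LinearMap.comp_apply, LinearMap.comp_apply] at this
  rw [this] at h2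
  obtain ⟨r, rfl⟩ := (cotι_exact (cotensor X Y) Z s).1
    (map_injective_id (cotι_injective X Y) (h2.trans (map_zero _).symm))
  exact ⟨r, rfl⟩

lemma cmp_cotιR_right (t : cotensor X (cotensor Y Z)) :
    TensorProduct.map LinearMap.id (cmp Y Z) ((cotιR X Y Z).lin t) = 0 := by
  change TensorProduct.map LinearMap.id (cmp Y Z)
    (TensorProduct.map LinearMap.id (cotι Y Z).lin _) = 0
  rw [← LinearMap.comp_apply, ← TensorProduct.map_comp, (cotι_exact Y Z).linearMap_comp_eq_zero,
    TensorProduct.map_zero_right, LinearMap.zero_apply]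

lemma cmp_cotιR_left (t : cotensor X (cotensor Y Z)) :
    cmp X (outer Y Z) ((cotιR X Y Z).lin t) = 0 := by
  have := LinearMap.congr_fun (cmp_map_right (X := X) (cotι Y Z)) ((cotι X _).lin t)
  rw [LinearMap.comp_apply, LinearMap.comp_apply, cmp_cotι, map_zero] at this
  exact this

lemma exists_cotιR {t : X ⊗[k] (Y ⊗[k] Z)} (h1 : TensorProduct.map LinearMap.id (cmp Y Z) t = 0)
    (h2 : cmp X (outer Y Z) t = 0) : ∃ s, (cotιR X Y Z).lin s = t := by
  obtain ⟨s, rfl⟩ := exists_map_id (cotι_exact Y Z) h1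
  have := LinearMap.congr_fun (cmp_map_right (X := X) (cotι Y Z)) s
  rw [LinearMap.comp_apply, LinearMap.comp_apply] at this
  rw [this] at h2
  obtain ⟨r, rfl⟩ := (cotι_exact X (cotensor Y Z) s).1
    (map_id_injective (map_id_injective (cotι_injective Y Z)) (h2.trans (map_zero _).symm))
  exact ⟨r, rfl⟩

/-- The right coaction of `X ⊗ Y` is the one of `Y`, so the condition for a cotensor product with
`Z` does not involve `X`. Together with its companion below, this shows that both bracketings of the
triple cotensor product are cut out by the same two conditions. -/
lemma cmp_outer_left_eq_zero_iff (X : Bicomod C D) (Y : Bicomod E F) (Z : Bicomod F G)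
    (t : (X ⊗[k] Y) ⊗[k] Z) : cmp (outer X Y) Z t = 0 ↔
      TensorProduct.map LinearMap.id (cmp Y Z) (TensorProduct.assoc k X Y Z t) = 0 := by
  have := LinearMap.congr_fun (cmp_outer_left X Y Z) t
  simp only [LinearMap.comp_apply, LinearEquiv.coe_coe] at this
  rw [← this, LinearEquiv.map_eq_zero_iff]

lemma cmp_outer_right_eq_zero_iff (X : Bicomod C D) (Y : Bicomod D E) (Z : Bicomod F G)
    (t : (X ⊗[k] Y) ⊗[k] Z) : cmp X (outer Y Z) (TensorProduct.assoc k X Y Z t) = 0 ↔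
      TensorProduct.map (cmp X Y) LinearMap.id t = 0 := by
  have := LinearMap.congr_fun (cmp_outer_right X Y Z) t
  simp only [LinearMap.comp_apply, LinearEquiv.coe_coe] at this
  rw [this]
  refine ⟨fun h => ?_, fun h => by rw [h, map_zero, map_zero]⟩
  refine (LinearEquiv.map_eq_zero_iff (TensorProduct.assoc k X (D ⊗[k] Y) Z)).1 ?_
  exact map_id_injective (TensorProduct.assoc k D Y Z).injective (h.trans (map_zero _).symm)

/-- The comparison of the two triple cotensor products, as a map to `X ⊗ (Y □ Z)`. -/
lemma exists_cotAssoc : ∃ f : cotensor (cotensor X Y) Z ⟶ cotensor X (cotensor Y Z),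
    f ≫ cotιR X Y Z = cotιL X Y Z ≫ outerAssoc X Y Z := by
  have h : ∀ t, ∃ s, (cotιR X Y Z).lin s = (cotιL X Y Z ≫ outerAssoc X Y Z).lin t := fun t =>
    exists_cotιR X Y Z ((cmp_outer_left_eq_zero_iff X Y Z _).1 (cmp_cotιL_right X Y Z t))
      ((cmp_outer_right_eq_zero_iff X Y Z _).2 (cmp_cotιL_left X Y Z t))
  let e := LinearEquiv.ofInjective _ (cotιR_injective X Y Z)
  let φ := e.symm.toLinearMap ∘ₗ LinearMap.codRestrict (LinearMap.range (cotιR X Y Z).lin)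
    (cotιL X Y Z ≫ outerAssoc X Y Z).lin h
  have hφ : (cotιR X Y Z).lin ∘ₗ φ = (cotιL X Y Z ≫ outerAssoc X Y Z).lin := LinearMap.ext fun t => by
    exact congrArg Subtype.val (e.apply_symm_apply (LinearMap.codRestrict
      (LinearMap.range (cotιR X Y Z).lin) (cotιL X Y Z ≫ outerAssoc X Y Z).lin h t))
  exact ⟨Hom.factor (cotιR_injective X Y Z) _ φ hφ, hom_ext hφ⟩

/-- The associativity isomorphism of the cotensor product. -/
noncomputable def cotAssoc : cotensor (cotensor X Y) Z ⟶ cotensor X (cotensor Y Z) :=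
  (exists_cotAssoc X Y Z).choose

lemma cotAssoc_ι : cotAssoc X Y Z ≫ cotιR X Y Z = cotιL X Y Z ≫ outerAssoc X Y Z :=
  (exists_cotAssoc X Y Z).choose_spec

instance : IsIso (cotAssoc X Y Z) := by
  have h := LinearMap.congr_fun (congrArg Hom.lin (cotAssoc_ι X Y Z))
  refine isIso_of_bijective ⟨fun x y e => ?_, fun y => ?_⟩
  · have h1 := h x
    have h2 := h y
    simp only [comp_lin, LinearMap.comp_apply] at h1 h2
    rw [e, h2] at h1
    exact (cotιL_injective X Y Z ((TensorProduct.assoc k X Y Z).injective h1)).symm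
  · obtain ⟨t, ht⟩ := (TensorProduct.assoc k X Y Z).surjective ((cotιR X Y Z).lin y)
    obtain ⟨s, hs⟩ := exists_cotιL X Y Z (t := t)
      ((cmp_outer_right_eq_zero_iff X Y Z _).1 (by rw [ht]; exact cmp_cotιR_left X Y Z y))
      ((cmp_outer_left_eq_zero_iff X Y Z _).2 (by rw [ht]; exact cmp_cotιR_right X Y Z y))
    refine ⟨s, cotιR_injective X Y Z ?_⟩
    refine (h s).trans ?_
    rw [comp_lin, LinearMap.comp_apply, hs]
    exact ht

lemma cotιL_naturality {X X' : Bicomod C D} {Y Y' : Bicomod D E} {Z Z' : Bicomod E F} (f : X ⟶ X')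
    (g : Y ⟶ Y') (h : Z ⟶ Z') : cotMap (cotMap f g) h ≫ cotιL X' Y' Z' =
      cotιL X Y Z ≫ outerMap₂ (outerMap₂ f g) h := by
  rw [cotιL, cotιL, ← Category.assoc, cotMap_ι, Category.assoc, outerMap₂_comp, Category.assoc,
    outerMap₂_comp, cotMap_ι, Category.comp_id, Category.id_comp]

lemma cotιR_naturality {X X' : Bicomod C D} {Y Y' : Bicomod D E} {Z Z' : Bicomod E F} (f : X ⟶ X')
    (g : Y ⟶ Y') (h : Z ⟶ Z') : cotMap f (cotMap g h) ≫ cotιR X' Y' Z' =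
      cotιR X Y Z ≫ outerMap₂ f (outerMap₂ g h) := by
  rw [cotιR, cotιR, ← Category.assoc, cotMap_ι, Category.assoc, outerMap₂_comp, Category.assoc,
    outerMap₂_comp, cotMap_ι, Category.comp_id, Category.id_comp]

lemma cancel_injective {M N L : Bicomod C D} {i : N ⟶ L} (hi : Function.Injective i.lin)
    {f g : M ⟶ N} (h : f ≫ i = g ≫ i) : f = g :=
  hom_ext (LinearMap.ext fun x => hi (LinearMap.congr_fun (congrArg Hom.lin h) x))

lemma cotAssoc_naturality {X X' : Bicomod C D} {Y Y' : Bicomod D E} {Z Z' : Bicomod E F}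
    (f : X ⟶ X') (g : Y ⟶ Y') (h : Z ⟶ Z') :
    cotMap (cotMap f g) h ≫ cotAssoc X' Y' Z' = cotAssoc X Y Z ≫ cotMap f (cotMap g h) := by
  refine cancel_injective (cotιR_injective _ _ _) ?_
  rw [Category.assoc, cotAssoc_ι, ← Category.assoc, cotιL_naturality, Category.assoc,
    Category.assoc, outerAssoc_naturality, cotιR_naturality, ← Category.assoc, ← Category.assoc,
    cotAssoc_ι]

end Assoc

end Bicomod

end DGC

namespace DGC
variable {k : Type v} [Field k]

namespace Bicomod

variable {C D E F G H : DGCoalg.{v, u} k}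

/-! ### The coalgebra as a unit for the cotensor product. -/

section Unit

lemma isIso_cotLift {X : Bicomod C D} {Y : Bicomod D E} {M : Bicomod C E} (f : M ⟶ outer X Y)
    (h : ∀ m, cmp X Y (f.lin m) = 0) (hi : Function.Injective f.lin)
    (hs : ∀ t, cmp X Y t = 0 → ∃ m, f.lin m = t) : IsIso (cotLift f h) := by
  refine isIso_of_bijective ⟨fun x y e => hi ?_, fun t => ?_⟩
  · exact congrArg (cotι X Y).lin e
  · obtain ⟨m, hm⟩ := hs _ (cmp_cotι t)
    exact ⟨m, cotι_injective X Y hm⟩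

lemma lact_injective (Y : Bicomod C E) : Function.Injective Y.lact := fun x y e => by
  have h := LinearMap.congr_fun Y.lact_counit
  simp only [LinearMap.comp_apply] at h
  have hx := h x
  rw [e, h y] at hx
  exact hx.symm

lemma ract_injective (X : Bicomod C D) : Function.Injective X.ract := fun x y e => by
  have h := LinearMap.congr_fun X.ract_counit
  simp only [LinearMap.comp_apply] at h
  have hx := h x
  rw [e, h y] at hx
  exact hx.symm

/-- The isomorphism `Y ≅ C □ Y`. -/
noncomputable def unitL (Y : Bicomod C E) : Y ⟶ cotensor (regular C) Y :=
  cotLift (coact Y) fun y => sub_eq_zero.2 (LinearMap.congr_fun Y.lact_coassoc y)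

lemma unitL_ι (Y : Bicomod C E) : unitL Y ≫ cotι _ _ = coact Y := rfl

instance (Y : Bicomod C E) : IsIso (unitL Y) := by
  refine isIso_cotLift _ _ (lact_injective Y) fun t ht => ?_
  -- The counit is applied to the first of the three factors in the equalizer condition `Δ ⊗ 1 = 1 ⊗
  -- λ` for `t`: the left side becomes `t` itself and the right side becomes the coaction on `(ε ⊗
  -- 1) t`, which is therefore the preimage.
  refine ⟨TensorProduct.lid k Y (TensorProduct.map C.ε LinearMap.id t), ?_⟩
  have ht' : TensorProduct.assoc k C C Y (TensorProduct.map C.Δ LinearMap.id t) =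
    TensorProduct.map LinearMap.id Y.lact t := sub_eq_zero.1 ht
  have h1 := congrArg (TensorProduct.lid k (C ⊗[k] Y))
    (congrArg (TensorProduct.map C.ε LinearMap.id) ht')
  have h2 : ∀ t : C ⊗[k] Y, TensorProduct.lid k (C ⊗[k] Y) (TensorProduct.map C.ε LinearMap.id
      (TensorProduct.map LinearMap.id Y.lact t)) =
      Y.lact (TensorProduct.lid k Y (TensorProduct.map C.ε LinearMap.id t)) := fun t => by
    induction t with
    | zero => simp
    | add x y hx hy => simp only [map_add, hx, hy]
    | tmul c y => simp
  have h3 : ∀ t : C ⊗[k] Y, TensorProduct.lid k (C ⊗[k] Y) (TensorProduct.map C.ε LinearMap.id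
      (TensorProduct.assoc k C C Y (TensorProduct.map C.Δ LinearMap.id t))) = t := fun t => by
    induction t with
    | zero => simp
    | add x y hx hy => simp only [map_add, hx, hy]
    | tmul c y =>
      have h := LinearMap.congr_fun (regular C).lact_counit c
      simp only [LinearMap.comp_apply, LinearMap.id_apply, LinearEquiv.coe_coe] at h
      conv_rhs => rw [← h]
      rw [map_tmul]
      change _ = (TensorProduct.lid k C) (TensorProduct.map C.ε LinearMap.id (C.Δ c)) ⊗ₜ[k] y
      generalize C.Δ c = s
      induction s with
      | zero => simp
      | add x y hx hy => simp only [map_add, add_tmul, hx, hy]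
      | tmul a b => simp [smul_tmul']
  rw [h2, h3] at h1
  exact h1.symm

lemma unitL_naturality {Y Y' : Bicomod C E} (f : Y ⟶ Y') :
    f ≫ unitL Y' = unitL Y ≫ cotMap (𝟙 _) f :=
  cot_hom_ext (by
    rw [Category.assoc, Category.assoc, cotMap_ι, unitL_ι, ← Category.assoc, unitL_ι,
      coact_naturality]
    rfl)

/-- The right coaction as a morphism of bicomodules. -/
noncomputable def coactR (X : Bicomod C D) : X ⟶ outer X (regular D) where
  lin := X.ract
  isMor := X.isMor_ract
  left := by rw [LinearMap.comp_assoc]; exact X.lact_ract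
  right := by
    rw [LinearMap.comp_assoc, LinearEquiv.toLinearMap_symm_comp_eq]
    exact X.ract_coassoc.symm

lemma coactR_naturality {X X' : Bicomod C D} (f : X ⟶ X') :
    f ≫ coactR X' = coactR X ≫ outerMap₂ f (𝟙 _) := hom_ext f.right

/-- The isomorphism `X ≅ X □ D`. -/
noncomputable def unitR (X : Bicomod C D) : X ⟶ cotensor X (regular D) :=
  cotLift (coactR X) fun y => sub_eq_zero.2 (LinearMap.congr_fun X.ract_coassoc y)

lemma unitR_ι (X : Bicomod C D) : unitR X ≫ cotι _ _ = coactR X := rfl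

instance (X : Bicomod C D) : IsIso (unitR X) := by
  refine isIso_cotLift _ _ (ract_injective X) fun t ht => ?_
  -- The mirror image: the counit is applied to the last of the three factors.
  refine ⟨TensorProduct.rid k X (TensorProduct.map LinearMap.id D.ε t), ?_⟩
  have ht' : TensorProduct.assoc k X D D (TensorProduct.map X.ract LinearMap.id t) =
    TensorProduct.map LinearMap.id D.Δ t := sub_eq_zero.1 ht
  have h1 := congrArg (TensorProduct.map LinearMap.id ((TensorProduct.rid k D).toLinearMap ∘ₗ
    TensorProduct.map LinearMap.id D.ε)) ht'
  have h2 : ∀ t : X ⊗[k] D, TensorProduct.map LinearMap.id ((TensorProduct.rid k D).toLinearMap ∘ₗ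
      TensorProduct.map LinearMap.id D.ε) (TensorProduct.assoc k X D D
        (TensorProduct.map X.ract LinearMap.id t)) =
      X.ract (TensorProduct.rid k X (TensorProduct.map LinearMap.id D.ε t)) := fun t => by
    induction t with
    | zero => simp
    | add x y hx hy => simp only [map_add, hx, hy]
    | tmul x d =>
      simp only [map_tmul, LinearMap.id_apply, TensorProduct.rid_tmul, map_smul]
      generalize X.ract x = s
      induction s with
      | zero => simp
      | add x y hx hy => simp only [map_add, add_tmul, smul_add, hx, hy]
      | tmul a b => simp
  have h3 : ∀ t : X ⊗[k] D, TensorProduct.map LinearMap.id ((TensorProduct.rid k D).toLinearMap ∘ₗ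
      TensorProduct.map LinearMap.id D.ε) (TensorProduct.map LinearMap.id D.Δ t) = t := fun t => by
    induction t with
    | zero => simp
    | add x y hx hy => simp only [map_add, hx, hy]
    | tmul x d =>
      have h := LinearMap.congr_fun (regular D).ract_counit d
      simp only [LinearMap.comp_apply, LinearMap.id_apply, LinearEquiv.coe_coe] at h
      conv_rhs => rw [← h]
      rfl
  rw [h2, h3] at h1
  exact h1

lemma unitR_naturality {X X' : Bicomod C D} (f : X ⟶ X') :
    f ≫ unitR X' = unitR X ≫ cotMap f (𝟙 _) :=
  cot_hom_ext (by
    rw [Category.assoc, Category.assoc, cotMap_ι, unitR_ι, ← Category.assoc, unitR_ι,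
      coactR_naturality])

end Unit

/-! ### Cotensor products with bicomodules of the form `X ⊗ W`. -/

section OuterCotensor

/-- The isomorphism `(X □ Y) ⊗ W ≅ X □ (Y ⊗ W)`. -/
noncomputable def cotOuterR (X : Bicomod C D) (Y : Bicomod D E) (W : Bicomod F G) :
    outer (cotensor X Y) W ⟶ cotensor X (outer Y W) :=
  cotLift (outerMap₂ (cotι X Y) (𝟙 W) ≫ outerAssoc X Y W) fun t => by
    refine (cmp_outer_right_eq_zero_iff X Y W _).2 ?_
    change TensorProduct.map (cmp X Y) LinearMap.id
      (TensorProduct.map (cotι X Y).lin LinearMap.id _) = 0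
    rw [← LinearMap.comp_apply, ← TensorProduct.map_comp, (cotι_exact X Y).linearMap_comp_eq_zero,
      TensorProduct.map_zero_left, LinearMap.zero_apply]

lemma cotOuterR_ι (X : Bicomod C D) (Y : Bicomod D E) (W : Bicomod F G) :
    cotOuterR X Y W ≫ cotι _ _ = outerMap₂ (cotι X Y) (𝟙 W) ≫ outerAssoc X Y W := rfl

/-- The equalizer condition for `X □ (Y ⊗ W)` is the one for `X □ Y` tensored with `W`, and
tensoring with `W` commutes with kernels. -/
instance (X : Bicomod C D) (Y : Bicomod D E) (W : Bicomod F G) : IsIso (cotOuterR X Y W) := by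
  refine isIso_cotLift _ _ ((TensorProduct.assoc k X Y W).injective.comp
    (map_injective_id (cotι_injective X Y))) fun t ht => ?_
  obtain ⟨t, rfl⟩ := (TensorProduct.assoc k X Y W).surjective t
  obtain ⟨s, rfl⟩ := exists_map_id' (cotι_exact X Y) ((cmp_outer_right_eq_zero_iff X Y W _).1 ht)
  exact ⟨s, rfl⟩

lemma cotOuterR_naturality {X X' : Bicomod C D} {Y Y' : Bicomod D E} {W W' : Bicomod F G}
    (f : X ⟶ X') (g : Y ⟶ Y') (h : W ⟶ W') :
    outerMap₂ (cotMap f g) h ≫ cotOuterR X' Y' W' =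
      cotOuterR X Y W ≫ cotMap f (outerMap₂ g h) := cot_hom_ext (by
  rw [Category.assoc, cotOuterR_ι, Category.assoc, cotMap_ι, ← Category.assoc, outerMap₂_comp,
    cotMap_ι, Category.comp_id, ← Category.id_comp h, ← outerMap₂_comp, Category.assoc,
    outerAssoc_naturality, Category.id_comp, ← Category.assoc, ← Category.assoc, cotOuterR_ι])

lemma inv_outerAssoc_lin (X : Bicomod C D) (Y : Bicomod E F) (Z : Bicomod G H) :
    (inv (outerAssoc X Y Z)).lin = (TensorProduct.assoc k X Y Z).symm.toLinearMap := by
  have h := congrArg Hom.lin (IsIso.inv_hom_id (outerAssoc X Y Z))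
  refine LinearMap.ext fun t => (TensorProduct.assoc k X Y Z).injective ?_
  rw [LinearEquiv.coe_coe, LinearEquiv.apply_symm_apply]
  exact LinearMap.congr_fun h t

/-- The isomorphism `W ⊗ (X □ Y) ≅ (W ⊗ X) □ Y`. -/
noncomputable def cotOuterL (W : Bicomod F G) (X : Bicomod C D) (Y : Bicomod D E) :
    outer W (cotensor X Y) ⟶ cotensor (outer W X) Y :=
  cotLift (outerMap₂ (𝟙 W) (cotι X Y) ≫ inv (outerAssoc W X Y)) fun t => by
    refine (cmp_outer_left_eq_zero_iff W X Y _).2 ?_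
    rw [comp_lin, LinearMap.comp_apply, inv_outerAssoc_lin, LinearEquiv.coe_coe,
      LinearEquiv.apply_symm_apply]
    change TensorProduct.map LinearMap.id (cmp X Y)
      (TensorProduct.map LinearMap.id (cotι X Y).lin _) = 0
    rw [← LinearMap.comp_apply, ← TensorProduct.map_comp, (cotι_exact X Y).linearMap_comp_eq_zero,
      TensorProduct.map_zero_right, LinearMap.zero_apply]

lemma cotOuterL_ι (W : Bicomod F G) (X : Bicomod C D) (Y : Bicomod D E) :
    cotOuterL W X Y ≫ cotι _ _ = outerMap₂ (𝟙 W) (cotι X Y) ≫ inv (outerAssoc W X Y) := rfl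

instance (W : Bicomod F G) (X : Bicomod C D) (Y : Bicomod D E) : IsIso (cotOuterL W X Y) := by
  refine isIso_cotLift _ _ ?_ fun t ht => ?_
  · rw [comp_lin, inv_outerAssoc_lin]
    exact (TensorProduct.assoc k W X Y).symm.injective.comp (map_id_injective (cotι_injective X Y))
  · obtain ⟨s, hs⟩ := exists_map_id (cotι_exact X Y) ((cmp_outer_left_eq_zero_iff W X Y _).1 ht)
    refine ⟨s, (TensorProduct.assoc k W X Y).injective ?_⟩
    rw [← hs, comp_lin, LinearMap.comp_apply, inv_outerAssoc_lin, LinearEquiv.coe_coe,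
      LinearEquiv.apply_symm_apply]
    rfl

lemma cotOuterL_naturality {W W' : Bicomod F G} {X X' : Bicomod C D} {Y Y' : Bicomod D E}
    (h : W ⟶ W') (f : X ⟶ X') (g : Y ⟶ Y') :
    outerMap₂ h (cotMap f g) ≫ cotOuterL W' X' Y' =
      cotOuterL W X Y ≫ cotMap (outerMap₂ h f) g := cot_hom_ext (by
  have e : inv (outerAssoc W X Y) ≫ outerMap₂ (outerMap₂ h f) g =
      outerMap₂ h (outerMap₂ f g) ≫ inv (outerAssoc W' X' Y') := by
    rw [IsIso.inv_comp_eq, ← Category.assoc, IsIso.eq_comp_inv, outerAssoc_naturality]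
  rw [Category.assoc, cotOuterL_ι, Category.assoc, cotMap_ι, ← Category.assoc, outerMap₂_comp,
    cotMap_ι, Category.comp_id, ← Category.id_comp h, ← outerMap₂_comp, Category.assoc,
    Category.id_comp, ← e, ← Category.assoc, ← Category.assoc, cotOuterL_ι])

/-- The isomorphism `X ⊗ W ≅ X □ (D ⊗ W)`. -/
noncomputable def cofreeR (X : Bicomod C D) (W : Bicomod E F) :
    outer X W ⟶ cotensor X (outer (regular D) W) :=
  outerMap₂ (unitR X) (𝟙 W) ≫ cotOuterR X (regular D) W

instance {X X' : Bicomod C D} {Y Y' : Bicomod E F} (f : X ⟶ X') (g : Y ⟶ Y') [IsIso f] [IsIso g] :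
    IsIso (outerMap₂ f g) :=
  ⟨outerMap₂ (inv f) (inv g), by simp [outerMap₂_comp, outerMap₂_id],
    by simp [outerMap₂_comp, outerMap₂_id]⟩

instance (X : Bicomod C D) (W : Bicomod E F) : IsIso (cofreeR X W) := by
  unfold cofreeR; infer_instance

lemma cofreeR_naturality {X X' : Bicomod C D} {W W' : Bicomod E F} (f : X ⟶ X') (g : W ⟶ W') :
    outerMap₂ f g ≫ cofreeR X' W' = cofreeR X W ≫ cotMap f (outerMap₂ (𝟙 _) g) := by
  unfold cofreeR
  rw [Category.assoc, ← cotOuterR_naturality, ← Category.assoc, outerMap₂_comp, ← Category.assoc,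
    outerMap₂_comp, unitR_naturality, Category.comp_id, Category.id_comp]

end OuterCotensor

end Bicomod

end DGC

/-! ### Abstract total complexes: comparison by columns, and augmentations of exact sequences. -/

namespace DGC
variable {k : Type v} [Field k]

namespace DGVect

/-- `V` is a total complex of the sequence `A 0 → A 1 → ⋯`, with inclusions `i r` and
projections `p r` of the columns. -/
structure DTot (A : ℕ → DGVect.{v, u} k) (δ : ∀ r, A r →ₗ[k] A (r + 1)) (V : DGVect.{v, u} k) where
  i : ∀ r, A r →ₗ[k] V
  p : ∀ r, V →ₗ[k] A r
  i_deg : ∀ r : ℕ, IsDeg (r : ℤ) (i r)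
  p_deg : ∀ r : ℕ, IsDeg (-(r : ℤ)) (p r)
  d_i : ∀ r x, V.d (i r x) = sgn k r • i r ((A r).d x) + i (r + 1) (δ r x)
  p_i : ∀ r x, p r (i r x) = x
  p_i_ne : ∀ r s x, r ≠ s → p r (i s x) = 0
  sum : ∀ x, ∃ N, ∀ N' ≥ N, x = ∑ r ∈ Finset.range N', i r (p r x)

namespace DTot

variable {A A' : ℕ → DGVect.{v, u} k} {δ : ∀ r, A r →ₗ[k] A (r + 1)}
  {δ' : ∀ r, A' r →ₗ[k] A' (r + 1)} {V V' : DGVect.{v, u} k} (T : DTot A δ V) (T' : DTot A' δ' V')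

lemma hom_ext {X : Type*} [AddCommGroup X] [Module k X] {f g : V →ₗ[k] X}
    (h : ∀ r x, f (T.i r x) = g (T.i r x)) : f = g := LinearMap.ext fun x => by
  obtain ⟨N, hN⟩ := T.sum x
  rw [hN N le_rfl, map_sum, map_sum]
  exact Finset.sum_congr rfl fun r _ => h r _

lemma eq_zero {x : V} (h : ∀ r, T.p r x = 0) : x = 0 := by
  obtain ⟨N, hN⟩ := T.sum x
  rw [hN N le_rfl]
  exact Finset.sum_eq_zero fun r _ => by rw [h, map_zero]

lemma exists_p_eq_zero (x : V) : ∃ N, ∀ r ≥ N, T.p r x = 0 := by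
  obtain ⟨N, hN⟩ := T.sum x
  refine ⟨N, fun r hr => ?_⟩
  rw [hN N le_rfl, map_sum]
  refine Finset.sum_eq_zero fun s hs => T.p_i_ne _ _ _ ?_
  have := Finset.mem_range.1 hs
  omega

lemma p_d_zero (x : V) : T.p 0 (V.d x) = (A 0).d (T.p 0 x) := by
  refine LinearMap.congr_fun (f := T.p 0 ∘ₗ V.d) (g := (A 0).d ∘ₗ T.p 0) (T.hom_ext fun r x => ?_) x
  simp only [LinearMap.comp_apply, T.d_i, map_add, map_smul]
  rw [T.p_i_ne 0 (r + 1) _ (by omega), add_zero]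
  by_cases h : r = 0
  · subst h; simp [T.p_i]
  · rw [T.p_i_ne 0 r _ (by omega), T.p_i_ne 0 r _ (by omega), smul_zero, map_zero]

lemma p_d_succ (r : ℕ) (x : V) : T.p (r + 1) (V.d x) =
    sgn k ((r + 1 : ℕ) : ℤ) • (A (r + 1)).d (T.p (r + 1) x) + δ r (T.p r x) := by
  refine LinearMap.congr_fun (f := T.p (r + 1) ∘ₗ V.d)
    (g := sgn k ((r + 1 : ℕ) : ℤ) • (A (r + 1)).d ∘ₗ T.p (r + 1) + δ r ∘ₗ T.p r)
    (T.hom_ext fun s x => ?_) x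
  simp only [LinearMap.comp_apply, LinearMap.add_apply, LinearMap.smul_apply, T.d_i, map_add,
    map_smul]
  by_cases h : s = r
  · subst h
    rw [T.p_i, T.p_i, T.p_i_ne _ _ _ (by omega), T.p_i_ne _ _ _ (by omega)]
    simp
  · rw [T.p_i_ne (r + 1) (s + 1) _ (by omega), T.p_i_ne r s _ (Ne.symm h), map_zero]
    by_cases h' : s = r + 1
    · subst h'; rw [T.p_i, T.p_i]
    · rw [T.p_i_ne _ _ _ (Ne.symm h'), T.p_i_ne _ _ _ (Ne.symm h'), map_zero, smul_zero, smul_zero]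

variable {T T'} in
lemma p_map {f : V →ₗ[k] V'} {g : ∀ r, A r →ₗ[k] A' r} (hf : ∀ r x, f (T.i r x) = T'.i r (g r x))
    (r : ℕ) (x : V) : T'.p r (f x) = g r (T.p r x) := by
  refine LinearMap.congr_fun (f := T'.p r ∘ₗ f) (g := g r ∘ₗ T.p r) (T.hom_ext fun s x => ?_) x
  simp only [LinearMap.comp_apply, hf]
  by_cases h : r = s
  · subst h; rw [T'.p_i, T.p_i]
  · rw [T'.p_i_ne _ _ _ h, T.p_i_ne _ _ _ h, map_zero]

variable {T T'} in
lemma bijective {f : V →ₗ[k] V'} {g : ∀ r, A r →ₗ[k] A' r}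
    (hf : ∀ r x, f (T.i r x) = T'.i r (g r x)) (hg : ∀ r, Function.Bijective (g r)) :
    Function.Bijective f := by
  refine ⟨(injective_iff_map_eq_zero f).2 fun x hx => T.eq_zero fun r => ?_, fun y => ?_⟩
  · have := p_map hf r x
    rw [hx, map_zero] at this
    exact (hg r).1 (this.symm.trans (map_zero _).symm)
  · obtain ⟨N, hN⟩ := T'.sum y
    choose s hs using fun r => (hg r).2 (T'.p r y)
    refine ⟨∑ r ∈ Finset.range N, T.i r (s r), ?_⟩
    rw [map_sum]
    simp only [hf, hs]
    exact (hN N le_rfl).symm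

variable {T T'} in
lemma isMor {f : V →ₗ[k] V'} {g : ∀ r, A r →ₗ[k] A' r} (hf : ∀ r x, f (T.i r x) = T'.i r (g r x))
    (hg : ∀ r, IsMor (g r)) (hδ : ∀ r x, g (r + 1) (δ r x) = δ' r (g r x)) : IsMor f where
  deg n x hx := by
    obtain ⟨N, hN⟩ := T.sum x
    rw [hN N le_rfl, map_sum]
    refine sum_mem fun r _ => ?_
    rw [hf]
    exact mem_cast (T'.i_deg r _ _ ((hg r).deg _ _ (T.p_deg r _ _ hx))) (by ring)
  comm := T.hom_ext fun r x => by
    simp only [LinearMap.comp_apply, T.d_i, map_add, map_smul, hf, T'.d_i, hδ, (hg r).comm_apply]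

end DTot

lemma eq_zero_of_gr {V : DGVect.{v, u} k} {a n : ℤ} (hV : ∀ n < a, V.gr n = ⊥) (hn : n < a) {x : V}
    (hx : x ∈ V.gr n) : x = 0 := by
  rw [hV n hn] at hx
  exact hx

variable {A A' : ℕ → DGVect.{v, u} k} {δ : ∀ r, A r →ₗ[k] A (r + 1)}
  {δ' : ∀ r, A' r →ₗ[k] A' (r + 1)} {V V' : DGVect.{v, u} k}

/-- A map of total complexes that is a quasi-isomorphism in each column is a quasi-isomorphism if
the columns are uniformly bounded below. -/
theorem QI.of_columns {T : DTot A δ V} {T' : DTot A' δ' V'} {f : V →ₗ[k] V'}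
    {g : ∀ r, A r →ₗ[k] A' r} (hfm : IsMor f) (hf : ∀ r x, f (T.i r x) = T'.i r (g r x))
    (hg : ∀ r, QI (V := A r) (W := A' r) (g r)) {a : ℤ}
    (hA : ∀ r, ∀ n < a, (A r).gr n = ⊥) (hA' : ∀ r, ∀ n < a, (A' r).gr n = ⊥) : QI f := by
  intro n
  -- Induction over the columns: `v` and `w` vanish in the columns below `N`, and `m` bounds the
  -- number of columns that can still contribute. In total degree at most `n + 1` the column `r` is
  -- in degree at most `n + 1 - r`, which is below the bound `a` once `r > n + 1 - a`.
  suffices h : ∀ m N : ℕ, n + 1 - a < N + m → ∀ v ∈ V.gr (n + 1), ∀ w ∈ V'.gr n, V.d v = 0 →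
      f v = V'.d w → (∀ r < N, T.p r v = 0) → (∀ r < N, T'.p r w = 0) →
      ∃ v' ∈ V.gr n, V.d v' = v ∧ ∃ w' ∈ V'.gr (n - 1), V'.d w' = w - f v' by
    intro v hv w hw h1 h2
    -- The condition for `N = 0` is `n + 1 - a < m`, and `n + 2 - a` is at most its truncation to a
    -- natural number.
    exact h (n + 2 - a).toNat 0 (by have := Int.self_le_toNat (n + 2 - a); push_cast; omega)
      v hv w hw h1 h2 (by simp) (by simp)
  intro m
  induction m with
  | zero =>
    intro N hN v hv w hw _ _ hv0 hw0
    have e1 : v = 0 := T.eq_zero fun r => by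
      by_cases hr : r < N
      · exact hv0 r hr
      · exact eq_zero_of_gr (hA r) (by push_cast at hN; omega) (T.p_deg r _ _ hv)
    have e2 : w = 0 := T'.eq_zero fun r => by
      by_cases hr : r < N
      · exact hw0 r hr
      · exact eq_zero_of_gr (hA' r) (by push_cast at hN; omega) (T'.p_deg r _ _ hw)
    subst e1 e2
    exact ⟨0, zero_mem _, by simp, 0, zero_mem _, by simp⟩
  | succ m ih =>
    intro N hN v hv w hw hdv hfv hv0 hw0
    have pd : ∀ x : V, (∀ r < N, T.p r x = 0) → T.p N (V.d x) = sgn k N • (A N).d (T.p N x) := by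
      intro x hx
      cases N with
      | zero => rw [T.p_d_zero]; simp
      | succ N => rw [T.p_d_succ, hx N (by omega), map_zero, add_zero]
    have pd' : ∀ x : V', (∀ r < N, T'.p r x = 0) →
        T'.p N (V'.d x) = sgn k N • (A' N).d (T'.p N x) := by
      intro x hx
      cases N with
      | zero => rw [T'.p_d_zero]; simp
      | succ N => rw [T'.p_d_succ, hx N (by omega), map_zero, add_zero]
    have c1 : (A N).d (T.p N v) = 0 := by
      have := pd v hv0
      rw [hdv, map_zero] at this
      have := congrArg (sgn k (N : ℤ) • ·) this
      simpa [smul_smul] using this.symm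
    have c2 : g N (T.p N v) = (A' N).d (sgn k (N : ℤ) • T'.p N w) := by
      rw [map_smul, ← pd' w hw0, ← hfv, DTot.p_map hf]
    -- The leading components of `v` and `w` form a pair to which the hypothesis on the column `N`
    -- applies, in degree `n - N`. The sign on `w` compensates the factor `(-1)^N` in the column
    -- differential.
    obtain ⟨a', ha', e1, b', hb', e2⟩ := hg N (n - N) (T.p N v)
      (mem_cast (T.p_deg N _ _ hv) (by ring)) (sgn k (N : ℤ) • T'.p N w)
      (Submodule.smul_mem _ _ (mem_cast (T'.p_deg N _ _ hw) (by ring))) c1 c2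
    have hx : sgn k (N : ℤ) • T.i N a' ∈ V.gr n :=
      Submodule.smul_mem _ _ (mem_cast (T.i_deg N _ _ ha') (by ring))
    have hy : T'.i N b' ∈ V'.gr (n - 1) := mem_cast (T'.i_deg N _ _ hb') (by ring)
    have hx0 : ∀ r < N, T.p r (sgn k (N : ℤ) • T.i N a') = 0 := fun r hr => by
      rw [map_smul, T.p_i_ne _ _ _ (by omega), smul_zero]
    have hdx0 : ∀ r < N, T.p r (V.d (sgn k (N : ℤ) • T.i N a')) = 0 := fun r hr => by
      rw [map_smul, T.d_i, map_smul, map_add, map_smul, T.p_i_ne _ _ _ (by omega),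
        T.p_i_ne _ _ _ (by omega)]
      simp
    have hy0 : ∀ r < N, T'.p r (T'.i N b') = 0 := fun r hr => T'.p_i_ne _ _ _ (by omega)
    have hdy0 : ∀ r < N, T'.p r (V'.d (T'.i N b')) = 0 := fun r hr => by
      rw [T'.d_i, map_add, map_smul, T'.p_i_ne _ _ _ (by omega), T'.p_i_ne _ _ _ (by omega)]
      simp
    -- Subtracting the coboundary given by the solution `(a', b')` in the column `N` makes the
    -- leading components vanish, and the contributions of `δ` to the next column are left to the
    -- induction.
    obtain ⟨v', hv', e3, w', hw', e4⟩ := ih (N + 1) (by push_cast at hN ⊢; omega)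
      (v - V.d (sgn k (N : ℤ) • T.i N a')) (sub_mem hv (V.d_mem _ _ hx))
      (w - f (sgn k (N : ℤ) • T.i N a') - V'.d (T'.i N b'))
      (sub_mem (sub_mem hw (hfm.deg _ _ hx)) (mem_cast (V'.d_mem _ _ hy) (by ring)))
      (by rw [map_sub, hdv, d_d_apply, sub_zero])
      (by rw [map_sub, map_sub, map_sub, d_d_apply, sub_zero, hfv, hfm.comm_apply])
      (fun r hr => by
        rcases Nat.lt_succ_iff_lt_or_eq.1 hr with h | rfl
        · rw [map_sub, hv0 r h, hdx0 r h, sub_zero]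
        · rw [map_sub, pd _ hx0, map_smul, T.p_i, map_smul, e1, smul_smul, sgn_mul_self, one_smul,
            sub_self])
      (fun r hr => by
        rcases Nat.lt_succ_iff_lt_or_eq.1 hr with h | rfl
        · rw [map_sub, map_sub, hw0 r h, hdy0 r h, DTot.p_map hf, hx0 r h, map_zero, sub_zero,
            sub_zero]
        · rw [map_sub, map_sub, pd' _ hy0, T'.p_i, e2, DTot.p_map hf, map_smul, T.p_i, map_smul,
            smul_sub, smul_smul, sgn_mul_self, one_smul]
          abel)
    refine ⟨v' + sgn k (N : ℤ) • T.i N a', add_mem hv' hx, by rw [map_add, e3]; abel,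
      w' + T'.i N b', add_mem hw' hy, ?_⟩
    rw [map_add, e4, map_add]
    abel

/-- The augmentation of the total complex of an exact sequence is a quasi-isomorphism. -/
theorem QI.of_exact {T : DTot (fun r => A (r + 1)) (fun r => δ (r + 1)) V}
    (hδ : ∀ r, IsMor (δ r)) (h0 : Function.Injective (δ 0))
    (hex : ∀ r x, δ (r + 1) x = 0 → ∃ y, δ r y = x) :
    QI (V := A 0) (W := V) (T.i 0 ∘ₗ δ 0) := by
  -- Exactness holds degree by degree: a preimage of a homogeneous element may be replaced by its
  -- component in that degree.
  have hex' : ∀ r n, ∀ x ∈ (A (r + 1)).gr n, δ (r + 1) x = 0 → ∃ y ∈ (A r).gr n, δ r y = x := by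
    intro r n x hx h
    obtain ⟨y, rfl⟩ := hex r x h
    refine ⟨(A r).proj n y, (A r).proj_mem n y, ?_⟩
    rw [(hδ r).comp_proj, proj_same hx]
  intro n v hv w hw hdv hfv
  -- Descending elimination of the top component of `w`. As `d w` lies in the column `0`, the top
  -- component is killed by `δ`, hence equals `δ s` for some `s` one column lower, and subtracting
  -- the coboundary of `s` removes it. This ends after finitely many steps because elements of `V`
  -- are finite sums, so no bound on degrees is needed here.
  have step : ∀ N : ℕ, ∀ w ∈ V.gr n, T.i 0 (δ 0 v) = V.d w → (∀ r > N, T.p r w = 0) →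
      ∃ t ∈ (A 1).gr n, ∃ u ∈ V.gr (n - 1), V.d u = w - T.i 0 t := by
    intro N
    induction N with
    | zero =>
      intro w hw _ h0
      refine ⟨T.p 0 w, mem_cast (T.p_deg 0 _ _ hw) (by simp), 0, zero_mem _, ?_⟩
      obtain ⟨N, hN⟩ := T.sum w
      have := hN (N + 1) (by omega)
      rw [Finset.sum_range_succ', Finset.sum_eq_zero (fun r _ => by
        rw [h0 _ (by omega), map_zero]), zero_add] at this
      rw [map_zero, ← this, sub_self]
    | succ N ih =>
      intro w hw hdw hN
      have h1 : δ (N + 2) (T.p (N + 1) w) = 0 := by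
        have := T.p_d_succ (N + 1) w
        rw [← hdw, hN (N + 2) (by omega), map_zero, smul_zero,
          T.p_i_ne (N + 1 + 1) 0 _ (by omega)] at this
        exact (this.trans (zero_add _)).symm
      obtain ⟨s, hs, e⟩ := hex' (N + 1) _ _ (T.p_deg (N + 1) _ _ hw) h1
      have hu : T.i N s ∈ V.gr (n - 1) := mem_cast (T.i_deg N _ _ hs) (by push_cast; ring)
      obtain ⟨t, ht, u, hu', e'⟩ := ih (w - V.d (T.i N s))
        (sub_mem hw (mem_cast (V.d_mem _ _ hu) (by ring)))
        (by rw [map_sub, d_d_apply, sub_zero, hdw]) (fun r hr => by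
          rw [map_sub, T.d_i, map_add, map_smul, T.p_i_ne r N _ (by omega), smul_zero, zero_add]
          by_cases h : r = N + 1
          · subst h; rw [T.p_i, e, sub_self]
          · rw [T.p_i_ne _ _ _ h, hN r (by omega), sub_zero])
      refine ⟨t, ht, u + T.i N s, add_mem hu' hu, ?_⟩
      rw [map_add, e']; abel
  obtain ⟨N, hN⟩ := T.exists_p_eq_zero w
  obtain ⟨t, ht, u, hu, e⟩ := step N w hw hfv (fun r hr => hN r (by omega))
  have e1 : V.d (T.i 0 t) = T.i 0 (δ 0 v) := by
    have := congrArg V.d e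
    rw [d_d_apply, map_sub, ← hfv] at this
    exact (sub_eq_zero.1 this.symm).symm
  -- Read off column `1` of `e1`. Exactness then gives `t = δ 0 s`, and column `0` of `e1` with
  -- injectivity of `δ 0` gives `d s = v`.
  have e2 : δ 1 t = 0 := by
    have := congrArg (T.p 1) e1
    rw [T.p_i_ne _ _ _ (by omega), T.d_i, map_add, map_smul, T.p_i_ne _ _ _ (by omega), smul_zero,
      zero_add, T.p_i] at this
    exact this
  obtain ⟨s, hs, rfl⟩ := hex' 0 n t ht e2
  refine ⟨s, hs, h0 ?_, u, hu, e⟩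
  have := congrArg (T.p 0) e1
  rw [T.p_i, T.p_d_zero, T.p_i, ← (hδ 0).comm_apply] at this
  exact this

/-- The standard total complex. -/
noncomputable def totDTot (A : ℕ → DGVect.{v, u} k) (δ : ∀ r, A r →ₗ[k] A (r + 1))
    (hδ : ∀ r, IsMor (δ r)) (h : ∀ r, δ (r + 1) ∘ₗ δ r = 0) : DTot A δ (tot A δ hδ h) where
  i r := DirectSum.lof k ℕ (fun r => A r) r
  p r := DirectSum.component k ℕ (fun r => A r) r
  i_deg r n x hx := lof_mem (fun r => (A r).shift (-(r : ℤ))) r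
    (mem_cast (V := A r) hx (by ring))
  p_deg r n := seq_mem (V := fun r => (A r).shift (-(r : ℤ)))
    (f := DirectSum.component k ℕ (fun r => A r) r) fun s x hx => by
      by_cases h : s = r
      · subst h
        have : DirectSum.component k ℕ (fun r => A r) s (DirectSum.lof k ℕ (fun r => A r) s x) = x :=
          DirectSum.component.lof_self ..
        rw [show DirectSum.component k ℕ (fun r => A r) s (DirectSum.lof k ℕ
          (fun r => ((A r).shift (-(r : ℤ))).carrier) s x) = x from this]
        exact hx
      · have : DirectSum.component k ℕ (fun r => A r) r (DirectSum.lof k ℕ (fun r => A r) s x) = 0 := by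
          rw [DirectSum.component.of, dif_neg h]
        rw [show DirectSum.component k ℕ (fun r => A r) r (DirectSum.lof k ℕ
          (fun r => ((A r).shift (-(r : ℤ))).carrier) s x) = 0 from this]
        exact zero_mem _
  d_i r x := by
    have := DirectSum.toModule_lof (M := fun r => ((A r).shift (-(r : ℤ))).carrier)
      (φ := fun r => DirectSum.lof k ℕ (fun r => ((A r).shift (-(r : ℤ))).carrier) r ∘ₗ
        ((A r).shift (-(r : ℤ))).d +
        DirectSum.lof k ℕ (fun r => ((A r).shift (-(r : ℤ))).carrier) (r + 1) ∘ₗ δ r) k r x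
    refine this.trans ?_
    rw [LinearMap.add_apply, LinearMap.comp_apply, LinearMap.comp_apply]
    congr 1
    change DirectSum.lof k ℕ (fun r => (A r).carrier) r (sgn k (-(r : ℤ)) • (A r).d x) = _
    rw [map_smul, sgn_neg]
  p_i r x := DirectSum.component.lof_self ..
  p_i_ne r s x hrs := by
    rw [DirectSum.component.of, dif_neg (Ne.symm hrs)]
  sum x := by
    classical
    induction x using DirectSum.induction_on with
    | zero => exact ⟨0, fun N _ => by simp⟩
    | add x y hx hy =>
      obtain ⟨N, hN⟩ := hx
      obtain ⟨N', hN'⟩ := hy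
      refine ⟨max N N', fun m hm => ?_⟩
      simp only [map_add, Finset.sum_add_distrib]
      rw [← hN m (le_trans (le_max_left _ _) hm), ← hN' m (le_trans (le_max_right _ _) hm)]
    | of s x =>
      refine ⟨s + 1, fun m hm => ?_⟩
      change DirectSum.lof k ℕ (fun r => (A r).carrier) s x = ∑ r ∈ Finset.range m,
        DirectSum.lof k ℕ (fun r => (A r).carrier) r (DirectSum.component k ℕ
          (fun r => (A r).carrier) r (DirectSum.lof k ℕ (fun r => (A r).carrier) s x))
      rw [Finset.sum_eq_single s]
      · rw [DirectSum.component.lof_self]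
      · intro r _ hr
        rw [DirectSum.component.of, dif_neg (Ne.symm hr), map_zero]
      · intro h
        exact absurd (Finset.mem_range.2 (by omega)) h

end DGVect

end DGC

/-! ### Total complexes under tensor and cotensor products. -/

namespace DGC
variable {k : Type v} [Field k]

lemma map_map_apply {A A' A'' B B' B'' : Type u} [AddCommGroup A] [Module k A] [AddCommGroup A']
    [Module k A'] [AddCommGroup A''] [Module k A''] [AddCommGroup B] [Module k B]
    [AddCommGroup B'] [Module k B'] [AddCommGroup B''] [Module k B''] (f : A →ₗ[k] A')
    (g : B →ₗ[k] B') (f' : A' →ₗ[k] A'') (g' : B' →ₗ[k] B'') (t : A ⊗[k] B) :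
    TensorProduct.map f' g' (TensorProduct.map f g t) =
      TensorProduct.map (f' ∘ₗ f) (g' ∘ₗ g) t := by
  rw [TensorProduct.map_comp, LinearMap.comp_apply]

namespace DGVect

lemma sg_sg (V : DGVect.{v, u} k) (a : ℤ) (x : V) : V.sg a (V.sg a x) = x := by
  refine LinearMap.congr_fun (f := V.sg a ∘ₗ V.sg a) (g := LinearMap.id)
    (DGVect.hom_ext fun n x hx => ?_) x
  simp [sg_of_mem a hx, smul_smul]

lemma isDeg_sg (V : DGVect.{v, u} k) (a : ℤ) : IsDeg 0 (V.sg a) := fun n x hx => by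
  rw [add_zero]; exact sg_mem a hx

namespace DTot

variable {A A' : ℕ → DGVect.{v, u} k} {δ : ∀ r, A r →ₗ[k] A (r + 1)}
  {δ' : ∀ r, A' r →ₗ[k] A' (r + 1)} {V V' : DGVect.{v, u} k}

/-- The tensor product of a total complex with a differential graded vector space on the right. -/
noncomputable def rTensor (T : DTot A δ V) (Y : DGVect.{v, u} k) :
    DTot (fun r => (A r).tensor Y) (fun r => TensorProduct.map (δ r) LinearMap.id)
      (V.tensor Y) where
  i r := TensorProduct.map (T.i r) LinearMap.id
  p r := TensorProduct.map (T.p r) LinearMap.id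
  i_deg r := (T.i_deg r).map (W := Y) (W' := Y) IsMor.id.isDeg (add_zero _)
  p_deg r := (T.p_deg r).map (W := Y) (W' := Y) IsMor.id.isDeg (add_zero _)
  d_i r x := by
    refine LinearMap.congr_fun (f := (V.tensor Y).d ∘ₗ TensorProduct.map (T.i r) LinearMap.id)
      (g := sgn k r • (TensorProduct.map (T.i r) LinearMap.id ∘ₗ ((A r).tensor Y).d) +
        TensorProduct.map (T.i (r + 1)) LinearMap.id ∘ₗ TensorProduct.map (δ r) LinearMap.id)
      (tensor_hom_ext fun m n a ha y hy => ?_) x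
    have h := tensor_d_tmul (T.i_deg r _ _ ha) y
    have h' := tensor_d_tmul ha y
    simp only [LinearMap.comp_apply, LinearMap.add_apply, LinearMap.smul_apply, map_tmul,
      LinearMap.id_apply] at h h' ⊢
    rw [h, h', T.d_i, add_tmul, map_add, map_smul, map_tmul, map_tmul, LinearMap.id_apply,
      LinearMap.id_apply, smul_add, smul_smul, ← smul_tmul', add_comm m, sgn_add]
    abel
  p_i r x := by
    rw [← LinearMap.comp_apply, ← TensorProduct.map_comp,
      show T.p r ∘ₗ T.i r = LinearMap.id from LinearMap.ext (T.p_i r), LinearMap.id_comp,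
      TensorProduct.map_id, LinearMap.id_apply]
  p_i_ne r s x h := by
    rw [← LinearMap.comp_apply, ← TensorProduct.map_comp,
      show T.p r ∘ₗ T.i s = 0 from LinearMap.ext fun x => T.p_i_ne r s x h,
      TensorProduct.map_zero_left, LinearMap.zero_apply]
  sum x := by
    induction x using TensorProduct.induction_on with
    | zero => exact ⟨0, fun N _ => by simp⟩
    | add x y hx hy =>
      obtain ⟨N, hN⟩ := hx
      obtain ⟨N', hN'⟩ := hy
      refine ⟨max N N', fun m hm => ?_⟩
      simp only [map_add, Finset.sum_add_distrib]
      rw [← hN m (le_trans (le_max_left _ _) hm), ← hN' m (le_trans (le_max_right _ _) hm)]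
    | tmul a y =>
      obtain ⟨N, hN⟩ := T.sum a
      refine ⟨N, fun m hm => ?_⟩
      simp only [map_tmul, LinearMap.id_apply]
      rw [← TensorProduct.sum_tmul, ← hN m hm]

/-- The tensor product of a total complex with a differential graded vector space on the left. -/
noncomputable def lTensor (X : DGVect.{v, u} k) (T : DTot A δ V) :
    DTot (fun r => X.tensor (A r)) (fun r => TensorProduct.map LinearMap.id (δ r))
      (X.tensor V) where
  -- The inclusion of the column `r` has degree `r`, and `X.sg r` is its Koszul sign against `X`. It
  -- is what gives the differential of `X ⊗ A r` the sign `(-1)^r` on both of its terms.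
  i r := TensorProduct.map (X.sg r) (T.i r)
  p r := TensorProduct.map (X.sg r) (T.p r)
  i_deg r := (X.isDeg_sg r).map (T.i_deg r) (zero_add _)
  p_deg r := (X.isDeg_sg r).map (T.p_deg r) (zero_add _)
  d_i r x := by
    refine LinearMap.congr_fun (f := (X.tensor V).d ∘ₗ TensorProduct.map (X.sg r) (T.i r))
      (g := sgn k r • (TensorProduct.map (X.sg r) (T.i r) ∘ₗ (X.tensor (A r)).d) +
        TensorProduct.map (X.sg (r + 1 : ℕ)) (T.i (r + 1)) ∘ₗ TensorProduct.map LinearMap.id (δ r))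
      (tensor_hom_ext fun m n x hx a ha => ?_) x
    have h := tensor_d_tmul hx (T.i r a)
    have h' := tensor_d_tmul hx a
    simp only [LinearMap.comp_apply, LinearMap.add_apply, LinearMap.smul_apply, map_tmul,
      LinearMap.id_apply, sg_of_mem _ hx, ← smul_tmul', map_smul] at h h' ⊢
    rw [h, h', T.d_i, tmul_add, map_add, map_smul, map_tmul, map_tmul,
      sg_of_mem _ (X.d_mem _ _ hx), sg_of_mem _ hx]
    simp only [← smul_tmul', tmul_smul, smul_add, smul_smul, mul_add, mul_one, sgn_add]
    push_cast
    simp only [add_mul, one_mul, sgn_add]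
    rw [mul_left_comm (sgn k (r : ℤ)), sgn_mul_self, mul_one, ← mul_assoc (sgn k (r : ℤ)),
      mul_comm (sgn k (r : ℤ) * _), mul_comm (sgn k (r : ℤ)) (sgn k m), ← mul_assoc, add_assoc]
  p_i r x := by
    rw [← LinearMap.comp_apply, ← TensorProduct.map_comp,
      show T.p r ∘ₗ T.i r = LinearMap.id from LinearMap.ext (T.p_i r),
      show X.sg r ∘ₗ X.sg r = LinearMap.id from LinearMap.ext (X.sg_sg r),
      TensorProduct.map_id, LinearMap.id_apply]
  p_i_ne r s x h := by
    rw [← LinearMap.comp_apply, ← TensorProduct.map_comp,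
      show T.p r ∘ₗ T.i s = 0 from LinearMap.ext fun x => T.p_i_ne r s x h,
      TensorProduct.map_zero_right, LinearMap.zero_apply]
  sum x := by
    induction x using TensorProduct.induction_on with
    | zero => exact ⟨0, fun N _ => by simp⟩
    | add x y hx hy =>
      obtain ⟨N, hN⟩ := hx
      obtain ⟨N', hN'⟩ := hy
      refine ⟨max N N', fun m hm => ?_⟩
      simp only [map_add, Finset.sum_add_distrib]
      rw [← hN m (le_trans (le_max_left _ _) hm), ← hN' m (le_trans (le_max_right _ _) hm)]
    | tmul x a =>
      obtain ⟨N, hN⟩ := T.sum a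
      refine ⟨N, fun m hm => ?_⟩
      simp only [map_tmul, sg_sg]
      rw [← TensorProduct.tmul_sum, ← hN m hm]

/-- A subcomplex of a total complex that is compatible with the columns is a total complex. -/
def restrict (T : DTot A δ V) {ι : V' →ₗ[k] V} (hι : IsMor ι) (hinj : Function.Injective ι)
    {ι' : ∀ r, A' r →ₗ[k] A r} (hι' : ∀ r, IsMor (ι' r)) (hinj' : ∀ r, Function.Injective (ι' r))
    (i : ∀ r, A' r →ₗ[k] V') (p : ∀ r, V' →ₗ[k] A' r)
    (hi : ∀ r x, ι (i r x) = T.i r (ι' r x)) (hp : ∀ r x, ι' r (p r x) = T.p r (ι x))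
    (hδ : ∀ r x, ι' (r + 1) (δ' r x) = δ r (ι' r x)) : DTot A' δ' V' where
  i := i
  p := p
  i_deg r n x hx := hι.mem_of_injective hinj (by
    rw [hi]; exact T.i_deg r _ _ ((hι' r).deg _ _ hx))
  p_deg r n x hx := (hι' r).mem_of_injective (hinj' r) (by
    rw [hp]; exact T.p_deg r _ _ (hι.deg _ _ hx))
  d_i r x := hinj (by
    rw [hι.comm_apply, hi, T.d_i, map_add, map_smul, hi, hi, hδ, (hι' r).comm_apply])
  p_i r x := hinj' r (by rw [hp, hi, T.p_i])
  p_i_ne r s x h := hinj' r (by rw [hp, hi, T.p_i_ne _ _ _ h, map_zero])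
  sum x := by
    obtain ⟨N, hN⟩ := T.sum (ι x)
    refine ⟨N, fun m hm => hinj ?_⟩
    rw [map_sum]
    simp only [hi, hp]
    exact hN m hm

end DTot

end DGVect

namespace Bicomod

variable {C D E F : DGCoalg.{v, u} k}

/-- `V` is a total complex of the sequence `A 0 → A 1 → ⋯` of bicomodules. -/
structure Tot (A : ℕ → Bicomod C D) (δ : ∀ r, A r ⟶ A (r + 1)) (V : Bicomod C D) extends
    DGVect.DTot (fun r => (A r).toDGVect) (fun r => (δ r).lin) V.toDGVect where
  i_colin : ∀ r : ℕ, IsColin (r : ℤ) (i r)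

section Cot

variable {X X' : Bicomod C D} {Y Y' : Bicomod D E}

lemma IsColin.outer_right {a : ℤ} {f : X →ₗ[k] X'} (hf : IsColin a f) (Y : Bicomod E F) :
    IsColin (M := outer X Y) (N := outer X' Y) a (TensorProduct.map f LinearMap.id) where
  deg := hf.deg.map (W := Y.toDGVect) (W' := Y.toDGVect) DGVect.IsMor.id.isDeg (add_zero _)
  left := by
    refine TensorProduct.ext' fun x y => ?_
    have h := LinearMap.congr_fun hf.left x
    simp only [LinearMap.comp_apply, map_tmul, LinearMap.id_apply, LinearEquiv.coe_coe] at h ⊢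
    rw [h]
    generalize X.lact x = t
    induction t with
    | zero => simp
    | add x y hx hy => simp only [add_tmul, map_add, hx, hy]
    | tmul c p => simp
  right := by
    refine TensorProduct.ext' fun x y => ?_
    simp only [LinearMap.comp_apply, map_tmul, LinearMap.id_apply, LinearEquiv.coe_coe]
    generalize Y.ract y = t
    induction t with
    | zero => simp
    | add x y hx hy => simp only [tmul_add, map_add, hx, hy]
    | tmul c p => simp

lemma lact_sg (X : Bicomod C D) (a : ℤ) (x : X) :
    X.lact (X.sg a x) = TensorProduct.map (C.sg a) (X.sg a) (X.lact x) := by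
  have := LinearMap.congr_fun (X.isMor_lact.comp_sg a) x
  rwa [DGVect.sg_tensor] at this

lemma ract_sg (X : Bicomod C D) (a : ℤ) :
    X.ract ∘ₗ X.sg a = TensorProduct.map (X.sg a) (D.sg a) ∘ₗ X.ract := by
  have := X.isMor_ract.comp_sg a
  rwa [DGVect.sg_tensor] at this

/-- The left coaction of `X ⊗ Y` only involves `X`, so the twist `C.sg a` required of a map of
degree `a` has to come from the sign `X.sg a`. It does because the coaction has degree zero and
commutes with these sign operators (`lact_sg`). -/
lemma IsColin.outer_left (X : Bicomod C D) {Y Y' : Bicomod E F} {a : ℤ} {g : Y →ₗ[k] Y'}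
    (hg : IsColin a g) :
    IsColin (M := outer X Y) (N := outer X Y') a (TensorProduct.map (X.sg a) g) where
  deg := (X.isDeg_sg a).map hg.deg (zero_add _)
  left := by
    refine TensorProduct.ext' fun x y => ?_
    simp only [LinearMap.comp_apply, map_tmul, LinearMap.id_apply, LinearEquiv.coe_coe]
    rw [lact_sg]
    generalize X.lact x = t
    induction t with
    | zero => simp
    | add x y hx hy => simp only [add_tmul, map_add, hx, hy]
    | tmul c p => simp
  right := by
    refine TensorProduct.ext' fun x y => ?_
    have h := LinearMap.congr_fun hg.right y
    simp only [LinearMap.comp_apply, map_tmul, LinearMap.id_apply, LinearEquiv.coe_coe] at h ⊢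
    rw [h]
    generalize Y.ract y = t
    induction t with
    | zero => simp
    | add x y hx hy => simp only [tmul_add, map_add, hx, hy]
    | tmul c p => simp

/-- The map `f □ Y` for a graded map `f` that is colinear on the right. -/
noncomputable def cotRight {f : X →ₗ[k] X'}
    (hf : X'.ract ∘ₗ f = TensorProduct.map f LinearMap.id ∘ₗ X.ract) (Y : Bicomod D E) :
    cotensor X Y →ₗ[k] cotensor X' Y :=
  cotLin f LinearMap.id LinearMap.id hf (by rw [TensorProduct.map_id]; rfl)

lemma cotι_cotRight {f : X →ₗ[k] X'}
    (hf : X'.ract ∘ₗ f = TensorProduct.map f LinearMap.id ∘ₗ X.ract) (Y : Bicomod D E)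
    (t : cotensor X Y) : (cotι X' Y).lin (cotRight hf Y t) =
      TensorProduct.map f LinearMap.id ((cotι X Y).lin t) := rfl

/-- The map `± X □ g` for a graded map `g` of degree `a` that is colinear on the left. -/
noncomputable def cotLeft (X : Bicomod C D) (a : ℤ) {g : Y →ₗ[k] Y'}
    (hg : Y'.lact ∘ₗ g = TensorProduct.map (D.sg a) g ∘ₗ Y.lact) :
    cotensor X Y →ₗ[k] cotensor X Y' :=
  cotLin (X.sg a) g (D.sg a) (ract_sg X a) hg

lemma cotι_cotLeft (X : Bicomod C D) (a : ℤ) {g : Y →ₗ[k] Y'}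
    (hg : Y'.lact ∘ₗ g = TensorProduct.map (D.sg a) g ∘ₗ Y.lact) (t : cotensor X Y) :
    (cotι X Y').lin (cotLeft X a hg t) =
      TensorProduct.map (X.sg a) g ((cotι X Y).lin t) := rfl

lemma IsColin.cotRight {a : ℤ} {f : X →ₗ[k] X'} (hf : IsColin a f) (Y : Bicomod D E) :
    IsColin a (cotRight hf.right Y) :=
  .of_comp (cotι_injective X' Y) ((hf.outer_right Y).comp (cotι X Y).isColin (zero_add a))

lemma IsColin.cotLeft (X : Bicomod C D) {a : ℤ} {g : Y →ₗ[k] Y'} (hg : IsColin a g) :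
    IsColin a (cotLeft X a hg.left) :=
  .of_comp (cotι_injective X Y') ((IsColin.outer_left X hg).comp (cotι X Y).isColin (zero_add a))

end Cot

namespace Tot

variable {A A' : ℕ → Bicomod C D} {δ : ∀ r, A r ⟶ A (r + 1)} {δ' : ∀ r, A' r ⟶ A' (r + 1)}
  {V V' : Bicomod C D}

/-- The columns span, and on each column the identity follows from the colinearity of the
inclusions, so it is not part of the structure. -/
lemma p_colin (T : Tot A δ V) (r : ℕ) : IsColin (-(r : ℤ)) (T.p r) where
  deg := T.p_deg r
  left := T.toDTot.hom_ext fun s x => by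
    have h := LinearMap.congr_fun (T.i_colin s).left x
    simp only [LinearMap.comp_apply] at h ⊢
    rw [h, map_map_apply, ← DGVect.sg_add]
    by_cases hrs : r = s
    · subst hrs
      rw [T.p_i, show T.p r ∘ₗ T.i r = LinearMap.id from LinearMap.ext (T.p_i r), neg_add_cancel,
        DGVect.sg_zero, TensorProduct.map_id, LinearMap.id_apply]
    · rw [T.p_i_ne r s x hrs,
        show T.p r ∘ₗ T.i s = 0 from LinearMap.ext fun x => T.p_i_ne r s x hrs,
        TensorProduct.map_zero_right, LinearMap.zero_apply, map_zero]
  right := T.toDTot.hom_ext fun s x => by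
    have h := LinearMap.congr_fun (T.i_colin s).right x
    simp only [LinearMap.comp_apply] at h ⊢
    rw [h, map_map_apply, LinearMap.id_comp]
    by_cases hrs : r = s
    · subst hrs
      rw [T.p_i, show T.p r ∘ₗ T.i r = LinearMap.id from LinearMap.ext (T.p_i r),
        TensorProduct.map_id, LinearMap.id_apply]
    · rw [T.p_i_ne r s x hrs,
        show T.p r ∘ₗ T.i s = 0 from LinearMap.ext fun x => T.p_i_ne r s x hrs,
        TensorProduct.map_zero_left, LinearMap.zero_apply, map_zero]

/-- The cotensor product of a total complex with a bicomodule on the right. -/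
noncomputable def cotR (T : Tot A δ V) (Y : Bicomod D E) :
    Tot (fun r => cotensor (A r) Y) (fun r => cotMap (δ r) (𝟙 Y)) (cotensor V Y) where
  toDTot := (T.toDTot.rTensor Y.toDGVect).restrict (ι := (cotι V Y).lin) (cotι V Y).isMor
    (cotι_injective V Y) (ι' := fun r => (cotι (A r) Y).lin) (fun r => (cotι (A r) Y).isMor)
    (fun r => cotι_injective (A r) Y) (fun r => cotRight (T.i_colin r).right Y)
    (fun r => cotRight (T.p_colin r).right Y) (fun _ _ => rfl) (fun _ _ => rfl) (fun _ _ => rfl)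
  i_colin r := (T.i_colin r).cotRight Y

/-- The cotensor product of a total complex with a bicomodule on the left. -/
noncomputable def cotL (X : Bicomod E C) (T : Tot A δ V) :
    Tot (fun r => cotensor X (A r)) (fun r => cotMap (𝟙 X) (δ r)) (cotensor X V) where
  toDTot := (T.toDTot.lTensor X.toDGVect).restrict (ι := (cotι X V).lin) (cotι X V).isMor
    (cotι_injective X V) (ι' := fun r => (cotι X (A r)).lin) (fun r => (cotι X (A r)).isMor)
    (fun r => cotι_injective X (A r)) (fun r => cotLeft X r (T.i_colin r).left)
    -- The projection has degree `-r`, but its Koszul sign is the same as in degree `r`; writing `r`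
    -- here lets it match the tensor product of the total complex.
    (fun r => cotLeft X r (by rw [← DGVect.sg_neg]; exact (T.p_colin r).left))
    (fun _ _ => rfl) (fun _ _ => rfl) (fun _ _ => rfl)
  i_colin r := IsColin.cotLeft X (T.i_colin r)

/-- The augmentation of a total complex. -/
noncomputable def aug (T : Tot A δ V) {M : Bicomod C D} (f : M ⟶ A 0) (h : f ≫ δ 0 = 0) : M ⟶ V :=
  IsColin.toHom (φ := T.i 0 ∘ₗ f.lin) ((T.i_colin 0).comp f.isColin (by simp))
    (LinearMap.ext fun x => by
      have h1 := LinearMap.congr_fun (congrArg Hom.lin h) x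
      have h2 := f.isMor.comm_apply x
      simp only [comp_lin, LinearMap.comp_apply, zero_lin, LinearMap.zero_apply] at h1 ⊢
      rw [T.d_i, h1, map_zero, add_zero, Nat.cast_zero, sgn_zero, one_smul, h2])

/-- A map of total complexes that is a quasi-isomorphism in each column is a quasi-isomorphism if
the columns are uniformly bounded below. -/
theorem qIso (T : Tot A δ V) (T' : Tot A' δ' V') {f : V ⟶ V'} {g : ∀ r, A r ⟶ A' r}
    (hf : ∀ r x, f.lin (T.i r x) = T'.i r ((g r).lin x)) (hg : ∀ r, QIso (g r)) {a : ℤ}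
    (hA : ∀ r, ∀ n < a, (A r).gr n = ⊥) (hA' : ∀ r, ∀ n < a, (A' r).gr n = ⊥) : QIso f :=
  (qIso_iff_qi f).2 (DGVect.QI.of_columns (T := T.toDTot) (T' := T'.toDTot)
    (g := fun r => (g r).lin) f.isMor hf (fun r => (qIso_iff_qi (g r)).1 (hg r)) hA hA')

end Tot

/-- The standard total complex of bicomodules. -/
noncomputable def totTot (A : ℕ → Bicomod C D) (δ : ∀ r, A r ⟶ A (r + 1))
    (h : ∀ r, δ r ≫ δ (r + 1) = 0) : Tot A δ (tot A δ h) where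
  toDTot := DGVect.totDTot (fun r => (A r).toDGVect) (fun r => (δ r).lin) (fun r => (δ r).isMor)
    (fun r => congrArg Hom.lin (h r))
  i_colin r :=
    { deg := (DGVect.totDTot (fun r => (A r).toDGVect) (fun r => (δ r).lin)
        (fun r => (δ r).isMor) (fun r => congrArg Hom.lin (h r))).i_deg r
      left := by
        refine LinearMap.ext fun x => ?_
        have h1 := DirectSum.toModule_lof (M := fun r => (A r).carrier)
          (φ := fun r => TensorProduct.map LinearMap.id
            (DirectSum.lof k ℕ (fun r => (A r).carrier) r) ∘ₗ
            TensorProduct.map (C.sg (-(r : ℤ))) LinearMap.id ∘ₗ (A r).lact) k r x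
        refine h1.trans ?_
        rw [LinearMap.comp_apply, LinearMap.comp_apply, ← LinearMap.comp_apply,
          ← TensorProduct.map_comp, DGVect.sg_neg, LinearMap.id_comp, LinearMap.comp_id]
        rfl
      right := LinearMap.ext fun x => DirectSum.toModule_lof (M := fun r => (A r).carrier)
        (φ := fun r => TensorProduct.map (DirectSum.lof k ℕ (fun r => (A r).carrier) r)
          LinearMap.id ∘ₗ (A r).ract) k r x }

/-- A family of isomorphisms of the columns induces an isomorphism of total complexes. -/
theorem exists_isIso_tot {A A' : ℕ → Bicomod C D} {δ : ∀ r, A r ⟶ A (r + 1)}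
    (h : ∀ r, δ r ≫ δ (r + 1) = 0) {δ' : ∀ r, A' r ⟶ A' (r + 1)} {V' : Bicomod C D}
    (T' : Tot A' δ' V') (g : ∀ r, A r ⟶ A' r) (hg : ∀ r, IsIso (g r))
    (hδ : ∀ r, δ r ≫ g (r + 1) = g r ≫ δ' r) : ∃ f : tot A δ h ⟶ V', IsIso f := by
  let T := totTot A δ h
  let φ : tot A δ h →ₗ[k] V' := DirectSum.toModule k ℕ V' (fun r => T'.i r ∘ₗ (g r).lin)
  have hφ : ∀ r x, φ (T.i r x) = T'.i r ((g r).lin x) := fun r x =>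
    DirectSum.toModule_lof (M := fun r => (A r).carrier) (φ := fun r => T'.i r ∘ₗ (g r).lin) k r x
  have hm : DGVect.IsMor (V := (tot A δ h).toDGVect) (W := V'.toDGVect) φ :=
    DGVect.DTot.isMor (T := T.toDTot) (T' := T'.toDTot) (g := fun r => (g r).lin) hφ
      (fun r => (g r).isMor) (fun r x => LinearMap.congr_fun (congrArg Hom.lin (hδ r)) x)
  let f : tot A δ h ⟶ V' :=
    { lin := φ
      isMor := hm
      left := T.toDTot.hom_ext fun r x => by
        have h1 := LinearMap.congr_fun (T.i_colin r).left x
        have h2 := LinearMap.congr_fun (T'.i_colin r).left ((g r).lin x)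
        have h3 := LinearMap.congr_fun (g r).left x
        simp only [LinearMap.comp_apply] at h1 h2 h3 ⊢
        rw [hφ, h1, h2, h3, map_map_apply, map_map_apply]
        congr 1
        congr 1
        exact (LinearMap.ext (hφ r)).symm
      right := T.toDTot.hom_ext fun r x => by
        have h1 := LinearMap.congr_fun (T.i_colin r).right x
        have h2 := LinearMap.congr_fun (T'.i_colin r).right ((g r).lin x)
        have h3 := LinearMap.congr_fun (g r).right x
        simp only [LinearMap.comp_apply] at h1 h2 h3 ⊢
        rw [hφ, h1, h2, h3, map_map_apply, map_map_apply]
        congr 1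
        congr 1
        exact (LinearMap.ext (hφ r)).symm }
  refine ⟨f, isIso_of_bijective (DGVect.DTot.bijective (T := T.toDTot) (T' := T'.toDTot)
    (g := fun r => (g r).lin) hφ fun r => ?_)⟩
  have := hg r
  have e1 := congrArg Hom.lin (IsIso.hom_inv_id (g r))
  have e2 := congrArg Hom.lin (IsIso.inv_hom_id (g r))
  exact Function.bijective_iff_has_inverse.2 ⟨(inv (g r)).lin, LinearMap.congr_fun e1,
    LinearMap.congr_fun e2⟩

end Bicomod

end DGC

/-! ### Contractions of the bar sequence and the augmentation of the standard resolution. -/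

namespace DGC
variable {k : Type v} [Field k]

namespace Bicomod

variable {C D E F : DGCoalg.{v, u} k}

section CotMapAdditive

variable {X X' : Bicomod C D} {Y Y' : Bicomod D E}

lemma cotMap_sub_left (f f' : X ⟶ X') (g : Y ⟶ Y') :
    cotMap (f - f') g = cotMap f g - cotMap f' g := cot_hom_ext (by
  rw [Preadditive.sub_comp, cotMap_ι, cotMap_ι, cotMap_ι, ← Preadditive.comp_sub]
  congr 1
  exact hom_ext (by
    rw [sub_lin]
    exact TensorProduct.ext' fun x y => by
      simp [sub_tmul]))

end CotMapAdditive

section Contractible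

variable {A : ℕ → Bicomod C D} {δ : ∀ r, A r ⟶ A (r + 1)} {V : Bicomod C D}

/-- If a sequence of bicomodules has a contraction that is colinear on the right, it remains exact
after cotensor multiplication on the right. -/
theorem Tot.qIso_aug_cotR (T : Tot (fun r => A (r + 1)) (fun r => δ (r + 1)) V)
    (h : δ 0 ≫ δ 1 = 0) (s : ∀ r, A (r + 1) →ₗ[k] A r)
    (hs : ∀ r, (A r).ract ∘ₗ s r = TensorProduct.map (s r) LinearMap.id ∘ₗ (A (r + 1)).ract)
    (h0 : ∀ x, s 0 ((δ 0).lin x) = x)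
    (hδ : ∀ r x, s (r + 1) ((δ (r + 1)).lin x) + (δ r).lin (s r x) = x) (Y : Bicomod D E) :
    QIso (cotMap (T.aug (δ 0) h) (𝟙 Y)) := by
  rw [qIso_iff_qi]
  -- The maps `s` restrict to `A r □ Y` because they are right colinear, which shows that the
  -- sequence of the `A r □ Y` is exact. They are not required to commute with the differentials or
  -- to be homogeneous.
  have key : ∀ r (x : cotensor (A (r + 1)) Y), cotRight (hs (r + 1)) Y
      ((cotMap (δ (r + 1)) (𝟙 Y)).lin x) +
      (cotMap (δ r) (𝟙 Y)).lin (cotRight (hs r) Y x) = x := fun r x => by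
    apply cotι_injective
    rw [map_add]
    change TensorProduct.map (s (r + 1)) LinearMap.id
        (TensorProduct.map (δ (r + 1)).lin LinearMap.id ((cotι _ Y).lin x)) +
      TensorProduct.map (δ r).lin LinearMap.id
        (TensorProduct.map (s r) LinearMap.id ((cotι _ Y).lin x)) = (cotι _ Y).lin x
    rw [map_map_apply, map_map_apply, ← LinearMap.add_apply, LinearMap.id_comp,
      ← TensorProduct.map_add_left, show s (r + 1) ∘ₗ (δ (r + 1)).lin + (δ r).lin ∘ₗ s r =
        LinearMap.id from LinearMap.ext (hδ r), TensorProduct.map_id, LinearMap.id_apply]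
  have e : (cotMap (T.aug (δ 0) h) (𝟙 Y)).lin = (T.cotR Y).i 0 ∘ₗ (cotMap (δ 0) (𝟙 Y)).lin :=
    LinearMap.ext fun x => cotι_injective _ _ (by
      change TensorProduct.map (T.i 0 ∘ₗ (δ 0).lin) LinearMap.id _ =
        TensorProduct.map (T.i 0) LinearMap.id (TensorProduct.map (δ 0).lin LinearMap.id _)
      rw [map_map_apply]
      rfl)
  rw [e]
  exact DGVect.QI.of_exact (A := fun r => (cotensor (A r) Y).toDGVect)
    (δ := fun r => (cotMap (δ r) (𝟙 Y)).lin) (T := (T.cotR Y).toDTot)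
    (fun r => (cotMap (δ r) (𝟙 Y)).isMor)
    (fun x y e => cotι_injective (A 0) Y (map_injective_id (X := Y)
      (Function.LeftInverse.injective h0) (congrArg (cotι _ Y).lin e)))
    (fun r x hx => ⟨cotRight (hs r) Y x, by
      have := key r x
      dsimp only at hx
      rwa [hx, map_zero, zero_add] at this⟩)

/-- If a sequence of bicomodules has a contraction that is colinear on the left, it remains exact
after cotensor multiplication on the left. -/
theorem Tot.qIso_aug_cotL (T : Tot (fun r => A (r + 1)) (fun r => δ (r + 1)) V)
    (h : δ 0 ≫ δ 1 = 0) (s : ∀ r, A (r + 1) →ₗ[k] A r)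
    (hs : ∀ r, (A r).lact ∘ₗ s r = TensorProduct.map LinearMap.id (s r) ∘ₗ (A (r + 1)).lact)
    (h0 : ∀ x, s 0 ((δ 0).lin x) = x)
    (hδ : ∀ r x, s (r + 1) ((δ (r + 1)).lin x) =
      (δ r).lin (s r x) + sgn k ((r + 1 : ℕ) : ℤ) • x) (X : Bicomod E C) :
    QIso (cotMap (𝟙 X) (T.aug (δ 0) h)) := by
  rw [qIso_iff_qi]
  have hs' : ∀ r, (A r).lact ∘ₗ s r = TensorProduct.map (C.sg 0) (s r) ∘ₗ (A (r + 1)).lact :=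
    fun r => by rw [DGVect.sg_zero]; exact hs r
  have key : ∀ r (x : cotensor X (A (r + 1))), cotLeft X 0 (hs' (r + 1))
      ((cotMap (𝟙 X) (δ (r + 1))).lin x) =
      (cotMap (𝟙 X) (δ r)).lin (cotLeft X 0 (hs' r) x) +
        sgn k ((r + 1 : ℕ) : ℤ) • x := fun r x => by
    apply cotι_injective
    rw [map_add, map_smul]
    change TensorProduct.map (X.sg 0) (s (r + 1))
        (TensorProduct.map LinearMap.id (δ (r + 1)).lin ((cotι X _).lin x)) =
      TensorProduct.map LinearMap.id (δ r).lin
        (TensorProduct.map (X.sg 0) (s r) ((cotι X _).lin x)) +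
        sgn k ((r + 1 : ℕ) : ℤ) • ((cotι X (A (r + 1))).lin x)
    rw [map_map_apply, map_map_apply, show s (r + 1) ∘ₗ (δ (r + 1)).lin = (δ r).lin ∘ₗ s r +
        sgn k ((r + 1 : ℕ) : ℤ) • LinearMap.id from LinearMap.ext (hδ r),
      TensorProduct.map_add_right, LinearMap.add_apply, TensorProduct.map_smul_right,
      LinearMap.smul_apply, DGVect.sg_zero, LinearMap.id_comp, TensorProduct.map_id,
      LinearMap.id_apply]
  have e : (cotMap (𝟙 X) (T.aug (δ 0) h)).lin =
      (Tot.cotL X T).i 0 ∘ₗ (cotMap (𝟙 X) (δ 0)).lin :=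
    LinearMap.ext fun x => cotι_injective _ _ (by
      change TensorProduct.map LinearMap.id (T.i 0 ∘ₗ (δ 0).lin) _ =
        TensorProduct.map (X.sg 0) (T.i 0) (TensorProduct.map LinearMap.id (δ 0).lin _)
      rw [map_map_apply, DGVect.sg_zero]
      rfl)
  rw [e]
  exact DGVect.QI.of_exact (A := fun r => (cotensor X (A r)).toDGVect)
    (δ := fun r => (cotMap (𝟙 X) (δ r)).lin) (T := (Tot.cotL X T).toDTot)
    (fun r => (cotMap (𝟙 X) (δ r)).isMor)
    (fun x y e => cotι_injective X (A 0) (map_id_injective (X := X)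
      (Function.LeftInverse.injective h0) (congrArg (cotι X _).lin e)))
    -- The contraction identity carries the sign `(-1)^(r+1)` in front of `x`, so the preimage has
    -- to be rescaled.
    (fun r x hx => ⟨- sgn k ((r + 1 : ℕ) : ℤ) • cotLeft X 0 (hs' r) x, by
      have := key r x
      dsimp only at hx
      rw [hx, map_zero] at this
      rw [map_smul, eq_neg_of_add_eq_zero_left this.symm, smul_neg, neg_smul, neg_neg, smul_smul,
        sgn_mul_self, one_smul]⟩)

end Contractible

section Contraction

variable {N : Bicomod C D}

/-- The recursion step for the differential of the standard resolution. -/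
noncomputable def barNext (β : N ⟶ outer (regular C) N) :
    outer (regular C) N ⟶ outer (regular C) (outer (regular C) N) :=
  coact (outer (regular C) N) - outerMap (regular C) β

lemma barNext_lin (β : N ⟶ outer (regular C) N) (x : C ⊗[k] N) : (barNext β).lin x =
    TensorProduct.assoc k C C N (TensorProduct.map C.Δ LinearMap.id x) -
      TensorProduct.map LinearMap.id β.lin x := by
  unfold barNext
  rw [sub_lin]
  rfl

variable (N) in
/-- The counit on the first factor. -/
noncomputable def counitFst : C ⊗[k] N →ₗ[k] N :=
  (TensorProduct.lid k N).toLinearMap ∘ₗ TensorProduct.map C.ε LinearMap.id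

variable (N) in
lemma counitFst_tmul (c : C) (x : N) : counitFst N (c ⊗ₜ x) = C.ε c • x := rfl

variable (N) in
lemma counitFst_lact (x : N) : counitFst N (N.lact x) = x :=
  LinearMap.congr_fun N.lact_counit x

lemma counitFst_naturality {N : Bicomod C D} {N' : Bicomod C E} (f : N →ₗ[k] N') (t : C ⊗[k] N) :
    counitFst N' (TensorProduct.map LinearMap.id f t) = f (counitFst N t) := by
  induction t with
  | zero => simp
  | add x y hx hy => simp only [map_add, hx, hy]
  | tmul c y => simp [counitFst_tmul]

variable (N) in
lemma counitFst_right : N.ract ∘ₗ counitFst N =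
    TensorProduct.map (counitFst N) LinearMap.id ∘ₗ (outer (regular C) N).ract := by
  refine TensorProduct.ext' fun c x => ?_
  change N.ract (C.ε c • x) = TensorProduct.map (counitFst N) LinearMap.id
    ((TensorProduct.assoc k C N D).symm (c ⊗ₜ N.ract x))
  rw [map_smul]
  generalize N.ract x = t
  induction t with
  | zero => simp
  | add x y hx hy => simp only [tmul_add, smul_add, map_add, hx, hy]
  | tmul c p => simp [counitFst_tmul, smul_tmul']

/-- In `Δ ⊗ 1 - 1 ⊗ β` the counit on the first factor turns the first term into the identity and
moves past `β` in the second. This is the extra degeneracy of the bar construction; it respects the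
right coaction. -/
lemma counitFst_barNext (β : N ⟶ outer (regular C) N) (x : C ⊗[k] N) :
    counitFst (outer (regular C) N) ((barNext β).lin x) + β.lin (counitFst N x) = x := by
  have h1 := counitFst_lact (outer (regular C) N) x
  have h2 := counitFst_naturality (N := N) (N' := outer (regular C) N) β.lin x
  rw [barNext_lin, map_sub, h2]
  exact (sub_add_cancel _ _).trans h1

/-- One step of the recursion for the counit on the last factor. -/
lemma counitLast_barNext {β : N ⟶ outer (regular C) N} {s : C ⊗[k] N →ₗ[k] N}
    (hs : N.lact ∘ₗ s = TensorProduct.map LinearMap.id s ∘ₗ (outer (regular C) N).lact)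
    (x : C ⊗[k] N) : TensorProduct.map LinearMap.id s ((barNext β).lin x) =
      N.lact (s x) - TensorProduct.map LinearMap.id (s ∘ₗ β.lin) x := by
  have h := LinearMap.congr_fun hs x
  rw [barNext_lin, map_sub, map_map_apply, LinearMap.id_comp]
  exact congrArg (· - _) h.symm

/-- A contraction identity with constant `a` for `β` yields one with constant `-a` for `barNext β`,
since `β` enters `barNext β` with a minus sign. The term with `Δ` commutes with `s` because they act
on different factors. -/
lemma counitLast_barNext_barNext {β : N ⟶ outer (regular C) N} {s : C ⊗[k] N →ₗ[k] N} {a : k}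
    (h : ∀ x, TensorProduct.map LinearMap.id s ((barNext β).lin x) = β.lin (s x) + a • x)
    (x : C ⊗[k] (C ⊗[k] N)) :
    TensorProduct.map LinearMap.id (TensorProduct.map LinearMap.id s)
        ((barNext (barNext β)).lin x) =
      (barNext β).lin (TensorProduct.map LinearMap.id s x) + (-a) • x := by
  rw [barNext_lin, map_sub, map_map_apply, LinearMap.id_comp,
    show TensorProduct.map LinearMap.id s ∘ₗ (barNext β).lin = β.lin ∘ₗ s + a • LinearMap.id from
      LinearMap.ext h, barNext_lin, TensorProduct.map_add_right, LinearMap.add_apply,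
    TensorProduct.map_smul_right, LinearMap.smul_apply, TensorProduct.map_id, LinearMap.id_apply,
    map_map_apply, LinearMap.id_comp, neg_smul, sub_add_eq_sub_sub, sub_eq_add_neg _ (a • x)]
  congr 2
  · induction x using TensorProduct.induction_on with
    | zero => simp
    | add x y hx hy => simp only [map_add, hx, hy]
    | tmul c y =>
      simp only [map_tmul, LinearMap.id_apply]
      generalize C.Δ c = t
      induction t with
      | zero => simp
      | add x y hx hy => simp only [add_tmul, map_add, hx, hy]
      | tmul a b => simp
  · rw [map_map_apply, LinearMap.id_comp]

lemma lact_left_step {N' : Bicomod C D} (s : N →ₗ[k] N') :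
    (outer (regular C) N').lact ∘ₗ TensorProduct.map LinearMap.id s =
      TensorProduct.map LinearMap.id (TensorProduct.map LinearMap.id s) ∘ₗ
        (outer (regular C) N).lact := by
  refine TensorProduct.ext' fun c x => ?_
  simp only [LinearMap.comp_apply, map_tmul, LinearMap.id_apply, LinearEquiv.coe_coe]
  generalize C.Δ c = t
  induction t with
  | zero => simp
  | add x y hx hy => simp only [add_tmul, map_add, hx, hy]
  | tmul a b => simp

variable (C) in
/-- The counit on the second of two factors. -/
noncomputable def counitSnd : C ⊗[k] C →ₗ[k] C :=
  (TensorProduct.rid k C).toLinearMap ∘ₗ TensorProduct.map LinearMap.id C.ε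

variable (C) in
lemma counitSnd_left : C.Δ ∘ₗ counitSnd C = TensorProduct.map LinearMap.id (counitSnd C) ∘ₗ
    (outer (regular C) (regular C)).lact := by
  refine TensorProduct.ext' fun c x => ?_
  change C.Δ (TensorProduct.rid k C (c ⊗ₜ C.ε x)) =
    TensorProduct.map LinearMap.id (counitSnd C) (TensorProduct.assoc k C C C (C.Δ c ⊗ₜ x))
  rw [TensorProduct.rid_tmul, map_smul]
  generalize C.Δ c = t
  induction t with
  | zero => simp
  | add x y hx hy => simp only [add_tmul, smul_add, map_add, hx, hy]
  | tmul a b => simp [counitSnd]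

variable (C) in
/-- The counit on the last factor. -/
noncomputable def counitLast : ∀ r, bar (regular C) (r + 1) →ₗ[k] bar (regular C) r
  | 0 => counitSnd C
  | r + 1 => TensorProduct.map (LinearMap.id : C →ₗ[k] C) (counitLast r)

variable (C) in
lemma counitLast_left (r : ℕ) : (bar (regular C) r).lact ∘ₗ counitLast C r =
    TensorProduct.map LinearMap.id (counitLast C r) ∘ₗ (bar (regular C) (r + 1)).lact := by
  cases r with
  | zero => exact counitSnd_left C
  | succ r => exact lact_left_step (counitLast C r)

variable (C) in
-- For `r = 0` the counit on the last factor cancels the last comultiplication, which enters `b'`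
-- with the sign `-1`; each further step of the recursion flips the sign. This contraction respects
-- the left coaction.
lemma counitLast_barD (r : ℕ) (x : bar (regular C) (r + 1)) :
    counitLast C (r + 1) ((barD (regular C) (r + 1)).lin x) =
      (barD (regular C) r).lin (counitLast C r x) + sgn k ((r + 1 : ℕ) : ℤ) • x := by
  induction r with
  | zero =>
    have h1 := counitLast_barNext (β := coact (regular C)) (counitSnd_left C) x
    have h2 : counitSnd C ∘ₗ C.Δ = LinearMap.id := (regular C).ract_counit
    rw [h2, TensorProduct.map_id] at h1
    simp only [zero_add, Nat.cast_one, sgn_one, neg_smul, one_smul]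
    exact h1.trans (sub_eq_add_neg _ _)
  | succ r ih =>
    have := counitLast_barNext_barNext (N := bar (regular C) r) (β := barD (regular C) r)
      (s := counitLast C r) ih x
    rw [show sgn k ((r + 1 + 1 : ℕ) : ℤ) = - sgn k ((r + 1 : ℕ) : ℤ) by
      push_cast; simp [sgn_add]]
    exact this

end Contraction

section Resolution

/-- The standard resolution as a total complex. -/
noncomputable def resTot (M : Bicomod C D) :
    Tot (fun r => bar M (r + 1)) (fun r => barD M (r + 1)) (res M) :=
  totTot (fun r => bar M (r + 1)) (fun r => barD M (r + 1)) (fun r => barD_comp M (r + 1))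

/-- The augmentation of the standard resolution. -/
noncomputable def resAug (M : Bicomod C D) : M ⟶ res M :=
  (resTot M).aug (barD M 0) (barD_comp M 0)

/-- The cotensor product of the standard resolution with a bicomodule on the right is a
resolution. -/
theorem qIso_resAug_cot (M : Bicomod C D) (Y : Bicomod D E) : QIso (cotMap (resAug M) (𝟙 Y)) :=
  -- The counit on the first factor is right colinear, so this contraction survives `- □ Y` for
  -- arbitrary `M`.
  Tot.qIso_aug_cotR (A := bar M) (δ := barD M) (resTot M) (barD_comp M 0)
    (fun r => counitFst (bar M r)) (fun r => counitFst_right (bar M r)) (counitFst_lact M)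
    (fun r x => counitFst_barNext (N := bar M r) (barD M r) x) Y

/-- The cotensor product of the standard resolution of `C` with a bicomodule on the left is a
resolution. -/
theorem qIso_cot_resAug (X : Bicomod D C) : QIso (cotMap (𝟙 X) (resAug (regular C))) :=
  -- Here a left colinear contraction is needed. It is the counit on the last factor, which exists
  -- because the coefficients are `C` itself.
  Tot.qIso_aug_cotL (A := bar (regular C)) (δ := barD (regular C)) (resTot (regular C))
    (barD_comp _ 0) (counitLast C) (counitLast_left C)
    (fun x => LinearMap.congr_fun (regular C).ract_counit x) (counitLast_barD C) X

end Resolution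

end Bicomod

end DGC

/-! ### Left bounded bicomodules, and exactness of the cotensor product with a resolution inserted.
-/

namespace DGC
variable {k : Type v} [Field k]

namespace DGVect

lemma tensorGr_eq_bot {V W : DGVect.{v, u} k} {a b : ℤ} (hV : ∀ n < a, V.gr n = ⊥)
    (hW : ∀ n < b, W.gr n = ⊥) : ∀ n < a + b, (V.tensor W).gr n = ⊥ := by
  intro n hn
  refine Submodule.span_eq_bot.2 ?_
  rintro _ ⟨p, q, e, v, hv, w, hw, rfl⟩
  by_cases h : p < a
  · rw [eq_zero_of_gr hV h hv, zero_tmul]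
  · rw [eq_zero_of_gr hW (by omega) hw, tmul_zero]

lemma gr_eq_bot_of_injective {V W : DGVect.{v, u} k} {f : V →ₗ[k] W} (hf : IsMor f)
    (hi : Function.Injective f) {n : ℤ} (h : W.gr n = ⊥) : V.gr n = ⊥ := by
  refine (Submodule.eq_bot_iff _).2 fun x hx => hi ?_
  have := hf.deg n x hx
  rw [h] at this
  exact ((Submodule.mem_bot k).1 this).trans (map_zero f).symm

lemma DTot.gr_eq_bot {A : ℕ → DGVect.{v, u} k} {δ : ∀ r, A r →ₗ[k] A (r + 1)} {V : DGVect.{v, u} k}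
    (T : DTot A δ V) {a : ℤ} (hA : ∀ r, ∀ n < a, (A r).gr n = ⊥) : ∀ n < a, V.gr n = ⊥ :=
  fun n hn => (Submodule.eq_bot_iff _).2 fun x hx => T.eq_zero fun r =>
    eq_zero_of_gr (hA r) (by omega) (T.p_deg r n x hx)

end DGVect

namespace Bicomod

variable {C D E F : DGCoalg.{v, u} k}

section Bounded

lemma outer_gr_eq_bot {X : Bicomod C D} {Y : Bicomod E F} {a b : ℤ} (hX : ∀ n < a, X.gr n = ⊥)
    (hY : ∀ n < b, Y.gr n = ⊥) : ∀ n < a + b, (outer X Y).gr n = ⊥ :=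
  DGVect.tensorGr_eq_bot hX hY

lemma cot_gr_eq_bot {X : Bicomod C D} {Y : Bicomod D E} {a b : ℤ} (hX : ∀ n < a, X.gr n = ⊥)
    (hY : ∀ n < b, Y.gr n = ⊥) : ∀ n < a + b, (cotensor X Y).gr n = ⊥ := fun n hn =>
  DGVect.gr_eq_bot_of_injective (cotι X Y).isMor (cotι_injective X Y) (outer_gr_eq_bot hX hY n hn)

/-- Tensoring with a positively graded `C` does not lower the bound, so it is uniform in `r`. This
uniformity is the condition under which quasi-isomorphisms may be tested on columns. -/
lemma bar_gr_eq_bot (hC : C.IsPos) {M : Bicomod C D} {a : ℤ} (hM : ∀ n < a, M.gr n = ⊥) (r : ℕ) :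
    ∀ n < a, (bar M r).gr n = ⊥ := by
  induction r with
  | zero => exact hM
  | succ r ih => exact fun n hn => outer_gr_eq_bot (X := regular C) hC ih n (by omega)

lemma res_gr_eq_bot (hC : C.IsPos) {M : Bicomod C D} {a : ℤ} (hM : ∀ n < a, M.gr n = ⊥) :
    ∀ n < a, (res M).gr n = ⊥ :=
  (resTot M).toDTot.gr_eq_bot fun r => bar_gr_eq_bot hC hM (r + 1)

lemma IsBddBelow.cotensor {X : Bicomod C D} {Y : Bicomod D E} (hX : X.IsBddBelow)
    (hY : Y.IsBddBelow) : (cotensor X Y).IsBddBelow := by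
  obtain ⟨a, ha⟩ := hX
  obtain ⟨b, hb⟩ := hY
  exact ⟨a + b, cot_gr_eq_bot ha hb⟩

lemma IsBddBelow.res (hC : C.IsPos) {M : Bicomod C D} (hM : M.IsBddBelow) : (res M).IsBddBelow := by
  obtain ⟨a, ha⟩ := hM
  exact ⟨a, res_gr_eq_bot hC ha⟩

lemma isBddBelow_regular (hC : C.IsPos) : (regular C).IsBddBelow := ⟨0, hC⟩

end Bounded

section Columns

lemma QIso.of_conj {M M' N N' : Bicomod C D} {f : M ⟶ N} {f' : M' ⟶ N'} (a : M ⟶ M') (b : N ⟶ N')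
    [IsIso a] [IsIso b] (e : f ≫ b = a ≫ f') (h : QIso f) : QIso f' :=
  .of_comp_right (f := a) (by rw [← e]; exact h.comp (QIso.of_isIso b)) (QIso.of_isIso a)

lemma QIso.outerMap₂ {X X' : Bicomod C D} {Y Y' : Bicomod E F} {f : X ⟶ X'} {g : Y ⟶ Y'}
    (hf : QIso f) (hg : QIso g) : QIso (outerMap₂ f g) := by
  have := (hf.outerMap₂_left Y).comp (QIso.outerMap₂_right X' hg)
  rwa [outerMap₂_comp, Category.comp_id, Category.id_comp] at this

lemma QIso.regular_cot {Y Y' : Bicomod C E} {g : Y ⟶ Y'} (hg : QIso g) :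
    QIso (cotMap (𝟙 (regular C)) g) :=
  .of_conj (unitL Y) (unitL Y') (unitL_naturality g) hg

/-- `(W ⊗ K) □ Y` is `W ⊗ (K □ Y)`, and tensoring with `W` preserves quasi-isomorphisms. -/
lemma QIso.outer_cot (W : Bicomod F C) (K : Bicomod C D) {Y Y' : Bicomod D E} {g : Y ⟶ Y'}
    (h : QIso (cotMap (𝟙 K) g)) : QIso (cotMap (𝟙 (outer W K)) g) := by
  have e := cotOuterL_naturality (𝟙 W) (𝟙 K) g
  rw [outerMap₂_id] at e
  exact .of_conj _ _ e (QIso.outerMap₂_right W h)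

/-- The cofree factor absorbs the cotensor product on the left: `X □ ((C ⊗ K) □ Y)` is `X ⊗ (K □
Y)`, an ordinary tensor product in `X`. -/
lemma QIso.cot_outer_cot (K : Bicomod C C) {X X' : Bicomod D C} {Y Y' : Bicomod C E} {f : X ⟶ X'}
    {g : Y ⟶ Y'} (hf : QIso f) (hg : QIso (cotMap (𝟙 K) g)) :
    QIso (cotMap f (cotMap (𝟙 (outer (regular C) K)) g)) := by
  have h' := QIso.of_conj _ _ (cofreeR_naturality f (cotMap (𝟙 K) g)) (QIso.outerMap₂ hf hg)
  have e := cotOuterL_naturality (𝟙 (regular C)) (𝟙 K) g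
  rw [outerMap₂_id] at e
  refine .of_conj (cotMap (𝟙 X) (cotOuterL (regular C) K Y))
    (cotMap (𝟙 X') (cotOuterL (regular C) K Y')) ?_ h'
  rw [cotMap_comp, cotMap_comp, e, Category.comp_id, Category.id_comp]

lemma bar_zero (M : Bicomod C D) : bar M 0 = M := rfl

lemma bar_succ (M : Bicomod C D) (r : ℕ) : bar M (r + 1) = outer (regular C) (bar M r) := rfl

lemma QIso.bar_cot (r : ℕ) {Y Y' : Bicomod C E} {g : Y ⟶ Y'} (hg : QIso g) :
    QIso (cotMap (𝟙 (bar (regular C) r)) g) := by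
  induction r with
  | zero => rw [bar_zero]; exact hg.regular_cot
  | succ r ih => rw [bar_succ]; exact QIso.outer_cot (regular C) (bar (regular C) r) ih

/-- The index `r + 1` provides at least one cofree factor `C` to absorb `X`. For the unresolved term
`bar 0 = C` the expression is `X □ Y`, to which this argument does not apply. -/
lemma QIso.cot_bar_cot (r : ℕ) {X X' : Bicomod D C} {Y Y' : Bicomod C E} {f : X ⟶ X'} {g : Y ⟶ Y'}
    (hf : QIso f) (hg : QIso g) :
    QIso (cotMap f (cotMap (𝟙 (bar (regular C) (r + 1))) g)) := by
  rw [bar_succ]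
  exact QIso.cot_outer_cot (bar (regular C) r) hf (QIso.bar_cot r hg)

variable {A A' : ℕ → Bicomod C D} {δ : ∀ r, A r ⟶ A (r + 1)} {δ' : ∀ r, A' r ⟶ A' (r + 1)}
  {V V' : Bicomod C D}

lemma Tot.cotR_map {T : Tot A δ V} {T' : Tot A' δ' V'} {f : V ⟶ V'} {g : ∀ r, A r ⟶ A' r}
    (hf : ∀ r x, f.lin (T.i r x) = T'.i r ((g r).lin x)) {Y Y' : Bicomod D E} (h : Y ⟶ Y') (r : ℕ)
    (x : cotensor (A r) Y) : (cotMap f h).lin ((T.cotR Y).i r x) =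
      (T'.cotR Y').i r ((cotMap (g r) h).lin x) := by
  apply cotι_injective
  change TensorProduct.map f.lin h.lin (TensorProduct.map (T.i r) LinearMap.id ((cotι _ Y).lin x)) =
    TensorProduct.map (T'.i r) LinearMap.id (TensorProduct.map (g r).lin h.lin ((cotι _ Y).lin x))
  rw [map_map_apply, map_map_apply, LinearMap.comp_id, LinearMap.id_comp,
    show f.lin ∘ₗ T.i r = T'.i r ∘ₗ (g r).lin from LinearMap.ext (hf r)]

lemma Tot.cotL_map {T : Tot A δ V} {T' : Tot A' δ' V'} {f : V ⟶ V'} {g : ∀ r, A r ⟶ A' r}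
    (hf : ∀ r x, f.lin (T.i r x) = T'.i r ((g r).lin x)) {X X' : Bicomod E C} (h : X ⟶ X') (r : ℕ)
    (x : cotensor X (A r)) : (cotMap h f).lin ((Tot.cotL X T).i r x) =
      (Tot.cotL X' T').i r ((cotMap h (g r)).lin x) := by
  apply cotι_injective
  change TensorProduct.map h.lin f.lin (TensorProduct.map (X.sg r) (T.i r) ((cotι X _).lin x)) =
    TensorProduct.map (X'.sg r) (T'.i r) (TensorProduct.map h.lin (g r).lin ((cotι X _).lin x))
  rw [map_map_apply, map_map_apply, h.isMor.comp_sg,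
    show f.lin ∘ₗ T.i r = T'.i r ∘ₗ (g r).lin from LinearMap.ext (hf r)]

/-- The standard resolution of `C` makes the cotensor product exact on left bounded
bicomodules. -/
theorem QIso.cot_res_cot (hC : C.IsPos) {X X' : Bicomod D C} {Y Y' : Bicomod C E} {f : X ⟶ X'}
    {g : Y ⟶ Y'} (hf : QIso f) (hg : QIso g) (hX : X.IsBddBelow) (hX' : X'.IsBddBelow)
    (hY : Y.IsBddBelow) (hY' : Y'.IsBddBelow) :
    QIso (cotMap f (cotMap (𝟙 (res (regular C))) g)) := by
  obtain ⟨a, ha⟩ := hX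
  obtain ⟨a', ha'⟩ := hX'
  obtain ⟨b, hb⟩ := hY
  obtain ⟨b', hb'⟩ := hY'
  -- Both sides are total complexes with columns `X □ (bar (r + 1) □ Y)`. All columns are bounded
  -- below by the sum of the bounds of the factors, with `0` for `C`, and the smaller of the two
  -- sums serves for both sides.
  refine Tot.qIso (Tot.cotL X ((resTot (regular C)).cotR Y))
    (Tot.cotL X' ((resTot (regular C)).cotR Y'))
    (g := fun r => cotMap f (cotMap (𝟙 (bar (regular C) (r + 1))) g))
    (fun r x => Tot.cotL_map (fun r x => Tot.cotR_map (T := resTot (regular C))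
      (T' := resTot (regular C)) (g := fun r => 𝟙 _) (fun _ _ => rfl) g r x) f r x)
    (fun r => hf.cot_bar_cot r hg) (a := min (a + (0 + b)) (a' + (0 + b'))) ?_ ?_
  · exact fun r n hn => cot_gr_eq_bot ha (cot_gr_eq_bot (bar_gr_eq_bot (M := regular C) (a := 0) hC hC (r + 1)) hb) n
      (by omega)
  · exact fun r n hn => cot_gr_eq_bot ha' (cot_gr_eq_bot (bar_gr_eq_bot (M := regular C) (a := 0) hC hC (r + 1)) hb') n
      (by omega)

end Columns

/-! ### The resolution of `M` as the cotensor product of the resolution of `C` with `M`. -/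

section ResIso

/-- The left coaction of `X □ Y` is the one of `X`. This identifies the leading term of `b'` on `C ⊗
N` with that on `C ⊗ K` when `N ≅ K □ M`. -/
lemma coact_cotOuterL (X : Bicomod C D) (Y : Bicomod D E) :
    coact (cotensor X Y) ≫ cotOuterL (regular C) X Y = cotMap (coact X) (𝟙 Y) := cot_hom_ext (by
  rw [Category.assoc, cotOuterL_ι, cotMap_ι, ← Category.assoc, IsIso.comp_inv_eq]
  exact hom_ext (cotι X Y).left.symm)

/-- The recursion step for the comparison `C^(⊗ r) ⊗ M ≅ (C^(⊗ r) ⊗ C) □ M`. -/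
noncomputable def cotNext {N M : Bicomod C D} {K : Bicomod C C} (j : N ⟶ cotensor K M) :
    outer (regular C) N ⟶ cotensor (outer (regular C) K) M :=
  outerMap₂ (𝟙 _) j ≫ cotOuterL (regular C) K M

lemma isIso_cotNext {N M : Bicomod C D} {K : Bicomod C C} {j : N ⟶ cotensor K M} (h : IsIso j) :
    IsIso (cotNext j) := by
  unfold cotNext; infer_instance

/-- A map `j` to a cotensor product is compatible with maps `β` and `γ`. -/
def CotComm {N N' M : Bicomod C D} {K K' : Bicomod C C} (β : N ⟶ N') (γ : K ⟶ K')
    (j : N ⟶ cotensor K M) (j' : N' ⟶ cotensor K' M) : Prop := β ≫ j' = j ≫ cotMap γ (𝟙 M)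

lemma cotComm_unitL (M : Bicomod C D) :
    CotComm (coact M) (coact (regular C)) (unitL M) (cotNext (unitL M)) := by
  unfold CotComm cotNext
  rw [← coact_cotOuterL, ← Category.assoc, ← Category.assoc]
  congr 1
  exact (coact_naturality _).symm

/-- Both differentials obey the same recursion `Δ ⊗ 1 - 1 ⊗ β`. The first term is compatible by
naturality of the coaction, the second one by hypothesis, so compatibility spreads from `C` and `M`
to all bar terms. -/
lemma CotComm.next {N M : Bicomod C D} {K : Bicomod C C} {β : N ⟶ outer (regular C) N}
    {γ : K ⟶ outer (regular C) K} {j : N ⟶ cotensor K M} (h : CotComm β γ j (cotNext j)) :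
    CotComm (barNext β) (barNext γ) (cotNext j) (cotNext (cotNext j)) := by
  have e1 : coact (outer (regular C) N) ≫ outerMap₂ (𝟙 _) (cotNext j) ≫
        cotOuterL (regular C) (outer (regular C) K) M =
      cotNext j ≫ cotMap (coact _) (𝟙 M) := by
    rw [← coact_cotOuterL, ← Category.assoc, ← Category.assoc]
    congr 1
    exact (coact_naturality _).symm
  have e2 : outerMap (regular C) β ≫ outerMap₂ (𝟙 _) (cotNext j) ≫
        cotOuterL (regular C) (outer (regular C) K) M =
      cotNext j ≫ cotMap (outerMap (regular C) γ) (𝟙 M) := by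
    have : outerMap (regular C) β = outerMap₂ (𝟙 _) β := rfl
    rw [this, ← Category.assoc, outerMap₂_comp, h, ← outerMap₂_comp, Category.assoc,
      cotOuterL_naturality, ← Category.assoc]
    rfl
  change barNext β ≫ outerMap₂ (𝟙 _) (cotNext j) ≫ cotOuterL (regular C) (outer (regular C) K) M =
    cotNext j ≫ cotMap (barNext γ) (𝟙 M)
  unfold barNext
  rw [Preadditive.sub_comp, e1, e2, cotMap_sub_left, Preadditive.comp_sub]

/-- The isomorphism `C^(⊗ r) ⊗ M ≅ (C^(⊗ r) ⊗ C) □ M`. -/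
noncomputable def barCot (M : Bicomod C D) : ∀ r, bar M r ⟶ cotensor (bar (regular C) r) M
  | 0 => unitL M
  | r + 1 => cotNext (N := bar M r) (K := bar (regular C) r) (barCot M r)

lemma isIso_barCot (M : Bicomod C D) (r : ℕ) : IsIso (barCot M r) := by
  induction r with
  | zero => exact inferInstanceAs (IsIso (unitL M))
  | succ r ih => exact isIso_cotNext ih

set_option maxHeartbeats 1000000 in
lemma cotComm_barCot_zero (M : Bicomod C D) :
    CotComm (barD M 0) (barD (regular C) 0) (barCot M 0) (barCot M (0 + 1)) := cotComm_unitL M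

lemma cotComm_barCot (M : Bicomod C D) (r : ℕ) :
    CotComm (barD M r) (barD (regular C) r) (barCot M r) (barCot M (r + 1)) := by
  induction r with
  | zero => exact cotComm_barCot_zero M
  | succ r ih => exact ih.next

/-- The standard resolution of `M` is the cotensor product of the one of `C` with `M`. -/
theorem exists_isIso_res (M : Bicomod C D) :
    ∃ f : res M ⟶ cotensor (res (regular C)) M, IsIso f :=
  exists_isIso_tot (fun r => barD_comp M (r + 1)) ((resTot (regular C)).cotR M)
    (fun r => barCot M (r + 1)) (fun r => isIso_barCot M (r + 1)) (fun r => cotComm_barCot M (r + 1))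

end ResIso

end Bicomod

end DGC

/-! ### The cocenter of a bicomodule. -/

namespace DGC
variable {k : Type v} [Field k]

namespace DGVect

variable {V W U : DGVect.{v, u} k}

lemma swap_swap_apply (V W : DGVect.{v, u} k) (t : V ⊗[k] W) : swap W V (swap V W t) = t := by
  refine LinearMap.congr_fun (f := swap W V ∘ₗ swap V W) (g := LinearMap.id)
    (tensor_hom_ext fun p q v hv w hw => ?_) t
  rw [LinearMap.comp_apply, swap_tmul hv hw, map_smul, swap_tmul hw hv, smul_smul, mul_comm q,
    sgn_mul_self, one_smul, LinearMap.id_apply]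

lemma swap_injective (V W : DGVect.{v, u} k) : Function.Injective (swap V W) :=
  Function.LeftInverse.injective (swap_swap_apply V W)

lemma swap_map_apply {V' W' : DGVect.{v, u} k} {f : V →ₗ[k] V'} {g : W →ₗ[k] W'} (hf : IsMor f)
    (hg : IsMor g) (t : V ⊗[k] W) :
    swap V' W' (TensorProduct.map f g t) = TensorProduct.map g f (swap V W t) :=
  LinearMap.congr_fun (swap_naturality hf hg) t

/-- The symmetry is compatible with maps of arbitrary degree. -/
lemma swap_sg_map {a : ℤ} {f : V →ₗ[k] W} (hf : IsDeg a f) (t : U ⊗[k] V) :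
    swap U W (TensorProduct.map (U.sg a) f t) =
      TensorProduct.map f LinearMap.id (swap U V t) := by
  refine LinearMap.congr_fun (f := swap U W ∘ₗ TensorProduct.map (U.sg a) f)
    (g := TensorProduct.map f LinearMap.id ∘ₗ swap U V)
    (tensor_hom_ext fun p q x hx y hy => ?_) t
  rw [LinearMap.comp_apply, LinearMap.comp_apply, map_tmul, sg_of_mem a hx, swap_tmul hx hy,
    ← smul_tmul', map_smul, swap_tmul hx (hf _ _ hy), smul_smul, map_smul, map_tmul,
    LinearMap.id_apply, mul_add, sgn_add, mul_comm a, mul_left_comm, sgn_mul_self, mul_one]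

/-- Two differential graded vector spaces with isomorphic cohomology. -/
def HIso (V W : DGVect.{v, u} k) : Prop := ∀ n, Nonempty (V.H n ≃ₗ[k] W.H n)

lemma HIso.symm (h : HIso V W) : HIso W V := fun n => (h n).map LinearEquiv.symm

lemma HIso.trans (h : HIso V W) (h' : HIso W U) : HIso V U := fun n =>
  (h n).elim fun e => (h' n).map fun e' => e.trans e'

lemma QI.hIso {f : V →ₗ[k] W} (hf : IsMor f) (h : QI f) : HIso V W := fun n => ⟨QI.equiv hf h n⟩

/-- Subcomplexes that correspond to each other under an injective map are isomorphic. -/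
lemma exists_bijective_of_range {V' W' : DGVect.{v, u} k} {i : V →ₗ[k] V'} {j : W →ₗ[k] W'}
    (hi : IsMor i) (hj : IsMor j) (hi' : Function.Injective i) (hj' : Function.Injective j)
    {φ : V' →ₗ[k] W'} (hφ : IsMor φ) (hφ' : Function.Injective φ)
    (h1 : ∀ x, ∃ y, j y = φ (i x)) (h2 : ∀ y, ∃ x, φ (i x) = j y) :
    ∃ f : V →ₗ[k] W, IsMor f ∧ Function.Bijective f ∧ ∀ x, j (f x) = φ (i x) := by
  let e := LinearEquiv.ofInjective j hj'
  let f := e.symm.toLinearMap ∘ₗ LinearMap.codRestrict (LinearMap.range j) (φ ∘ₗ i) h1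
  have hf : ∀ x, j (f x) = φ (i x) := fun x =>
    congrArg Subtype.val (e.apply_symm_apply
      (LinearMap.codRestrict (LinearMap.range j) (φ ∘ₗ i) h1 x))
  refine ⟨f, ⟨fun n x hx => hj.mem_of_injective hj' ?_, LinearMap.ext fun x => hj' ?_⟩, ⟨?_, ?_⟩, hf⟩
  · rw [hf]; exact hφ.deg _ _ (hi.deg _ _ hx)
  · change j (f (V.d x)) = j (W.d (f x))
    rw [hf, hj.comm_apply, hf, hi.comm_apply, hφ.comm_apply]
  · intro x y e
    have := congrArg j e
    rw [hf, hf] at this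
    exact hi' (hφ' this)
  · intro y
    obtain ⟨x, hx⟩ := h2 y
    exact ⟨x, hj' ((hf x).trans hx)⟩

end DGVect

namespace Bicomod

variable {C D E F : DGCoalg.{v, u} k}

section Trace

/-- The difference of the two coactions of a `C`-bicomodule. -/
noncomputable def trMap (W : Bicomod C C) : W →ₗ[k] W ⊗[k] C :=
  W.ract - DGVect.swap C.toDGVect W.toDGVect ∘ₗ W.lact

lemma trMap_apply (W : Bicomod C C) (x : W) :
    trMap W x = W.ract x - DGVect.swap C.toDGVect W.toDGVect (W.lact x) := rfl

lemma isMor_trMap (W : Bicomod C C) :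
    DGVect.IsMor (V := W.toDGVect) (W := W.toDGVect.tensor C.toDGVect) (trMap W) :=
  W.isMor_ract.sub (DGVect.IsMor.comp (V := W.toDGVect) (W := C.toDGVect.tensor W.toDGVect)
    (U := W.toDGVect.tensor C.toDGVect) (DGVect.isMor_swap _ _) W.isMor_lact)

/-- The cocenter of a bicomodule, on which both coactions agree. -/
noncomputable def tr (W : Bicomod C C) : DGVect.{v, u} k :=
  DGVect.ker (V := W.toDGVect) (W := W.toDGVect.tensor C.toDGVect) (trMap W) (isMor_trMap W)

/-- The inclusion of the cocenter. -/
noncomputable def trι (W : Bicomod C C) : tr W →ₗ[k] W := (LinearMap.ker (trMap W)).subtype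

lemma isMor_trι (W : Bicomod C C) : DGVect.IsMor (V := tr W) (W := W.toDGVect) (trι W) :=
  ⟨fun _ _ h => h, rfl⟩

lemma trι_injective (W : Bicomod C C) : Function.Injective (trι W) := Subtype.val_injective

lemma trMap_trι (W : Bicomod C C) (x : tr W) : trMap W (trι W x) = 0 := x.2

lemma exists_trι {W : Bicomod C C} {x : W} (h : trMap W x = 0) : ∃ y, trι W y = x := ⟨⟨x, h⟩, rfl⟩

/-- The twist `C.sg a` in the left coaction is exactly the sign that the symmetry absorbs when a map
of degree `a` changes sides. So the cocenter is functorial for colinear maps of every degree, and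
the cocenter of a total complex is again a total complex. -/
lemma IsColin.trMap_apply {W W' : Bicomod C C} {a : ℤ} {f : W →ₗ[k] W'} (hf : IsColin a f) (x : W) :
    trMap W' (f x) = TensorProduct.map f LinearMap.id (trMap W x) := by
  have h1 := LinearMap.congr_fun hf.left x
  have h2 := LinearMap.congr_fun hf.right x
  simp only [LinearMap.comp_apply] at h1 h2
  rw [Bicomod.trMap_apply, Bicomod.trMap_apply, h1, h2, map_sub]
  congr 1
  exact DGVect.swap_sg_map hf.deg _

/-- The map induced on cocenters by a colinear map. -/
noncomputable def trLin {W W' : Bicomod C C} {a : ℤ} {f : W →ₗ[k] W'} (hf : IsColin a f) :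
    tr W →ₗ[k] tr W' :=
  LinearMap.codRestrict (LinearMap.ker (trMap W')) (f ∘ₗ trι W) fun x => by
    rw [LinearMap.mem_ker, LinearMap.comp_apply, hf.trMap_apply, trMap_trι, map_zero]

/-- Functoriality of the cocenter. -/
noncomputable def trHom {W W' : Bicomod C C} (f : W ⟶ W') : tr W →ₗ[k] tr W' := trLin f.isColin

lemma isMor_trHom {W W' : Bicomod C C} (f : W ⟶ W') :
    DGVect.IsMor (V := tr W) (W := tr W') (trHom f) :=
  ⟨fun n _ hx => f.isMor.deg n _ hx, LinearMap.ext fun x => trι_injective W'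
    (f.isMor.comm_apply (trι W x))⟩

lemma bijective_trHom {W W' : Bicomod C C} (f : W ⟶ W') [IsIso f] :
    Function.Bijective (trHom f) := by
  have e1 := congrArg Hom.lin (IsIso.hom_inv_id f)
  have e2 := congrArg Hom.lin (IsIso.inv_hom_id f)
  exact Function.bijective_iff_has_inverse.2 ⟨trHom (inv f),
    fun x => trι_injective W (LinearMap.congr_fun e1 _),
    fun x => trι_injective W' (LinearMap.congr_fun e2 _)⟩

lemma hIso_tr_of_isIso {W W' : Bicomod C C} (f : W ⟶ W') [IsIso f] : DGVect.HIso (tr W) (tr W') :=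
  DGVect.QI.hIso (isMor_trHom f) (DGVect.QI.of_bijective (isMor_trHom f) (bijective_trHom f))

/-- The cocenter of a total complex. -/
noncomputable def Tot.tr {A : ℕ → Bicomod C C} {δ : ∀ r, A r ⟶ A (r + 1)} {V : Bicomod C C}
    (T : Tot A δ V) : DGVect.DTot (fun r => tr (A r)) (fun r => trHom (δ r)) (tr V) :=
  T.toDTot.restrict (ι := trι V) (isMor_trι V) (trι_injective V) (ι' := fun r => trι (A r))
    (fun r => isMor_trι (A r)) (fun r => trι_injective (A r)) (fun r => trLin (T.i_colin r))
    (fun r => trLin (T.p_colin r)) (fun _ _ => rfl) (fun _ _ => rfl) (fun _ _ => rfl)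

end Trace

/-! ### The cocenter of `C ⊗ W` is `W`. -/

section TraceCofree

lemma isMor_counitFst (W : Bicomod C D) : DGVect.IsMor (V := C.toDGVect.tensor W.toDGVect)
    (W := W.toDGVect) (counitFst W) where
  deg n := DGVect.tensor_mem fun p q e c hc w hw => by
    rw [counitFst_tmul]
    by_cases h : p = 0
    · subst h
      rw [zero_add] at e
      subst e
      exact Submodule.smul_mem _ _ hw
    · rw [C.counit_gr p h c hc, zero_smul]
      exact zero_mem _
  comm := DGVect.tensor_hom_ext fun p q c hc w hw => by
    have h := DGVect.tensor_d_tmul hc w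
    rw [LinearMap.comp_apply, LinearMap.comp_apply, h, map_add, map_smul, counitFst_tmul,
      counitFst_tmul, counitFst_tmul, show C.ε (C.d c) = 0 from LinearMap.congr_fun C.counit_d c,
      zero_smul, zero_add, map_smul]
    by_cases hp : p = 0
    · subst hp; rw [sgn_zero, one_smul]
    · rw [C.counit_gr p hp c hc, zero_smul, smul_zero]

lemma lact_regular_outer (W : Bicomod C D) (t : C ⊗[k] W) : (outer (regular C) W).lact t =
    TensorProduct.assoc k C C W (TensorProduct.map C.Δ LinearMap.id t) := rfl

lemma counit_map_comul (W : Bicomod C D) (t : C ⊗[k] W) :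
    TensorProduct.map LinearMap.id (counitFst W)
      (TensorProduct.assoc k C C W (TensorProduct.map C.Δ LinearMap.id t)) = t := by
  induction t with
  | zero => simp
  | add x y hx hy => simp only [map_add, hx, hy]
  | tmul c w =>
    have h := LinearMap.congr_fun (regular C).ract_counit c
    simp only [LinearMap.comp_apply, LinearMap.id_apply, LinearEquiv.coe_coe] at h
    rw [map_tmul]
    conv_rhs => rw [← h]
    change _ = TensorProduct.rid k C (TensorProduct.map LinearMap.id C.ε (C.Δ c)) ⊗ₜ[k] w
    generalize C.Δ c = s
    induction s with
    | zero => simp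
    | add x y hx hy => simp only [map_add, add_tmul, hx, hy]
    | tmul a b => simp [counitFst_tmul, smul_tmul']

/-- The map `w ↦ ± w₁ ⊗ w₀`. -/
noncomputable def rotate (W : Bicomod C C) : W →ₗ[k] C ⊗[k] W :=
  DGVect.swap W.toDGVect C.toDGVect ∘ₗ W.ract

lemma rotate_injective (W : Bicomod C C) : Function.Injective (rotate W) :=
  (DGVect.swap_injective _ _).comp (ract_injective W)

lemma isMor_rotate (W : Bicomod C C) : DGVect.IsMor (V := W.toDGVect)
    (W := (outer (regular C) W).toDGVect) (rotate W) :=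
  DGVect.IsMor.comp (V := W.toDGVect) (W := W.toDGVect.tensor C.toDGVect)
    (U := C.toDGVect.tensor W.toDGVect) (DGVect.isMor_swap _ _) W.isMor_ract

lemma rotate_naturality {W W' : Bicomod C C} (f : W ⟶ W') (x : W) :
    rotate W' (f.lin x) = TensorProduct.map LinearMap.id f.lin (rotate W x) := by
  have h := LinearMap.congr_fun f.right x
  simp only [LinearMap.comp_apply] at h
  change DGVect.swap _ _ (W'.ract (f.lin x)) = _
  rw [h]
  exact DGVect.swap_map_apply f.isMor DGVect.IsMor.id _

lemma swap_rotate (V W : DGVect.{v, u} k) (u : (W ⊗[k] V) ⊗[k] V) :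
    (TensorProduct.assoc k V W V).symm (DGVect.swap (W.tensor V) V u) =
    DGVect.swap V (V.tensor W) (TensorProduct.assoc k V V W
      (DGVect.swap W (V.tensor V) (TensorProduct.assoc k W V V u))) := by
  refine LinearMap.congr_fun
    (f := (TensorProduct.assoc k V W V).symm.toLinearMap ∘ₗ DGVect.swap (W.tensor V) V)
    (g := DGVect.swap V (V.tensor W) ∘ₗ (TensorProduct.assoc k V V W).toLinearMap ∘ₗ
      DGVect.swap W (V.tensor V) ∘ₗ (TensorProduct.assoc k W V V).toLinearMap)
    (DGVect.tensor_hom_ext₃ fun p q r w hw x hx y hy => ?_) u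
  simp only [LinearMap.comp_apply, LinearEquiv.coe_coe, assoc_tmul]
  rw [DGVect.swap_tmul (V := W.tensor V) (W := V) (DGVect.tmul_mem hw hx rfl) hy,
    DGVect.swap_tmul (V := W) (W := V.tensor V) hw (DGVect.tmul_mem hx hy rfl), map_smul, map_smul,
    map_smul, assoc_symm_tmul, assoc_tmul,
    DGVect.swap_tmul (V := V) (W := V.tensor W) hx (DGVect.tmul_mem hy hw rfl), smul_smul,
    ← sgn_add]
  congr 1
  rw [show p * (q + r) + q * (r + p) = (p + q) * r + (p * q + p * q) by ring, sgn_add,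
    sgn_add (p * q), sgn_mul_self, mul_one]

/-- By coassociativity the two coactions on `± w₁ ⊗ w₀` are obtained from `w₀ ⊗ w₁ ⊗ w₂` by
permutations that agree after the symmetry; `swap_rotate` checks that the signs agree as well. -/
lemma trMap_rotate (W : Bicomod C C) (w : W) :
    trMap (outer (regular C) W) (rotate W w) = 0 := by
  have h1 : (outer (regular C) W).lact (rotate W w) = TensorProduct.assoc k C C W
      (DGVect.swap W.toDGVect (C.toDGVect.tensor C.toDGVect)
        (TensorProduct.map LinearMap.id C.Δ (W.ract w))) := by
    rw [DGVect.swap_map_apply (V := W.toDGVect) (W := C.toDGVect) (V' := W.toDGVect)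
      (W' := C.toDGVect.tensor C.toDGVect) DGVect.IsMor.id C.isMor_comul]
    rfl
  have h2 : (outer (regular C) W).ract (rotate W w) = (TensorProduct.assoc k C W C).symm
      (DGVect.swap (W.toDGVect.tensor C.toDGVect) C.toDGVect
        (TensorProduct.map W.ract LinearMap.id (W.ract w))) := by
    rw [DGVect.swap_map_apply (V := W.toDGVect) (W := C.toDGVect)
      (V' := W.toDGVect.tensor C.toDGVect) (W' := C.toDGVect) W.isMor_ract DGVect.IsMor.id]
    rfl
  have h3 := LinearMap.congr_fun W.ract_coassoc w
  simp only [LinearMap.comp_apply, LinearEquiv.coe_coe] at h3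
  rw [trMap_apply, h1, h2, sub_eq_zero, ← h3]
  exact swap_rotate C.toDGVect W.toDGVect _

/-- Apply the counit to the `C` in front of `W` in the equation of the two coactions: the left
coaction, once swapped, gives back `t` with its factors exchanged, and the right coaction gives the
coaction on `(ε ⊗ 1) t`. -/
lemma eq_rotate {W : Bicomod C C} {t : C ⊗[k] W} (h : trMap (outer (regular C) W) t = 0) :
    t = rotate W (counitFst W t) := by
  have h2 : TensorProduct.map (counitFst W) LinearMap.id ((outer (regular C) W).ract t) =
      TensorProduct.map (counitFst W) LinearMap.id (DGVect.swap C.toDGVect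
        (C.toDGVect.tensor W.toDGVect) ((outer (regular C) W).lact t)) :=
    congrArg _ (sub_eq_zero.1 h)
  rw [← LinearMap.comp_apply, ← counitFst_right,
    ← DGVect.swap_map_apply (V := C.toDGVect) (W := C.toDGVect.tensor W.toDGVect)
      (V' := C.toDGVect) (W' := W.toDGVect) DGVect.IsMor.id (isMor_counitFst W), lact_regular_outer,
    counit_map_comul] at h2
  change t = DGVect.swap W.toDGVect C.toDGVect (W.ract (counitFst W t))
  rw [LinearMap.comp_apply] at h2
  rw [h2, DGVect.swap_swap_apply]

/-- The cocenter of a cofree bicomodule. -/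
noncomputable def rotateTr (W : Bicomod C C) : W →ₗ[k] tr (outer (regular C) W) :=
  LinearMap.codRestrict _ (rotate W) (trMap_rotate W)

lemma isMor_rotateTr (W : Bicomod C C) : DGVect.IsMor (V := W.toDGVect)
    (W := tr (outer (regular C) W)) (rotateTr W) :=
  ⟨fun n x hx => (isMor_rotate W).deg n x hx, LinearMap.ext fun x => trι_injective _
    ((isMor_rotate W).comm_apply x)⟩

lemma bijective_rotateTr (W : Bicomod C C) : Function.Bijective (rotateTr W) :=
  ⟨fun _ _ e => rotate_injective W (congrArg (trι _) e), fun t =>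
    ⟨counitFst W (trι _ t), trι_injective _ (eq_rotate (trMap_trι _ t)).symm⟩⟩

lemma rotateTr_naturality {W W' : Bicomod C C} (f : W ⟶ W') (x : W) :
    rotateTr W' (f.lin x) = trHom (outerMap₂ (𝟙 (regular C)) f) (rotateTr W x) :=
  trι_injective _ (rotate_naturality f x)

end TraceCofree

/-! ### Cyclic invariance of the cocenter of a cotensor product. -/

section TraceCyclic

variable {X : Bicomod C D} {Y : Bicomod D C}

lemma swap_cyclic (U V W : DGVect.{v, u} k) (s : (U ⊗[k] V) ⊗[k] W) :
    TensorProduct.assoc k W U V (DGVect.swap V (W.tensor U) (TensorProduct.assoc k V W U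
      (DGVect.swap U (V.tensor W) (TensorProduct.assoc k U V W s)))) =
    DGVect.swap (U.tensor V) W s := by
  refine LinearMap.congr_fun (f := (TensorProduct.assoc k W U V).toLinearMap ∘ₗ
      DGVect.swap V (W.tensor U) ∘ₗ (TensorProduct.assoc k V W U).toLinearMap ∘ₗ
      DGVect.swap U (V.tensor W) ∘ₗ (TensorProduct.assoc k U V W).toLinearMap)
    (g := DGVect.swap (U.tensor V) W)
    (DGVect.tensor_hom_ext₃ fun p q r w hw x hx y hy => ?_) s
  simp only [LinearMap.comp_apply, LinearEquiv.coe_coe, assoc_tmul]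
  rw [DGVect.swap_tmul (V := U.tensor V) (W := W) (DGVect.tmul_mem hw hx rfl) hy,
    DGVect.swap_tmul (V := U) (W := V.tensor W) hw (DGVect.tmul_mem hx hy rfl), map_smul, map_smul,
    map_smul, assoc_tmul,
    DGVect.swap_tmul (V := V) (W := W.tensor U) hx (DGVect.tmul_mem hy hw rfl), map_smul,
    assoc_tmul, smul_smul, ← sgn_add]
  congr 1
  rw [show p * (q + r) + q * (r + p) = (p + q) * r + (p * q + p * q) by ring, sgn_add,
    sgn_add (p * q), sgn_mul_self, mul_one]

/-- Under the symmetry, the condition that defines the cotensor product on one side becomes the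
condition that defines the cocenter. -/
lemma cmp_swap (X : Bicomod C D) (Y : Bicomod D C) (t : X ⊗[k] Y) :
    cmp Y X (DGVect.swap X.toDGVect Y.toDGVect t) =
      TensorProduct.assoc k Y C X (DGVect.swap X.toDGVect (Y.toDGVect.tensor C.toDGVect)
        (TensorProduct.assoc k X Y C (trMap (outer X Y) t))) := by
  have h1 := DGVect.swap_map_apply (V := X.toDGVect) (W := Y.toDGVect) (V' := X.toDGVect)
    (W' := Y.toDGVect.tensor C.toDGVect) DGVect.IsMor.id Y.isMor_ract t
  have h2 := DGVect.swap_map_apply (V := X.toDGVect) (W := Y.toDGVect)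
    (V' := C.toDGVect.tensor X.toDGVect) (W' := Y.toDGVect) X.isMor_lact DGVect.IsMor.id t
  have h3 := swap_cyclic C.toDGVect X.toDGVect Y.toDGVect (TensorProduct.map X.lact LinearMap.id t)
  rw [trMap_apply, map_sub, map_sub, map_sub]
  change TensorProduct.assoc k Y C X (TensorProduct.map Y.ract LinearMap.id _) -
    TensorProduct.map LinearMap.id X.lact _ = _
  rw [← h1, ← h2, ← h3]
  congr 3
  change _ = TensorProduct.assoc k X Y C ((TensorProduct.assoc k X Y C).symm
    (TensorProduct.map LinearMap.id Y.ract t))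
  rw [LinearEquiv.apply_symm_apply]

lemma cmp_swap_eq_zero_iff (X : Bicomod C D) (Y : Bicomod D C) (t : X ⊗[k] Y) :
    cmp Y X (DGVect.swap X.toDGVect Y.toDGVect t) = 0 ↔ trMap (outer X Y) t = 0 := by
  rw [cmp_swap, LinearEquiv.map_eq_zero_iff]
  refine ⟨fun h => ?_, fun h => by rw [h, map_zero, map_zero]⟩
  have := DGVect.swap_injective X.toDGVect (Y.toDGVect.tensor C.toDGVect) (h.trans (map_zero _).symm)
  exact (LinearEquiv.map_eq_zero_iff _).1 this

/-- The inclusion of the cocenter of a cotensor product in the tensor product. -/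
noncomputable def trCotι (X : Bicomod C D) (Y : Bicomod D C) : tr (cotensor X Y) →ₗ[k] X ⊗[k] Y :=
  (cotι X Y).lin ∘ₗ trι _

lemma isMor_trCotι (X : Bicomod C D) (Y : Bicomod D C) : DGVect.IsMor (V := tr (cotensor X Y))
    (W := X.toDGVect.tensor Y.toDGVect) (trCotι X Y) :=
  DGVect.IsMor.comp (V := tr (cotensor X Y)) (W := (cotensor X Y).toDGVect)
    (U := X.toDGVect.tensor Y.toDGVect) (cotι X Y).isMor (isMor_trι _)

lemma trCotι_injective (X : Bicomod C D) (Y : Bicomod D C) : Function.Injective (trCotι X Y) :=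
  (cotι_injective X Y).comp (trι_injective _)

/-- Inside `X ⊗ Y` the cocenter of `X □ Y` is given by two conditions, one glueing along `D` and one
along `C`. The description is symmetric in the two coalgebras, which is the reason for cyclic
invariance. -/
lemma mem_range_trCotι (X : Bicomod C D) (Y : Bicomod D C) (t : X ⊗[k] Y) :
    (∃ s, trCotι X Y s = t) ↔ cmp X Y t = 0 ∧ trMap (outer X Y) t = 0 := by
  constructor
  · rintro ⟨s, rfl⟩
    refine ⟨cmp_cotι _, ?_⟩
    have h : trMap (outer X Y) ((cotι X Y).lin (trι _ s)) = TensorProduct.map (cotι X Y).lin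
      LinearMap.id (trMap (cotensor X Y) (trι _ s)) := (cotι X Y).isColin.trMap_apply _
    rw [trMap_trι, map_zero] at h
    exact h
  · rintro ⟨h1, h2⟩
    obtain ⟨y, rfl⟩ := (cotι_exact X Y t).1 h1
    have h : trMap (outer X Y) ((cotι X Y).lin y) = TensorProduct.map (cotι X Y).lin
      LinearMap.id (trMap (cotensor X Y) y) := (cotι X Y).isColin.trMap_apply _
    rw [h] at h2
    obtain ⟨s, hs⟩ := exists_trι (map_injective_id (cotι_injective X Y) (h2.trans (map_zero _).symm))
    exact ⟨s, congrArg (cotι X Y).lin hs⟩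

/-- The cocenter of a cotensor product is cyclically invariant. -/
theorem hIso_tr_cyclic (X : Bicomod C D) (Y : Bicomod D C) :
    DGVect.HIso (tr (cotensor X Y)) (tr (cotensor Y X)) := by
  -- The symmetry exchanges the two defining conditions, by `cmp_swap_eq_zero_iff` used for `(X, Y)`
  -- and for `(Y, X)`.
  have key : ∀ t : X ⊗[k] Y, (∃ s, trCotι Y X s = DGVect.swap X.toDGVect Y.toDGVect t) ↔
      ∃ s, trCotι X Y s = t := fun t => by
    rw [mem_range_trCotι, mem_range_trCotι, cmp_swap_eq_zero_iff, ← cmp_swap_eq_zero_iff Y X,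
      DGVect.swap_swap_apply, and_comm]
  obtain ⟨f, hf, hb, -⟩ := DGVect.exists_bijective_of_range (V := tr (cotensor X Y))
    (W := tr (cotensor Y X)) (V' := X.toDGVect.tensor Y.toDGVect)
    (W' := Y.toDGVect.tensor X.toDGVect) (isMor_trCotι X Y)
    (isMor_trCotι Y X) (trCotι_injective X Y) (trCotι_injective Y X)
    (DGVect.isMor_swap X.toDGVect Y.toDGVect) (DGVect.swap_injective _ _)
    (fun x => (key _).2 ⟨x, rfl⟩) (fun y => by
      obtain ⟨s, hs⟩ := (key (DGVect.swap Y.toDGVect X.toDGVect (trCotι Y X y))).1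
        ⟨y, (DGVect.swap_swap_apply _ _ _).symm⟩
      exact ⟨s, by rw [hs, DGVect.swap_swap_apply]⟩)
  exact DGVect.QI.hIso hf (DGVect.QI.of_bijective hf hb)

end TraceCyclic

end Bicomod

end DGC

namespace DGC
variable {k : Type v} [Field k]

namespace Bicomod

variable {C D E F : DGCoalg.{v, u} k}

/-! ### The cotensor product over `C^e` as a cocenter. -/

section Env

/-- Moving the first factor between the third and the fourth one. -/
noncomputable def envPerm (V X M : DGVect.{v, u} k) :
    V ⊗[k] (X ⊗[k] (V ⊗[k] M)) ≃ₗ[k] X ⊗[k] ((V ⊗[k] V) ⊗[k] M) :=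
  TensorProduct.congr (LinearEquiv.refl k V) (TensorProduct.assoc k X V M).symm ≪≫ₗ
    (TensorProduct.assoc k V (X ⊗[k] V) M).symm ≪≫ₗ
    TensorProduct.congr (LinearEquiv.ofBijective (DGVect.swap V (X.tensor V))
      ⟨DGVect.swap_injective _ _, fun t => ⟨_, DGVect.swap_swap_apply _ _ t⟩⟩)
      (LinearEquiv.refl k M) ≪≫ₗ
    TensorProduct.congr (TensorProduct.assoc k X V V) (LinearEquiv.refl k M) ≪≫ₗ
    TensorProduct.assoc k X (V ⊗[k] V) M

lemma envPerm_tmul (V X M : DGVect.{v, u} k) (c : V) (x : X) (c' : V) (m : M) :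
    envPerm V X M (c ⊗ₜ (x ⊗ₜ (c' ⊗ₜ m))) = TensorProduct.assoc k X (V ⊗[k] V) M
      (TensorProduct.assoc k X V V (DGVect.swap V (X.tensor V) (c ⊗ₜ (x ⊗ₜ c'))) ⊗ₜ m) := rfl

/-- Up to the permutation `envPerm`, the coaction of `C^e` on `X` is the left coaction of `X ⊗ M`
followed by the right coaction of `X` into the middle. -/
lemma assoc_renv (X M : Bicomod C C) (t : X ⊗[k] M) :
    TensorProduct.assoc k X (C ⊗[k] C) M (TensorProduct.map (renv X) LinearMap.id t) =
      envPerm C.toDGVect X.toDGVect M.toDGVect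
        (TensorProduct.map LinearMap.id (coactRight X M).lin ((outer X M).lact t)) := by
  induction t with
  | zero => simp only [map_zero]
  | add x y hx hy => simp only [map_add, hx, hy]
  | tmul x m =>
    change TensorProduct.assoc k X (C ⊗[k] C) M (TensorProduct.assoc k X C C
      (DGVect.swap C.toDGVect (X.toDGVect.tensor C.toDGVect)
        (TensorProduct.map LinearMap.id X.ract (X.lact x))) ⊗ₜ m) =
      envPerm C.toDGVect X.toDGVect M.toDGVect
        (TensorProduct.map LinearMap.id (coactRight X M).lin
          (TensorProduct.assoc k C X M (X.lact x ⊗ₜ m)))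
    generalize X.lact x = s
    induction s with
    | zero => simp only [map_zero, zero_tmul]
    | add x y hx hy => simp only [map_add, add_tmul, hx, hy]
    | tmul c x =>
      rw [map_tmul, LinearMap.id_apply, assoc_tmul, map_tmul, LinearMap.id_apply]
      change _ = envPerm C.toDGVect X.toDGVect M.toDGVect
        (c ⊗ₜ TensorProduct.assoc k X C M (X.ract x ⊗ₜ m))
      generalize X.ract x = s
      induction s with
      | zero => simp only [map_zero, tmul_zero, zero_tmul]
      | add x y hx hy => simp only [map_add, add_tmul, tmul_add, hx, hy]
      | tmul x c' => rw [assoc_tmul, envPerm_tmul]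

/-- The factor `c` crosses `x` and `c'` twice, at no cost in signs, so only its crossing with `m`
remains. -/
lemma envPerm_swap (V X M : DGVect.{v, u} k) (x : X) (c' : V) (m : M) (c : V) :
    envPerm V X M (DGVect.swap (X.tensor (V.tensor M)) V ((x ⊗ₜ (c' ⊗ₜ m)) ⊗ₜ c)) =
      x ⊗ₜ (TensorProduct.assoc k V V M).symm (c' ⊗ₜ DGVect.swap M V (m ⊗ₜ c)) := by
  refine DGVect.induction (V := X) (p := fun x => envPerm V X M
    (DGVect.swap (X.tensor (V.tensor M)) V ((x ⊗ₜ (c' ⊗ₜ m)) ⊗ₜ c)) =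
      x ⊗ₜ (TensorProduct.assoc k V V M).symm (c' ⊗ₜ DGVect.swap M V (m ⊗ₜ c))) x
    (fun p x hx => ?_) (by simp only [zero_tmul, map_zero])
    (fun _ _ h h' => by simp only [add_tmul, map_add, h, h'])
  refine DGVect.induction (V := V) (p := fun c' => envPerm V X M
    (DGVect.swap (X.tensor (V.tensor M)) V ((x ⊗ₜ (c' ⊗ₜ m)) ⊗ₜ c)) =
      x ⊗ₜ (TensorProduct.assoc k V V M).symm (c' ⊗ₜ DGVect.swap M V (m ⊗ₜ c))) c'
    (fun q c' hc' => ?_) (by simp only [zero_tmul, tmul_zero, map_zero])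
    (fun _ _ h h' => by simp only [add_tmul, tmul_add, map_add, h, h'])
  refine DGVect.induction (V := M) (p := fun m => envPerm V X M
    (DGVect.swap (X.tensor (V.tensor M)) V ((x ⊗ₜ (c' ⊗ₜ m)) ⊗ₜ c)) =
      x ⊗ₜ (TensorProduct.assoc k V V M).symm (c' ⊗ₜ DGVect.swap M V (m ⊗ₜ c))) m
    (fun r m hm => ?_) (by simp only [zero_tmul, tmul_zero, map_zero])
    (fun _ _ h h' => by simp only [add_tmul, tmul_add, map_add, h, h'])
  refine DGVect.induction (V := V) (p := fun c => envPerm V X M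
    (DGVect.swap (X.tensor (V.tensor M)) V ((x ⊗ₜ (c' ⊗ₜ m)) ⊗ₜ c)) =
      x ⊗ₜ (TensorProduct.assoc k V V M).symm (c' ⊗ₜ DGVect.swap M V (m ⊗ₜ c))) c
    (fun s c hc => ?_) (by simp only [tmul_zero, map_zero])
    (fun _ _ h h' => by simp only [tmul_add, map_add, h, h'])
  have h1 := DGVect.tmul_mem (V := X) (W := V.tensor M) hx
    (DGVect.tmul_mem (V := V) (W := M) hc' hm rfl) rfl
  rw [DGVect.swap_tmul (V := X.tensor (V.tensor M)) (W := V) h1 hc, map_smul, envPerm_tmul,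
    DGVect.swap_tmul (V := V) (W := X.tensor V) hc (DGVect.tmul_mem hx hc' rfl),
    DGVect.swap_tmul hm hc, map_smul, assoc_tmul, ← smul_tmul', map_smul, assoc_tmul, smul_smul,
    tmul_smul, map_smul, assoc_symm_tmul, tmul_smul, ← sgn_add]
  congr 1
  rw [show (p + (q + r)) * s + s * (p + q) = r * s + (s * (p + q) + s * (p + q)) by ring, sgn_add,
    sgn_add (s * (p + q)), sgn_mul_self, mul_one]

/-- The counterpart of `assoc_renv`: up to the same permutation, the coaction of `C^e` on `M` is the
right coaction of `X ⊗ M` rotated to the front, followed by the left coaction of `M` into the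
middle. -/
lemma map_lenv (X M : Bicomod C C) (t : X ⊗[k] M) :
    TensorProduct.map LinearMap.id (lenv M) t = envPerm C.toDGVect X.toDGVect M.toDGVect
      (TensorProduct.map LinearMap.id (outerMap X (coact M)).lin (rotate (outer X M) t)) := by
  change _ = envPerm C.toDGVect X.toDGVect M.toDGVect
    (TensorProduct.map LinearMap.id (outerMap X (coact M)).lin
      (DGVect.swap (X.toDGVect.tensor M.toDGVect) C.toDGVect ((outer X M).ract t)))
  rw [← DGVect.swap_map_apply (V := X.toDGVect.tensor M.toDGVect) (W := C.toDGVect)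
    (V' := X.toDGVect.tensor (C.toDGVect.tensor M.toDGVect)) (W' := C.toDGVect)
    (outerMap X (coact M)).isMor DGVect.IsMor.id]
  induction t with
  | zero => simp only [map_zero]
  | add x y hx hy => simp only [map_add, hx, hy]
  | tmul x m =>
    have h := LinearMap.congr_fun M.lact_ract m
    simp only [LinearMap.comp_apply, LinearEquiv.coe_coe] at h
    change x ⊗ₜ (TensorProduct.assoc k C C M).symm (TensorProduct.map LinearMap.id
        (DGVect.swap M.toDGVect C.toDGVect)
        (TensorProduct.map LinearMap.id M.ract (M.lact m))) = _
    rw [← h]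
    change _ = envPerm C.toDGVect X.toDGVect M.toDGVect
      (DGVect.swap (X.toDGVect.tensor (C.toDGVect.tensor M.toDGVect)) C.toDGVect
        (TensorProduct.map (TensorProduct.map LinearMap.id M.lact) LinearMap.id
          ((TensorProduct.assoc k X M C).symm (x ⊗ₜ M.ract m))))
    generalize M.ract m = s
    induction s with
    | zero => simp only [map_zero, tmul_zero]
    | add x y hx hy => simp only [map_add, tmul_add, hx, hy]
    | tmul m c =>
      rw [assoc_symm_tmul, map_tmul, map_tmul, map_tmul, LinearMap.id_apply, LinearMap.id_apply]
      generalize M.lact m = s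
      induction s with
      | zero => simp only [map_zero, tmul_zero, zero_tmul]
      | add x y hx hy => simp only [map_add, tmul_add, add_tmul, hx, hy]
      | tmul c' m =>
        rw [assoc_tmul, map_tmul, LinearMap.id_apply]
        exact (envPerm_swap C.toDGVect X.toDGVect M.toDGVect x c' m c).symm

/-- The map `x ⊗ (c ⊗ m) ↦ ε(c) x ⊗ m`. -/
noncomputable def counitMid (X : Bicomod D C) (M : Bicomod C E) :
    X ⊗[k] (C ⊗[k] M) →ₗ[k] X ⊗[k] M :=
  TensorProduct.map LinearMap.id (counitFst M)

lemma counitMid_coact (X : Bicomod D C) (M : Bicomod C E) :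
    counitMid X M ∘ₗ (outerMap X (coact M)).lin = LinearMap.id :=
  TensorProduct.ext' fun x m => by
    change x ⊗ₜ counitFst M (M.lact m) = _
    rw [counitFst_lact, LinearMap.id_apply]

lemma counitMid_coactRight (X : Bicomod D C) (M : Bicomod C E) :
    counitMid X M ∘ₗ (coactRight X M).lin = LinearMap.id :=
  TensorProduct.ext' fun x m => by
    have h := LinearMap.congr_fun X.ract_counit x
    simp only [LinearMap.comp_apply, LinearMap.id_apply, LinearEquiv.coe_coe] at h
    rw [LinearMap.id_apply]
    conv_rhs => rw [← h]
    change TensorProduct.map LinearMap.id (counitFst M) (TensorProduct.assoc k X C M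
      (X.ract x ⊗ₜ m)) = _
    generalize X.ract x = s
    induction s with
    | zero => simp only [map_zero, zero_tmul]
    | add x y hx hy => simp only [map_add, add_tmul, hx, hy]
    | tmul x c => simp [counitFst_tmul, smul_tmul']

lemma counitFst_rotate (W : Bicomod C C) (w : W) : counitFst W (rotate W w) = w := by
  have h := LinearMap.congr_fun W.ract_counit w
  simp only [LinearMap.comp_apply, LinearMap.id_apply, LinearEquiv.coe_coe] at h
  conv_rhs => rw [← h]
  refine LinearMap.congr_fun (f := counitFst W ∘ₗ DGVect.swap W.toDGVect C.toDGVect)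
    (g := (TensorProduct.rid k W).toLinearMap ∘ₗ TensorProduct.map LinearMap.id C.ε)
    (DGVect.tensor_hom_ext fun p q x hx c hc => ?_) (W.ract w)
  rw [LinearMap.comp_apply, DGVect.swap_tmul hx hc, map_smul, counitFst_tmul]
  change _ = C.ε c • x
  by_cases hq : q = 0
  · subst hq; simp
  · rw [C.counit_gr q hq c hc]; simp

lemma trMap_eq_zero_iff (W : Bicomod C C) (w : W) : trMap W w = 0 ↔ W.lact w = rotate W w := by
  rw [trMap_apply, sub_eq_zero]
  constructor
  · intro h
    change _ = DGVect.swap W.toDGVect C.toDGVect (W.ract w)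
    rw [h, DGVect.swap_swap_apply]
  · intro h
    rw [h]
    exact (DGVect.swap_swap_apply W.toDGVect C.toDGVect (W.ract w)).symm

/-- After removing the permutation, the equation compares two elements of `C ⊗ (X ⊗ (C ⊗ M))`. The
counit on the outer `C` leaves the condition for `X □ M`, and the counit on the inner `C` leaves the
equality of the two coactions on `X ⊗ M`. Conversely the two conditions give the equation since both
maps `X ⊗ M → X ⊗ C ⊗ M` commute with the left coaction. -/
lemma cotensorEnv_iff (X M : Bicomod C C) (t : X ⊗[k] M) :
    ((TensorProduct.assoc k X (C ⊗[k] C) M).toLinearMap ∘ₗ TensorProduct.map (renv X) LinearMap.id -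
      TensorProduct.map LinearMap.id (lenv M) :
        X ⊗[k] M →ₗ[k] X ⊗[k] ((C ⊗[k] C) ⊗[k] M)) t = 0 ↔
    cmp X M t = 0 ∧ trMap (outer X M) t = 0 := by
  rw [LinearMap.sub_apply, sub_eq_zero, LinearMap.comp_apply, LinearEquiv.coe_coe, assoc_renv,
    map_lenv, (envPerm C.toDGVect X.toDGVect M.toDGVect).injective.eq_iff, trMap_eq_zero_iff,
    ← cotensor_lin, sub_lin, LinearMap.sub_apply, sub_eq_zero]
  have n1 := LinearMap.congr_fun (coactRight X M).left t
  have n2 := LinearMap.congr_fun (outerMap X (coact M)).left t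
  constructor
  · intro h
    constructor
    · have := congrArg (counitFst (outer X (outer (regular C) M))) h
      rw [counitFst_naturality, counitFst_naturality, counitFst_rotate, counitFst_lact] at this
      exact this
    · have := congrArg (TensorProduct.map LinearMap.id (counitMid X M)) h
      rw [map_map_apply, map_map_apply, counitMid_coact, counitMid_coactRight, LinearMap.comp_id,
        TensorProduct.map_id] at this
      exact this
  · rintro ⟨h1, h2⟩
    rw [← h2]
    exact n1.symm.trans ((congrArg (outer X (outer (regular C) M)).lact h1).trans n2)

/-- The cotensor product over `C^e` is the cocenter of the cotensor product over `C`. -/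
theorem hIso_cotensorEnv (X M : Bicomod C C) :
    DGVect.HIso (cotensorEnv X M) (tr (cotensor X M)) := by
  obtain ⟨f, hf, hb, -⟩ := DGVect.exists_bijective_of_range (V := cotensorEnv X M)
    (W := tr (cotensor X M)) (V' := X.toDGVect.tensor M.toDGVect)
    (W' := X.toDGVect.tensor M.toDGVect)
    (i := (LinearMap.ker ((TensorProduct.assoc k X (C ⊗[k] C) M).toLinearMap ∘ₗ
      TensorProduct.map (renv X) LinearMap.id - TensorProduct.map LinearMap.id (lenv M) :
        X ⊗[k] M →ₗ[k] X ⊗[k] ((C ⊗[k] C) ⊗[k] M))).subtype)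
    ⟨fun _ _ h => h, rfl⟩ (isMor_trCotι X M) Subtype.val_injective (trCotι_injective X M)
    (φ := LinearMap.id) DGVect.IsMor.id Function.injective_id
    (fun x => (mem_range_trCotι X M _).2 ((cotensorEnv_iff X M _).1 x.2))
    (fun y => ⟨⟨_, (cotensorEnv_iff X M _).2 ((mem_range_trCotι X M _).1 ⟨y, rfl⟩)⟩, rfl⟩)
  exact DGVect.QI.hIso hf (DGVect.QI.of_bijective hf hb)

end Env

/-! ### Invariance of `tr (B □ M)` under quasi-isomorphisms in `M`. -/

section TraceRes

/-- The cofree factor absorbs the cocenter: `tr ((C ⊗ K) □ M)` is `tr (C ⊗ (K □ M))`, hence `K □ M`,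
naturally in `M`. -/
lemma QIso.tr_outer_cot (K : Bicomod C D) {M M' : Bicomod D C} {g : M ⟶ M'}
    (h : QIso (cotMap (𝟙 K) g)) : DGVect.QI (V := tr (cotensor (outer (regular C) K) M))
      (W := tr (cotensor (outer (regular C) K) M'))
      (trHom (cotMap (𝟙 (outer (regular C) K)) g)) := by
  have e := cotOuterL_naturality (𝟙 (regular C)) (𝟙 K) g
  rw [outerMap₂_id] at e
  have e' : ∀ x, trHom (cotMap (𝟙 (outer (regular C) K)) g)
      (trHom (cotOuterL (regular C) K M) (rotateTr _ x)) =
      trHom (cotOuterL (regular C) K M') (rotateTr _ ((cotMap (𝟙 K) g).lin x)) := fun x => by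
    rw [rotateTr_naturality]
    exact (trι_injective _ (LinearMap.congr_fun (congrArg Hom.lin e) (trι _ (rotateTr _ x)))).symm
  let a (M : Bicomod D C) := trHom (cotOuterL (regular C) K M) ∘ₗ rotateTr (cotensor K M)
  have ha : ∀ M, DGVect.IsMor (V := (cotensor K M).toDGVect)
      (W := tr (cotensor (outer (regular C) K) M)) (a M) := fun M =>
    DGVect.IsMor.comp (V := (cotensor K M).toDGVect)
      (W := tr (outer (regular C) (cotensor K M)))
      (U := tr (cotensor (outer (regular C) K) M)) (isMor_trHom _) (isMor_rotateTr _)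
  have ha' : ∀ M, DGVect.QI (V := (cotensor K M).toDGVect)
      (W := tr (cotensor (outer (regular C) K) M)) (a M) := fun M =>
    .of_bijective (ha M) ((bijective_trHom _).comp (bijective_rotateTr _))
  refine DGVect.QI.of_comp_right (f := a M) (ha M) (isMor_trHom _) ?_ (ha' M)
  rw [show trHom (cotMap (𝟙 (outer (regular C) K)) g) ∘ₗ a M = a M' ∘ₗ (cotMap (𝟙 K) g).lin from
    LinearMap.ext e']
  exact DGVect.QI.comp (cotMap (𝟙 K) g).isMor (ha M') ((qIso_iff_qi _).1 h) (ha' M')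

lemma QIso.tr_bar_cot (r : ℕ) {M M' : Bicomod C C} {g : M ⟶ M'} (hg : QIso g) :
    DGVect.QI (V := tr (cotensor (bar (regular C) (r + 1)) M))
      (W := tr (cotensor (bar (regular C) (r + 1)) M'))
      (trHom (cotMap (𝟙 (bar (regular C) (r + 1))) g)) := by
  rw [bar_succ]
  exact QIso.tr_outer_cot _ (hg.bar_cot r)

lemma tr_gr_eq_bot {W : Bicomod C C} {a : ℤ} (h : ∀ n < a, W.gr n = ⊥) :
    ∀ n < a, (tr W).gr n = ⊥ := fun n hn =>
  DGVect.gr_eq_bot_of_injective (isMor_trι W) (trι_injective W) (h n hn)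

/-- Hochschild cohomology depends only on the quasi-isomorphism class of the coefficients. -/
theorem QIso.hIso_tr_res (hC : C.IsPos) {M M' : Bicomod C C} {g : M ⟶ M'} (hg : QIso g)
    (hM : M.IsBddBelow) (hM' : M'.IsBddBelow) :
    DGVect.HIso (tr (cotensor (res (regular C)) M)) (tr (cotensor (res (regular C)) M')) := by
  obtain ⟨a, ha⟩ := hM
  obtain ⟨a', ha'⟩ := hM'
  refine DGVect.QI.hIso (isMor_trHom (cotMap (𝟙 (res (regular C))) g)) ?_
  refine DGVect.QI.of_columns (T := ((resTot (regular C)).cotR M).tr)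
    (T' := ((resTot (regular C)).cotR M').tr)
    (g := fun r => trHom (cotMap (𝟙 (bar (regular C) (r + 1))) g)) (isMor_trHom _)
    (fun r x => trι_injective _ (Tot.cotR_map (T := resTot (regular C))
      (T' := resTot (regular C)) (g := fun r => 𝟙 _) (fun _ _ => rfl) g r (trι _ x)))
    (fun r => hg.tr_bar_cot r) (a := min (0 + a) (0 + a')) ?_ ?_
  · exact fun r n hn => tr_gr_eq_bot (cot_gr_eq_bot
      (bar_gr_eq_bot (M := regular C) (a := 0) hC hC (r + 1)) ha) n (by omega)
  · exact fun r n hn => tr_gr_eq_bot (cot_gr_eq_bot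
      (bar_gr_eq_bot (M := regular C) (a := 0) hC hC (r + 1)) ha') n (by omega)

end TraceRes

/-! ### The cocenter of `W ⊗ C` is `W`. -/

section Lead

/-- The counit on the last factor. -/
noncomputable def counitEnd (W : Bicomod D C) : W ⊗[k] C →ₗ[k] W :=
  (TensorProduct.rid k W).toLinearMap ∘ₗ TensorProduct.map LinearMap.id C.ε

lemma counitEnd_tmul (W : Bicomod D C) (w : W) (c : C) : counitEnd W (w ⊗ₜ c) = C.ε c • w := rfl

lemma isMor_counitEnd (W : Bicomod D C) : DGVect.IsMor (V := W.toDGVect.tensor C.toDGVect)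
    (W := W.toDGVect) (counitEnd W) where
  deg n := DGVect.tensor_mem fun p q e w hw c hc => by
    rw [counitEnd_tmul]
    by_cases h : q = 0
    · subst h
      rw [add_zero] at e
      subst e
      exact Submodule.smul_mem _ _ hw
    · rw [C.counit_gr q h c hc, zero_smul]
      exact zero_mem _
  comm := DGVect.tensor_hom_ext fun p q w hw c hc => by
    have h := DGVect.tensor_d_tmul hw c
    rw [LinearMap.comp_apply, LinearMap.comp_apply, h, map_add, map_smul, counitEnd_tmul,
      counitEnd_tmul, counitEnd_tmul, show C.ε (C.d c) = 0 from LinearMap.congr_fun C.counit_d c,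
      zero_smul, smul_zero, add_zero, map_smul]

lemma counitEnd_left (W : Bicomod D C) (t : W ⊗[k] C) : TensorProduct.map LinearMap.id (counitEnd W)
    ((outer W (regular C)).lact t) = W.lact (counitEnd W t) := by
  induction t with
  | zero => simp only [map_zero]
  | add x y hx hy => simp only [map_add, hx, hy]
  | tmul w c =>
    change TensorProduct.map LinearMap.id (counitEnd W) (TensorProduct.assoc k D W C
      (W.lact w ⊗ₜ c)) = W.lact (C.ε c • w)
    rw [map_smul]
    generalize W.lact w = t
    induction t with
    | zero => simp
    | add x y hx hy => simp only [add_tmul, smul_add, map_add, hx, hy]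
    | tmul c p => simp [counitEnd_tmul]

lemma counitEnd_comul (W : Bicomod D C) (t : W ⊗[k] C) :
    TensorProduct.map (counitEnd W) LinearMap.id ((outer W (regular C)).ract t) = t := by
  induction t with
  | zero => simp only [map_zero]
  | add x y hx hy => simp only [map_add, hx, hy]
  | tmul w c =>
    have h := LinearMap.congr_fun (regular C).lact_counit c
    simp only [LinearMap.comp_apply, LinearMap.id_apply, LinearEquiv.coe_coe] at h
    conv_rhs => rw [← h]
    change TensorProduct.map (counitEnd W) LinearMap.id ((TensorProduct.assoc k W C C).symm
      (w ⊗ₜ C.Δ c)) = w ⊗ₜ[k] TensorProduct.lid k C (TensorProduct.map C.ε LinearMap.id (C.Δ c))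
    generalize C.Δ c = s
    induction s with
    | zero => simp
    | add x y hx hy => simp only [map_add, tmul_add, hx, hy]
    | tmul a b => simp [counitEnd_tmul, smul_tmul']

/-- The map `w ↦ ± w₀ ⊗ w₋₁`. -/
noncomputable def lead (W : Bicomod C D) : W →ₗ[k] W ⊗[k] C :=
  DGVect.swap C.toDGVect W.toDGVect ∘ₗ W.lact

/-- The mirror image of `trMap_rotate`. This version, with `C` in the last place, is needed because
the last coface of the Hochschild complex moves the first tensor factor of the coaction to the end.
-/
lemma trMap_lead (W : Bicomod C C) (w : W) : trMap (outer W (regular C)) (lead W w) = 0 := by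
  have h1 : (outer W (regular C)).lact (lead W w) = TensorProduct.assoc k C W C
      (DGVect.swap C.toDGVect (C.toDGVect.tensor W.toDGVect)
        (TensorProduct.map LinearMap.id W.lact (W.lact w))) := by
    rw [DGVect.swap_map_apply (V := C.toDGVect) (W := W.toDGVect) (V' := C.toDGVect)
      (W' := C.toDGVect.tensor W.toDGVect) DGVect.IsMor.id W.isMor_lact]
    rfl
  have h2 : (outer W (regular C)).ract (lead W w) = (TensorProduct.assoc k W C C).symm
      (DGVect.swap (C.toDGVect.tensor C.toDGVect) W.toDGVect
        (TensorProduct.map C.Δ LinearMap.id (W.lact w))) := by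
    rw [DGVect.swap_map_apply (V := C.toDGVect) (W := W.toDGVect)
      (V' := C.toDGVect.tensor C.toDGVect) (W' := W.toDGVect) C.isMor_comul DGVect.IsMor.id]
    rfl
  have h3 := LinearMap.congr_fun W.lact_coassoc w
  simp only [LinearMap.comp_apply, LinearEquiv.coe_coe] at h3
  rw [trMap_apply, h1, h2, sub_eq_zero, ← h3, LinearEquiv.symm_apply_eq]
  exact (swap_cyclic C.toDGVect C.toDGVect W.toDGVect _).symm

lemma eq_lead {W : Bicomod C C} {t : W ⊗[k] C} (h : trMap (outer W (regular C)) t = 0) :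
    t = lead W (counitEnd W t) := by
  have h2 : TensorProduct.map (counitEnd W) LinearMap.id ((outer W (regular C)).ract t) =
      TensorProduct.map (counitEnd W) LinearMap.id (DGVect.swap C.toDGVect
        (W.toDGVect.tensor C.toDGVect) ((outer W (regular C)).lact t)) :=
    congrArg _ (sub_eq_zero.1 h)
  rw [counitEnd_comul, ← DGVect.swap_map_apply (V := C.toDGVect)
    (W := W.toDGVect.tensor C.toDGVect) (V' := C.toDGVect) (W' := W.toDGVect) DGVect.IsMor.id
    (isMor_counitEnd W), counitEnd_left] at h2
  exact h2

lemma lead_injective (W : Bicomod C D) : Function.Injective (lead W) :=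
  (DGVect.swap_injective _ _).comp (lact_injective W)

/-- The cocenter of a cofree bicomodule. -/
noncomputable def leadTr (W : Bicomod C C) : W →ₗ[k] tr (outer W (regular C)) :=
  LinearMap.codRestrict _ (lead W) (trMap_lead W)

lemma bijective_leadTr (W : Bicomod C C) : Function.Bijective (leadTr W) :=
  ⟨fun _ _ e => lead_injective W (congrArg (trι _) e), fun t =>
    ⟨counitEnd W (trι _ t), trι_injective _ (eq_lead (trMap_trι _ t)).symm⟩⟩

end Lead

end Bicomod

end DGC

namespace DGC
variable {k : Type v} [Field k]

namespace Bicomod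

variable {C D E F : DGCoalg.{v, u} k}

/-! ### The Hochschild complex as the cocenter of the standard resolution. -/

section HochComplex

variable (C)

/-- The isomorphism that appends a factor, as a map of bicomodules. -/
noncomputable def appendHom : ∀ n, outer (bar (regular C) n) (regular C) ⟶
    outer (regular C) (bar (regular C) n)
  | 0 => 𝟙 (outer (regular C) (regular C))
  | n + 1 => outerAssoc (regular C) (bar (regular C) n) (regular C) ≫
      outerMap₂ (𝟙 (regular C)) (appendHom n)

lemma appendHom_lin (n : ℕ) : (appendHom C n).lin = append C n := by
  induction n with
  | zero => rfl
  | succ n ih =>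
    change TensorProduct.map LinearMap.id (appendHom C n).lin ∘ₗ _ = _
    rw [ih]
    rfl

lemma isIso_appendHom (n : ℕ) : IsIso (appendHom C n) := by
  induction n with
  | zero => exact IsIso.id (outer (regular C) (regular C))
  | succ n ih =>
    have := ih
    exact inferInstanceAs (IsIso (outerAssoc (regular C) (bar (regular C) n) (regular C) ≫
      outerMap₂ (𝟙 (regular C)) (appendHom C n)))

/-- The last coface, as a map to the cocenter. -/
noncomputable def lastCofaceTr (n : ℕ) :
    bar (regular C) n →ₗ[k] tr (outer (regular C) (bar (regular C) n)) :=
  trHom (appendHom C n) ∘ₗ leadTr (bar (regular C) n)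

lemma trι_lastCofaceTr (n : ℕ) (x : bar (regular C) n) :
    trι _ (lastCofaceTr C n x) = lastCoface C n x := by
  change (appendHom C n).lin (lead _ x) = _
  rw [appendHom_lin]
  rfl

lemma bijective_lastCofaceTr (n : ℕ) : Function.Bijective (lastCofaceTr C n) :=
  have := isIso_appendHom C n
  (bijective_trHom (appendHom C n)).comp (bijective_leadTr _)

lemma isMor_lastCofaceTr (n : ℕ) : DGVect.IsMor (V := (bar (regular C) n).toDGVect)
    (W := tr (outer (regular C) (bar (regular C) n))) (lastCofaceTr C n) where
  deg m x hx := by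
    refine (isMor_trι _).mem_of_injective (trι_injective _) ?_
    rw [trι_lastCofaceTr]
    exact (isMor_lastCoface C n).deg m x hx
  comm := LinearMap.ext fun x => trι_injective _ (by
    rw [LinearMap.comp_apply, LinearMap.comp_apply, (isMor_trι _).comm_apply, trι_lastCofaceTr,
      trι_lastCofaceTr]
    exact (isMor_lastCoface C n).comm_apply x)

/-- Write `b = b' + s λ`, with `λ` the last coface and `s` a sign that changes with `n`. Since `b'
b' = 0`, the equation `b b = 0` becomes `s (b' λ - λ b) = 0`. Hence `λ` transports the Hochschild
differential to `b'`, and no separate computation is needed. -/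
lemma barD_lastCoface (n : ℕ) (x : bar (regular C) n) :
    (barD (regular C) (n + 1)).lin (lastCoface C n x) = lastCoface C (n + 1) (hochD C n x) := by
  have h1 := LinearMap.congr_fun (hochD_comp C n) x
  have h2 : (barD (regular C) (n + 1)).lin ((barD (regular C) n).lin x) = 0 :=
    LinearMap.congr_fun (congrArg Hom.lin (barD_comp (regular C) n)) x
  have e : sgn k (((n + 1 : ℕ) : ℤ) + 1) = - sgn k (n + 1) := by
    rw [sgn_add]; push_cast; simp
  have h3 : hochD C n x = (barD (regular C) n).lin x + sgn k (n + 1) • lastCoface C n x := rfl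
  have h4 : ∀ y, hochD C (n + 1) y = (barD (regular C) (n + 1)).lin y +
      sgn k (((n + 1 : ℕ) : ℤ) + 1) • lastCoface C (n + 1) y := fun _ => rfl
  rw [LinearMap.comp_apply, h4, e, LinearMap.zero_apply] at h1
  conv at h1 => lhs; lhs; rw [h3, map_add, h2, zero_add, map_smul]
  rw [neg_smul, ← sub_eq_add_neg, ← smul_sub] at h1
  have h5 := congrArg (sgn k ((n : ℤ) + 1) • ·) h1
  simp only [smul_smul, sgn_mul_self, one_smul, smul_zero] at h5
  exact sub_eq_zero.1 h5

/-- The Hochschild complex is the cocenter of the standard resolution. -/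
theorem hIso_hochComplex : DGVect.HIso (hochComplex C) (tr (res (regular C))) := by
  let T := DGVect.totDTot (fun n => (bar (regular C) n).toDGVect) (hochD C) (isMor_hochD C)
    (hochD_comp C)
  let T' := (resTot (regular C)).tr
  -- The column `r` is `C^(⊗ (r+1))` on the left and `tr (C^(⊗ (r+2)))` on the right, because the
  -- resolution starts at `bar 1`; the last coface raises the number of factors by one and is
  -- bijective onto the cocenter.
  let φ : hochComplex C →ₗ[k] tr (res (regular C)) :=
    DirectSum.toModule k ℕ _ (fun r => T'.i r ∘ₗ lastCofaceTr C r)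
  have hφ : ∀ r x, φ (T.i r x) = T'.i r (lastCofaceTr C r x) := fun r x =>
    DirectSum.toModule_lof (M := fun r => (bar (regular C) r).carrier)
      (φ := fun r => T'.i r ∘ₗ lastCofaceTr C r) k r x
  have hm : DGVect.IsMor (V := hochComplex C) (W := tr (res (regular C))) φ :=
    DGVect.DTot.isMor (T := T) (T' := T') (g := lastCofaceTr C) hφ (isMor_lastCofaceTr C)
      (fun r x => trι_injective _ ((trι_lastCofaceTr C (r + 1) (hochD C r x)).trans
        ((barD_lastCoface C r x).symm.trans (congrArg (barD (regular C) (r + 1)).lin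
          (trι_lastCofaceTr C r x).symm))))
  exact DGVect.QI.hIso hm (DGVect.QI.of_bijective hm
    (DGVect.DTot.bijective (T := T) (T' := T') hφ (bijective_lastCofaceTr C)))

end HochComplex

/-! ### Invariance of Hochschild cohomology. -/

section Invariance

/-- The bicomodules `M` and `N` are linked by a zigzag of two quasi-isomorphisms of left bounded
bicomodules. -/
def Linked (M N : Bicomod C D) : Prop :=
  ∃ (Z : Bicomod C D) (f : M ⟶ Z) (g : N ⟶ Z), Z.IsBddBelow ∧ QIso f ∧ QIso g

/-- The map from a bicomodule to its resolution. -/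
noncomputable def toRes (M : Bicomod C D) : M ⟶ cotensor (res (regular C)) M :=
  unitL M ≫ cotMap (resAug (regular C)) (𝟙 M)

lemma toRes_naturality {M M' : Bicomod C D} (f : M ⟶ M') :
    f ≫ toRes M' = toRes M ≫ cotMap (𝟙 _) f := by
  rw [toRes, toRes, ← Category.assoc, unitL_naturality, Category.assoc, Category.assoc,
    cotMap_comp, cotMap_comp, Category.comp_id, Category.id_comp, Category.id_comp,
    Category.comp_id]

lemma qIso_toRes (M : Bicomod C D) : QIso (toRes M) :=
  (QIso.of_isIso _).comp (qIso_resAug_cot _ _)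

lemma isBddBelow_res_cot (hC : C.IsPos) {M : Bicomod C D} (hM : M.IsBddBelow) :
    (cotensor (res (regular C)) M).IsBddBelow :=
  ((isBddBelow_regular hC).res hC).cotensor hM

/-- The isomorphism `(P □ (B □ Q)) □ N ≅ P □ (B □ (Q □ N))`. -/
noncomputable def assocRes (P : Bicomod F D) (Q : Bicomod D C) (N : Bicomod C E) :
    cotensor (cotensor P (cotensor (res (regular D)) Q)) N ⟶
      cotensor P (cotensor (res (regular D)) (cotensor Q N)) :=
  cotAssoc _ _ _ ≫ cotMap (𝟙 P) (cotAssoc _ _ _)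

instance (P : Bicomod F D) (Q : Bicomod D C) (N : Bicomod C E) : IsIso (assocRes P Q N) := by
  unfold assocRes; infer_instance

lemma assocRes_naturality {P P' : Bicomod F D} {Q : Bicomod D C} {N N' : Bicomod C E} (p : P ⟶ P')
    (g : N ⟶ N') :
    cotMap (cotMap p (𝟙 (cotensor (res (regular D)) Q))) g ≫ assocRes P' Q N' =
      assocRes P Q N ≫ cotMap p (cotMap (𝟙 _) (cotMap (𝟙 Q) g)) := by
  have h := cotAssoc_naturality (𝟙 (res (regular D))) (𝟙 Q) g
  rw [cotMap_id] at h
  rw [assocRes, assocRes, ← Category.assoc, cotAssoc_naturality, Category.assoc, Category.assoc,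
    cotMap_comp, cotMap_comp, h, Category.comp_id, Category.id_comp]

/-- Inside the cocenter, `C` is replaced by `P □ (B □ Q)`, and the resulting cyclic word in `P`,
`B`, `Q`, `B`, `M`, `B` is read from another starting point, as a cocenter over `D` in place of one
over `C`. -/
lemma hIso_tr_twist (hC : C.IsPos) (hD : D.IsPos) {P : Bicomod C D} {Q : Bicomod D C}
    (hP : P.IsBddBelow) (hQ : Q.IsBddBelow)
    (h : Linked (cotensor P (cotensor (res (regular D)) Q)) (regular C)) {M : Bicomod C C}
    (hM : M.IsBddBelow) :
    DGVect.HIso (tr (cotensor (res (regular C)) M)) (tr (cotensor (res (regular D))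
      (cotensor (cotensor Q (cotensor (res (regular C)) M)) (cotensor (res (regular C)) P)))) := by
  obtain ⟨Z, f, g, hZ, hf, hg⟩ := h
  have b1 := isBddBelow_res_cot hC hM
  have b2 := isBddBelow_regular hC
  have b3 := hP.cotensor (isBddBelow_res_cot hD hQ)
  -- Replacing `M` by `B □ M` puts a resolution between `M` and the copy of `C` about to be
  -- inserted; this is what permits exchanging `C` for a quasi-isomorphic bicomodule.
  have h1 := (qIso_toRes M).hIso_tr_res hC hM b1
  have h2 := (QIso.of_isIso (unitL (cotensor (res (regular C)) M))).hIso_tr_res hC b1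
    (b2.cotensor b1)
  -- The exchange follows the zigzag: from `C` to `Z`, and from there back to `P □ (B □ Q)`.
  have h3 := (hg.cot_res_cot hC (QIso.id M) b2 hZ hM hM).hIso_tr_res hC (b2.cotensor b1)
    (hZ.cotensor b1)
  have h4 := (hf.cot_res_cot hC (QIso.id M) b3 hZ hM hM).hIso_tr_res hC (b3.cotensor b1)
    (hZ.cotensor b1)
  have h5 := hIso_tr_of_isIso (cotMap (𝟙 (res (regular C)))
    (assocRes P Q (cotensor (res (regular C)) M)))
  have h6 := hIso_tr_of_isIso (cotAssoc (res (regular C)) P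
    (cotensor (res (regular D)) (cotensor Q (cotensor (res (regular C)) M))))
  -- After reassociation `B □ P` stands in front. Moving it to the end changes a cocenter over `C`
  -- into one over `D`.
  have h7 := hIso_tr_cyclic (cotensor (res (regular C)) P)
    (cotensor (res (regular D)) (cotensor Q (cotensor (res (regular C)) M)))
  have h8 := hIso_tr_of_isIso (cotAssoc (res (regular D))
    (cotensor Q (cotensor (res (regular C)) M)) (cotensor (res (regular C)) P))
  exact h1.trans (h2.trans (h3.trans (h4.symm.trans (h5.trans (h6.symm.trans (h7.trans h8))))))

/-- The derived cotensor product in terms of the resolution of the coalgebra. -/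
lemma exists_isIso_dcotensor (P : Bicomod C D) (N : Bicomod D E) :
    ∃ f : P.dcotensor N ⟶ cotensor P (cotensor (res (regular D)) N), IsIso f := by
  obtain ⟨f, hf⟩ := exists_isIso_res N
  have h : IsIso (cotMap (𝟙 P) f) := inferInstance
  exact ⟨_, h⟩

/-- The twist `(Q □ M) □ P` in terms of the resolution of the coalgebra. -/
lemma exists_isIso_twist (P : Bicomod C D) (Q : Bicomod D C) (M : Bicomod C C) :
    ∃ f : (Q.dcotensor M).dcotensor P ⟶
      cotensor (cotensor Q (cotensor (res (regular C)) M)) (cotensor (res (regular C)) P),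
      IsIso f := by
  obtain ⟨f, hf⟩ := exists_isIso_dcotensor Q M
  obtain ⟨g, hg⟩ := exists_isIso_res P
  have h : IsIso (cotMap f g) := inferInstance
  exact ⟨_, h⟩

theorem hIso_hoch (hC : C.IsPos) (hD : D.IsPos) {P : Bicomod C D} {Q : Bicomod D C}
    (hP : P.IsBddBelow) (hQ : Q.IsBddBelow)
    (h : Linked (cotensor P (cotensor (res (regular D)) Q)) (regular C)) {M : Bicomod C C}
    (hM : M.IsBddBelow) : DGVect.HIso (cotensorEnv (res (regular C)) M)
      (cotensorEnv (res (regular D)) ((Q.dcotensor M).dcotensor P)) := by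
  obtain ⟨f, hf⟩ := exists_isIso_twist P Q M
  exact (hIso_cotensorEnv _ _).trans ((hIso_tr_twist hC hD hP hQ h hM).trans
    ((hIso_tr_of_isIso (cotMap (𝟙 (res (regular D))) f)).symm.trans (hIso_cotensorEnv _ _).symm))

/-- The quasi-isomorphism `Q → Q □ (B □ C)`. -/
noncomputable def toCotRes (Q : Bicomod D C) :
    Q ⟶ cotensor Q (cotensor (res (regular C)) (regular C)) :=
  unitR Q ≫ cotMap (𝟙 Q) (resAug (regular C)) ≫ cotMap (𝟙 Q) (unitR _)

lemma toCotRes_naturality {Q Q' : Bicomod D C} (f : Q ⟶ Q') :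
    f ≫ toCotRes Q' = toCotRes Q ≫ cotMap f (𝟙 _) := by
  rw [toCotRes, toCotRes, ← Category.assoc, unitR_naturality, Category.assoc, Category.assoc,
    Category.assoc]
  simp only [cotMap_comp, Category.comp_id, Category.id_comp]

lemma qIso_toCotRes (Q : Bicomod D C) : QIso (toCotRes Q) :=
  (QIso.of_isIso _).comp ((qIso_cot_resAug Q).comp (QIso.of_isIso _))

/-- The case `M = C` of the twist. The map `Q → Q □ (B □ C)` is a quasi-isomorphism, so the twist of
`C` is linked to `Q □ (B □ P)` and hence, by the second zigzag, to `D`. -/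
theorem hIso_hochComplex_of_linked (hC : C.IsPos) (hD : D.IsPos) {P : Bicomod C D}
    {Q : Bicomod D C} (hP : P.IsBddBelow) (hQ : Q.IsBddBelow)
    (h : Linked (cotensor P (cotensor (res (regular D)) Q)) (regular C))
    (h' : Linked (cotensor Q (cotensor (res (regular C)) P)) (regular D)) :
    DGVect.HIso (hochComplex C) (hochComplex D) := by
  obtain ⟨Z, f, g, hZ, hf, hg⟩ := h'
  have b1 := isBddBelow_regular hC
  have b2 := isBddBelow_regular hD
  have b3 := hQ.cotensor (isBddBelow_res_cot hC b1)
  have b4 := isBddBelow_res_cot hC hP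
  have h1 := ((qIso_toCotRes Q).cot_res_cot hC (QIso.id P) hQ b3 hP hP).hIso_tr_res hD
    (hQ.cotensor b4) (b3.cotensor b4)
  exact (hIso_hochComplex C).trans ((hIso_tr_of_isIso (unitR (res (regular C)))).trans
    ((hIso_tr_twist hC hD hP hQ h b1).trans (h1.symm.trans
      ((hf.hIso_tr_res hD (hQ.cotensor b4) hZ).trans ((hg.hIso_tr_res hD b2 hZ).symm.trans
        ((hIso_tr_of_isIso (unitR (res (regular D)))).symm.trans (hIso_hochComplex D).symm))))))

end Invariance

end Bicomod

end DGC

/-! ### Truncation of bicomodules over positively graded coalgebras. -/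

namespace DGC
variable {k : Type v} [Field k]

namespace DGVect

/-- The quotient of a differential graded vector space by a graded subspace that is stable under
the differential. -/
abbrev quot (V : DGVect.{v, u} k) (N : Submodule k V) (hN : ∀ n, ∀ x ∈ N, V.proj n x ∈ N)
    (hd : ∀ x ∈ N, V.d x ∈ N) : DGVect.{v, u} k where
  carrier := V ⧸ N
  gr n := (V.gr n).map N.mkQ
  internal := by
    refine isInternal_of _ ?_ (fun n => N.mapQ N (V.proj n) (hN n)) ?_ ?_
    · rw [← Submodule.map_iSup, V.iSup_gr, Submodule.map_top, Submodule.range_mkQ]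
    · rintro n _ ⟨x, hx, rfl⟩
      rw [Submodule.mkQ_apply, Submodule.mapQ_apply, proj_same hx]
    · rintro m n hmn _ ⟨x, hx, rfl⟩
      rw [Submodule.mkQ_apply, Submodule.mapQ_apply, proj_ne hmn hx, Submodule.Quotient.mk_zero]
  d := N.mapQ N V.d hd
  d_mem := by
    rintro n _ ⟨x, hx, rfl⟩
    exact ⟨V.d x, V.d_mem n x hx, rfl⟩
  d_d := by
    refine Submodule.linearMap_qext _ (LinearMap.ext fun x => ?_)
    change N.mkQ (V.d (V.d x)) = 0
    rw [V.d_d_apply, map_zero]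

/-- The subcomplex of a complex that consists of the terms of degree less than `a` and the
coboundaries of degree `a`. -/
def lower (V : DGVect.{v, u} k) (a : ℤ) : Submodule k V :=
  (⨆ n : Set.Iio a, V.gr n) ⊔ (V.gr (a - 1)).map V.d

variable {V : DGVect.{v, u} k} {a : ℤ}

lemma mem_lower {n : ℤ} (hn : n < a) {x : V} (hx : x ∈ V.gr n) : x ∈ V.lower a :=
  Submodule.mem_sup_left (Submodule.mem_iSup_of_mem (⟨n, hn⟩ : Set.Iio a) hx)

lemma d_mem_lower {x : V} (hx : x ∈ V.gr (a - 1)) : V.d x ∈ V.lower a :=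
  Submodule.mem_sup_right ⟨x, hx, rfl⟩

lemma lower_le {S : Submodule k V} (h1 : ∀ n < a, ∀ x ∈ V.gr n, x ∈ S)
    (h2 : ∀ x ∈ V.gr (a - 1), V.d x ∈ S) : V.lower a ≤ S := by
  refine sup_le (iSup_le fun n x hx => h1 n n.2 x hx) ?_
  rintro _ ⟨x, hx, rfl⟩
  exact h2 x hx

lemma proj_mem_lower (n : ℤ) : ∀ x ∈ V.lower a, V.proj n x ∈ V.lower a := by
  suffices h : V.lower a ≤ (V.lower a).comap (V.proj n) from h
  refine lower_le (fun m hm x hx => ?_) fun x hx => ?_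
  · by_cases h : m = n
    · subst h
      rw [Submodule.mem_comap, proj_same hx]
      exact mem_lower hm hx
    · rw [Submodule.mem_comap, proj_ne h hx]
      exact zero_mem _
  · have hx' := V.d_mem _ _ hx
    by_cases h : a - 1 + 1 = n
    · subst h
      rw [Submodule.mem_comap, proj_same hx']
      exact d_mem_lower hx
    · rw [Submodule.mem_comap, proj_ne h hx']
      exact zero_mem _

lemma d_lower : ∀ x ∈ V.lower a, V.d x ∈ V.lower a := by
  suffices h : V.lower a ≤ (V.lower a).comap V.d from h
  refine lower_le (fun m hm x hx => ?_) fun x hx => ?_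
  · by_cases h : m = a - 1
    · subst h
      exact d_mem_lower hx
    · exact mem_lower (by omega) (V.d_mem _ _ hx)
  · rw [Submodule.mem_comap, V.d_d_apply]
    exact zero_mem _

lemma eq_zero_of_mem_lower {n : ℤ} (hn : a < n) {x : V} (hx : x ∈ V.gr n) (h : x ∈ V.lower a) :
    x = 0 := by
  rw [← proj_same hx]
  suffices h' : V.lower a ≤ LinearMap.ker (V.proj n) from h' h
  exact lower_le (fun m hm x hx => proj_ne (by omega) hx)
    fun x hx => proj_ne (by omega) (V.d_mem _ _ hx)

lemma exists_d_of_mem_lower {x : V} (hx : x ∈ V.gr a) (h : x ∈ V.lower a) :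
    ∃ y ∈ V.gr (a - 1), V.d y = x := by
  rw [← proj_same hx]
  suffices h' : V.lower a ≤ ((V.gr (a - 1)).map V.d).comap (V.proj a) from h' h
  refine lower_le (fun m hm x hx => ?_) fun x hx => ?_
  · rw [Submodule.mem_comap, proj_ne (by omega) hx]
    exact zero_mem _
  · rw [Submodule.mem_comap, proj_same (mem_cast (V.d_mem _ _ hx) (by ring))]
    exact ⟨x, hx, rfl⟩

variable (V a) in
/-- The truncation of a complex to degrees at least `a`. -/
abbrev trunc : DGVect.{v, u} k := V.quot (V.lower a) proj_mem_lower d_lower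

lemma isMor_mkQ : IsMor (V := V) (W := V.trunc a) (V.lower a).mkQ :=
  ⟨fun _ x hx => ⟨x, hx, rfl⟩, rfl⟩

lemma mkQ_eq_zero {n : ℤ} (hn : n < a) {x : V} (hx : x ∈ V.gr n) : (V.lower a).mkQ x = 0 :=
  (Submodule.Quotient.mk_eq_zero _).2 (mem_lower hn hx)

/-- A map that is zero in degrees less than `a` and compatible with the differentials vanishes on
the lower part. -/
lemma eq_zero_on_lower {W : DGVect.{v, u} k} {f : V →ₗ[k] W} (hf : f ∘ₗ V.d = W.d ∘ₗ f)
    (h : ∀ n < a, ∀ x ∈ V.gr n, f x = 0) : V.lower a ≤ LinearMap.ker f :=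
  lower_le h fun x hx => by
    rw [LinearMap.mem_ker, ← LinearMap.comp_apply, hf, LinearMap.comp_apply,
      h (a - 1) (by omega) x hx, map_zero]

end DGVect

namespace Bicomod

variable {C D E F : DGCoalg.{v, u} k}

section Truncation

variable (hC : C.IsPos) (hD : D.IsPos) (M : Bicomod C D) (a : ℤ)

/-- In the coaction of an element of degree less than `a` every term `c ⊗ m` with `c ≠ 0` has `|c| ≥
0`, hence `|m| < a`, so the part to be divided out is a subcomodule in those degrees. The
coboundaries in degree `a` follow since everything commutes with the differentials. -/
lemma map_mkQ_lact (hC : C.IsPos) : M.toDGVect.lower a ≤ LinearMap.ker (TensorProduct.map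
    (LinearMap.id : C →ₗ[k] C) (M.toDGVect.lower a).mkQ ∘ₗ M.lact) := by
  have h1 := (DGVect.IsMor.map (V := C.toDGVect) (V' := C.toDGVect) (W := M.toDGVect)
    (W' := M.toDGVect.trunc a) .id DGVect.isMor_mkQ)
  refine DGVect.eq_zero_on_lower (W := C.toDGVect.tensor (M.toDGVect.trunc a))
    (DGVect.IsMor.comp (V := M.toDGVect) (W := C.toDGVect.tensor M.toDGVect)
      (U := C.toDGVect.tensor (M.toDGVect.trunc a)) h1 M.isMor_lact).comm fun n hn x hx => ?_
  have h2 := M.isMor_lact.deg n x hx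
  refine DGVect.tensor_mem (V := C.toDGVect) (W := M.toDGVect) (S := ⊥)
    (f := TensorProduct.map (LinearMap.id : C →ₗ[k] C) (M.toDGVect.lower a).mkQ) (fun p q e c hc m hm => ?_) _ h2
  rw [map_tmul, Submodule.mem_bot, LinearMap.id_apply]
  by_cases hp : p < 0
  · rw [DGVect.eq_zero_of_gr (V := C.toDGVect) hC hp hc, zero_tmul]
  · rw [DGVect.mkQ_eq_zero (by omega) hm, tmul_zero]

lemma map_mkQ_ract (hD : D.IsPos) : M.toDGVect.lower a ≤ LinearMap.ker (TensorProduct.map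
    (M.toDGVect.lower a).mkQ (LinearMap.id : D →ₗ[k] D) ∘ₗ M.ract) := by
  have h1 := (DGVect.IsMor.map (V := M.toDGVect) (V' := M.toDGVect.trunc a) (W := D.toDGVect)
    (W' := D.toDGVect) DGVect.isMor_mkQ .id)
  refine DGVect.eq_zero_on_lower (W := (M.toDGVect.trunc a).tensor D.toDGVect)
    (DGVect.IsMor.comp (V := M.toDGVect) (W := M.toDGVect.tensor D.toDGVect)
      (U := (M.toDGVect.trunc a).tensor D.toDGVect) h1 M.isMor_ract).comm fun n hn x hx => ?_
  have h2 := M.isMor_ract.deg n x hx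
  refine DGVect.tensor_mem (V := M.toDGVect) (W := D.toDGVect) (S := ⊥)
    (f := TensorProduct.map (M.toDGVect.lower a).mkQ (LinearMap.id : D →ₗ[k] D)) (fun p q e m hm c hc => ?_) _ h2
  rw [map_tmul, Submodule.mem_bot, LinearMap.id_apply]
  by_cases hq : q < 0
  · rw [DGVect.eq_zero_of_gr (V := D.toDGVect) hD hq hc, tmul_zero]
  · rw [DGVect.mkQ_eq_zero (by omega) hm, zero_tmul]

/-- The truncation of a bicomodule to degrees at least `a`. -/
noncomputable abbrev trunc : Bicomod C D :=
  ofEpi (M.toDGVect.trunc a) (fun _ : Unit => M) (fun _ => (M.toDGVect.lower a).mkQ) (fun _ => 0)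
    (fun Y _ _ f g h => Submodule.linearMap_qext _ (h ()))
    (fun n => by rw [iSup_const])
    (fun _ => by rw [add_zero]; rfl)
    ((M.toDGVect.lower a).liftQ _ (map_mkQ_lact M a hC))
    ((M.toDGVect.lower a).liftQ _ (map_mkQ_ract M a hD))
    (fun _ => Submodule.liftQ_mkQ _ _ _) (fun _ => Submodule.liftQ_mkQ _ _ _)
    (fun _ => by rw [LinearMap.comp_zero, TensorProduct.map_zero_right, LinearMap.zero_comp])
    (fun _ => by rw [LinearMap.comp_zero, TensorProduct.map_zero_left, LinearMap.zero_comp])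

/-- The projection to the truncation. -/
noncomputable def truncπ : M ⟶ trunc hC hD M a where
  lin := (M.toDGVect.lower a).mkQ
  isMor := DGVect.isMor_mkQ
  left := Submodule.liftQ_mkQ _ _ _
  right := Submodule.liftQ_mkQ _ _ _

lemma isBddBelow_trunc : (trunc hC hD M a).IsBddBelow := by
  refine ⟨a, fun n hn => ?_⟩
  rw [eq_bot_iff]
  rintro _ ⟨x, hx, rfl⟩
  exact DGVect.mkQ_eq_zero hn hx

/-- Nothing changes in cohomology above `a`, and below `a` both sides vanish. In degree `a` itself
precisely the coboundaries have been divided out, so a class that dies in the quotient was already a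
coboundary. -/
lemma qIso_truncπ (h : ∀ n < a, ∀ x ∈ M.gr n, M.d x = 0 → ∃ y ∈ M.gr (n - 1), M.d y = x) :
    QIso (truncπ hC hD M a) := by
  rw [qIso_iff]
  constructor
  · rintro n x hx hdx ⟨_, ⟨y, hy, rfl⟩, e⟩
    have hdy := DGVect.mem_cast (V := M.toDGVect) (M.d_mem _ _ hy) (sub_add_cancel n 1)
    have e' : x - M.d y ∈ M.toDGVect.lower a := (Submodule.Quotient.eq _).1 e.symm
    rcases lt_trichotomy n a with hn | rfl | hn
    · exact h n hn x hx hdx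
    · obtain ⟨z, hz, ez⟩ := DGVect.exists_d_of_mem_lower (V := M.toDGVect) (sub_mem hx hdy) e'
      exact ⟨z + y, add_mem hz hy, by rw [map_add, ez, sub_add_cancel]⟩
    · exact ⟨y, hy, (sub_eq_zero.1 (DGVect.eq_zero_of_mem_lower (V := M.toDGVect) hn
        (sub_mem hx hdy) e')).symm⟩
  · rintro n _ ⟨y, hy, rfl⟩ hdy
    by_cases hn : n < a
    · refine ⟨0, zero_mem _, map_zero _, 0, zero_mem _, ?_⟩
      rw [DGVect.mkQ_eq_zero hn hy, map_zero, map_zero, sub_zero]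
    · have e' : M.d y ∈ M.toDGVect.lower a := (Submodule.Quotient.mk_eq_zero _).1 hdy
      refine ⟨y, hy, DGVect.eq_zero_of_mem_lower (V := M.toDGVect) (n := n + 1) (by omega)
        (M.d_mem _ _ hy) e', 0, zero_mem _, ?_⟩
      rw [map_zero]
      exact (sub_self _).symm

/-- A bicomodule that is quasi-isomorphic to a left bounded one may be truncated. -/
theorem exists_qIso_isBddBelow (hC : C.IsPos) (hD : D.IsPos) {M N : Bicomod C D} {s : M ⟶ N}
    (hs : QIso s) (hM : M.IsBddBelow) :
    ∃ (Z : Bicomod C D) (t : N ⟶ Z), Z.IsBddBelow ∧ QIso t := by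
  obtain ⟨a, ha⟩ := hM
  refine ⟨trunc hC hD N a, truncπ hC hD N a, isBddBelow_trunc .., qIso_truncπ hC hD N a ?_⟩
  intro n hn y hy hdy
  -- Below the bound of `M`, a cocycle of `N` is cohomologous to the image of an element of `M`, and
  -- that element is zero.
  obtain ⟨x, hx, -, z, hz, e⟩ := ((qIso_iff s).1 hs).2 n y hy hdy
  rw [ha n hn, Submodule.mem_bot] at hx
  rw [hx, map_zero, sub_zero] at e
  exact ⟨z, hz, e⟩

end Truncation

end Bicomod

end DGC

/-! ### Localization of a full subcategory under a calculus of left fractions. -/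

namespace DGC

section Subcategory

variable {K K' K'' E : Type*} [Category* K] [Category* K'] [Category* K''] [Category* E]
  (W'' : MorphismProperty K'') (P'' : ObjectProperty K'')
  (W' : MorphismProperty K') (P' : ObjectProperty K')
  (W : MorphismProperty K) (P : ObjectProperty K)

/-- The class `W` may be localized on the full subcategory `P`: a morphism in `W` from an object
of `P` can be continued to a morphism in `W` between objects of `P`. -/
class IsLocalizing : Prop where
  exists_comp : ∀ {X Y : K} (s : X ⟶ Y), P X → W s → ∃ (Z : K) (b : Y ⟶ Z), P Z ∧ W (s ≫ b)

/-- The morphisms of the full subcategory that belong to `W`. -/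
abbrev resW : MorphismProperty P.FullSubcategory := W.inverseImage P.ι

/-- The localization of the full subcategory. -/
abbrev LocSub := (resW W P).Localization

/-- Fractions and equalizing maps are taken in the ambient category, and their targets are then
carried into `P` by `IsLocalizing`, which applies because the denominators start in `P`. -/
instance [W.HasLeftCalculusOfFractions] [IsLocalizing W P] :
    (resW W P).HasLeftCalculusOfFractions where
  exists_leftFraction := by
    rintro X Y ⟨s, hs, f⟩
    obtain ⟨φ, hφ⟩ := MorphismProperty.HasLeftCalculusOfFractions.exists_leftFraction
      (W := W) (MorphismProperty.RightFraction.mk (W := W) s.hom hs f.hom)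
    obtain ⟨Z, b, hZ, hb⟩ := IsLocalizing.exists_comp (P := P) φ.s Y.2 φ.hs
    refine ⟨⟨P.homMk (Y := ⟨Z, hZ⟩) (φ.f ≫ b), P.homMk (Y := ⟨Z, hZ⟩) (φ.s ≫ b), hb⟩,
      P.hom_ext ?_⟩
    have : f.hom ≫ φ.s ≫ b = s.hom ≫ φ.f ≫ b := by
      have h : f.hom ≫ φ.s = s.hom ≫ φ.f := hφ
      rw [← Category.assoc, h, Category.assoc]
    exact this
  ext := by
    intro A X Y f₁ f₂ s hs e
    obtain ⟨Y', t, ht, e'⟩ := MorphismProperty.HasLeftCalculusOfFractions.ext (W := W)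
      f₁.hom f₂.hom s.hom hs (congrArg (fun f => f.hom) e)
    obtain ⟨Z, b, hZ, hb⟩ := IsLocalizing.exists_comp (P := P) t Y.2 ht
    refine ⟨⟨Z, hZ⟩, P.homMk (t ≫ b), hb, P.hom_ext ?_⟩
    have : f₁.hom ≫ t ≫ b = f₂.hom ≫ t ≫ b := by
      rw [← Category.assoc, e', Category.assoc]
    exact this

section Lift

variable {W P}

/-- The functor on the localization induced by a functor on the full subcategory. -/
noncomputable abbrev locLift (H : P.FullSubcategory ⥤ E) (hH : (resW W P).IsInvertedBy H) :
    LocSub W P ⥤ E :=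
  Localization.lift H hH (resW W P).Q

/-- The comparison of `locLift H` with `H`. -/
noncomputable abbrev locLiftFac (H : P.FullSubcategory ⥤ E) (hH : (resW W P).IsInvertedBy H) :
    (resW W P).Q ⋙ locLift H hH ≅ H :=
  Localization.fac H hH (resW W P).Q

end Lift

lemma inverted_ι : (resW W P).IsInvertedBy (P.ι ⋙ W.Q) := fun _ _ f hf =>
  Localization.inverts W.Q W f.hom hf

/-- The functor from the localization of the full subcategory to the localization. -/
noncomputable abbrev locι : LocSub W P ⥤ W.Localization := locLift (P.ι ⋙ W.Q) (inverted_ι W P)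

/-- A morphism of the localization between objects of `P` is a left fraction `X → Y' ← Y`. Expanding
it by a morphism `Y' → Z` with `Z` in `P` makes both legs belong to the subcategory without changing
the fraction. -/
lemma full_locι [W.HasLeftCalculusOfFractions] [IsLocalizing W P] : (locι W P).Full := by
  let e := locLiftFac (P.ι ⋙ W.Q) (inverted_ι W P)
  have : (resW W P).Q.EssSurj := Localization.essSurj _ (resW W P)
  refine (locι W P).full_of_comp_essSurj (resW W P).Q fun X Y φ => ?_
  obtain ⟨f, hf⟩ := Localization.exists_leftFraction W.Q W (e.inv.app X ≫ φ ≫ e.hom.app Y)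
  obtain ⟨Z, b, hZ, hb⟩ := IsLocalizing.exists_comp (P := P) f.s Y.2 f.hs
  let Z' : P.FullSubcategory := ⟨Z, hZ⟩
  let s : Y ⟶ Z' := P.homMk (f.s ≫ b)
  let g : X ⟶ Z' := P.homMk (f.f ≫ b)
  have hs : IsIso ((resW W P).Q.map s) := Localization.inverts (resW W P).Q (resW W P) s hb
  refine ⟨(resW W P).Q.map g ≫ inv ((resW W P).Q.map s), ?_⟩
  rw [Functor.map_comp, Functor.map_inv, IsIso.comp_inv_eq]
  have h1 := e.hom.naturality g
  have h2 := e.hom.naturality s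
  simp only [Functor.comp_map] at h1 h2
  rw [← cancel_mono (e.hom.app Z'), Category.assoc, h2, h1]
  have h3 : φ ≫ e.hom.app Y = e.hom.app X ≫ f.map W.Q (Localization.inverts W.Q W) := by
    rw [← hf, Iso.hom_inv_id_app_assoc]
  rw [← Category.assoc, h3, Category.assoc]
  congr 1
  have h4 := f.map_comp_map_s W.Q (Localization.inverts W.Q W)
  change W.Q.map (f.f ≫ b) = _ ≫ W.Q.map (f.s ≫ b)
  rw [W.Q.map_comp, W.Q.map_comp, ← h4, Category.assoc]

/-- By the calculus of fractions it suffices to treat two morphisms of the subcategory. If they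
agree in the large localization, they are equalized by a morphism of `W` out of their target, which
can be continued into `P`. -/
lemma faithful_locι [W.HasLeftCalculusOfFractions] [IsLocalizing W P] : (locι W P).Faithful := by
  let e := locLiftFac (P.ι ⋙ W.Q) (inverted_ι W P)
  refine Functor.faithful_of_comp_of_hasLeftCalculusOfFractions (resW W P).Q (resW W P) _
    fun X Y f g hfg => ?_
  have h1 := e.hom.naturality f
  have h2 := e.hom.naturality g
  simp only [Functor.comp_map] at h1 h2
  have h3 : W.Q.map f.hom = W.Q.map g.hom := by
    have h4 : e.hom.app X ≫ W.Q.map f.hom = e.hom.app X ≫ W.Q.map g.hom :=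
      h1.symm.trans ((congrArg (· ≫ e.hom.app Y) hfg).trans h2)
    exact (cancel_epi _).1 h4
  rw [MorphismProperty.map_eq_iff_postcomp W.Q W] at h3
  obtain ⟨Z, t, ht, e'⟩ := h3
  obtain ⟨Z', b, hZ', hb⟩ := IsLocalizing.exists_comp (P := P) t Y.2 ht
  let s : Y ⟶ ⟨Z', hZ'⟩ := P.homMk (t ≫ b)
  have hs : IsIso ((resW W P).Q.map s) := Localization.inverts (resW W P).Q (resW W P) s hb
  rw [← cancel_mono ((resW W P).Q.map s), ← Functor.map_comp, ← Functor.map_comp]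
  congr 1
  refine P.hom_ext ?_
  have : f.hom ≫ t ≫ b = g.hom ≫ t ≫ b := by rw [← Category.assoc, e', Category.assoc]
  exact this

section Restrict

variable {W'' P'' W' P'}

variable {W P}

/-- A functor between the ambient categories, followed by the localization of the full
subcategory of the target. -/
noncomputable abbrev restr (W' : MorphismProperty K') (S : K ⥤ K')
    (hS : ∀ X, P X → P' (S.obj X)) : P.FullSubcategory ⥤ LocSub W' P' :=
  P'.lift (P.ι ⋙ S) (fun X => hS _ X.2) ⋙ (resW W' P').Q

/-- The transformation lives on the ambient categories, but it has to belong to `W'` only on the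
objects of `P`; this is where boundedness conditions enter later. -/
noncomputable def restrIso {S S' : K ⥤ K'} (hS : ∀ X, P X → P' (S.obj X))
    (hS' : ∀ X, P X → P' (S'.obj X)) (τ : S ⟶ S') (hτ : ∀ X, P X → W' (τ.app X)) :
    restr W' S hS ≅ restr W' S' hS' :=
  NatIso.ofComponents (fun X =>
    have : IsIso ((resW W' P').Q.map (X := ⟨S.obj X.1, hS _ X.2⟩) (Y := ⟨S'.obj X.1, hS' _ X.2⟩)
      (P'.homMk (τ.app X.1))) := Localization.inverts (resW W' P').Q (resW W' P') _ (hτ _ X.2)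
    asIso ((resW W' P').Q.map (X := ⟨S.obj X.1, hS _ X.2⟩) (Y := ⟨S'.obj X.1, hS' _ X.2⟩)
      (P'.homMk (τ.app X.1)))) (fun {X Y} f => by
    have : (P'.lift (P.ι ⋙ S) (fun X => hS _ X.2)).map f ≫
        P'.homMk (X := ⟨S.obj Y.1, hS _ Y.2⟩) (Y := ⟨S'.obj Y.1, hS' _ Y.2⟩) (τ.app Y.1) =
        P'.homMk (X := ⟨S.obj X.1, hS _ X.2⟩) (Y := ⟨S'.obj X.1, hS' _ X.2⟩) (τ.app X.1) ≫
        (P'.lift (P.ι ⋙ S') (fun X => hS' _ X.2)).map f := P'.hom_ext (τ.naturality f.hom)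
    exact ((resW W' P').Q.map_comp _ _).symm.trans
      ((congrArg (fun g => (resW W' P').Q.map g) this).trans ((resW W' P').Q.map_comp _ _)))

/-- The functor between the localizations of the full subcategories. -/
noncomputable abbrev locMap (S : K ⥤ K') (hS : ∀ X, P X → P' (S.obj X))
    (hW : ∀ {X Y} (f : X ⟶ Y), P X → P Y → W f → W' (S.map f)) : LocSub W P ⥤ LocSub W' P' :=
  locLift (restr W' S hS) fun X Y f hf =>
    Localization.inverts (resW W' P').Q (resW W' P') _ (hW f.hom X.2 Y.2 hf)

/-- Compatibility of `locMap` with composition. -/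
noncomputable def locMapComp {S : K ⥤ K'} {S' : K' ⥤ K''} (hS : ∀ X, P X → P' (S.obj X))
    (hW : ∀ {X Y} (f : X ⟶ Y), P X → P Y → W f → W' (S.map f))
    (hS' : ∀ X, P' X → P'' (S'.obj X))
    (hW' : ∀ {X Y} (f : X ⟶ Y), P' X → P' Y → W' f → W'' (S'.map f)) :
    (resW W P).Q ⋙ locMap S hS hW ⋙ locMap S' hS' hW' ≅
      restr W'' (S ⋙ S') (fun X hX => hS' _ (hS X hX)) :=
  (Functor.associator _ _ _).symm ≪≫ Functor.isoWhiskerRight (locLiftFac _ _) _ ≪≫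
    Functor.associator _ _ _ ≪≫ Functor.isoWhiskerLeft _ (locLiftFac _ _) ≪≫ Iso.refl _

/-- Functors that are inverse to each other after restriction to the full subcategories and
localization induce equivalences. -/
lemma isEquivalence_locMap {S : K ⥤ K'} {S' : K' ⥤ K} (hS : ∀ X, P X → P' (S.obj X))
    (hW : ∀ {X Y} (f : X ⟶ Y), P X → P Y → W f → W' (S.map f))
    (hS' : ∀ X, P' X → P (S'.obj X))
    (hW' : ∀ {X Y} (f : X ⟶ Y), P' X → P' Y → W' f → W (S'.map f))
    (e : restr W (𝟭 K) (fun _ h => h) ≅ restr W (S ⋙ S') (fun X hX => hS' _ (hS X hX)))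
    (e' : restr W' (𝟭 K') (fun _ h => h) ≅ restr W' (S' ⋙ S) (fun X hX => hS _ (hS' X hX))) :
    (locMap S hS hW).IsEquivalence :=
  (CategoryTheory.Equivalence.mk (locMap S hS hW) (locMap S' hS' hW')
    (Localization.liftNatIso (resW W P).Q (resW W P) (restr W (𝟭 K) (fun _ h => h))
      (restr W (S ⋙ S') (fun X hX => hS' _ (hS X hX))) (h₁ := ⟨Iso.refl _⟩)
      (h₂ := ⟨locMapComp hS hW hS' hW'⟩) _ _ e)
    (Localization.liftNatIso (resW W' P').Q (resW W' P')
      (restr W' (S' ⋙ S) (fun X hX => hS _ (hS' X hX))) (restr W' (𝟭 K') (fun _ h => h))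
      (h₁ := ⟨locMapComp hS' hW' hS hW⟩) (h₂ := ⟨Iso.refl _⟩) _ _ e'.symm)).isEquivalence_functor

end Restrict

end Subcategory

end DGC

/-! ### Graded morphism spaces under functors that commute with the shift. -/

namespace DGC

section ShiftedHom

variable {A B : Type*} [Category* A] [Category* B] [HasShift A ℤ] [HasShift B ℤ]

/-- The map of shifted morphisms given by a functor that commutes with the shift and isomorphisms
of the objects. -/
noncomputable def shiftedMap (T : A ⥤ B) [T.CommShift ℤ] {X Y : A} {X' Y' : B} (e : T.obj X ≅ X')
    (e' : T.obj Y ≅ Y') {n : ℤ} (f : ShiftedHom X Y n) : ShiftedHom X' Y' n :=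
  e.inv ≫ f.map T ≫ e'.hom⟦n⟧'

lemma shiftedMap_mk₀ (T : A ⥤ B) [T.CommShift ℤ] {X : A} {X' : B} (e : T.obj X ≅ X') :
    shiftedMap T e e (ShiftedHom.mk₀ 0 rfl (𝟙 X)) = ShiftedHom.mk₀ (0 : ℤ) rfl (𝟙 X') := by
  rw [shiftedMap, ShiftedHom.map_mk₀, T.map_id, ← ShiftedHom.comp_mk₀ _ (0 : ℤ) rfl,
    ShiftedHom.mk₀_comp_mk₀, ← ShiftedHom.mk₀_comp (0 : ℤ) rfl, ShiftedHom.mk₀_comp_mk₀,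
    Category.id_comp, Iso.inv_hom_id]

lemma shiftedMap_comp (T : A ⥤ B) [T.CommShift ℤ] {X Y Z : A} {X' Y' Z' : B} (e : T.obj X ≅ X')
    (e' : T.obj Y ≅ Y') (e'' : T.obj Z ≅ Z') {a b c : ℤ} (f : ShiftedHom X Y a)
    (g : ShiftedHom Y Z b) (h : b + a = c) :
    shiftedMap T e e'' (f.comp g h) = (shiftedMap T e e' f).comp (shiftedMap T e' e'' g) h := by
  have h1 : e'.hom⟦a⟧' ≫ e'.inv⟦a⟧' = 𝟙 _ := by
    rw [← CategoryTheory.Functor.map_comp, Iso.hom_inv_id, CategoryTheory.Functor.map_id]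
  have h2 := (shiftFunctorAdd' B b a c h).inv.naturality e''.hom
  rw [shiftedMap, shiftedMap, shiftedMap, ShiftedHom.map_comp]
  simp only [ShiftedHom.comp, CategoryTheory.Functor.map_comp, Category.assoc]
  rw [reassoc_of% h1, ← h2]
  rfl

lemma bijective_shiftedMap (T : A ⥤ B) [T.CommShift ℤ] [T.Full] [T.Faithful] {X Y : A} {X' Y' : B}
    (e : T.obj X ≅ X') (e' : T.obj Y ≅ Y') (n : ℤ) :
    Function.Bijective (shiftedMap T e e' (n := n)) := by
  let j : T.obj (Y⟦n⟧) ≅ Y'⟦n⟧ := (T.commShiftIso n).app Y ≪≫ (shiftFunctor B n).mapIso e'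
  have h : shiftedMap T e e' (n := n) = (e.homCongr j) ∘ fun f => T.map f := by
    funext f
    simp [shiftedMap, ShiftedHom.map, j]
  rw [h]
  exact (e.homCongr j).bijective.comp ⟨T.map_injective, T.map_surjective⟩

variable [Preadditive A] [Preadditive B] (R : Type*) [Ring R] [Linear R A]
  [Linear R B]

/-- The linear isomorphism of shifted morphisms given by a fully faithful functor that commutes
with the shift. -/
noncomputable def shiftedEquiv (T : A ⥤ B) [T.CommShift ℤ] [T.Full] [T.Faithful] [T.Additive]
    [T.Linear R] {X Y : A} {X' Y' : B} (e : T.obj X ≅ X') (e' : T.obj Y ≅ Y') (n : ℤ) :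
    ShiftedHom X Y n ≃ₗ[R] ShiftedHom X' Y' n :=
  LinearEquiv.ofBijective
    { toFun := shiftedMap T e e'
      map_add' := fun f g => by
        simp only [shiftedMap, ShiftedHom.map_add, Preadditive.add_comp, Preadditive.comp_add]
      map_smul' := fun r f => by
        simp only [shiftedMap, ShiftedHom.map_smul, Linear.smul_comp, Linear.comp_smul,
          RingHom.id_apply] }
    (bijective_shiftedMap T e e' n)

lemma shiftedEquiv_apply (T : A ⥤ B) [T.CommShift ℤ] [T.Full] [T.Faithful] [T.Additive]
    [T.Linear R] {X Y : A} {X' Y' : B} (e : T.obj X ≅ X') (e' : T.obj Y ≅ Y') (n : ℤ)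
    (f : ShiftedHom X Y n) : shiftedEquiv R T e e' n f = shiftedMap T e e' f := rfl

/-- Two fully faithful functors on the same category identify the graded algebras of shifted
endomorphisms of the images of an object. -/
lemma exists_shiftedEquiv {B' : Type*} [Category* B'] [HasShift B' ℤ] [Preadditive B']
    [Linear R B'] (T : A ⥤ B) [T.CommShift ℤ] [T.Full] [T.Faithful] [T.Additive] [T.Linear R]
    (T' : A ⥤ B') [T'.CommShift ℤ] [T'.Full] [T'.Faithful] [T'.Additive] [T'.Linear R] {X : A}
    {Y : B} {Y' : B'} (e : T.obj X ≅ Y) (e' : T'.obj X ≅ Y') :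
    ∃ φ : ∀ n : ℤ, ShiftedHom Y Y n ≃ₗ[R] ShiftedHom Y' Y' n,
      φ 0 (ShiftedHom.mk₀ 0 rfl (𝟙 _)) = ShiftedHom.mk₀ 0 rfl (𝟙 _) ∧
      ∀ (a b c : ℤ) (h : b + a = c) (f : ShiftedHom Y Y a) (g : ShiftedHom Y Y b),
        φ c (ShiftedHom.comp f g h) = ShiftedHom.comp (φ a f) (φ b g) h := by
  -- The two categories are compared through `A`, so that units and compositions on both sides are
  -- images of those in `A`.
  refine ⟨fun n => (shiftedEquiv R T e e n).symm.trans (shiftedEquiv R T' e' e' n), ?_,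
    fun a b c h f g => ?_⟩
  · rw [LinearEquiv.trans_apply, ← shiftedMap_mk₀ T e, ← shiftedEquiv_apply R,
      LinearEquiv.symm_apply_apply, shiftedEquiv_apply, shiftedMap_mk₀]
  · obtain ⟨f, rfl⟩ := (shiftedEquiv R T e e a).surjective f
    obtain ⟨g, rfl⟩ := (shiftedEquiv R T e e b).surjective g
    simp only [LinearEquiv.trans_apply, LinearEquiv.symm_apply_apply]
    have h1 : ShiftedHom.comp (shiftedEquiv R T e e a f) (shiftedEquiv R T e e b g) h =
        shiftedEquiv R T e e c (f.comp g h) := (shiftedMap_comp T e e e f g h).symm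
    rw [h1, LinearEquiv.symm_apply_apply]
    exact shiftedMap_comp T' e' e' e' f g h

end ShiftedHom

section Subcategory

variable {K : Type*} [Category* K] {W : MorphismProperty K}
  {P : ObjectProperty K}

instance [HasShift K ℤ] [W.IsCompatibleWithShift ℤ] [P.IsStableUnderShift ℤ] [W.RespectsIso] :
    (resW W P).IsCompatibleWithShift ℤ where
  condition a := by
    ext X Y f
    have e := (P.ι.commShiftIso a).hom.naturality f
    have h1 : W (P.ι.map (f⟦a⟧')) ↔ W ((P.ι.map f)⟦a⟧') :=
      W.arrow_mk_iso_iff (Arrow.isoMk ((P.ι.commShiftIso a).app X) ((P.ι.commShiftIso a).app Y)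
        e.symm)
    exact h1.trans (MorphismProperty.IsCompatibleWithShift.iff W _ a)

variable {E : Type*} [Category* E] [HasShift E ℤ] [HasShift K ℤ] [W.IsCompatibleWithShift ℤ]
  [P.IsStableUnderShift ℤ] [W.RespectsIso]

noncomputable instance (H : P.FullSubcategory ⥤ E) [H.CommShift ℤ]
    (hH : (resW W P).IsInvertedBy H) : (locLift H hH).CommShift ℤ :=
  Functor.commShiftOfLocalization (resW W P).Q (resW W P) ℤ H (locLift H hH)

end Subcategory

section Linear

variable {K E : Type*} [Category* K] [Category* E] {W : MorphismProperty K} {P : ObjectProperty K}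
  [Preadditive K] [Preadditive E] [W.HasLeftCalculusOfFractions] [IsLocalizing W P]

lemma additive_locLift (H : P.FullSubcategory ⥤ E) [H.Additive]
    (hH : (resW W P).IsInvertedBy H) : (locLift H hH).Additive := by
  rw [Localization.functor_additive_iff (resW W P).Q (resW W P)]
  exact Functor.additive_of_iso (locLiftFac H hH).symm

lemma linear_locLift (R : Type*) [Ring R] [Linear R K] [Linear R E] (H : P.FullSubcategory ⥤ E)
    [H.Linear R] (hH : (resW W P).IsInvertedBy H) : (locLift H hH).Linear R :=
  (Localization.functor_linear_iff (resW W P).Q (resW W P) R H (locLift H hH)).1 inferInstance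

end Linear

end DGC

/-! ### Functors acting on colinear maps of all degrees: compatibility with homotopies and shifts.
-/

namespace DGC
variable {k : Type v} [Field k]
namespace Bicomod

variable {C D E F : DGCoalg.{v, u} k}

/-- The identity of `M` as a map `M[a] → M` of degree `a`. -/
lemma isColin_shift_id (M : Bicomod C D) (a : ℤ) :
    IsColin (M := M.shift a) (N := M) a (LinearMap.id : M →ₗ[k] M) where
  deg n x hx := hx
  left := by
    change M.lact ∘ₗ LinearMap.id = TensorProduct.map (C.sg a) LinearMap.id ∘ₗ
      TensorProduct.map (C.sg a) LinearMap.id ∘ₗ M.lact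
    rw [← LinearMap.comp_assoc, ← TensorProduct.map_comp, sg_sg, LinearMap.comp_id,
      LinearMap.comp_id, TensorProduct.map_id, LinearMap.id_comp]
  right := comp_id_eq M

/-- The identity of `M` as a map `M → M[a]` of degree `-a`. -/
lemma isColin_id_shift (M : Bicomod C D) (a : ℤ) :
    IsColin (M := M) (N := M.shift a) (-a) (LinearMap.id : M →ₗ[k] M) where
  deg n x hx := DGVect.mem_cast (V := M.toDGVect) hx (by omega)
  left := by rw [DGVect.sg_neg]; rfl
  right := comp_id_eq M

/-- A functor between categories of bicomodules that is defined on the colinear maps of all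
degrees and compatible with the differentials. -/
structure GrFunctor (C D E F : DGCoalg.{v, u} k) where
  /-- The underlying functor. -/
  fct : Bicomod C D ⥤ Bicomod E F
  /-- The action on colinear maps. -/
  gmap : ∀ {a : ℤ} {M N : Bicomod C D} {φ : M →ₗ[k] N}, IsColin a φ → (fct.obj M →ₗ[k] fct.obj N)
  colin : ∀ {a : ℤ} {M N : Bicomod C D} {φ : M →ₗ[k] N} (h : IsColin a φ), IsColin a (gmap h)
  gmap_comp : ∀ {a b c : ℤ} {M N L : Bicomod C D} {φ : M →ₗ[k] N} {ψ : N →ₗ[k] L}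
    (h : IsColin a φ) (h' : IsColin b ψ) (e : a + b = c),
    gmap (h'.comp h e) = gmap h' ∘ₗ gmap h
  map_lin : ∀ {M N : Bicomod C D} (f : M ⟶ N), (fct.map f).lin = gmap f.isColin
  gmap_add : ∀ {a : ℤ} {M N : Bicomod C D} {φ ψ : M →ₗ[k] N} (h : IsColin a φ)
    (h' : IsColin a ψ), gmap (h.add h') = gmap h + gmap h'
  gmap_smul : ∀ {a : ℤ} {M N : Bicomod C D} {φ : M →ₗ[k] N} (h : IsColin a φ) (c : k),
    gmap (h.smul c) = c • gmap h
  gmap_d : ∀ {a b : ℤ} {M N : Bicomod C D} {φ θ : M →ₗ[k] N} (h : IsColin a φ)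
    (h' : IsColin b θ), a + 1 = b → θ = N.d ∘ₗ φ - sgn k a • φ ∘ₗ M.d →
    gmap h' = (fct.obj N).d ∘ₗ gmap h - sgn k a • gmap h ∘ₗ (fct.obj M).d

namespace GrFunctor

variable (S : GrFunctor C D E F) {M N : Bicomod C D}

lemma gmap_congr {a : ℤ} {φ ψ : M →ₗ[k] N} (e : φ = ψ) (h : IsColin a φ) (h' : IsColin a ψ) :
    S.gmap h = S.gmap h' := by
  subst e
  rfl

lemma gmap_zero (a : ℤ) : S.gmap (isColin_zero (M := M) (N := N) a) = 0 := by
  refine (S.gmap_congr (smul_zero 0).symm _ _).trans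
    ((S.gmap_smul (isColin_zero (M := M) (N := N) a) (0 : k)).trans ?_)
  exact zero_smul k (S.gmap (isColin_zero (M := M) (N := N) a))

lemma map_add (f g : M ⟶ N) : S.fct.map (f + g) = S.fct.map f + S.fct.map g := hom_ext (by
  rw [add_lin, S.map_lin, S.map_lin, S.map_lin, ← S.gmap_add])

lemma map_smul (c : k) (f : M ⟶ N) : S.fct.map (c • f) = c • S.fct.map f := hom_ext (by
  rw [smul_lin, S.map_lin, S.map_lin, ← S.gmap_smul])

/-- A homotopy is a colinear map of degree `-1` whose graded commutator with the differential is `f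
- g`, and `gmap_d` preserves such commutators. -/
lemma homotopic {f g : M ⟶ N} (h : Homotopic f g) : Homotopic (S.fct.map f) (S.fct.map g) := by
  obtain ⟨h, hh, e⟩ := h
  have hfg : IsColin 0 (f.lin + (-1 : k) • g.lin) := f.isColin.add (g.isColin.smul _)
  refine ⟨S.gmap hh, S.colin hh, ?_⟩
  have h1 := S.gmap_d hh hfg (by omega) (by
    rw [sgn_neg, sgn_one, neg_smul, one_smul, ← sub_eq_add_neg, e, neg_smul, one_smul,
      sub_neg_eq_add, add_comm])
  rw [S.gmap_add f.isColin (g.isColin.smul _), S.gmap_smul, sgn_neg, sgn_one, neg_smul, one_smul,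
    neg_smul, one_smul, sub_neg_eq_add, add_comm (LinearMap.comp _ _)] at h1
  rw [← h1, S.map_lin, S.map_lin, sub_eq_add_neg]

/-- The comparison of `S(M[a])` with `S(M)[a]`. -/
noncomputable def shiftHom (M : Bicomod C D) (a : ℤ) :
    S.fct.obj (M.shift a) ⟶ (S.fct.obj M).shift a :=
  IsColin.toHom (φ := S.gmap (isColin_shift_id M a))
    ((isColin_id_shift _ a).comp (S.colin (isColin_shift_id M a)) (add_neg_cancel a)) (by
    -- The identity `M[a] → M` has degree `a` and commutes with the differentials up to `(-1)^a`, so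
    -- its graded commutator is zero; this is transported by `gmap_d`.
    have h := S.gmap_d (isColin_shift_id M a) (isColin_zero (a + 1)) rfl (by
      change 0 = M.d ∘ₗ LinearMap.id - sgn k a • LinearMap.id ∘ₗ (sgn k a • M.d)
      rw [LinearMap.comp_id, LinearMap.id_comp, smul_smul, sgn_mul_self, one_smul, sub_self])
    rw [S.gmap_zero, eq_comm, sub_eq_zero] at h
    change _ = (sgn k a • (S.fct.obj M).d) ∘ₗ S.gmap (isColin_shift_id M a)
    rw [LinearMap.smul_comp, h, smul_smul, sgn_mul_self, one_smul])

lemma shiftHom_lin (M : Bicomod C D) (a : ℤ) :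
    (S.shiftHom M a).lin = S.gmap (isColin_shift_id M a) := rfl

instance (M : Bicomod C D) (a : ℤ) : IsIso (S.shiftHom M a) := isIso_of_bijective (by
  have h1 : S.gmap (isColin_shift_id M a) ∘ₗ S.gmap (isColin_id_shift M a) = LinearMap.id := by
    rw [← S.gmap_comp (isColin_id_shift M a) (isColin_shift_id M a) (neg_add_cancel a)]
    exact (S.map_lin (𝟙 M)).symm.trans (congrArg Hom.lin (S.fct.map_id M))
  have h2 : S.gmap (isColin_id_shift M a) ∘ₗ S.gmap (isColin_shift_id M a) = LinearMap.id := by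
    rw [← S.gmap_comp (isColin_shift_id M a) (isColin_id_shift M a) (add_neg_cancel a)]
    exact (S.map_lin (𝟙 (M.shift a))).symm.trans (congrArg Hom.lin (S.fct.map_id (M.shift a)))
  exact Function.bijective_iff_has_inverse.2 ⟨S.gmap (isColin_id_shift M a),
    LinearMap.congr_fun h2, LinearMap.congr_fun h1⟩)

lemma shiftHom_naturality (f : M ⟶ N) (a : ℤ) :
    S.fct.map ((shiftF a).map f) ≫ S.shiftHom N a =
      S.shiftHom M a ≫ (shiftF a).map (S.fct.map f) := hom_ext (by
  rw [comp_lin, comp_lin, S.map_lin, shiftHom_lin, shiftHom_lin,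
    ← S.gmap_comp _ (isColin_shift_id N a) (zero_add a)]
  change _ = (S.fct.map f).lin ∘ₗ _
  rw [S.map_lin, ← S.gmap_comp (isColin_shift_id M a) _ (add_zero a)])

/-- All comparison maps are images under `gmap` of the identity of `M` in some degree, so the
coherence conditions reduce to `gmap_comp`. -/
noncomputable instance : S.fct.CommShift ℤ where
  commShiftIso a := NatIso.ofComponents (fun M => asIso (S.shiftHom M a))
    (fun f => S.shiftHom_naturality f a)
  commShiftIso_zero := by
    refine Iso.ext (NatTrans.ext (funext fun M => ?_))
    rw [Functor.CommShift.isoZero_hom_app]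
    refine hom_ext ?_
    rw [comp_lin]
    exact (S.map_lin (shiftZeroIso M).hom).symm
  commShiftIso_add a b := by
    refine Iso.ext (NatTrans.ext (funext fun M => ?_))
    rw [Functor.CommShift.isoAdd_hom_app]
    refine hom_ext ?_
    rw [comp_lin, comp_lin, comp_lin]
    change S.gmap (isColin_shift_id M (a + b)) = S.gmap (isColin_shift_id M a) ∘ₗ
      S.gmap (isColin_shift_id (M.shift a) b) ∘ₗ (S.fct.map (shiftAddIso M a b).hom).lin
    rw [S.map_lin, ← S.gmap_comp _ (isColin_shift_id (M.shift a) b) (zero_add b),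
      ← S.gmap_comp _ (isColin_shift_id M a) (add_comm b a)]

/-- The induced functor on homotopy categories. -/
noncomputable abbrev ho : Ho C D ⥤ Ho E F :=
  CategoryTheory.Quotient.lift Homotopic (S.fct ⋙ Quotient.functor Homotopic)
    fun _ _ _ _ h => CategoryTheory.Quotient.sound _ (S.homotopic h)

instance : S.ho.Additive where
  map_add {X Y f g} := by
    obtain ⟨f, rfl⟩ := (Quotient.functor Homotopic).map_surjective (X := X.as) (Y := Y.as) f
    obtain ⟨g, rfl⟩ := (Quotient.functor Homotopic).map_surjective (X := X.as) (Y := Y.as) g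
    exact (congrArg (Quotient.functor Homotopic).map (S.map_add f g)).trans
      ((Quotient.functor Homotopic).map_add)

instance : S.ho.Linear k where
  map_smul {X Y} f c := by
    obtain ⟨f, rfl⟩ := (Quotient.functor Homotopic).map_surjective (X := X.as) (Y := Y.as) f
    exact congrArg (Quotient.functor Homotopic).map (S.map_smul c f)

end GrFunctor

end Bicomod
end DGC

/-! ### Cotensor products as functors on graded maps. -/

namespace DGC
variable {k : Type v} [Field k]
namespace Bicomod

variable {C D E F : DGCoalg.{v, u} k}

/-- The graded commutator of the differential with `X.sg a ⊗ φ` is `X.sg (a + 1) ⊗ [d, φ]`: the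
terms that differentiate `X` cancel, because `d` anticommutes with `X.sg` according to the parity of
`a`. -/
lemma outer_d_left (X : Bicomod C D) {M N : Bicomod E F} {a b : ℤ} {φ θ : M →ₗ[k] N}
    (e : a + 1 = b) (h : θ = N.d ∘ₗ φ - sgn k a • φ ∘ₗ M.d) :
    TensorProduct.map (X.sg b) θ = (outer X N).d ∘ₗ TensorProduct.map (X.sg a) φ -
      sgn k a • TensorProduct.map (X.sg a) φ ∘ₗ (outer X M).d := by
  refine TensorProduct.ext' fun x y => ?_
  have h1 := LinearMap.congr_fun (DGVect.d_sg (V := X.toDGVect) a) x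
  have h2 : X.sg b x = X.sg 1 (X.sg a x) := by rw [← e, add_comm, DGVect.sg_add]; rfl
  have h3 : X.sg a (X.sg 1 x) = X.sg 1 (X.sg a x) := by
    rw [← LinearMap.comp_apply, ← DGVect.sg_add, e, h2]
  simp only [LinearMap.comp_apply, LinearMap.smul_apply] at h1
  simp only [LinearMap.sub_apply, LinearMap.smul_apply, LinearMap.comp_apply, map_tmul,
    LinearMap.add_apply, LinearMap.id_apply, map_add, h1, h2, h3, h, tmul_sub, tmul_smul, smul_add,
    ← smul_tmul']
  abel

lemma outer_d_right (Y : Bicomod E F) {M N : Bicomod C D} {a : ℤ} {φ θ : M →ₗ[k] N}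
    (hφ : IsColin a φ) (h : θ = N.d ∘ₗ φ - sgn k a • φ ∘ₗ M.d) :
    TensorProduct.map θ LinearMap.id = (outer N Y).d ∘ₗ TensorProduct.map φ LinearMap.id -
      sgn k a • TensorProduct.map φ LinearMap.id ∘ₗ (outer M Y).d := by
  refine TensorProduct.ext' fun x y => ?_
  have h1 := LinearMap.congr_fun (hφ.deg.comp_sg (V := M.toDGVect) (W := N.toDGVect) 1) x
  simp only [LinearMap.comp_apply, LinearMap.smul_apply, one_mul] at h1
  simp only [LinearMap.sub_apply, LinearMap.smul_apply, LinearMap.comp_apply, map_tmul,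
    LinearMap.add_apply, map_add, h1, h, sub_tmul, smul_add, LinearMap.id_apply, ← smul_tmul',
    smul_smul, sgn_mul_self, one_smul]
  abel

/-- The functor `M ↦ X □ M`. -/
noncomputable abbrev cotLG (X : Bicomod C D) (E : DGCoalg.{v, u} k) : GrFunctor D E C E where
  fct :=
    { obj := fun M => cotensor X M
      map := fun f => cotMap (𝟙 X) f
      map_id := fun M => cotMap_id X M
      map_comp := fun f g => by rw [cotMap_comp, Category.comp_id] }
  gmap h := cotLeft X _ h.left
  colin h := h.cotLeft X
  gmap_comp {a b c M N L φ ψ} h h' e := LinearMap.ext fun t => cotι_injective X L (by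
    rw [LinearMap.comp_apply, cotι_cotLeft, cotι_cotLeft, cotι_cotLeft, map_map_apply,
      ← DGVect.sg_add, add_comm b, e])
  map_lin {M N} f := LinearMap.ext fun t => cotι_injective X N (by
    rw [cotι_cotLeft, DGVect.sg_zero]
    rfl)
  gmap_add {a M N φ ψ} h h' := LinearMap.ext fun t => cotι_injective X N (by
    rw [LinearMap.add_apply, _root_.map_add, cotι_cotLeft, cotι_cotLeft, cotι_cotLeft,
      TensorProduct.map_add_right, LinearMap.add_apply])
  gmap_smul {a M N φ} h c := LinearMap.ext fun t => cotι_injective X N (by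
    rw [LinearMap.smul_apply, _root_.map_smul, cotι_cotLeft, cotι_cotLeft,
      TensorProduct.map_smul_right, LinearMap.smul_apply])
  gmap_d {a b M N φ θ} h h' e e' := LinearMap.ext fun t => cotι_injective X N (by
    rw [cotι_cotLeft, outer_d_left X e e', LinearMap.sub_apply, LinearMap.sub_apply,
      LinearMap.smul_apply, LinearMap.smul_apply, _root_.map_sub, _root_.map_smul,
      LinearMap.comp_apply, LinearMap.comp_apply, LinearMap.comp_apply, LinearMap.comp_apply,
      cotι_cotLeft, (cotι X N).isMor.comm_apply, cotι_cotLeft, (cotι X M).isMor.comm_apply])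

/-- The functor `M ↦ M □ Y`. -/
noncomputable abbrev cotRG (C : DGCoalg.{v, u} k) (Y : Bicomod D E) : GrFunctor C D C E where
  fct :=
    { obj := fun M => cotensor M Y
      map := fun f => cotMap f (𝟙 Y)
      map_id := fun M => cotMap_id M Y
      map_comp := fun f g => by rw [cotMap_comp, Category.comp_id] }
  gmap h := cotRight h.right Y
  colin h := h.cotRight Y
  gmap_comp {a b c M N L φ ψ} h h' e := LinearMap.ext fun t => cotι_injective L Y (by
    rw [LinearMap.comp_apply, cotι_cotRight, cotι_cotRight, cotι_cotRight, map_map_apply,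
      LinearMap.comp_id])
  map_lin {M N} f := rfl
  gmap_add {a M N φ ψ} h h' := LinearMap.ext fun t => cotι_injective N Y (by
    rw [LinearMap.add_apply, _root_.map_add, cotι_cotRight, cotι_cotRight, cotι_cotRight,
      TensorProduct.map_add_left, LinearMap.add_apply])
  gmap_smul {a M N φ} h c := LinearMap.ext fun t => cotι_injective N Y (by
    rw [LinearMap.smul_apply, _root_.map_smul, cotι_cotRight, cotι_cotRight,
      TensorProduct.map_smul_left, LinearMap.smul_apply])
  gmap_d {a b M N φ θ} h h' e e' := LinearMap.ext fun t => cotι_injective N Y (by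
    rw [cotι_cotRight, outer_d_right Y h e', LinearMap.sub_apply, LinearMap.sub_apply,
      LinearMap.smul_apply, LinearMap.smul_apply, _root_.map_sub, _root_.map_smul,
      LinearMap.comp_apply, LinearMap.comp_apply, LinearMap.comp_apply, LinearMap.comp_apply,
      cotι_cotRight, (cotι N Y).isMor.comm_apply, cotι_cotRight, (cotι M Y).isMor.comm_apply])

end Bicomod
end DGC

/-! ### Left bounded bicomodules in the derived category, and isomorphisms as zigzags. -/

namespace DGC
variable {k : Type v} [Field k]
namespace Bicomod

variable {C D E F : DGCoalg.{v, u} k}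

variable (C D) in
/-- The bicomodules that are bounded below, in the homotopy category. -/
def bdd : ObjectProperty (Ho C D) := fun X => X.as.IsBddBelow

lemma IsBddBelow.shift {M : Bicomod C D} (h : M.IsBddBelow) (a : ℤ) : (M.shift a).IsBddBelow := by
  obtain ⟨m, hm⟩ := h
  exact ⟨m - a, fun n hn => hm (n + a) (by omega)⟩

instance : (bdd C D).IsStableUnderShift ℤ where
  isStableUnderShiftBy a := ⟨fun X hX => by
    have h : X⟦a⟧ = (Quotient.functor Homotopic).obj (X.as⟦a⟧) :=
      Quotient.functor_obj_shift Homotopic ℤ X.as a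
    change bdd C D (X⟦a⟧)
    rw [h]
    exact IsBddBelow.shift hX a⟩

/-- A quasi-isomorphism out of a left bounded bicomodule is continued by the truncation of its
target. -/
lemma isLocalizing_qis (hC : C.IsPos) (hD : D.IsPos) : IsLocalizing (qis C D) (bdd C D) where
  exists_comp := by
    rintro X Y _ hX ⟨s, rfl, hs⟩
    obtain ⟨Z, t, hZ, ht⟩ := exists_qIso_isBddBelow hC hD hs hX
    refine ⟨(Quotient.functor Homotopic).obj Z, (Quotient.functor Homotopic).map t, hZ, ?_⟩
    exact (qis C D).comp_mem _ _ ⟨s, rfl, hs⟩ ⟨t, rfl, ht⟩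

section Cohomology

variable (C D) in
/-- Cohomology as a functor on bicomodules. -/
noncomputable def coh (n : ℤ) : Bicomod C D ⥤ ModuleCat.{u} k where
  obj M := ModuleCat.of k (M.toDGVect.H n)
  map {M N} f := ModuleCat.ofHom (DGVect.Hmap (V := M.toDGVect) (W := N.toDGVect) f.isMor n)
  map_id _ := ModuleCat.hom_ext (LinearMap.ext fun x =>
    Submodule.Quotient.induction_on _ x fun _ => rfl)
  map_comp f g := ModuleCat.hom_ext (QIso.bij_comp f g n)

lemma coh_map_eq (n : ℤ) {M N : Bicomod C D} {f g : M ⟶ N} (h : Homotopic f g) :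
    (coh C D n).map f = (coh C D n).map g := by
  obtain ⟨h, hh, e⟩ := h
  refine ModuleCat.hom_ext (LinearMap.ext fun x => Submodule.Quotient.induction_on _ x
    fun ⟨x, hx, hdx⟩ => (Submodule.Quotient.eq _).2 ⟨h x, hh.deg n x hx, ?_⟩)
  have hdx' : M.d x = 0 := hdx
  have := LinearMap.congr_fun e x
  simp only [LinearMap.sub_apply, LinearMap.add_apply, LinearMap.comp_apply, hdx', map_zero,
    zero_add] at this
  exact this.symm

variable (C D) in
/-- Cohomology as a functor on the homotopy category. -/
noncomputable def cohHo (n : ℤ) : Ho C D ⥤ ModuleCat.{u} k :=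
  CategoryTheory.Quotient.lift Homotopic (coh C D n) fun _ _ _ _ h => coh_map_eq n h

lemma inverted_cohHo (n : ℤ) : (qis C D).IsInvertedBy (cohHo C D n) := by
  rintro X Y _ ⟨f, rfl, hf⟩
  rw [ConcreteCategory.isIso_iff_bijective]
  exact hf n

/-- Cohomology factors through the derived category, so a morphism that becomes invertible there
induces isomorphisms in cohomology. -/
lemma qIso_of_isIso_toDer {M N : Bicomod C D} {f : M ⟶ N}
    (h : IsIso ((qis C D).Q.map ((Quotient.functor Homotopic).map f))) : QIso f := fun n => by
  have e := Localization.fac (cohHo C D n) (inverted_cohHo n) (qis C D).Q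
  have h1 : IsIso ((cohHo C D n).map ((Quotient.functor Homotopic).map f)) :=
    (NatIso.isIso_map_iff e _).1 (inferInstanceAs (IsIso ((Localization.lift (cohHo C D n)
      (inverted_cohHo n) (qis C D).Q).map ((qis C D).Q.map ((Quotient.functor Homotopic).map f)))))
  exact (ConcreteCategory.isIso_iff_bijective _).1 h1

end Cohomology

/-- An isomorphism of the derived category is a fraction `M → Y ← N`. Its denominator is a
quasi-isomorphism by definition and its numerator by `qIso_of_isIso_toDer`; as `N` is left bounded,
`Y` can be truncated. -/
lemma linked_of_iso (hC : C.IsPos) (hD : D.IsPos) {M N : Bicomod C D} (hN : N.IsBddBelow)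
    (e : toDer M ≅ toDer N) : Linked M N := by
  obtain ⟨φ, hφ⟩ := Localization.exists_leftFraction (qis C D).Q (qis C D) e.hom
  obtain ⟨s, hs, hs'⟩ := φ.hs
  obtain ⟨f, hf⟩ := (Quotient.functor Homotopic).map_surjective (X := M) (Y := φ.Y'.as) φ.f
  have h1 := φ.map_comp_map_s (qis C D).Q (Localization.inverts _ _)
  rw [← hφ] at h1
  have h2 : IsIso ((qis C D).Q.map φ.s) := Localization.inverts (qis C D).Q (qis C D) φ.s φ.hs
  have h3 : IsIso ((qis C D).Q.map φ.f) := by rw [← h1]; infer_instance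
  rw [← hf] at h3
  obtain ⟨Z, t, hZ, ht⟩ := exists_qIso_isBddBelow hC hD hs' hN
  exact ⟨Z, f ≫ t, s ≫ t, hZ, (qIso_of_isIso_toDer h3).comp ht, hs'.comp ht⟩

end Bicomod
end DGC

/-! ### Mutually inverse functors up to quasi-isomorphism and the equivalences they induce. -/

namespace DGC
variable {k : Type v} [Field k]
namespace Bicomod

variable {C D E F G H : DGCoalg.{v, u} k}

namespace GrFunctor

variable (C D) in
/-- The identity functor. -/
noncomputable abbrev id : GrFunctor C D C D where
  fct := 𝟭 _
  gmap {_ _ _ φ} _ := φ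
  colin h := h
  gmap_comp _ _ _ := rfl
  map_lin _ := rfl
  gmap_add _ _ := rfl
  gmap_smul _ _ := rfl
  gmap_d _ _ _ e := e

/-- The composition of functors. -/
noncomputable abbrev comp (S : GrFunctor C D E F) (S' : GrFunctor E F G H) : GrFunctor C D G H where
  fct := S.fct ⋙ S'.fct
  gmap h := S'.gmap (S.colin h)
  colin h := S'.colin (S.colin h)
  gmap_comp h h' e := by
    rw [← S'.gmap_comp (S.colin h) (S.colin h') e]
    exact S'.gmap_congr (S.gmap_comp h h' e) _ _
  map_lin f := (S'.map_lin (S.fct.map f)).trans (S'.gmap_congr (S.map_lin f) _ _)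
  gmap_add h h' := by
    rw [← S'.gmap_add (S.colin h) (S.colin h')]
    exact S'.gmap_congr (S.gmap_add h h') _ _
  gmap_smul h c := by
    rw [← S'.gmap_smul (S.colin h) c]
    exact S'.gmap_congr (S.gmap_smul h c) _ _
  gmap_d hφ hθ e hd := S'.gmap_d (S.colin hφ) (S.colin hθ) e (S.gmap_d hφ hθ e hd)

/-- The functor preserves bicomodules that are bounded below, and quasi-isomorphisms between
them. -/
structure Exact (S : GrFunctor C D E F) : Prop where
  bdd : ∀ {M : Bicomod C D}, M.IsBddBelow → (S.fct.obj M).IsBddBelow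
  qIso : ∀ {M N : Bicomod C D} {f : M ⟶ N}, M.IsBddBelow → N.IsBddBelow → QIso f →
    QIso (S.fct.map f)

lemma Exact.comp {S : GrFunctor C D E F} {S' : GrFunctor E F G H} (h : S.Exact) (h' : S'.Exact) :
    (S.comp S').Exact where
  bdd hM := h'.bdd (h.bdd hM)
  qIso hM hN hf := h'.qIso (h.bdd hM) (h.bdd hN) (h.qIso hM hN hf)

lemma Exact.bdd_ho {S : GrFunctor C D E F} (h : S.Exact) (X : Ho C D) (hX : Bicomod.bdd C D X) :
    Bicomod.bdd E F (S.ho.obj X) := h.bdd hX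

lemma Exact.qis_ho {S : GrFunctor C D E F} (h : S.Exact) {X Y : Ho C D} (f : X ⟶ Y)
    (hX : Bicomod.bdd C D X) (hY : Bicomod.bdd C D Y) (hf : qis C D f) :
    qis E F (S.ho.map f) := by
  obtain ⟨f, rfl, hf⟩ := hf
  exact ⟨S.fct.map f, rfl, h.qIso hX hY hf⟩

/-- The transformation on homotopy categories induced by a transformation. -/
noncomputable def hoTrans {S S' : GrFunctor C D E F} (τ : S.fct ⟶ S'.fct) : S.ho ⟶ S'.ho :=
  Quotient.natTransLift _
    { app := fun M => (Quotient.functor Homotopic).map (τ.app M)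
      naturality := fun M N f => by
        refine ((Quotient.functor Homotopic).map_comp (S.fct.map f) (τ.app N)).symm.trans
          (Eq.trans ?_ ((Quotient.functor Homotopic).map_comp (τ.app M) (S'.fct.map f)))
        rw [τ.naturality] }

/-- The functors are linked by a zigzag of two transformations that are quasi-isomorphisms on
the bicomodules that are bounded below. -/
def Joined (S S' : GrFunctor C D E F) : Prop :=
  ∃ (T : GrFunctor C D E F) (τ : S.fct ⟶ T.fct) (τ' : S'.fct ⟶ T.fct),
    (∀ M, M.IsBddBelow → (T.fct.obj M).IsBddBelow) ∧
    (∀ M, M.IsBddBelow → QIso (τ.app M)) ∧ ∀ M, M.IsBddBelow → QIso (τ'.app M)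

/-- The middle functor only has to preserve left boundedness: it enters through its values and is
not itself passed to the localization of the source. -/
lemma Joined.nonempty_iso {S S' : GrFunctor C D E F} (h : Joined S S')
    (hS : ∀ X, bdd C D X → bdd E F (S.ho.obj X)) (hS' : ∀ X, bdd C D X → bdd E F (S'.ho.obj X)) :
    Nonempty (restr (qis E F) S.ho hS ≅ restr (qis E F) S'.ho hS') := by
  obtain ⟨T, τ, τ', hT, hτ, hτ'⟩ := h
  have hT' : ∀ X, bdd C D X → bdd E F (T.ho.obj X) := fun X hX => hT X.as hX
  exact ⟨restrIso hS hT' (hoTrans τ) (fun X hX => ⟨_, rfl, hτ X.as hX⟩) ≪≫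
    (restrIso hS' hT' (hoTrans τ') (fun X hX => ⟨_, rfl, hτ' X.as hX⟩)).symm⟩

variable (C D) in
/-- The identity functor on homotopy categories. -/
noncomputable def hoId : 𝟭 (Ho C D) ⟶ (GrFunctor.id C D).ho :=
  Quotient.natTransLift _
    { app := fun M => 𝟙 ((Quotient.functor Homotopic).obj M)
      naturality := fun _ _ f => (Category.comp_id ((Quotient.functor Homotopic).map f)).trans
        (Category.id_comp ((Quotient.functor Homotopic).map f)).symm }

/-- Composition of the functors on homotopy categories. -/
noncomputable def hoComp (S : GrFunctor C D E F) (S' : GrFunctor E F G H) :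
    (S.comp S').ho ⟶ S.ho ⋙ S'.ho :=
  Quotient.natTransLift _
    { app := fun M => 𝟙 ((Quotient.functor Homotopic).obj (S'.fct.obj (S.fct.obj M)))
      naturality := fun _ _ f =>
        (Category.comp_id ((Quotient.functor Homotopic).map (S'.fct.map (S.fct.map f)))).trans
        (Category.id_comp ((Quotient.functor Homotopic).map (S'.fct.map (S.fct.map f)))).symm }

lemma Joined.nonempty_iso_comp {S : GrFunctor C D E F} {S' : GrFunctor E F C D} (hS : S.Exact)
    (hS' : S'.Exact) (h : Joined (GrFunctor.id C D) (S.comp S')) :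
    Nonempty (restr (qis C D) (𝟭 _) (fun _ h => h) ≅
      restr (P := bdd C D) (P' := bdd C D) (qis C D) (S.ho ⋙ S'.ho)
        (fun X hX => hS'.bdd_ho _ (hS.bdd_ho X hX))) := by
  obtain ⟨e⟩ := h.nonempty_iso (fun _ h => h) (hS.comp hS').bdd_ho
  exact ⟨restrIso _ _ (hoId C D) (fun X _ => (qis C D).id_mem X) ≪≫ e ≪≫
    restrIso _ _ (hoComp S S') (fun X _ => (qis C D).id_mem _)⟩

/-- Functors that are inverse to each other up to quasi-isomorphism induce equivalences of the
derived categories of bicomodules that are bounded below. -/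
lemma isEquivalence_ho {S : GrFunctor C D E F} {S' : GrFunctor E F C D} (hS : S.Exact)
    (hS' : S'.Exact) (h : Joined (GrFunctor.id C D) (S.comp S'))
    (h' : Joined (GrFunctor.id E F) (S'.comp S)) :
    (locMap (W := qis C D) (W' := qis E F) S.ho hS.bdd_ho hS.qis_ho).IsEquivalence := by
  obtain ⟨e⟩ := h.nonempty_iso_comp hS hS'
  obtain ⟨e'⟩ := h'.nonempty_iso_comp hS' hS
  exact isEquivalence_locMap hS.bdd_ho hS.qis_ho hS'.bdd_ho hS'.qis_ho e e'

end GrFunctor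

end Bicomod
end DGC

/-! ### Comparison of the full derived categories through the left bounded ones. -/

namespace DGC
variable {k : Type v} [Field k]
namespace Bicomod

variable {C D E F G H : DGCoalg.{v, u} k}

namespace GrFunctor

section DerivedComp

variable (S : GrFunctor C D E F) (S' : GrFunctor E F G H)

/-- The composition of two functors, from the bicomodules that are bounded below to the derived
category. -/
noncomputable abbrev toDerBdd : (Bicomod.bdd C D).FullSubcategory ⥤ Der G H :=
  (Bicomod.bdd C D).ι ⋙ S.ho ⋙ S'.ho ⋙ (qis G H).Q

variable {S S'}

lemma inverted_toDerBdd (hS : S.Exact) (hS' : S'.Exact) :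
    (resW (qis C D) (Bicomod.bdd C D)).IsInvertedBy (toDerBdd S S') :=
  fun X Y f hf => Localization.inverts (qis G H).Q (qis G H) _ (hS'.qis_ho _ (hS.bdd_ho _ X.2)
    (hS.bdd_ho _ Y.2) (hS.qis_ho f.hom X.2 Y.2 hf))

variable (hS : S.Exact) (hS' : S'.Exact)

/-- The composite is lifted in one piece from the homotopy category to the full derived category, so
that its compatibility with shifts and its linearity come directly from `S.ho` and `S'.ho`. The
isomorphism `derCompIso` with the stepwise composite serves only to show that it is fully faithful.
-/
noncomputable abbrev derComp : LocSub (qis C D) (Bicomod.bdd C D) ⥤ Der G H :=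
  locLift (toDerBdd S S') (inverted_toDerBdd hS hS')

/-- The functor `derComp` is the composition of the functors on derived categories. -/
noncomputable def derCompIso :
    locMap (W := qis C D) (W' := qis E F) S.ho hS.bdd_ho hS.qis_ho ⋙
    locMap (W := qis E F) (W' := qis G H) S'.ho hS'.bdd_ho hS'.qis_ho ⋙
      locι (qis G H) (Bicomod.bdd G H) ≅ derComp hS hS' :=
  Localization.liftNatIso (resW (qis C D) (Bicomod.bdd C D)).Q (resW (qis C D) (Bicomod.bdd C D))
    (restr (P := Bicomod.bdd C D) (P' := Bicomod.bdd G H) (qis G H) (S.ho ⋙ S'.ho)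
      (fun X hX => hS'.bdd_ho _ (hS.bdd_ho X hX)) ⋙ locι (qis G H) (Bicomod.bdd G H))
    (toDerBdd S S')
    (h₁ := ⟨Functor.isoWhiskerRight (locMapComp hS.bdd_ho hS.qis_ho hS'.bdd_ho hS'.qis_ho)
      (locι (qis G H) (Bicomod.bdd G H))⟩)
    (h₂ := ⟨locLiftFac _ _⟩) _ _
    (Functor.isoWhiskerLeft _ (locLiftFac _ (inverted_ι (qis G H) (Bicomod.bdd G H))))

/-- Two equivalences followed by the full functor `locι`; positivity of `G` and `H` enters through
truncation. -/
lemma full_derComp (hG : G.IsPos) (hH : H.IsPos)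
    (h : (locMap (W := qis C D) (W' := qis E F) S.ho hS.bdd_ho hS.qis_ho).IsEquivalence)
    (h' : (locMap (W := qis E F) (W' := qis G H) S'.ho hS'.bdd_ho hS'.qis_ho).IsEquivalence) :
    (derComp hS hS').Full := by
  have := isLocalizing_qis hG hH
  have := full_locι (qis G H) (Bicomod.bdd G H)
  exact Functor.Full.of_iso (derCompIso hS hS')

lemma faithful_derComp (hG : G.IsPos) (hH : H.IsPos)
    (h : (locMap (W := qis C D) (W' := qis E F) S.ho hS.bdd_ho hS.qis_ho).IsEquivalence)
    (h' : (locMap (W := qis E F) (W' := qis G H) S'.ho hS'.bdd_ho hS'.qis_ho).IsEquivalence) :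
    (derComp hS hS').Faithful := by
  have := isLocalizing_qis hG hH
  have := faithful_locι (qis G H) (Bicomod.bdd G H)
  exact Functor.Faithful.of_iso (derCompIso hS hS')

/-- A left bounded bicomodule as an object of the derived category of bicomodules that are
bounded below. -/
noncomputable abbrev toDerPlus {M : Bicomod C D} (hM : M.IsBddBelow) :
    LocSub (qis C D) (Bicomod.bdd C D) :=
  (resW (qis C D) (Bicomod.bdd C D)).Q.obj ⟨(Quotient.functor Homotopic).obj M, hM⟩

/-- The value of `derComp`. -/
noncomputable def derCompObj {M : Bicomod C D} (hM : M.IsBddBelow) :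
    (derComp hS hS').obj (toDerPlus hM) ≅ toDer (S'.fct.obj (S.fct.obj M)) :=
  (locLiftFac (toDerBdd S S') (inverted_toDerBdd hS hS')).app _

/-- The value of the inclusion of derived categories. -/
noncomputable def locιObj {M : Bicomod C D} (hM : M.IsBddBelow) :
    (locι (qis C D) (Bicomod.bdd C D)).obj (toDerPlus hM) ≅ toDer M :=
  (locLiftFac _ (inverted_ι (qis C D) (Bicomod.bdd C D))).app _

/-- The localization of left bounded bicomodules maps fully faithfully to both derived categories,
by `locι` to the one of the source and by `derComp` to the one of the target, so the two morphism
spaces are both identified with one over it. -/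
theorem nonempty_shiftedEquiv (hC : C.IsPos) (hD : D.IsPos) (hG : G.IsPos) (hH : H.IsPos)
    (h : (locMap (W := qis C D) (W' := qis E F) S.ho hS.bdd_ho hS.qis_ho).IsEquivalence)
    (h' : (locMap (W := qis E F) (W' := qis G H) S'.ho hS'.bdd_ho hS'.qis_ho).IsEquivalence)
    {M N : Bicomod C D} (hM : M.IsBddBelow) (hN : N.IsBddBelow)
    {X Y : Der G H} (e : toDer (S'.fct.obj (S.fct.obj M)) ≅ X)
    (e' : toDer (S'.fct.obj (S.fct.obj N)) ≅ Y) (n : ℤ) :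
    Nonempty (ShiftedHom (toDer M) (toDer N) n ≃ₗ[k] ShiftedHom X Y n) := by
  have := isLocalizing_qis hC hD
  have := full_locι (qis C D) (Bicomod.bdd C D)
  have := faithful_locι (qis C D) (Bicomod.bdd C D)
  have := additive_locLift _ (inverted_ι (qis C D) (Bicomod.bdd C D))
  have := linear_locLift k _ (inverted_ι (qis C D) (Bicomod.bdd C D))
  have := full_derComp hS hS' hG hH h h'
  have := faithful_derComp hS hS' hG hH h h'
  have := additive_locLift _ (inverted_toDerBdd hS hS')
  have := linear_locLift k _ (inverted_toDerBdd hS hS')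
  exact ⟨(shiftedEquiv k (locι (qis C D) (Bicomod.bdd C D)) (locιObj hM) (locιObj hN) n).symm.trans
    (shiftedEquiv k (derComp hS hS') (derCompObj hS hS' hM ≪≫ e) (derCompObj hS hS' hN ≪≫ e') n)⟩

theorem exists_algEquiv (hC : C.IsPos) (hD : D.IsPos) (hG : G.IsPos) (hH : H.IsPos)
    (h : (locMap (W := qis C D) (W' := qis E F) S.ho hS.bdd_ho hS.qis_ho).IsEquivalence)
    (h' : (locMap (W := qis E F) (W' := qis G H) S'.ho hS'.bdd_ho hS'.qis_ho).IsEquivalence)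
    {M : Bicomod C D} (hM : M.IsBddBelow)
    {X : Der G H} (e : toDer (S'.fct.obj (S.fct.obj M)) ≅ X) :
    ∃ φ : ∀ n : ℤ, ShiftedHom (toDer M) (toDer M) n ≃ₗ[k] ShiftedHom X X n,
      φ 0 (ShiftedHom.mk₀ 0 rfl (𝟙 _)) = ShiftedHom.mk₀ 0 rfl (𝟙 _) ∧
      ∀ (a b c : ℤ) (h : b + a = c) (f : ShiftedHom (toDer M) (toDer M) a)
        (g : ShiftedHom (toDer M) (toDer M) b),
        φ c (ShiftedHom.comp f g h) = ShiftedHom.comp (φ a f) (φ b g) h := by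
  have := isLocalizing_qis hC hD
  have := full_locι (qis C D) (Bicomod.bdd C D)
  have := faithful_locι (qis C D) (Bicomod.bdd C D)
  have := additive_locLift _ (inverted_ι (qis C D) (Bicomod.bdd C D))
  have := linear_locLift k _ (inverted_ι (qis C D) (Bicomod.bdd C D))
  have := full_derComp hS hS' hG hH h h'
  have := faithful_derComp hS hS' hG hH h h'
  have := additive_locLift _ (inverted_toDerBdd hS hS')
  have := linear_locLift k _ (inverted_toDerBdd hS hS')
  exact exists_shiftedEquiv k (locι (qis C D) (Bicomod.bdd C D)) (derComp hS hS') (locιObj hM)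
    (derCompObj hS hS' hM ≪≫ e)

end DerivedComp

end GrFunctor

end Bicomod
end DGC

/-! ### The twist functors `Q □ (B □ -)` and `- □ (B □ P)`. -/

namespace DGC
variable {k : Type v} [Field k]
namespace Bicomod

variable {C D E F : DGCoalg.{v, u} k}

/-- The functor `M ↦ Q □ (B □ M)`. -/
noncomputable abbrev twL (Q : Bicomod D C) (E : DGCoalg.{v, u} k) : GrFunctor C E D E :=
  (cotLG (res (regular C)) E).comp (cotLG Q E)

/-- The functor `M ↦ M □ (B □ P)`. -/
noncomputable abbrev twR (E : DGCoalg.{v, u} k) (P : Bicomod C D) : GrFunctor E C E D :=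
  cotRG E (cotensor (res (regular C)) P)

lemma exact_twL (hC : C.IsPos) {Q : Bicomod D C} (hQ : Q.IsBddBelow) : (twL Q E).Exact where
  bdd hM := hQ.cotensor (isBddBelow_res_cot hC hM)
  qIso hM hN hf := by
    dsimp only [twL, cotLG, GrFunctor.comp, Functor.comp_obj, Functor.comp_map]
    exact (QIso.id Q).cot_res_cot hC hf hQ hQ hM hN

lemma exact_twR (hC : C.IsPos) {P : Bicomod C D} (hP : P.IsBddBelow) : (twR E P).Exact where
  bdd hM := hM.cotensor (isBddBelow_res_cot hC hP)
  qIso hM hN hf := by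
    have h := hf.cot_res_cot hC (QIso.id P) hM hN hP hP
    rw [cotMap_id] at h
    exact h

/-- The transformation `M → Z □ (B □ M)` given by a morphism `C → Z`. -/
noncomputable def twLUnit {Z : Bicomod C C} (g : regular C ⟶ Z) (E : DGCoalg.{v, u} k) :
    (GrFunctor.id C E).fct ⟶ (twL Z E).fct where
  app M := toRes M ≫ unitL _ ≫ cotMap g (cotMap (𝟙 _) (𝟙 M))
  naturality M N s := by
    dsimp only [twL, cotLG, GrFunctor.comp, GrFunctor.id, Functor.comp_obj, Functor.comp_map,
      Functor.id_obj, Functor.id_map]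
    rw [← Category.assoc, toRes_naturality, Category.assoc, ← Category.assoc (cotMap _ _),
      unitL_naturality]
    simp only [Category.assoc, cotMap_comp, Category.comp_id, Category.id_comp]

/-- The map `P □ (B □ (Q □ (B □ M))) → Z □ (B □ M)` given by a morphism `P □ (B □ Q) → Z`. -/
noncomputable def assocMap {P : Bicomod C D} {Q : Bicomod D C} {Z : Bicomod C C}
    (f : cotensor P (cotensor (res (regular D)) Q) ⟶ Z) (M : Bicomod C E) :
    cotensor P (cotensor (res (regular D)) (cotensor Q (cotensor (res (regular C)) M))) ⟶
      cotensor Z (cotensor (res (regular C)) M) :=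
  inv (assocRes P Q (cotensor (res (regular C)) M)) ≫ cotMap f (cotMap (𝟙 _) (𝟙 M))

lemma assocMap_naturality {P : Bicomod C D} {Q : Bicomod D C} {Z : Bicomod C C}
    (f : cotensor P (cotensor (res (regular D)) Q) ⟶ Z) {M N : Bicomod C E} (s : M ⟶ N) :
    cotMap (𝟙 P) (cotMap (𝟙 _) (cotMap (𝟙 Q) (cotMap (𝟙 _) s))) ≫ assocMap f N =
      assocMap f M ≫ cotMap (𝟙 Z) (cotMap (𝟙 _) s) := by
  have h1 := assocRes_naturality (Q := Q) (𝟙 P) (cotMap (𝟙 (res (regular C))) s)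
  have h2 : cotMap (𝟙 P) (cotMap (𝟙 _) (cotMap (𝟙 Q) (cotMap (𝟙 _) s))) ≫
      inv (assocRes P Q (cotensor (res (regular C)) N)) =
      inv (assocRes P Q (cotensor (res (regular C)) M)) ≫
        cotMap (cotMap (𝟙 P) (𝟙 (cotensor (res (regular D)) Q)))
          (cotMap (𝟙 (res (regular C))) s) := by
    rw [IsIso.comp_inv_eq, Category.assoc, h1, IsIso.inv_hom_id_assoc]
  rw [assocMap, assocMap, ← Category.assoc, h2]
  simp only [Category.assoc, cotMap_comp, cotMap_id, Category.comp_id, Category.id_comp]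

/-- The transformation `P □ (B □ (Q □ (B □ M))) → Z □ (B □ M)` given by a morphism
`P □ (B □ Q) → Z`. -/
noncomputable def twLMap {P : Bicomod C D} {Q : Bicomod D C} {Z : Bicomod C C}
    (f : cotensor P (cotensor (res (regular D)) Q) ⟶ Z) (E : DGCoalg.{v, u} k) :
    ((twL Q E).comp (twL P E)).fct ⟶ (twL Z E).fct where
  app M := by
    dsimp only [twL, cotLG, GrFunctor.comp, Functor.comp_obj, Functor.comp_map]
    exact assocMap f M
  naturality M N s := by
    dsimp only [twL, cotLG, GrFunctor.comp, Functor.comp_obj, Functor.comp_map]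
    exact assocMap_naturality f s

/-- The zigzag `C → Z ← P □ (B □ Q)`, cotensored with `B □ M`, links `M`, through its resolution `B
□ M ≅ C □ (B □ M)`, to `P □ (B □ (Q □ (B □ M)))`, naturally in `M`. -/
lemma joined_twL (hC : C.IsPos) (hD : D.IsPos) {P : Bicomod C D} {Q : Bicomod D C}
    (hP : P.IsBddBelow) (hQ : Q.IsBddBelow)
    (h : Linked (cotensor P (cotensor (res (regular D)) Q)) (regular C)) :
    GrFunctor.Joined (GrFunctor.id C E) ((twL Q E).comp (twL P E)) := by
  obtain ⟨Z, f, g, hZ, hf, hg⟩ := h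
  have b2 := isBddBelow_regular hC
  have b3 := hP.cotensor (isBddBelow_res_cot hD hQ)
  refine ⟨twL Z E, twLUnit g E, twLMap f E, fun M hM => (exact_twL hC hZ).bdd hM,
    fun M hM => ?_, fun M hM => ?_⟩
  · have h := (qIso_toRes M).comp ((QIso.of_isIso (unitL _)).comp
      (hg.cot_res_cot hC (QIso.id M) b2 hZ hM hM))
    exact h
  · have h := (QIso.of_isIso (inv (assocRes P Q (cotensor (res (regular C)) M)))).comp
      (hf.cot_res_cot hC (QIso.id M) b3 hZ hM hM)
    dsimp only [twLMap, twL, cotLG, GrFunctor.comp, Functor.comp_obj, Functor.comp_map]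
    exact h

/-- The same zigzag on the other side: `M → M □ (B □ Z) ← (M □ (B □ P)) □ (B □ Q)`. The first map
passes through `M → M □ (B □ C)`, a quasi-isomorphism thanks to the left colinear contraction of the
resolution of `C`. -/
lemma joined_twR (hC : C.IsPos) (hD : D.IsPos) {P : Bicomod C D} {Q : Bicomod D C}
    (hP : P.IsBddBelow) (hQ : Q.IsBddBelow)
    (h : Linked (cotensor P (cotensor (res (regular D)) Q)) (regular C)) :
    GrFunctor.Joined (GrFunctor.id E C) ((twR E P).comp (twR E Q)) := by
  obtain ⟨Z, f, g, hZ, hf, hg⟩ := h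
  have b2 := isBddBelow_regular hC
  have b3 := hP.cotensor (isBddBelow_res_cot hD hQ)
  refine ⟨twR E Z,
    { app := fun M => toCotRes M ≫ cotMap (𝟙 M) (cotMap (𝟙 _) g)
      naturality := fun M N s => ?_ },
    { app := fun M => assocRes M P (cotensor (res (regular D)) Q) ≫
        cotMap (𝟙 M) (cotMap (𝟙 _) f)
      naturality := fun M N s => ?_ },
    fun M hM => (exact_twR hC hZ).bdd hM,
    fun M hM => (qIso_toCotRes M).comp ((QIso.id M).cot_res_cot hC hg hM hM b2 hZ),
    fun M hM => (QIso.of_isIso _).comp ((QIso.id M).cot_res_cot hC hf hM hM b3 hZ)⟩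
  · dsimp only [twR, cotRG, GrFunctor.comp, GrFunctor.id, Functor.comp_obj, Functor.comp_map,
      Functor.id_obj, Functor.id_map]
    rw [← Category.assoc, toCotRes_naturality]
    simp only [Category.assoc, cotMap_comp, Category.comp_id, Category.id_comp]
  · dsimp only [twR, cotRG, GrFunctor.comp, GrFunctor.id, Functor.comp_obj, Functor.comp_map,
      Functor.id_obj, Functor.id_map]
    rw [← Category.assoc, assocRes_naturality]
    simp only [Category.assoc, cotMap_comp, cotMap_id, Category.comp_id, Category.id_comp]

section Twist

variable {P : Bicomod C D} {Q : Bicomod D C}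

lemma isEquivalence_twL (hC : C.IsPos) (hD : D.IsPos) (hP : P.IsBddBelow) (hQ : Q.IsBddBelow)
    (h : Linked (cotensor P (cotensor (res (regular D)) Q)) (regular C))
    (h' : Linked (cotensor Q (cotensor (res (regular C)) P)) (regular D)) :
    (locMap (W := qis C E) (W' := qis D E) (twL Q E).ho (exact_twL hC hQ).bdd_ho
      (exact_twL hC hQ).qis_ho).IsEquivalence :=
  GrFunctor.isEquivalence_ho (exact_twL hC hQ) (exact_twL hD hP) (joined_twL hC hD hP hQ h)
    (joined_twL hD hC hQ hP h')

lemma isEquivalence_twR (hC : C.IsPos) (hD : D.IsPos) (hP : P.IsBddBelow) (hQ : Q.IsBddBelow)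
    (h : Linked (cotensor P (cotensor (res (regular D)) Q)) (regular C))
    (h' : Linked (cotensor Q (cotensor (res (regular C)) P)) (regular D)) :
    (locMap (W := qis E C) (W' := qis E D) (twR E P).ho (exact_twR hC hP).bdd_ho
      (exact_twR hC hP).qis_ho).IsEquivalence :=
  GrFunctor.isEquivalence_ho (exact_twR hC hP) (exact_twR hD hQ) (joined_twR hC hD hP hQ h)
    (joined_twR hD hC hQ hP h')

end Twist

end Bicomod
end DGC

/-! ### The isomorphisms of the theorem. -/

namespace DGC
variable {k : Type v} [Field k]
namespace Bicomod

variable {C D : DGCoalg.{v, u} k}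

section DerivedTwist

lemma QIso.nonempty_iso {M N : Bicomod C D} {f : M ⟶ N} (hf : QIso f) :
    Nonempty (toDer M ≅ toDer N) := by
  have := Localization.inverts (qis C D).Q (qis C D) _ ((qis_map_iff f).2 hf)
  exact ⟨asIso ((qis C D).Q.map ((Quotient.functor Homotopic).map f))⟩

lemma Linked.of_dcotensor (hC : C.IsPos) {P : Bicomod C D} {Q : Bicomod D C}
    (h : Nonempty ((P.dcotensor Q).toDer ≅ (regular C).toDer)) :
    Linked (cotensor P (cotensor (res (regular D)) Q)) (regular C) := by
  obtain ⟨e⟩ := h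
  obtain ⟨f, hf⟩ := exists_isIso_dcotensor P Q
  obtain ⟨e'⟩ := (QIso.of_isIso f).nonempty_iso
  exact linked_of_iso hC hC (isBddBelow_regular hC) (e'.symm ≪≫ e)

variable {P : Bicomod C D} {Q : Bicomod D C}

/-- The bicomodule `(Q □ (B □ C)) □ (B □ P)` is quasi-isomorphic to `Q □ (B □ P)`, which the second
zigzag links to `D`. So the equivalence of derived categories matches the targets `C` and `D` of the
morphisms that define `HH`. -/
lemma nonempty_iso_twist_regular (hC : C.IsPos) (hP : P.IsBddBelow) (hQ : Q.IsBddBelow)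
    (h' : Linked (cotensor Q (cotensor (res (regular C)) P)) (regular D)) :
    Nonempty (toDer ((twR D P).fct.obj ((twL Q C).fct.obj (regular C))) ≅
      toDer (regular D)) := by
  dsimp only [twL, twR, cotLG, cotRG, GrFunctor.comp, Functor.comp_obj]
  obtain ⟨Z, f, g, hZ, hf, hg⟩ := h'
  obtain ⟨e₁⟩ := ((qIso_toCotRes Q).cot_res_cot hC (QIso.id P) hQ
    (hQ.cotensor (isBddBelow_res_cot hC (isBddBelow_regular hC))) hP hP).nonempty_iso
  obtain ⟨e₂⟩ := hf.nonempty_iso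
  obtain ⟨e₃⟩ := hg.nonempty_iso
  exact ⟨e₁.symm ≪≫ e₂ ≪≫ e₃.symm⟩

lemma nonempty_iso_twist (P : Bicomod C D) (Q : Bicomod D C) (M : Bicomod C C) :
    Nonempty (toDer ((twR D P).fct.obj ((twL Q C).fct.obj M)) ≅
      toDer ((Q.dcotensor M).dcotensor P)) := by
  dsimp only [twL, twR, cotLG, cotRG, GrFunctor.comp, Functor.comp_obj]
  obtain ⟨f, hf⟩ := exists_isIso_twist P Q M
  obtain ⟨e⟩ := (QIso.of_isIso f).nonempty_iso
  exact ⟨e.symm⟩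

/-- The equivalence goes from `C`-`C`-bicomodules to `D`-`C`-bicomodules by `Q □ (B □ -)`, and on to
`D`-`D`-bicomodules by `- □ (B □ P)`. -/
theorem nonempty_HH_twist (hC : C.IsPos) (hD : D.IsPos) (hP : P.IsBddBelow) (hQ : Q.IsBddBelow)
    (h : Linked (cotensor P (cotensor (res (regular D)) Q)) (regular C))
    (h' : Linked (cotensor Q (cotensor (res (regular C)) P)) (regular D))
    {M : Bicomod C C} (hM : M.IsBddBelow) (n : ℤ) :
    Nonempty (M.HH n ≃ₗ[k] ((Q.dcotensor M).dcotensor P).HH n) := by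
  obtain ⟨e⟩ := nonempty_iso_twist P Q M
  obtain ⟨e'⟩ := nonempty_iso_twist_regular hC hP hQ h'
  exact GrFunctor.nonempty_shiftedEquiv (exact_twL hC hQ) (exact_twR hC hP) hC hC hD hD
    (isEquivalence_twL hC hD hP hQ h h') (isEquivalence_twR hC hD hP hQ h h') hM
    (isBddBelow_regular hC) e e' n

theorem exists_HH_equiv (hC : C.IsPos) (hD : D.IsPos) (hP : P.IsBddBelow) (hQ : Q.IsBddBelow)
    (h : Linked (cotensor P (cotensor (res (regular D)) Q)) (regular C))
    (h' : Linked (cotensor Q (cotensor (res (regular C)) P)) (regular D)) :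
    ∃ φ : ∀ n : ℤ, (regular C).HH n ≃ₗ[k] (regular D).HH n,
      φ 0 (ShiftedHom.mk₀ 0 rfl (𝟙 _)) = ShiftedHom.mk₀ 0 rfl (𝟙 _) ∧
      ∀ (a b c : ℤ) (h : b + a = c) (f : (regular C).HH a) (g : (regular C).HH b),
        φ c (ShiftedHom.comp f g h) = ShiftedHom.comp (φ a f) (φ b g) h := by
  obtain ⟨e⟩ := nonempty_iso_twist_regular hC hP hQ h'
  exact GrFunctor.exists_algEquiv (exact_twL hC hQ) (exact_twR hC hP) hC hC hD hD
    (isEquivalence_twL hC hD hP hQ h h') (isEquivalence_twR hC hD hP hQ h h')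
    (isBddBelow_regular hC) e

end DerivedTwist

end Bicomod
end DGC
theorem theorem5 {k : Type v} [Field k] (C D : DGC.DGCoalg.{v, u} k) (hC : C.IsPos) (hD : D.IsPos)
    (P : DGC.Bicomod C D) (Q : DGC.Bicomod D C) (hP : P.IsBddBelow) (hQ : Q.IsBddBelow)
    (hPQ : Nonempty ((P.dcotensor Q).toDer ≅ (DGC.Bicomod.regular C).toDer))
    (hQP : Nonempty ((Q.dcotensor P).toDer ≅ (DGC.Bicomod.regular D).toDer)) :
    (∀ M : DGC.Bicomod C C, M.IsBddBelow →
      (∀ n : ℤ, Nonempty (M.Hoch n ≃ₗ[k] ((Q.dcotensor M).dcotensor P).Hoch n)) ∧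
      (∀ n : ℤ, Nonempty (M.HH n ≃ₗ[k] ((Q.dcotensor M).dcotensor P).HH n))) ∧
    (∀ n : ℤ, Nonempty (DGC.Bicomod.HochC C n ≃ₗ[k] DGC.Bicomod.HochC D n)) ∧
    ∃ φ : ∀ n : ℤ, (DGC.Bicomod.regular C).HH n ≃ₗ[k] (DGC.Bicomod.regular D).HH n,
      φ 0 (ShiftedHom.mk₀ 0 rfl (𝟙 _)) = ShiftedHom.mk₀ 0 rfl (𝟙 _) ∧
      ∀ (a b c : ℤ) (h : b + a = c) (f : (DGC.Bicomod.regular C).HH a)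
        (g : (DGC.Bicomod.regular C).HH b),
        φ c (ShiftedHom.comp f g h) = ShiftedHom.comp (φ a f) (φ b g) h := by
  -- From here on the hypotheses are used only as zigzags of quasi-isomorphisms between left bounded
  -- bicomodules.
  have h := DGC.Bicomod.Linked.of_dcotensor hC hPQ
  have h' := DGC.Bicomod.Linked.of_dcotensor hD hQP
  exact ⟨fun M hM => ⟨DGC.Bicomod.hIso_hoch hC hD hP hQ h hM,
    DGC.Bicomod.nonempty_HH_twist hC hD hP hQ h h' hM⟩,
    DGC.Bicomod.hIso_hochComplex_of_linked hC hD hP hQ h h',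
    DGC.Bicomod.exists_HH_equiv hC hD hP hQ h h'⟩
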